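/- **Setting.** Let $\varphi:[0,\infty)\to[0,\infty)$ be convex, $\varphi\in C^2((0,\infty))\cap C^1([0,\infty))$, $\varphi(0)=\varphi'(0)=0$, $\lim_{t\to\infty}\varphi(t)=\infty$, and let $c_0\varphi'(t)\le\varphi''(t)\,t\le c_1\varphi'(t)$ for all $t>0$, where $c_0>0$ and $c_1$ are called the characteristics of $\varphi$. For $a\ge 0$ let $\varphi_a$ be given by $\varphi_a(0)=0$, $\varphi_a'(t)=\frac{\varphi'(a+t)}{a+t}\,t$. Let $J\subset\mathbb R$ be an open interval, $\Omega\subset\mathbb R^n$ open, and let $u:J\times\Omega\to\mathbb R^N$ be a local weak solution of $$\partial_t u-\operatorname{div}\Big(\frac{\varphi'(|\nabla u|)}{|\nabla u|}\nabla u\Big)=0 ,$$ that is, $u\in L^\infty_{\rm loc}(J;L^2_{\rm loc}(\Omega))$ has a weak spatial gradient $\nabla u$ with $\varphi(|\nabla u|)\in L^1_{\rm loc}(J\times\Omega)$, and $$\int_{J\times\Omega}\frac{\varphi'(|\nabla u|)}{|\nabla u|}\nabla u\cdot\nabla\zeta\,dz=\int_{J\times\Omega}u\cdot\partial_t\zeta\,dz\qquad\text{for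 all }\zeta\in C_0^\infty(J\times\Omega;\mathbb R^N).$$ Assume moreover $\nabla u\in L^2_{\rm loc}(J\times\Omega)$ and write $v=|\nabla u|$ (Euclidean norm of the matrix). For $\alpha,r>0$ put $Q_r=(t_0-\alpha r^2,t_0)\times B_r(x_0)$, and let $C^\infty_{0,\rm par}(Q_r)=C_0^\infty\big(Q_r\cup(\{t_0\}\times B_r(x_0))\big)$. For $\gamma>0$ let $$G(t)=\big(\sqrt{\varphi'(t)t}-\sqrt{\varphi'(\gamma)\gamma}\,\big)_+,\qquad H(t)=(t^2-\gamma^2)_+ .$$ **Statement.** (i) For given characteristics $c_0,c_1$ there are $q>1$ and $K>0$ such that every $\varphi$ as above satisfies $$\varphi_a(s^{q-1}t)\le K\,s^q\,\varphi_a(t)\qquad\text{for all }a,t\ge0,\ s\in[0,1].\tag{$*$}$$ (ii) For every $q>1$ and $K>0$ there is a constant $c\ge 0$, depending only on $n,c_0,c_1,q,K$, such that the following holds for every $\varphi$ as above satisfying $(*)$, every $N,J,\Omega,u$ as above, all $\gamma,\alpha>0$, all radii $0<R\le\rho\le 2R$ with $\overline{Q_\rho}\subset J\times\Omega$, and all $\eta\in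 C^\infty_{0,\rm par}(Q_\rho)$ with $0\le\eta\le1$. The function $G(v)\,\eta^{q/2}$ has a weak spatial gradient in $Q_\rho$, and $$\begin{aligned}&\sup_{t\in(t_0-\alpha R^2,t_0)}\frac1\alpha\,\frac{1}{|B_R|}\int_{B_R(x_0)}H(v)\,\eta^q\,dx+\frac{R^2}{|Q_R|}\int_{Q_R}\big|\nabla\big(G(v)\eta^{q/2}\big)\big|^2dz\\ &\qquad\le c\,\Big(\frac{R^2}{|Q_\rho|}\int_{Q_\rho}\varphi(v)\,\|\nabla\eta\|_\infty^2\,\chi_{\{v>\gamma\}}\,dz+\frac{R^2}{|Q_\rho|}\int_{Q_\rho}H(v)\,\eta^{q-1}|\partial_t\eta|\,dz\Big).\end{aligned}$$ Here $\sup$ is the essential supremum in time, and $\|\nabla\eta\|_\infty=\sup_{Q_\rho}|\nabla\eta|$ with $\nabla$ the spatial gradient. -/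

import Mathlib

open Set MeasureTheory
open scoped ENNReal NNReal ContDiff

noncomputable section

namespace PhiCaloric

/-- The Euclidean space `ℝⁿ`. -/
abbrev Space (n : ℕ) : Type := EuclideanSpace ℝ (Fin n)

/-- `N × n` matrices with the Euclidean (Frobenius) norm; the entry `(i, j)` of a gradient
is `∂_j u_i`. -/
abbrev Mat (N n : ℕ) : Type := EuclideanSpace ℝ (Fin N × Fin n)

/-- The derivative of a function on `[0, ∞)` (one-sided at the end point `0`). -/
def d (φ : ℝ → ℝ) (t : ℝ) : ℝ := derivWithin φ (Ici 0) t

/-- The standing assumption on the Orlicz function `φ : [0, ∞) → [0, ∞)`, with characteristics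
`c₀, c₁`: `c₀ φ'(t) ≤ φ''(t) t ≤ c₁ φ'(t)` for `t > 0`. Only the values of `φ` on `[0, ∞)`
matter. -/
structure IsOrlicz (φ : ℝ → ℝ) (c₀ c₁ : ℝ) : Prop where
  nonneg : ∀ t, 0 ≤ t → 0 ≤ φ t
  convex : ConvexOn ℝ (Ici 0) φ
  contDiff_two : ContDiffOn ℝ 2 φ (Ioi 0)
  contDiff_one : ContDiffOn ℝ 1 φ (Ici 0)
  zero : φ 0 = 0
  d_zero : d φ 0 = 0
  tendsto : Filter.Tendsto φ Filter.atTop Filter.atTop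
  lower : ∀ t, 0 < t → c₀ * d φ t ≤ deriv (d φ) t * t
  upper : ∀ t, 0 < t → deriv (d φ) t * t ≤ c₁ * d φ t

/-- The shifted function `φ_a`, determined by `φ_a(0) = 0` and
`φ_a'(t) = φ'(a + t) / (a + t) * t`. -/
def shifted (φ : ℝ → ℝ) (a t : ℝ) : ℝ :=
  ∫ s in (0 : ℝ)..t, d φ (a + s) / (a + s) * s

/-- The exponent condition `φ_a(s^(q-1) t) ≤ K s^q φ_a(t)`, uniformly in `a, t ≥ 0` and
`s ∈ [0, 1]`. -/
def ExponentCondition (φ : ℝ → ℝ) (q K : ℝ) : Prop :=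
  ∀ a t s : ℝ, 0 ≤ a → 0 ≤ t → 0 ≤ s → s ≤ 1 →
    shifted φ a (s ^ (q - 1) * t) ≤ K * s ^ q * shifted φ a t

/-- `A(P) = φ'(|P|) P / |P|`, with `A(0) = 0`. -/
def A {N n : ℕ} (φ : ℝ → ℝ) (P : Mat N n) : Mat N n := (d φ ‖P‖ / ‖P‖) • P

/-- The time derivative of a smooth function on space-time `ℝ × ℝⁿ`. -/
def timeDeriv {n : ℕ} {F : Type*} [NormedAddCommGroup F] [NormedSpace ℝ F]
    (ζ : ℝ × Space n → F) (z : ℝ × Space n) : F :=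
  fderiv ℝ ζ z (1, 0)

/-- The spatial partial derivative `∂_j` of a smooth function on space-time. -/
def spacePartial {n : ℕ} {F : Type*} [NormedAddCommGroup F] [NormedSpace ℝ F]
    (j : Fin n) (ζ : ℝ × Space n → F) (z : ℝ × Space n) : F :=
  fderiv ℝ ζ z (0, EuclideanSpace.single j 1)

/-- The spatial gradient of a smooth scalar function. -/
def spaceGrad {n : ℕ} (ζ : ℝ × Space n → ℝ) (z : ℝ × Space n) : Space n :=
  WithLp.toLp 2 fun j => spacePartial j ζ z

/-- The spatial gradient of a smooth vectorial function. -/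
def spaceJac {N n : ℕ} (ζ : ℝ × Space n → Space N) (z : ℝ × Space n) : Mat N n :=
  WithLp.toLp 2 fun p => spacePartial p.2 ζ z p.1

/-- Membership in `C_0^∞(U; F)`. -/
structure IsTest {n : ℕ} {F : Type*} [NormedAddCommGroup F] [NormedSpace ℝ F]
    (U : Set (ℝ × Space n)) (ζ : ℝ × Space n → F) : Prop where
  smooth : ContDiff ℝ ∞ ζ
  compact : HasCompactSupport ζ
  support : tsupport ζ ⊆ U

/-- `g` is the weak spatial partial derivative `∂_j f` in the open space-time set `U`. -/
structure HasWeakPartial {n : ℕ} (U : Set (ℝ × Space n)) (j : Fin n)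
    (f g : ℝ × Space n → ℝ) : Prop where
  left : LocallyIntegrableOn f U
  right : LocallyIntegrableOn g U
  parts : ∀ ζ : ℝ × Space n → ℝ, IsTest U ζ →
    ∫ z in U, f z * spacePartial j ζ z = -∫ z in U, g z * ζ z

/-- `(u, Du)` is a local weak solution of `∂_t u - div A(∇u) = 0` on `J × Ω`, where `Du` is
the weak spatial gradient of `u`: `u ∈ L^∞_loc(J; L²_loc(Ω))`, `φ(|∇u|) ∈ L¹_loc(J × Ω)`, and
the equation holds in the weak sense. -/
structure IsLocalWeakSolution {N n : ℕ} (φ : ℝ → ℝ) (J : Set ℝ) (Ω : Set (Space n))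
    (u : ℝ × Space n → Space N) (Du : ℝ × Space n → Mat N n) : Prop where
  meas : AEStronglyMeasurable u (volume.restrict (J ×ˢ Ω))
  bounded : ∀ (I : Set ℝ) (K : Set (Space n)), IsCompact I → I ⊆ J → IsCompact K → K ⊆ Ω →
    ∃ M : ℝ≥0, ∀ᵐ t ∂volume.restrict I, ∫⁻ x in K, ‖u (t, x)‖ₑ ^ 2 ≤ M
  grad : ∀ (i : Fin N) (j : Fin n),
    HasWeakPartial (J ×ˢ Ω) j (fun z => u z i) (fun z => Du z (i, j))
  energy : LocallyIntegrableOn (fun z => φ ‖Du z‖) (J ×ˢ Ω)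
  weak : ∀ ζ : ℝ × Space n → Space N, IsTest (J ×ˢ Ω) ζ →
    ∫ z in J ×ˢ Ω, inner ℝ (A φ (Du z)) (spaceJac ζ z) =
      ∫ z in J ×ˢ Ω, inner ℝ (u z) (timeDeriv ζ z)

/-- The time interval `(t₀ - α r², t₀)`. -/
def timeInt (t₀ α r : ℝ) : Set ℝ := Ioo (t₀ - α * r ^ 2) t₀

/-- The parabolic cylinder `Q_r = (t₀ - α r², t₀) × B_r(x₀)`. -/
def cyl {n : ℕ} (t₀ : ℝ) (x₀ : Space n) (α r : ℝ) : Set (ℝ × Space n) :=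
  timeInt t₀ α r ×ˢ Metric.ball x₀ r

/-- Membership in `C_{0,par}^∞(Q_r) = C_0^∞(Q_r ∪ {t₀} × B_r(x₀))`: restrictions to `t ≤ t₀` of
smooth functions that vanish for `t ≤ t₀` outside of a compact subset of
`(t₀ - α r², t₀] × B_r(x₀)`. The values for `t > t₀` are irrelevant. -/
def IsParTest {n : ℕ} (t₀ : ℝ) (x₀ : Space n) (α r : ℝ) (η : ℝ × Space n → ℝ) : Prop :=
  ContDiff ℝ ∞ η ∧ ∃ K : Set (ℝ × Space n), IsCompact K ∧
    K ⊆ Ioc (t₀ - α * r ^ 2) t₀ ×ˢ Metric.ball x₀ r ∧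
    ∀ z : ℝ × Space n, z.1 ≤ t₀ → z ∉ K → η z = 0

/-- `G(t) = (√(φ'(t) t) - √(φ'(γ) γ))₊`. -/
def G (φ : ℝ → ℝ) (γ t : ℝ) : ℝ := max (√(d φ t * t) - √(d φ γ * γ)) 0

/-- `H(t) = (t² - γ²)₊`. -/
def H (γ t : ℝ) : ℝ := max (t ^ 2 - γ ^ 2) 0

/-- `‖∇η‖_∞`, the supremum of the length of the spatial gradient over the set `Q`. -/
def gradSup {n : ℕ} (Q : Set (ℝ × Space n)) (η : ℝ × Space n → ℝ) : ℝ≥0∞ :=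
  ⨆ z ∈ Q, ‖spaceGrad η z‖ₑ

end PhiCaloric

end

set_option linter.unusedSectionVars false

noncomputable section

namespace PhiCaloric

/-! ### Radial maps with power type growth -/

/-! Formally, differentiate the system in `x_k` and test with `∂_k u κ(|∇u|²) η^q ψ(t)`, where `κ`
approximates the indicator of `(γ², ∞)`. The time derivative produces `(|∇u|² - γ²)₊` on time
slices. The flux is elliptic: with `V(P) = √(φ'(|P|)|P|) P/|P|`, the form `DA(P)X · X` is bounded
below by a multiple of `|DV(P)X|²`, so the diffusion term controls `|∇V|²` on `{v > γ}`. Since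
`G(v)` is 1-Lipschitz in `V` and vanishes on `{v ≤ γ}`, this bounds `|∇G(v)|²`. The term with `∇η`
is at most a multiple of `√(φ'(v)v) |∇V| η^(q-1) |∇η|` and is absorbed by Young's inequality,
because `q ≥ 2` gives `η^(q-1) ≤ η^(q/2)`; the exponent condition itself forces `q ≥ 2`, and this is
its only role. The term with `κ'` has a good sign for radial fluxes, provided second derivatives of
`u` commute. The work lies in justifying this for a weak solution that has no time derivative and, a
priori, no second space derivatives.

Testing. Difference quotients `D_h u` solve a linear system whose flux is `D_h A(∇u)`. Mollification
in space and time commutes with it, so a smooth computation applies. The products of flux and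
gradient converge because `φ'(a) b ≤ φ'(a) a + φ'(b) b` gives an integrable majorant of two-point
form, which survives mollification of both factors (`mol_mul_le`). The result is
`WeakSystem.integral_testIntegrand`.

Second order regularity. With `κ = 1` one obtains a Caccioppoli inequality for `D_h V`, with an
error `h⁻¹` times the mean quadratic oscillation of `V` on segments of length `h`. The error arises
because `D_h u` is an average of `∇u` over a segment whose interior points are not comparable with
its end points. Two passes over nested sets remove it: the trivial bound of the oscillation gives
half a derivative of `V`, and half a derivative makes the error bounded
(`exists_setIntegral_dq_V_le'`). Hence `V` has weak derivatives `Z_k` in `L²`, which are strong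
limits of `D_h V` (`exists_regular`).

The limit `h → 0`. Strong convergence of `D_h V` yields majorants that converge in `L¹`, which
suffices for dominated convergence. Where `∇u ≠ 0`, the map `V` has an injective derivative, so `D_h
∇u` and `D_h A(∇u)` converge pointwise as well; where `∇u = 0` the truncation kills the integrand.
The limits of `D_h ∇u` are not weak derivatives of a locally integrable function by construction, so
their symmetry is derived by computing the weak gradient of `κ(|∇u|²)` in two ways (`ae_symm`). This
gives `energy_inequality`.

Conclusion. With `ψ(t) = ∫_t^{t₀} k` for a probability density `k`, the inequality bounds both a
`k`-average of the time slices and the gradient term (`caccioppoli_cutoff`). Letting `k` concentrate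
at a time gives the slice estimate, and letting it concentrate at `t₀` gives the gradient estimate.

Part (i) is the scaling `φ_a'(σs) ≤ σ^min(c₀,1) φ_a'(s)`, uniform in the shift `a`. -/

/-- `τ` grows at least like `t ^ l` and at most like `t ^ L`. -/
structure PowerGrowth (τ : ℝ → ℝ) (l L : ℝ) : Prop where
  zero : τ 0 = 0
  pos : ∀ t, 0 < t → 0 < τ t
  l_pos : 0 < l
  le_rpow : ∀ r s, 0 ≤ r → r ≤ s → 0 < s → τ r ≤ (r / s) ^ l * τ s
  rpow_le : ∀ r s, 0 ≤ r → r ≤ s → 0 < s → (r / s) ^ L * τ s ≤ τ r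

/-- The radial map with profile `τ`. -/
def radial {F : Type*} [NormedAddCommGroup F] [NormedSpace ℝ F] (τ : ℝ → ℝ) (P : F) : F :=
  (τ ‖P‖ / ‖P‖) • P

namespace PowerGrowth

variable {τ : ℝ → ℝ} {l L : ℝ} (h : PowerGrowth τ l L)
include h

lemma nonneg {t : ℝ} (ht : 0 ≤ t) : 0 ≤ τ t := by
  rcases ht.eq_or_lt with rfl | ht
  · exact h.zero.ge
  · exact (h.pos t ht).le

lemma mono {r s : ℝ} (hr : 0 ≤ r) (hrs : r ≤ s) : τ r ≤ τ s := by
  rcases (hr.trans hrs).eq_or_lt with hs | hs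
  · have : r = s := le_antisymm hrs (hs ▸ hr)
    rw [this]
  · refine (h.le_rpow r s hr hrs hs).trans ?_
    refine mul_le_of_le_one_left (h.pos s hs).le ?_
    exact Real.rpow_le_one (by positivity) ((div_le_one hs).2 hrs) h.l_pos.le

lemma weaken {l' L' : ℝ} (hl' : 0 < l') (hl : l' ≤ l) (hL : L ≤ L') (hL0 : 0 < L) :
    PowerGrowth τ l' L' where
  zero := h.zero
  pos := h.pos
  l_pos := hl'
  le_rpow r s hr hrs hs := by
    refine (h.le_rpow r s hr hrs hs).trans ?_
    refine mul_le_mul_of_nonneg_right ?_ (h.pos s hs).le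
    exact Real.rpow_le_rpow_of_exponent_ge_of_imp (by positivity) ((div_le_one hs).2 hrs) hl
      (fun _ h0 => absurd h0 h.l_pos.ne')
  rpow_le r s hr hrs hs := by
    refine le_trans ?_ (h.rpow_le r s hr hrs hs)
    refine mul_le_mul_of_nonneg_right ?_ (h.pos s hs).le
    exact Real.rpow_le_rpow_of_exponent_ge_of_imp (by positivity) ((div_le_one hs).2 hrs) hL
      (fun _ h0 => absurd h0 (hL0.trans_le hL).ne')

/-- Bernoulli's inequality for the power `l ≤ 1`. It replaces the derivative bound `τ' ≥ l τ(s)/s`,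
so that no differentiability of `τ` is used; `sub_le` is the counterpart for `L ≥ 1`. -/
lemma sub_ge (hl : l ≤ 1) {r s : ℝ} (hr : 0 ≤ r) (hrs : r ≤ s) (hs : 0 < s) :
    l * (τ s / s) * (s - r) ≤ τ s - τ r := by
  have h1 := h.le_rpow r s hr hrs hs
  have h2 : (r / s) ^ l ≤ 1 + l * (r / s - 1) := by
    have := rpow_one_add_le_one_add_mul_self (s := r / s - 1) (p := l)
      (by have : 0 ≤ r / s := by positivity
          linarith) h.l_pos.le hl
    simpa using this
  have h3 : l * (τ s / s) * (s - r) = τ s - (1 + l * (r / s - 1)) * τ s := by field_simp; ring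
  rw [h3]
  have := mul_le_mul_of_nonneg_right h2 (h.pos s hs).le
  linarith

lemma sub_le (hL : 1 ≤ L) {r s : ℝ} (hr : 0 ≤ r) (hrs : r ≤ s) (hs : 0 < s) :
    τ s - τ r ≤ L * (τ s / s) * (s - r) := by
  have h1 := h.rpow_le r s hr hrs hs
  have h2 : 1 + L * (r / s - 1) ≤ (r / s) ^ L := by
    have := one_add_mul_self_le_rpow_one_add (s := r / s - 1) (p := L)
      (by have : 0 ≤ r / s := by positivity
          linarith) hL
    simpa using this
  have h3 : L * (τ s / s) * (s - r) = τ s - (1 + L * (r / s - 1)) * τ s := by field_simp; ring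
  rw [h3]
  have := mul_le_mul_of_nonneg_right h2 (h.pos s hs).le
  linarith

lemma doubling (hL : 0 ≤ L) {r s : ℝ} (hr : 0 ≤ r) (hrs : r ≤ s) (hs : s ≤ 2 * r) :
    τ s ≤ 2 ^ L * τ r := by
  rcases hr.eq_or_lt with rfl | hr'
  · have : s = 0 := le_antisymm (by simpa using hs) hrs
    simp [this, h.zero]
  have hs0 : 0 < s := hr'.trans_le hrs
  have h1 := h.rpow_le r s hr hrs hs0
  have h2 : (1 / 2 : ℝ) ^ L ≤ (r / s) ^ L := by
    refine Real.rpow_le_rpow (by norm_num) ?_ hL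
    rw [div_le_div_iff₀ (by norm_num) hs0]; linarith
  have h3 : (1 / 2 : ℝ) ^ L * τ s ≤ τ r :=
    (mul_le_mul_of_nonneg_right h2 (h.pos s hs0).le).trans h1
  have h4 : (2 : ℝ) ^ L * (1 / 2 : ℝ) ^ L = 1 := by
    rw [← Real.mul_rpow (by norm_num) (by norm_num)]; norm_num
  calc τ s = 2 ^ L * ((1 / 2 : ℝ) ^ L * τ s) := by rw [← mul_assoc, h4, one_mul]
    _ ≤ _ := by gcongr

/-- Monotonicity alone: replace the smaller of `a`, `b` by the larger one. This serves as Young's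
inequality without the conjugate function. -/
lemma young {a b : ℝ} (ha : 0 ≤ a) (hb : 0 ≤ b) : τ a * b ≤ τ a * a + τ b * b := by
  rcases le_total a b with hab | hab
  · have := mul_le_mul_of_nonneg_right (h.mono ha hab) hb
    have := mul_nonneg (h.nonneg ha) ha
    linarith
  · have := mul_le_mul_of_nonneg_left hab (h.nonneg ha)
    have := mul_nonneg (h.nonneg hb) hb
    linarith

variable {F : Type*} [NormedAddCommGroup F] [InnerProductSpace ℝ F]

lemma norm_radial (P : F) : ‖radial τ P‖ = τ ‖P‖ := by
  rcases eq_or_ne P 0 with rfl | hP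
  · simp [radial, h.zero]
  · have hP' : 0 < ‖P‖ := norm_pos_iff.2 hP
    rw [radial, norm_smul, Real.norm_eq_abs, abs_of_nonneg
      (div_nonneg (h.nonneg hP'.le) hP'.le)]
    field_simp

lemma profile_mul (P : F) : τ ‖P‖ / ‖P‖ * ‖P‖ = τ ‖P‖ := by
  rcases eq_or_ne P 0 with rfl | hP
  · simp [h.zero]
  · have hP' : 0 < ‖P‖ := norm_pos_iff.2 hP
    field_simp

/-- Decomposition into a radial and an angular part: the last bracket equals `2(|P||Q| - P·Q)`,
which is nonnegative and vanishes for parallel vectors of equal orientation. Monotonicity of radial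
maps thereby reduces to the scalar profile. -/
lemma inner_radial_sub (P Q : F) :
    inner ℝ (radial τ P - radial τ Q) (P - Q) = (τ ‖P‖ - τ ‖Q‖) * (‖P‖ - ‖Q‖) +
      (τ ‖P‖ / ‖P‖ + τ ‖Q‖ / ‖Q‖) / 2 * (‖P - Q‖ ^ 2 - (‖P‖ - ‖Q‖) ^ 2) := by
  have e1 : ‖P - Q‖ ^ 2 = ‖P‖ ^ 2 - 2 * inner ℝ P Q + ‖Q‖ ^ 2 := norm_sub_sq_real P Q
  have hp := h.profile_mul P
  have hq := h.profile_mul Q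
  rw [e1]
  simp only [radial, inner_sub_left, inner_sub_right, real_inner_smul_left,
    real_inner_self_eq_norm_sq, real_inner_comm P Q]
  generalize τ ‖P‖ / ‖P‖ = a at *
  generalize τ ‖Q‖ / ‖Q‖ = b at *
  rw [← hp, ← hq]; ring

lemma norm_radial_sub_sq (P Q : F) :
    ‖radial τ P - radial τ Q‖ ^ 2 = (τ ‖P‖ - τ ‖Q‖) ^ 2 +
      (τ ‖P‖ / ‖P‖) * (τ ‖Q‖ / ‖Q‖) * (‖P - Q‖ ^ 2 - (‖P‖ - ‖Q‖) ^ 2) := by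
  have e1 : ‖P - Q‖ ^ 2 = ‖P‖ ^ 2 - 2 * inner ℝ P Q + ‖Q‖ ^ 2 := norm_sub_sq_real P Q
  have e2 := norm_sub_sq_real (radial τ P) (radial τ Q)
  have hp := h.profile_mul P
  have hq := h.profile_mul Q
  rw [e1, e2, h.norm_radial, h.norm_radial]
  simp only [radial, real_inner_smul_left, real_inner_smul_right]
  generalize τ ‖P‖ / ‖P‖ = a at *
  generalize τ ‖Q‖ / ‖Q‖ = b at *
  rw [← hp, ← hq]; ring

omit h in
lemma sq_sub_nonneg (P Q : F) : 0 ≤ ‖P - Q‖ ^ 2 - (‖P‖ - ‖Q‖) ^ 2 := by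
  have := abs_norm_sub_norm_le P Q
  have := sq_le_sq' (by linarith [neg_abs_le (‖P‖ - ‖Q‖), norm_nonneg (P - Q)])
    ((le_abs_self _).trans this)
  linarith

lemma profile_nonneg {t : ℝ} (ht : 0 ≤ t) : 0 ≤ τ t / t := div_nonneg (h.nonneg ht) ht

omit h in
lemma exists_monotone_aux {p : F → F → Prop} (hs : ∀ P Q, p P Q → p Q P)
    (hp : ∀ P Q : F, ‖Q‖ ≤ ‖P‖ → p P Q) (P Q : F) : p P Q := by
  rcases le_total ‖Q‖ ‖P‖ with h | h
  · exact hp _ _ h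
  · exact hs _ _ (hp _ _ h)

lemma profile_add_le (hL : 0 ≤ L) {r s : ℝ} (hr : 0 ≤ r) (hrs : r ≤ s) :
    τ (s + r) / (s + r) ≤ 2 ^ L * (τ s / s) := by
  rcases (hr.trans hrs).eq_or_lt with hs | hs
  · have : r = 0 := le_antisymm (hs ▸ hrs) hr
    simp [← hs, this, h.zero]
  have h1 := h.doubling hL hs.le (by linarith : s ≤ s + r) (by linarith)
  rw [← mul_div_assoc]
  gcongr
  · exact mul_nonneg (by positivity) (h.nonneg hs.le)
  · linarith

lemma profile_le_add {r s : ℝ} (hr : 0 ≤ r) (hrs : r ≤ s) :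
    τ s / s ≤ 2 * (τ (s + r) / (s + r)) := by
  rcases (hr.trans hrs).eq_or_lt with hs | hs
  · have : r = 0 := le_antisymm (hs ▸ hrs) hr
    simp [← hs, this, h.zero]
  have h1 := h.mono hs.le (by linarith : s ≤ s + r)
  have h2 := h.pos s hs
  rw [← mul_div_assoc, div_le_div_iff₀ hs (by linarith)]
  nlinarith

/-- Strong monotonicity of radial maps. -/
lemma le_inner_radial_sub (hl : l ≤ 1) (hL : 0 ≤ L) (P Q : F) :
    min l (1 / 2) / 2 ^ L * (τ (‖P‖ + ‖Q‖) / (‖P‖ + ‖Q‖)) * ‖P - Q‖ ^ 2 ≤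
      inner ℝ (radial τ P - radial τ Q) (P - Q) := by
  refine exists_monotone_aux (p := fun P Q : F => min l (1 / 2) / 2 ^ L *
    (τ (‖P‖ + ‖Q‖) / (‖P‖ + ‖Q‖)) * ‖P - Q‖ ^ 2 ≤
      inner ℝ (radial τ P - radial τ Q) (P - Q)) ?_ ?_ P Q
  · intro P Q hPQ
    rw [add_comm ‖Q‖, norm_sub_rev Q P, ← neg_sub P Q, ← neg_sub (radial τ P), inner_neg_neg]
    exact hPQ
  intro P Q hPQ
  have hr := norm_nonneg Q
  rw [h.inner_radial_sub]
  have hD := sq_sub_nonneg P Q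
  have h1 := h.profile_add_le hL hr hPQ
  have hl0 := h.l_pos
  rcases (hr.trans hPQ).eq_or_lt with hs | hs
  · have e1 : P = 0 := norm_eq_zero.1 hs.symm
    have e2 : Q = 0 := norm_eq_zero.1 (le_antisymm (hs ▸ hPQ) hr)
    simp [e1, e2]
  have h2 := h.sub_ge hl hr hPQ hs
  have h3 := h.profile_nonneg hr
  have h4 := h.profile_nonneg hs.le
  set a := τ ‖P‖ / ‖P‖
  set m := τ (‖P‖ + ‖Q‖) / (‖P‖ + ‖Q‖)
  set μ := min l (1 / 2)
  have hμ0 : 0 ≤ μ := le_min hl0.le (by norm_num)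
  have hμ1 : μ ≤ l := min_le_left _ _
  have hμ2 : μ ≤ 1 / 2 := min_le_right _ _
  have h5 : μ / 2 ^ L * m ≤ μ * a := by
    rw [div_mul_eq_mul_div, div_le_iff₀ (by positivity)]
    nlinarith
  have hd : 0 ≤ ‖P‖ - ‖Q‖ := sub_nonneg.2 hPQ
  calc μ / 2 ^ L * m * ‖P - Q‖ ^ 2 ≤ μ * a * ‖P - Q‖ ^ 2 := by gcongr
    _ = μ * a * (‖P‖ - ‖Q‖) * (‖P‖ - ‖Q‖) + μ * a * (‖P - Q‖ ^ 2 - (‖P‖ - ‖Q‖) ^ 2) := by ring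
    _ ≤ (l * a * (‖P‖ - ‖Q‖)) * (‖P‖ - ‖Q‖) +
        (1 / 2 * a) * (‖P - Q‖ ^ 2 - (‖P‖ - ‖Q‖) ^ 2) := by gcongr
    _ ≤ _ := by
      gcongr
      linarith

/-- Growth of differences of radial maps. -/
lemma norm_radial_sub_le (hL : 1 ≤ L) (P Q : F) :
    ‖radial τ P - radial τ Q‖ ≤
      2 * (L + 4) * (τ (‖P‖ + ‖Q‖) / (‖P‖ + ‖Q‖)) * ‖P - Q‖ := by
  refine exists_monotone_aux (p := fun P Q : F => ‖radial τ P - radial τ Q‖ ≤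
      2 * (L + 4) * (τ (‖P‖ + ‖Q‖) / (‖P‖ + ‖Q‖)) * ‖P - Q‖) ?_ ?_ P Q
  · intro P Q hPQ
    rw [add_comm ‖Q‖, norm_sub_rev Q P, norm_sub_rev (radial τ Q)]
    exact hPQ
  intro P Q hPQ
  have hr := norm_nonneg Q
  have hD := sq_sub_nonneg P Q
  have h1 := h.profile_le_add hr hPQ
  rcases (hr.trans hPQ).eq_or_lt with hs | hs
  · have e1 : P = 0 := norm_eq_zero.1 hs.symm
    have e2 : Q = 0 := norm_eq_zero.1 (le_antisymm (hs ▸ hPQ) hr)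
    simp [e1, e2]
  have h2 := h.sub_le hL hr hPQ hs
  have h2' : 0 ≤ τ ‖P‖ - τ ‖Q‖ := sub_nonneg.2 (h.mono hr hPQ)
  have h3 := h.profile_nonneg hr
  have h4 := h.profile_nonneg hs.le
  have hd : 0 ≤ ‖P‖ - ‖Q‖ := sub_nonneg.2 hPQ
  have hn : ‖P‖ - ‖Q‖ ≤ ‖P - Q‖ := norm_sub_norm_le P Q
  have hn' : ‖P - Q‖ ≤ ‖P‖ + ‖Q‖ := norm_sub_le P Q
  -- The quotient `τ(|Q|)/|Q|` may be large for small `|Q|`. If `|Q| ≤ |P|/2`, the angular part is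
  -- at most `4|P||Q|`, which compensates the quotient, and `|P| ≤ 2|P - Q|`; otherwise the two
  -- quotients are comparable.
  have key : (τ ‖P‖ / ‖P‖) * (τ ‖Q‖ / ‖Q‖) * (‖P - Q‖ ^ 2 - (‖P‖ - ‖Q‖) ^ 2) ≤
      16 * ((τ ‖P‖ / ‖P‖) * ‖P - Q‖) ^ 2 := by
    rcases le_total (2 * ‖Q‖) ‖P‖ with hc | hc
    · have e : ‖P - Q‖ ^ 2 - (‖P‖ - ‖Q‖) ^ 2 ≤ 4 * ‖P‖ * ‖Q‖ := by nlinarith [norm_nonneg (P - Q)]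
      have hq := h.profile_mul Q
      have hp := h.profile_mul P
      have hm := h.mono hr hPQ
      calc (τ ‖P‖ / ‖P‖) * (τ ‖Q‖ / ‖Q‖) * (‖P - Q‖ ^ 2 - (‖P‖ - ‖Q‖) ^ 2)
          ≤ (τ ‖P‖ / ‖P‖) * (τ ‖Q‖ / ‖Q‖) * (4 * ‖P‖ * ‖Q‖) := by gcongr
        _ = 4 * (τ ‖P‖ / ‖P‖ * ‖P‖) * (τ ‖Q‖ / ‖Q‖ * ‖Q‖) := by ring
        _ = 4 * τ ‖P‖ * τ ‖Q‖ := by rw [hp, hq]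
        _ ≤ 4 * τ ‖P‖ * τ ‖P‖ := by
          have := h.nonneg hs.le
          gcongr
        _ = 4 * (τ ‖P‖ / ‖P‖ * ‖P‖) ^ 2 := by rw [hp]; ring
        _ ≤ 4 * (τ ‖P‖ / ‖P‖ * (2 * ‖P - Q‖)) ^ 2 := by
          gcongr
          linarith
        _ = _ := by ring
    · have e : τ ‖Q‖ / ‖Q‖ ≤ 2 * (τ ‖P‖ / ‖P‖) := by
        have hQ : 0 < ‖Q‖ := by linarith
        have hm := h.mono hr hPQ
        have := h.pos _ hs
        rw [← mul_div_assoc, div_le_div_iff₀ hQ hs]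
        nlinarith
      have e2 : ‖P - Q‖ ^ 2 - (‖P‖ - ‖Q‖) ^ 2 ≤ ‖P - Q‖ ^ 2 := by nlinarith
      calc _ ≤ (τ ‖P‖ / ‖P‖) * (2 * (τ ‖P‖ / ‖P‖)) * ‖P - Q‖ ^ 2 := by gcongr
        _ ≤ _ := by nlinarith [sq_nonneg ((τ ‖P‖ / ‖P‖) * ‖P - Q‖)]
  have hsq : ‖radial τ P - radial τ Q‖ ^ 2 ≤ ((L + 4) * ((τ ‖P‖ / ‖P‖) * ‖P - Q‖)) ^ 2 := by
    rw [h.norm_radial_sub_sq]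
    have e3 : (τ ‖P‖ - τ ‖Q‖) ^ 2 ≤ (L * ((τ ‖P‖ / ‖P‖) * ‖P - Q‖)) ^ 2 := by
      apply pow_le_pow_left₀ h2'
      calc _ ≤ L * (τ ‖P‖ / ‖P‖) * (‖P‖ - ‖Q‖) := h2
        _ ≤ L * (τ ‖P‖ / ‖P‖) * ‖P - Q‖ := by gcongr
        _ = _ := by ring
    nlinarith [sq_nonneg ((τ ‖P‖ / ‖P‖) * ‖P - Q‖)]
  have hpos : 0 ≤ (L + 4) * ((τ ‖P‖ / ‖P‖) * ‖P - Q‖) := by positivity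
  have := (pow_le_pow_iff_left₀ (norm_nonneg _) hpos (by norm_num)).1 hsq
  calc _ ≤ _ := this
    _ ≤ (L + 4) * ((2 * (τ (‖P‖ + ‖Q‖) / (‖P‖ + ‖Q‖))) * ‖P - Q‖) := by gcongr
    _ = _ := by ring

lemma le_norm_radial_sub (hl : l ≤ 1) (hL : 0 ≤ L) (P Q : F) :
    min l (1 / 2) / 2 ^ L * (τ (‖P‖ + ‖Q‖) / (‖P‖ + ‖Q‖)) * ‖P - Q‖ ≤
      ‖radial τ P - radial τ Q‖ := by
  rcases eq_or_ne P Q with rfl | hPQ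
  · simp
  have h0 : 0 < ‖P - Q‖ := norm_pos_iff.2 (sub_ne_zero.2 hPQ)
  have h1 := (h.le_inner_radial_sub hl hL P Q).trans (real_inner_le_norm _ _)
  rw [pow_two, ← mul_assoc] at h1
  exact le_of_mul_le_mul_right h1 h0

end PowerGrowth

end PhiCaloric
end

noncomputable section

namespace PhiCaloric

/-! ### Consequences of the growth conditions -/

/-- The modulus `√(φ'(t) t)` of the natural quantity `V`. -/
def nu (φ : ℝ → ℝ) (t : ℝ) : ℝ := √(d φ t * t)

/-- The natural quantity `V(P) = √(φ'(|P|) |P|) P / |P|`. -/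
def V {F : Type*} [NormedAddCommGroup F] [NormedSpace ℝ F] (φ : ℝ → ℝ) (P : F) : F :=
  radial (nu φ) P

lemma A_eq_radial {N n : ℕ} (φ : ℝ → ℝ) (P : Mat N n) : A φ P = radial (d φ) P := rfl

namespace IsOrlicz

variable {φ : ℝ → ℝ} {c₀ c₁ : ℝ} (h : IsOrlicz φ c₀ c₁)
include h

lemma hasDerivAt {t : ℝ} (ht : 0 < t) : HasDerivAt φ (d φ t) t := by
  have h1 : DifferentiableWithinAt ℝ φ (Ici 0) t :=
    (h.contDiff_one.differentiableOn (by norm_num)) t ht.le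
  exact h1.hasDerivWithinAt.hasDerivAt (Ici_mem_nhds ht)

lemma continuousOn_d : ContinuousOn (d φ) (Ici 0) :=
  h.contDiff_one.continuousOn_derivWithin (uniqueDiffOn_Ici 0) (by norm_num)

lemma contDiffOn_d : ContDiffOn ℝ 1 (d φ) (Ioi 0) := by
  have h1 := ((contDiffOn_succ_iff_deriv_of_isOpen (n := 1) (𝕜 := ℝ) (f := φ) (s := Ioi 0)
    isOpen_Ioi).1 h.contDiff_two).2.2
  exact h1.congr fun t ht => (h.hasDerivAt ht).deriv.symm

lemma hasDerivAt_d {t : ℝ} (ht : 0 < t) : HasDerivAt (d φ) (deriv (d φ) t) t :=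
  ((h.contDiffOn_d.differentiableOn (by norm_num)).differentiableAt (Ioi_mem_nhds ht)).hasDerivAt

lemma le_d_mul {t : ℝ} (ht : 0 ≤ t) : φ t ≤ d φ t * t := by
  rcases ht.eq_or_lt with rfl | ht
  · simp [h.zero]
  · have h1 := h.convex.slope_le_of_hasDerivAt (mem_Ici.2 le_rfl) (mem_Ici.2 ht.le) ht
      (h.hasDerivAt ht)
    rw [slope_def_field, h.zero, sub_zero, sub_zero, div_le_iff₀ ht] at h1
    exact h1

lemma d_nonneg {t : ℝ} (ht : 0 ≤ t) : 0 ≤ d φ t := by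
  rcases ht.eq_or_lt with rfl | ht
  · exact h.d_zero.ge
  · have h1 := (h.nonneg t ht.le).trans (h.le_d_mul ht.le)
    exact nonneg_of_mul_nonneg_left h1 ht

/-- The upper characteristic says that the derivative of `φ'(t) t^(-c₁)` is nonpositive. The lower
one gives the opposite monotonicity with `c₀`, and together they amount to the power growth of `φ'`.
-/
lemma d_mul_rpow_anti {r s : ℝ} (hr : 0 < r) (hrs : r ≤ s) :
    d φ s * s ^ (-c₁) ≤ d φ r * r ^ (-c₁) := by
  have hd : ∀ t ∈ Ioi (0 : ℝ), HasDerivAt (fun t => d φ t * t ^ (-c₁))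
      (deriv (d φ) t * t ^ (-c₁) + d φ t * (-c₁ * t ^ (-c₁ - 1))) t := fun t ht =>
    (h.hasDerivAt_d ht).mul (Real.hasDerivAt_rpow_const (Or.inl (ne_of_gt ht)))
  have h1 : AntitoneOn (fun t => d φ t * t ^ (-c₁)) (Ioi 0) := by
    refine antitoneOn_of_deriv_nonpos (convex_Ioi 0)
      (fun t ht => (hd t ht).continuousAt.continuousWithinAt)
      (fun t ht => (hd t (interior_subset ht)).differentiableAt.differentiableWithinAt)
      (fun t ht => ?_)
    rw [interior_Ioi] at ht
    rw [(hd t ht).deriv]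
    have ht' : 0 < t := ht
    have e : t ^ (-c₁) = t ^ (-c₁ - 1) * t := by
      rw [← Real.rpow_add_one ht'.ne']; ring_nf
    have := h.upper t ht
    have h2 : 0 < t ^ (-c₁ - 1) := Real.rpow_pos_of_pos ht' _
    rw [e]
    nlinarith
  exact h1 hr (hr.trans_le hrs) hrs

lemma d_mul_rpow_mono {r s : ℝ} (hr : 0 < r) (hrs : r ≤ s) :
    d φ r * r ^ (-c₀) ≤ d φ s * s ^ (-c₀) := by
  have hd : ∀ t ∈ Ioi (0 : ℝ), HasDerivAt (fun t => d φ t * t ^ (-c₀))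
      (deriv (d φ) t * t ^ (-c₀) + d φ t * (-c₀ * t ^ (-c₀ - 1))) t := fun t ht =>
    (h.hasDerivAt_d ht).mul (Real.hasDerivAt_rpow_const (Or.inl (ne_of_gt ht)))
  have h1 : MonotoneOn (fun t => d φ t * t ^ (-c₀)) (Ioi 0) := by
    refine monotoneOn_of_deriv_nonneg (convex_Ioi 0)
      (fun t ht => (hd t ht).continuousAt.continuousWithinAt)
      (fun t ht => (hd t (interior_subset ht)).differentiableAt.differentiableWithinAt)
      (fun t ht => ?_)
    rw [interior_Ioi] at ht
    rw [(hd t ht).deriv]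
    have ht' : 0 < t := ht
    have e : t ^ (-c₀) = t ^ (-c₀ - 1) * t := by
      rw [← Real.rpow_add_one ht'.ne']; ring_nf
    have := h.lower t ht
    have h2 : 0 < t ^ (-c₀ - 1) := Real.rpow_pos_of_pos ht' _
    rw [e]
    nlinarith
  exact h1 hr (hr.trans_le hrs) hrs

/-- If `φ'` vanished at some `t > 0`, then by the monotonicity of `φ'(s) s^(-c₁)` it would be
nonpositive from there on, and `φ(s) ≤ φ'(s) s ≤ 0` would contradict `φ → ∞`. -/
lemma d_pos {t : ℝ} (ht : 0 < t) : 0 < d φ t := by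
  refine lt_of_le_of_ne (h.d_nonneg ht.le) fun h0 => ?_
  have h1 : ∀ s, t ≤ s → φ s ≤ 0 := by
    intro s hs
    have h2 := h.d_mul_rpow_anti ht hs
    rw [← h0, zero_mul] at h2
    have h3 : 0 < s ^ (-c₁) := Real.rpow_pos_of_pos (ht.trans_le hs) _
    have h4 : d φ s ≤ 0 := nonpos_of_mul_nonpos_left h2 h3
    exact (h.le_d_mul (ht.le.trans hs)).trans
      (mul_nonpos_of_nonpos_of_nonneg h4 (ht.le.trans hs))
  obtain ⟨s, hs1, hs2⟩ := ((h.tendsto.eventually_ge_atTop 1).and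
    (Filter.eventually_ge_atTop t)).exists
  linarith [h1 s hs2]

lemma c₀_le_c₁ : c₀ ≤ c₁ := by
  have h1 := h.d_pos one_pos
  have h2 := (h.lower 1 one_pos).trans (h.upper 1 one_pos)
  exact le_of_mul_le_mul_right h2 h1

lemma powerGrowth_d (hc₀ : 0 < c₀) : PowerGrowth (d φ) c₀ c₁ where
  zero := h.d_zero
  pos _ ht := h.d_pos ht
  l_pos := hc₀
  le_rpow r s hr hrs hs := by
    rcases hr.eq_or_lt with rfl | hr
    · rw [h.d_zero]
      exact mul_nonneg (by positivity) (h.d_pos hs).le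
    · have h1 := h.d_mul_rpow_mono hr hrs
      rw [Real.rpow_neg hr.le, Real.rpow_neg hs.le, ← div_eq_mul_inv, ← div_eq_mul_inv,
        div_le_div_iff₀ (Real.rpow_pos_of_pos hr _) (Real.rpow_pos_of_pos hs _)] at h1
      rw [Real.div_rpow hr.le hs.le, div_mul_eq_mul_div, le_div_iff₀ (Real.rpow_pos_of_pos hs _)]
      linarith
  rpow_le r s hr hrs hs := by
    have hc₁ : 0 < c₁ := hc₀.trans_le h.c₀_le_c₁
    rcases hr.eq_or_lt with rfl | hr
    · rw [h.d_zero, zero_div, Real.zero_rpow hc₁.ne', zero_mul]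
    · have h1 := h.d_mul_rpow_anti hr hrs
      rw [Real.rpow_neg hr.le, Real.rpow_neg hs.le, ← div_eq_mul_inv, ← div_eq_mul_inv,
        div_le_div_iff₀ (Real.rpow_pos_of_pos hs _) (Real.rpow_pos_of_pos hr _)] at h1
      rw [Real.div_rpow hr.le hs.le, div_mul_eq_mul_div, div_le_iff₀ (Real.rpow_pos_of_pos hs _)]
      linarith

lemma d_mul_self_nonneg {t : ℝ} (ht : 0 ≤ t) : 0 ≤ d φ t * t := mul_nonneg (h.d_nonneg ht) ht

lemma nu_sq {t : ℝ} (ht : 0 ≤ t) : nu φ t ^ 2 = d φ t * t :=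
  Real.sq_sqrt (h.d_mul_self_nonneg ht)

lemma powerGrowth_nu (hc₀ : 0 < c₀) : PowerGrowth (nu φ) ((1 + c₀) / 2) ((1 + c₁) / 2) where
  zero := by simp [nu]
  pos t ht := Real.sqrt_pos.2 (mul_pos (h.d_pos ht) ht)
  l_pos := by linarith
  le_rpow r s hr hrs hs := by
    have h1 := (h.powerGrowth_d hc₀).le_rpow r s hr hrs hs
    have hx : 0 ≤ r / s := by positivity
    have e : (r / s) ^ ((1 + c₀) / 2) = √((r / s) * (r / s) ^ c₀) := by
      rw [Real.sqrt_eq_rpow, ← Real.rpow_one_add' hx (by linarith), ← Real.rpow_mul hx]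
      ring_nf
    rw [e, nu, nu, ← Real.sqrt_mul (by positivity)]
    refine Real.sqrt_le_sqrt ?_
    calc d φ r * r ≤ (r / s) ^ c₀ * d φ s * r := by gcongr
      _ = _ := by field_simp
  rpow_le r s hr hrs hs := by
    have h1 := (h.powerGrowth_d hc₀).rpow_le r s hr hrs hs
    have hc₁ : 0 < c₁ := hc₀.trans_le h.c₀_le_c₁
    have hx : 0 ≤ r / s := by positivity
    have e : (r / s) ^ ((1 + c₁) / 2) = √((r / s) * (r / s) ^ c₁) := by
      rw [Real.sqrt_eq_rpow, ← Real.rpow_one_add' hx (by linarith), ← Real.rpow_mul hx]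
      ring_nf
    rw [e, nu, nu, ← Real.sqrt_mul (by positivity)]
    refine Real.sqrt_le_sqrt ?_
    calc _ = (r / s) ^ c₁ * d φ s * r := by field_simp
      _ ≤ d φ r * r := by gcongr

/-- Convexity at `t/2` gives `φ'(t/2) t/2 ≤ φ(t) - φ(t/2)`, and doubling compares `φ'(t)` with
`φ'(t/2)`. This is where the energy `φ'(v)v` of the proof is traded for the `φ(v)` of the statement.
-/
lemma d_mul_le (hc₀ : 0 < c₀) {t : ℝ} (ht : 0 ≤ t) : d φ t * t ≤ 2 ^ (c₁ + 1) * φ t := by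
  have hc₁ : 0 < c₁ := hc₀.trans_le h.c₀_le_c₁
  rcases ht.eq_or_lt with rfl | ht
  · simp [h.zero]
  · have h1 := h.convex.le_slope_of_hasDerivAt (mem_Ici.2 (half_pos ht).le) (mem_Ici.2 ht.le)
      (half_lt_self ht) (h.hasDerivAt (half_pos ht))
    have h3 := h.nonneg (t / 2) (by positivity)
    rw [slope_def_field, le_div_iff₀ (by linarith)] at h1
    have h2 := (h.powerGrowth_d hc₀).doubling hc₁.le (half_pos ht).le (half_lt_self ht).le
      (by linarith)
    rw [Real.rpow_add (by norm_num), Real.rpow_one]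
    have h4 : (0 : ℝ) < 2 ^ c₁ := by positivity
    have h5 : d φ t * t ≤ 2 ^ c₁ * (d φ (t / 2) * t) := by nlinarith
    have h6 : d φ (t / 2) * t ≤ 2 * φ t := by linarith
    nlinarith

lemma V_norm {F : Type*} [NormedAddCommGroup F] [InnerProductSpace ℝ F] (hc₀ : 0 < c₀) (P : F) :
    ‖V φ P‖ = nu φ ‖P‖ := (h.powerGrowth_nu hc₀).norm_radial P

lemma continuous_d_norm {F : Type*} [NormedAddCommGroup F] :
    Continuous fun P : F => d φ ‖P‖ := by
  have h1 : Continuous fun t : ℝ => d φ (max t 0) :=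
    h.continuousOn_d.comp_continuous (by fun_prop) (fun t => mem_Ici.2 (le_max_right t 0))
  have := h1.comp (continuous_norm (E := F))
  simpa [Function.comp_def] using this

lemma measurable_A {N n : ℕ} : Measurable fun P : Mat N n => A φ P := by
  have := h.continuous_d_norm (F := Mat N n)
  unfold A
  exact (this.measurable.div measurable_norm).smul measurable_id

lemma measurable_V {N n : ℕ} : Measurable fun P : Mat N n => V φ P := by
  have := h.continuous_d_norm (F := Mat N n)
  unfold V radial nu
  exact ((this.mul continuous_norm).measurable.sqrt.div measurable_norm).smul measurable_id

lemma continuousOn_shift {a : ℝ} (ha : 0 ≤ a) :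
    ContinuousOn (fun s => d φ (a + s) / (a + s) * s) (Ici 0) := by
  have h1 : ContinuousOn (fun s => d φ (a + s)) (Ici 0) :=
    h.continuousOn_d.comp (by fun_prop) fun s hs => add_nonneg ha hs
  rcases ha.eq_or_lt with rfl | ha
  · refine h.continuousOn_d.congr fun s hs => ?_
    rcases (mem_Ici.1 hs).eq_or_lt with rfl | hs
    · simp [h.d_zero]
    · simp only [zero_add]; field_simp
  · exact (h1.div (by fun_prop) fun s hs => by have := mem_Ici.1 hs; positivity).mul continuousOn_id

/-- This is the scaling `φ_a'(σs) ≤ σ^c φ_a'(s)` with `c = min c₀ 1`. The ratio `x = (a + σs)/(a +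
s)` lies in `[σ, 1]`; power growth of `φ'` gives a factor `x^c`, and `x^c σ ≤ σ^c x` holds because
`c ≤ 1`. The exponent must be capped at `1` since for `a > 0` the function `φ_a'` is linear near
`0`. -/
lemma shift_rpow_le (hc₀ : 0 < c₀) {a s σ : ℝ} (ha : 0 ≤ a) (hs : 0 ≤ s) (hσ : 0 < σ)
    (hσ1 : σ ≤ 1) : d φ (a + σ * s) / (a + σ * s) * (σ * s) ≤
      σ ^ min c₀ 1 * (d φ (a + s) / (a + s) * s) := by
  have hc₁ : 0 < c₁ := hc₀.trans_le h.c₀_le_c₁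
  rcases hs.eq_or_lt with rfl | hs
  · simp
  have hg := (h.powerGrowth_d hc₀).weaken (l' := min c₀ 1) (by positivity) (min_le_left _ _)
    le_rfl hc₁
  set c := min c₀ 1 with hc
  have hc1 : c ≤ 1 := min_le_right _ _
  have hS : 0 < a + s := by positivity
  have hr : 0 < a + σ * s := by positivity
  have hrS : a + σ * s ≤ a + s := by nlinarith
  have h1 := hg.le_rpow _ _ hr.le hrS hS
  set x := (a + σ * s) / (a + s) with hx
  have hx0 : 0 < x := by positivity
  have hσx : σ ≤ x := by rw [hx, le_div_iff₀ hS]; nlinarith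
  have h2 : x ^ c * σ ≤ σ ^ c * x := by
    calc x ^ c * σ = x ^ c * (σ ^ c * σ ^ (1 - c)) := by
          rw [← Real.rpow_add hσ]; simp
      _ ≤ x ^ c * (σ ^ c * x ^ (1 - c)) := by
          have := Real.rpow_le_rpow hσ.le hσx (by linarith : 0 ≤ 1 - c)
          gcongr
      _ = σ ^ c * (x ^ c * x ^ (1 - c)) := by ring
      _ = _ := by rw [← Real.rpow_add hx0]; simp
  have hd := h.d_pos hS
  calc d φ (a + σ * s) / (a + σ * s) * (σ * s)
      ≤ x ^ c * d φ (a + s) / (a + σ * s) * (σ * s) := by gcongr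
    _ = (x ^ c * σ) * (d φ (a + s) / (a + σ * s) * s) := by ring
    _ ≤ (σ ^ c * x) * (d φ (a + s) / (a + σ * s) * s) := by gcongr
    _ = _ := by rw [hx]; field_simp

lemma shifted_mul_le (hc₀ : 0 < c₀) {a t σ : ℝ} (ha : 0 ≤ a) (ht : 0 ≤ t) (hσ : 0 < σ)
    (hσ1 : σ ≤ 1) : shifted φ a (σ * t) ≤ σ ^ (1 + min c₀ 1) * shifted φ a t := by
  have hcont := h.continuousOn_shift ha
  have hint : IntervalIntegrable (fun s => d φ (a + s) / (a + s) * s) volume 0 t :=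
    (hcont.mono (by rw [uIcc_of_le ht]; exact Icc_subset_Ici_self)).intervalIntegrable
  have hint2 : IntervalIntegrable (fun s => d φ (a + σ * s) / (a + σ * s) * (σ * s)) volume 0 t := by
    refine ContinuousOn.intervalIntegrable ?_
    rw [uIcc_of_le ht]
    exact hcont.comp (f := fun s => σ * s) (by fun_prop) fun s hs =>
      mul_nonneg hσ.le hs.1
  have e := intervalIntegral.mul_integral_comp_mul_left (a := 0) (b := t)
    (f := fun s => d φ (a + s) / (a + s) * s) σ
  rw [mul_zero] at e
  unfold shifted
  rw [← e, Real.rpow_add hσ, Real.rpow_one, mul_assoc]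
  gcongr
  rw [← intervalIntegral.integral_const_mul]
  exact intervalIntegral.integral_mono_on ht hint2 (hint.const_mul _)
    fun s hs => h.shift_rpow_le hc₀ ha hs.1 hσ hσ1

lemma exponentCondition (hc₀ : 0 < c₀) :
    ExponentCondition φ ((1 + min c₀ 1) / min c₀ 1) 1 := by
  intro a t s ha ht hs hs1
  have hc : 0 < min c₀ 1 := lt_min hc₀ one_pos
  have e : (1 + min c₀ 1) / min c₀ 1 - 1 = 1 / min c₀ 1 := by field_simp; ring
  rw [e, one_mul]
  rcases hs.eq_or_lt with rfl | hs
  · rw [Real.zero_rpow (by positivity), Real.zero_rpow (by positivity), zero_mul, zero_mul]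
    simp [shifted]
  -- With `c = min c₀ 1` take `σ = s^(1/c) = s^(q-1)`; then `σ^(1+c) = s^q`.
  have h1 := h.shifted_mul_le hc₀ ha ht (Real.rpow_pos_of_pos hs (1 / min c₀ 1))
    (Real.rpow_le_one hs.le hs1 (by positivity))
  rw [← Real.rpow_mul hs.le] at h1
  convert! h1 using 3
  ring

/-- For the shift `a = 1` the function `φ_1` is bounded below by a multiple of `t²` on `[0, 1]`. The
exponent condition at `t = 1` then reads `s^(2(q-1)) ≤ C s^q`, that is `s^(q-2) ≤ C`, which fails
for small `s` if `q < 2`. -/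
lemma two_le_of_exponentCondition (hc₀ : 0 < c₀) {q K : ℝ} (hq1 : 1 < q) (hK : 0 < K)
    (hq : ExponentCondition φ q K) : 2 ≤ q := by
  by_contra! hq2
  have hg := h.powerGrowth_d hc₀
  have hcont := h.continuousOn_shift zero_le_one
  have hint : ∀ t, 0 ≤ t →
      IntervalIntegrable (fun s => d φ (1 + s) / (1 + s) * s) volume 0 t := fun t ht =>
    (hcont.mono (by rw [uIcc_of_le ht]; exact Icc_subset_Ici_self)).intervalIntegrable
  have hp1 := h.d_pos one_pos
  have hp2 := h.d_pos two_pos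
  have hlow : ∀ t, 0 ≤ t → t ≤ 1 → d φ 1 / 4 * t ^ 2 ≤ shifted φ 1 t := by
    intro t ht ht1
    have e : d φ 1 / 4 * t ^ 2 = ∫ s in (0 : ℝ)..t, d φ 1 / 2 * s := by
      rw [intervalIntegral.integral_const_mul, integral_id]; ring
    rw [e]
    refine intervalIntegral.integral_mono_on ht (by
      apply Continuous.intervalIntegrable; fun_prop) (hint t ht) fun s hs => ?_
    have hm := hg.mono zero_le_one (by linarith [hs.1] : (1 : ℝ) ≤ 1 + s)
    have hs0 := hs.1
    have hs1 := hs.2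
    rw [mul_comm, mul_comm (_ / _)]
    refine mul_le_mul_of_nonneg_left ?_ hs0
    rw [div_le_div_iff₀ (by norm_num) (by linarith)]
    nlinarith
  have hup : shifted φ 1 1 ≤ d φ 2 := by
    have e : d φ 2 = ∫ s in (0 : ℝ)..1, d φ 2 := by simp
    rw [e]
    refine intervalIntegral.integral_mono_on zero_le_one (hint 1 zero_le_one) (by simp)
      fun s hs => ?_
    have hs0 := hs.1
    have hs1 := hs.2
    have hm := hg.mono (by linarith) (by linarith [hs.2] : (1 : ℝ) + s ≤ 2)
    rw [div_mul_eq_mul_div, div_le_iff₀ (by linarith)]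
    nlinarith [h.d_nonneg (by linarith : 0 ≤ 1 + s)]
  set M := K * d φ 2 / (d φ 1 / 4) with hM
  have hM0 : 0 < M := by positivity
  -- Chosen so that `s^(q-2) = M + 1` exceeds the constant `M` allowed by the condition; `s ≤ 1`
  -- because the exponent `1/(q-2)` is negative.
  set s := (M + 1) ^ (1 / (q - 2)) with hs
  have hs0 : 0 < s := by positivity
  have hs1 : s ≤ 1 := Real.rpow_le_one_of_one_le_of_nonpos (by linarith)
    (div_nonpos_of_nonneg_of_nonpos zero_le_one (by linarith))
  have hsq : s ^ (q - 2) = M + 1 := by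
    rw [hs, ← Real.rpow_mul (by linarith), one_div, inv_mul_cancel₀ (by linarith), Real.rpow_one]
  have h1 := hq 1 1 s zero_le_one zero_le_one hs0.le hs1
  rw [mul_one] at h1
  have h2 := hlow (s ^ (q - 1)) (by positivity) (Real.rpow_le_one hs0.le hs1 (by linarith))
  have h3 : d φ 1 / 4 * (s ^ (q - 1)) ^ 2 ≤ K * s ^ q * d φ 2 := by
    refine h2.trans (h1.trans ?_)
    gcongr
  have h4 : (s ^ (q - 1)) ^ 2 = s ^ (q - 2) * s ^ q := by
    rw [← Real.rpow_natCast, ← Real.rpow_mul hs0.le, ← Real.rpow_add hs0]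
    congr 1; push_cast; ring
  rw [h4, hsq] at h3
  have h5 : 0 < s ^ q := by positivity
  have h6 : d φ 1 / 4 * (M + 1) ≤ K * d φ 2 := by
    refine le_of_mul_le_mul_right ?_ h5
    linarith
  have h7 : d φ 1 / 4 * M = K * d φ 2 := by rw [hM]; field_simp
  linarith

end IsOrlicz

end PhiCaloric
end

noncomputable section

namespace PhiCaloric

/-! ### Pointwise inequalities for `A` and `V` -/

/-- The coefficient `φ'(t) / t`. -/
def coef (φ : ℝ → ℝ) (t : ℝ) : ℝ := d φ t / t

namespace IsOrlicz

variable {φ : ℝ → ℝ} {c₀ c₁ : ℝ} (h : IsOrlicz φ c₀ c₁)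
include h

lemma coef_nonneg {t : ℝ} (ht : 0 ≤ t) : 0 ≤ coef φ t := div_nonneg (h.d_nonneg ht) ht

lemma coef_mul (t : ℝ) : coef φ t * t = d φ t := by
  rcases eq_or_ne t 0 with rfl | ht
  · simp [h.d_zero]
  · unfold coef; field_simp

lemma nu_div_sq {t : ℝ} (ht : 0 ≤ t) : (nu φ t / t) ^ 2 = coef φ t := by
  rcases ht.eq_or_lt with rfl | ht
  · simp [coef]
  · rw [div_pow, h.nu_sq ht.le, coef]; field_simp

lemma coef_le (hc₀ : 0 < c₀) {s t : ℝ} (hs : 0 ≤ s) (hst : s ≤ 2 * t) (hts : t ≤ 2 * s) :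
    coef φ s ≤ 2 * 2 ^ c₁ * coef φ t := by
  have hc₁ : 0 < c₁ := hc₀.trans_le h.c₀_le_c₁
  have hg := h.powerGrowth_d hc₀
  have h1 : (1 : ℝ) ≤ 2 ^ c₁ := Real.one_le_rpow (by norm_num) hc₁.le
  rcases hs.eq_or_lt with rfl | hs
  · have : t = 0 := by linarith
    simp [this, coef]
  have ht : 0 < t := by linarith
  rcases le_total s t with hle | hle
  · have h2 := hg.mono hs.le hle
    have h3 : coef φ s ≤ 2 * coef φ t := by
      unfold coef
      rw [← mul_div_assoc, div_le_div_iff₀ hs ht]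
      nlinarith [h.d_pos hs]
    have h4 := h.coef_nonneg ht.le
    nlinarith
  · have h2 := hg.doubling hc₁.le ht.le hle hst
    have h3 : coef φ s ≤ 2 ^ c₁ * coef φ t := by
      unfold coef
      rw [← mul_div_assoc, div_le_div_iff₀ hs ht]
      have := h.d_pos ht
      have : 0 < 2 ^ c₁ * d φ t := by positivity
      nlinarith
    have h4 := h.coef_nonneg ht.le
    nlinarith

variable {F : Type*} [NormedAddCommGroup F] [InnerProductSpace ℝ F]

lemma norm_V_sq (hc₀ : 0 < c₀) (P : F) : ‖V φ P‖ ^ 2 = d φ ‖P‖ * ‖P‖ := by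
  rw [h.V_norm hc₀, h.nu_sq (norm_nonneg _)]

lemma exists_norm_radial_sub_le (hc₀ : 0 < c₀) : ∃ C, 0 < C ∧ ∀ P Q : F,
    ‖radial (d φ) P - radial (d φ) Q‖ ≤ C * (coef φ (‖P‖ + ‖Q‖) * ‖P - Q‖) := by
  have hc₁ : 0 < c₁ := hc₀.trans_le h.c₀_le_c₁
  have hg := (h.powerGrowth_d hc₀).weaken hc₀ le_rfl (le_max_left c₁ 1) hc₁
  refine ⟨2 * (max c₁ 1 + 4), by positivity, fun P Q => ?_⟩
  rw [← mul_assoc]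
  exact hg.norm_radial_sub_le (le_max_right _ _) P Q

lemma exists_coef_mul_le_inner (hc₀ : 0 < c₀) : ∃ C, 0 < C ∧ ∀ P Q : F,
    coef φ (‖P‖ + ‖Q‖) * ‖P - Q‖ ^ 2 ≤
      C * inner ℝ (radial (d φ) P - radial (d φ) Q) (P - Q) := by
  have hc₁ : 0 < c₁ := hc₀.trans_le h.c₀_le_c₁
  have hg := (h.powerGrowth_d hc₀).weaken (l' := min c₀ 1) (by positivity) (min_le_left _ _)
    le_rfl hc₁
  have hmin : 0 < min (min c₀ 1) (1 / 2 : ℝ) := by positivity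
  refine ⟨(min (min c₀ 1) (1 / 2) / 2 ^ c₁)⁻¹, by positivity, fun P Q => ?_⟩
  have := hg.le_inner_radial_sub (min_le_right _ _) hc₁.le P Q
  rw [mul_assoc] at this
  rw [inv_mul_eq_div, le_div_iff₀' (by positivity)]
  exact this

lemma exists_norm_V_sub_sq_le (hc₀ : 0 < c₀) : ∃ C, 0 < C ∧ ∀ P Q : F,
    ‖V φ P - V φ Q‖ ^ 2 ≤ C * (coef φ (‖P‖ + ‖Q‖) * ‖P - Q‖ ^ 2) := by
  have hc₁ : 0 < c₁ := hc₀.trans_le h.c₀_le_c₁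
  have hg := (h.powerGrowth_nu hc₀).weaken (l' := (1 + c₀) / 2) (by positivity) le_rfl
    (le_max_left ((1 + c₁) / 2) 1) (by positivity)
  refine ⟨(2 * (max ((1 + c₁) / 2) 1 + 4)) ^ 2, by positivity, fun P Q => ?_⟩
  have := hg.norm_radial_sub_le (le_max_right _ _) P Q
  have h2 := pow_le_pow_left₀ (norm_nonneg _) this 2
  rw [mul_pow, mul_pow, h.nu_div_sq (by positivity), mul_assoc] at h2
  exact h2

lemma exists_coef_mul_le_norm_V (hc₀ : 0 < c₀) : ∃ C, 0 < C ∧ ∀ P Q : F,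
    coef φ (‖P‖ + ‖Q‖) * ‖P - Q‖ ^ 2 ≤ C * ‖V φ P - V φ Q‖ ^ 2 := by
  have hc₁ : 0 < c₁ := hc₀.trans_le h.c₀_le_c₁
  have hg := (h.powerGrowth_nu hc₀).weaken (l' := min ((1 + c₀) / 2) 1) (by positivity)
    (min_le_left _ _) le_rfl (by positivity)
  have hmin : 0 < min (min ((1 + c₀) / 2) 1) (1 / 2 : ℝ) := by positivity
  refine ⟨((min (min ((1 + c₀) / 2) 1) (1 / 2) / 2 ^ ((1 + c₁) / 2)) ^ 2)⁻¹, by positivity,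
    fun P Q => ?_⟩
  have := hg.le_norm_radial_sub (min_le_right _ _) (by positivity) P Q
  have h2 := pow_le_pow_left₀ (by
    have := hg.profile_nonneg (add_nonneg (norm_nonneg P) (norm_nonneg Q))
    positivity) this 2
  rw [mul_pow, mul_pow, h.nu_div_sq (by positivity), mul_assoc] at h2
  rw [inv_mul_eq_div, le_div_iff₀' (by positivity)]
  exact h2

lemma exists_norm_V_le_of_two_mul_le (hc₀ : 0 < c₀) : ∃ C, 0 < C ∧ ∀ P Q : F,
    2 * ‖P‖ ≤ ‖Q‖ → d φ ‖Q‖ * ‖Q‖ ≤ C * ‖V φ Q - V φ P‖ ^ 2 := by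
  obtain ⟨C, hC, h1⟩ := h.exists_coef_mul_le_norm_V (F := F) hc₀
  refine ⟨8 * C, by positivity, fun P Q hPQ => ?_⟩
  have hP := norm_nonneg P
  rcases (norm_nonneg Q).eq_or_lt with h0 | h0
  · rw [← h0]; simp; positivity
  have h2 : ‖Q‖ / 2 ≤ ‖Q - P‖ := by
    have := norm_sub_norm_le Q P
    linarith
  have h3 : d φ ‖Q‖ ≤ coef φ (‖Q‖ + ‖P‖) * (2 * ‖Q‖) := by
    have hm := (h.powerGrowth_d hc₀).mono h0.le (by linarith : ‖Q‖ ≤ ‖Q‖ + ‖P‖)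
    rw [← h.coef_mul (‖Q‖ + ‖P‖)] at hm
    refine hm.trans ?_
    have := h.coef_nonneg (by linarith : 0 ≤ ‖Q‖ + ‖P‖)
    gcongr
    linarith
  have h4 := h.coef_nonneg (by linarith : 0 ≤ ‖Q‖ + ‖P‖)
  have h5 := h1 Q P
  calc d φ ‖Q‖ * ‖Q‖ ≤ coef φ (‖Q‖ + ‖P‖) * (2 * ‖Q‖) * ‖Q‖ := by gcongr
    _ = 8 * (coef φ (‖Q‖ + ‖P‖) * (‖Q‖ / 2) ^ 2) := by ring
    _ ≤ 8 * (coef φ (‖Q‖ + ‖P‖) * ‖Q - P‖ ^ 2) := by gcongr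
    _ ≤ _ := by linarith

/-- Young's inequality for the function shifted by `|P|`. The increment of `A` is comparable to
`φ_{|P|}'(|Q - P|)`, where `φ_{|P|}'(t) = coef φ (|P| + t) t` is increasing; replace the smaller of
`|Q - P|`, `|R - P|` by the larger, and recognize `φ_{|P|}'(t) t` as the squared increment of `V`.
All differences share the base point `P`, as difference quotients at one point in two directions do.
-/
lemma exists_norm_A_mul_norm_le (hc₀ : 0 < c₀) : ∃ C, 0 < C ∧ ∀ P Q R : F,
    ‖radial (d φ) Q - radial (d φ) P‖ * ‖R - P‖ ≤
      C * (‖V φ Q - V φ P‖ ^ 2 + ‖V φ R - V φ P‖ ^ 2) := by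
  have hc₁ : 0 < c₁ := hc₀.trans_le h.c₀_le_c₁
  obtain ⟨C₁, hC₁, h1⟩ := h.exists_norm_radial_sub_le (F := F) hc₀
  obtain ⟨C₂, hC₂, h2⟩ := h.exists_coef_mul_le_norm_V (F := F) hc₀
  have hcmp : ∀ P Q : F, coef φ (‖Q‖ + ‖P‖) ≤ 2 * 2 ^ c₁ * coef φ (‖P‖ + ‖Q - P‖) ∧
      coef φ (‖P‖ + ‖Q - P‖) ≤ 2 * 2 ^ c₁ * coef φ (‖Q‖ + ‖P‖) := by
    intro P Q
    have e1 := norm_sub_norm_le Q P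
    have e2 := norm_sub_le Q P
    have e3 := norm_nonneg P
    have e4 := norm_nonneg (Q - P)
    have e5 := norm_nonneg Q
    exact ⟨h.coef_le hc₀ (by positivity) (by linarith) (by linarith),
      h.coef_le hc₀ (by positivity) (by linarith) (by linarith)⟩
  set k : ℝ := 2 * 2 ^ c₁
  have hk1 : 1 ≤ k := by
    have : (1 : ℝ) ≤ 2 ^ c₁ := Real.one_le_rpow (by norm_num) hc₁.le
    simp only [k]; linarith
  refine ⟨C₁ * C₂ * (k * k), by positivity, fun P Q R => ?_⟩
  have hb := h.coef_nonneg (add_nonneg (norm_nonneg Q) (norm_nonneg P))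
  have hkk : 1 ≤ k * k := by nlinarith
  refine (mul_le_mul_of_nonneg_right (h1 Q P) (norm_nonneg _)).trans ?_
  rcases le_total ‖R - P‖ ‖Q - P‖ with hc | hc
  · have : coef φ (‖Q‖ + ‖P‖) * ‖Q - P‖ * ‖R - P‖ ≤ C₂ * ‖V φ Q - V φ P‖ ^ 2 := by
      refine le_trans ?_ (h2 Q P)
      rw [pow_two, ← mul_assoc]
      gcongr
    calc _ = C₁ * (coef φ (‖Q‖ + ‖P‖) * ‖Q - P‖ * ‖R - P‖) := by ring
      _ ≤ C₁ * (C₂ * ‖V φ Q - V φ P‖ ^ 2) := by gcongr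
      _ ≤ C₁ * C₂ * (k * k) * ‖V φ Q - V φ P‖ ^ 2 := by
        have : 0 ≤ C₁ * C₂ * ‖V φ Q - V φ P‖ ^ 2 := by positivity
        nlinarith
      _ ≤ _ := by
        gcongr
        have := sq_nonneg ‖V φ R - V φ P‖
        linarith
  · rcases (norm_nonneg (Q - P)).eq_or_lt with h0 | h0
    · rw [← h0]
      simp only [mul_zero, zero_mul]
      positivity
    have h0' := h0.trans_le hc
    have h3 := h.shift_rpow_le hc₀ (norm_nonneg P) (norm_nonneg (R - P))
      (div_pos h0 h0') ((div_le_one h0').2 hc)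
    have h4 : (‖Q - P‖ / ‖R - P‖) ^ min c₀ 1 ≤ 1 :=
      Real.rpow_le_one (by positivity) ((div_le_one h0').2 hc) (by positivity)
    rw [div_mul_cancel₀ _ h0'.ne'] at h3
    have hb3 := h.coef_nonneg (add_nonneg (norm_nonneg P) (norm_nonneg (R - P)))
    have h5 : coef φ (‖P‖ + ‖Q - P‖) * ‖Q - P‖ ≤ coef φ (‖P‖ + ‖R - P‖) * ‖R - P‖ :=
      h3.trans (mul_le_of_le_one_left (by unfold coef at hb3; positivity) h4)
    have hb2 := h.coef_nonneg (add_nonneg (norm_nonneg P) (norm_nonneg (Q - P)))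
    calc C₁ * (coef φ (‖Q‖ + ‖P‖) * ‖Q - P‖) * ‖R - P‖
        ≤ C₁ * (k * coef φ (‖P‖ + ‖Q - P‖) * ‖Q - P‖) * ‖R - P‖ := by
          gcongr
          exact (hcmp P Q).1
      _ = C₁ * (k * (coef φ (‖P‖ + ‖Q - P‖) * ‖Q - P‖)) * ‖R - P‖ := by ring
      _ ≤ C₁ * (k * (coef φ (‖P‖ + ‖R - P‖) * ‖R - P‖)) * ‖R - P‖ := by gcongr
      _ ≤ C₁ * (k * (k * coef φ (‖R‖ + ‖P‖) * ‖R - P‖)) * ‖R - P‖ := by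
          gcongr
          exact (hcmp P R).2
      _ = C₁ * (k * k) * (coef φ (‖R‖ + ‖P‖) * ‖R - P‖ ^ 2) := by ring
      _ ≤ C₁ * (k * k) * (C₂ * ‖V φ R - V φ P‖ ^ 2) := by
          exact mul_le_mul_of_nonneg_left (h2 R P) (by positivity)
      _ = C₁ * C₂ * (k * k) * (‖V φ R - V φ P‖ ^ 2) := by ring
      _ ≤ _ := by
        gcongr
        have := sq_nonneg ‖V φ Q - V φ P‖
        linarith

/-- Here `P`, `Q` are the values at the ends of a segment and `R` a value in between. If `|R|` is
comparable with `|P| + |Q|` the first term suffices; if it is much larger, then `φ'(|R|)|R|` is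
already controlled by the increment of `V` from `P` to `R`. -/
lemma exists_coef_mul_norm_mul_le (hc₀ : 0 < c₀) : ∃ C, 0 < C ∧ ∀ P Q R : F,
    coef φ (‖P‖ + ‖Q‖) * ‖Q - P‖ * ‖R‖ ≤
      2 * (coef φ (‖P‖ + ‖Q‖) * ‖Q - P‖ * (‖P‖ + ‖Q‖)) + C * ‖V φ R - V φ P‖ ^ 2 := by
  obtain ⟨C, hC, h1⟩ := h.exists_norm_V_le_of_two_mul_le (F := F) hc₀
  refine ⟨C, hC, fun P Q R => ?_⟩
  have hP := norm_nonneg P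
  have hQ := norm_nonneg Q
  have hb := h.coef_nonneg (add_nonneg hP hQ)
  have hx : 0 ≤ coef φ (‖P‖ + ‖Q‖) * ‖Q - P‖ := by positivity
  rcases le_total ‖R‖ (2 * (‖P‖ + ‖Q‖)) with hc | hc
  · have : 0 ≤ C * ‖V φ R - V φ P‖ ^ 2 := by positivity
    nlinarith
  · have h2 := h1 P R (by linarith)
    have h3 : coef φ (‖P‖ + ‖Q‖) * ‖Q - P‖ ≤ d φ ‖R‖ := by
      calc _ ≤ coef φ (‖P‖ + ‖Q‖) * (‖P‖ + ‖Q‖) := by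
            gcongr
            rw [add_comm]; exact norm_sub_le _ _
        _ = d φ (‖P‖ + ‖Q‖) := h.coef_mul _
        _ ≤ _ := (h.powerGrowth_d hc₀).mono (by positivity) (by linarith)
    have h4 := mul_le_mul_of_nonneg_right h3 (norm_nonneg R)
    have : 0 ≤ coef φ (‖P‖ + ‖Q‖) * ‖Q - P‖ * (‖P‖ + ‖Q‖) := by positivity
    linarith

/-- Away from the degenerate point `P = Q = 0`, with `m = |P| + |Q| ≥ γ`, the comparison of `V` with
its argument gives `|Q - P|² ≤ C m |V(Q) - V(P)|²`. The arithmetic-geometric mean inequality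
separates the factors, so that later a difference quotient of `P` is integrable together with its
majorant. -/
lemma exists_norm_sub_div_le (hc₀ : 0 < c₀) {γ : ℝ} (hγ : 0 < γ) : ∃ C, 0 < C ∧
    ∀ P Q : F, γ ≤ ‖P‖ + ‖Q‖ → ∀ k > 0,
      ‖Q - P‖ / k ≤ ‖P‖ + ‖Q‖ + C * (‖V φ Q - V φ P‖ / k) ^ 2 := by
  obtain ⟨C, hC, h1⟩ := h.exists_coef_mul_le_norm_V (F := F) hc₀
  have hd := h.d_pos hγ
  refine ⟨C / d φ γ, by positivity, fun P Q hm k hk => ?_⟩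
  set m := ‖P‖ + ‖Q‖ with hmdef
  have hm0 : 0 < m := hγ.trans_le hm
  have h2 := h1 Q P
  rw [add_comm ‖Q‖, ← hmdef] at h2
  have h3 : d φ γ ≤ coef φ m * m := by
    rw [h.coef_mul]; exact (h.powerGrowth_d hc₀).mono hγ.le hm
  have h4 : ‖Q - P‖ ^ 2 ≤ m * (C / d φ γ * ‖V φ Q - V φ P‖ ^ 2) := by
    rw [div_mul_eq_mul_div, mul_div_assoc', le_div_iff₀ hd]
    calc _ ≤ ‖Q - P‖ ^ 2 * (coef φ m * m) := by gcongr
      _ = m * (coef φ m * ‖Q - P‖ ^ 2) := by ring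
      _ ≤ _ := by gcongr
  have h5 : (‖Q - P‖ / k) ^ 2 ≤ m * (C / d φ γ * (‖V φ Q - V φ P‖ / k) ^ 2) := by
    rw [div_pow, div_pow, div_le_iff₀ (by positivity)]
    calc _ ≤ _ := h4
      _ = _ := by field_simp
  set y := C / d φ γ * (‖V φ Q - V φ P‖ / k) ^ 2 with hy
  have hy0 : 0 ≤ y := by positivity
  refine le_of_sq_le_sq ?_ (by positivity)
  nlinarith

/-- A large value `R` can only be reached from a small value `P` at the expense of a large increment
of `V`. -/
lemma exists_norm_le_of_small (hc₀ : 0 < c₀) {γ : ℝ} (hγ : 0 < γ) : ∃ C, 0 < C ∧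
    ∀ P R : F, ‖P‖ ≤ γ → ‖R‖ ≤ 2 * γ + C * ‖V φ R - V φ P‖ ^ 2 := by
  obtain ⟨C, hC, h1⟩ := h.exists_norm_V_le_of_two_mul_le (F := F) hc₀
  have hd := h.d_pos hγ
  refine ⟨C / d φ γ, by positivity, fun P R hP => ?_⟩
  rcases le_total ‖R‖ (2 * γ) with hc | hc
  · have : 0 ≤ C / d φ γ * ‖V φ R - V φ P‖ ^ 2 := by positivity
    linarith
  · have h2 := h1 P R (by linarith)
    have h3 := (h.powerGrowth_d hc₀).mono hγ.le (by linarith : γ ≤ ‖R‖)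
    have h4 : ‖R‖ ≤ C / d φ γ * ‖V φ R - V φ P‖ ^ 2 := by
      rw [div_mul_eq_mul_div, le_div_iff₀ hd]
      nlinarith [norm_nonneg R]
    linarith

end IsOrlicz

end PhiCaloric
end

noncomputable section

namespace PhiCaloric

open Filter Topology

/-! ### A dominated convergence theorem with converging majorants -/

/-- Clamp `f m` to `[-G, G]`. The clamped functions are dominated by the fixed `G`, and the clamping
error is at most `|g m - G|`, which tends to `0` in `L¹`. That `|F| ≤ G` follows along a subsequence
on which `g` converges almost everywhere. -/
lemma tendsto_integral_of_tendsto_majorant {α : Type*} [MeasurableSpace α] {μ : Measure α}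
    {f g : ℕ → α → ℝ} {F G : α → ℝ} (hf : ∀ m, AEStronglyMeasurable (f m) μ)
    (hg : ∀ m, Integrable (g m) μ) (hG : Integrable G μ)
    (hgG : Tendsto (fun m => ∫ z, |g m z - G z| ∂μ) atTop (𝓝 0))
    (hfg : ∀ m, ∀ᵐ z ∂μ, |f m z| ≤ g m z)
    (hfF : ∀ᵐ z ∂μ, Tendsto (fun m => f m z) atTop (𝓝 (F z))) :
    Integrable F μ ∧ Tendsto (fun m => ∫ z, f m z ∂μ) atTop (𝓝 (∫ z, F z ∂μ)) := by
  have hF : AEStronglyMeasurable F μ := aestronglyMeasurable_of_tendsto_ae atTop hf hfF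
  have hFG : ∀ᵐ z ∂μ, |F z| ≤ G z := by
    have h1 : Tendsto (fun m => eLpNorm (g m - G) 1 μ) atTop (𝓝 0) := by
      have : (fun m => eLpNorm (g m - G) 1 μ) =
          fun m => ENNReal.ofReal (∫ z, |g m z - G z| ∂μ) := by
        funext m
        rw [eLpNorm_one_eq_lintegral_enorm,
          ofReal_integral_eq_lintegral_ofReal (f := fun z => |g m z - G z|) ((hg m).sub hG).norm
            (ae_of_all _ fun z => abs_nonneg _)]
        refine lintegral_congr fun z => ?_
        rw [← ofReal_norm]; rfl
      rw [this, ← ENNReal.ofReal_zero]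
      exact ENNReal.tendsto_ofReal hgG
    obtain ⟨ns, hns, h2⟩ := (tendstoInMeasure_of_tendsto_eLpNorm one_ne_zero
      (fun m => (hg m).aestronglyMeasurable) hG.aestronglyMeasurable h1).exists_seq_tendsto_ae
    filter_upwards [h2, hfF, ae_all_iff.2 hfg] with z h2 h3 h4
    exact le_of_tendsto_of_tendsto ((h3.comp hns.tendsto_atTop).abs) h2
      (Eventually.of_forall fun i => h4 (ns i))
  have hFi : Integrable F μ := hG.mono' hF hFG
  refine ⟨hFi, ?_⟩
  set c : ℕ → α → ℝ := fun m z => max (-G z) (min (f m z) (G z)) with hc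
  have hcm : ∀ m, AEStronglyMeasurable (c m) μ := fun m =>
    hG.aestronglyMeasurable.neg.sup ((hf m).inf hG.aestronglyMeasurable)
  have hcG : ∀ m, ∀ᵐ z ∂μ, ‖c m z‖ ≤ G z := fun m => by
    filter_upwards [hFG] with z hz
    have : 0 ≤ G z := (abs_nonneg _).trans hz
    rw [Real.norm_eq_abs, abs_le]
    exact ⟨le_max_left _ _, max_le (by linarith) (min_le_right _ _)⟩
  have hcF : ∀ᵐ z ∂μ, Tendsto (fun m => c m z) atTop (𝓝 (F z)) := by
    filter_upwards [hFG, hfF] with z h1 h2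
    have h3 := abs_le.1 h1
    have h4 : max (-G z) (min (F z) (G z)) = F z := by
      rw [min_eq_left h3.2, max_eq_right h3.1]
    have h5 := (tendsto_const_nhds (x := -G z)).max (h2.min (tendsto_const_nhds (x := G z)))
    rwa [h4] at h5
  have hlim := tendsto_integral_of_dominated_convergence G hcm hG hcG hcF
  have hdiff : Tendsto (fun m => ∫ z, f m z ∂μ - ∫ z, c m z ∂μ) atTop (𝓝 0) := by
    refine squeeze_zero_norm (fun m => ?_) hgG
    have hfi : Integrable (f m) μ := (hg m).mono' (hf m) (hfg m)
    have hci : Integrable (c m) μ := hG.mono' (hcm m) (hcG m)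
    rw [← integral_sub hfi hci]
    refine (norm_integral_le_integral_norm _).trans ?_
    refine integral_mono_ae (hfi.sub hci).norm ((hg m).sub hG).abs ?_
    filter_upwards [hFG, hfg m] with z h1 h2
    have h0 : 0 ≤ G z := (abs_nonneg _).trans h1
    have h3 := abs_le.1 h2
    have h4 := le_abs_self (g m z - G z)
    have h5 := abs_nonneg (g m z - G z)
    change |f m z - max (-G z) (min (f m z) (G z))| ≤ |g m z - G z|
    rcases le_total (f m z) (G z) with h6 | h6
    · rw [min_eq_left h6]
      rcases le_total (-G z) (f m z) with h7 | h7
      · rw [max_eq_right h7]; simp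
      · rw [max_eq_left h7, abs_le]; constructor <;> linarith
    · rw [min_eq_right h6, max_eq_right (by linarith), abs_le]; constructor <;> linarith
  simpa using hdiff.add hlim

/-! ### Mollification -/

section Mollify

variable {E : Type*} [NormedAddCommGroup E] [NormedSpace ℝ E] [MeasurableSpace E] [BorelSpace E]
  [FiniteDimensional ℝ E]

/-- Bump functions with shrinking supports. -/
def bump (E : Type*) [NormedAddCommGroup E] [NormedSpace ℝ E] (m : ℕ) : ContDiffBump (0 : E) where
  rIn := 1 / (2 * (m + 1))
  rOut := 1 / (m + 1)
  rIn_pos := by positivity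
  rIn_lt_rOut := by
    apply one_div_lt_one_div_of_lt (by positivity)
    have : (0 : ℝ) ≤ m := m.cast_nonneg
    linarith

/-- The mollification of `g` at scale `1 / (m + 1)`. -/
def mol (μ : Measure E) (m : ℕ) (g : E → ℝ) : E → ℝ :=
  convolution ((bump E m).normed μ) g (ContinuousLinearMap.lsmul ℝ ℝ) μ

variable (μ : Measure E) [μ.IsAddHaarMeasure] (m : ℕ)

lemma mol_eq (g : E → ℝ) (z : E) : mol μ m g z = ∫ y, (bump E m).normed μ (z - y) * g y ∂μ := by
  rw [mol, convolution_eq_swap]; rfl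

lemma mol_contDiff {g : E → ℝ} (hg : LocallyIntegrable g μ) {n : ℕ∞} :
    ContDiff ℝ n (mol μ m g) :=
  (bump E m).hasCompactSupport_normed.contDiff_convolution_left _ (bump E m).contDiff_normed hg

lemma tendsto_bump_rOut : Tendsto (fun m => (bump E m).rOut) atTop (𝓝 0) :=
  tendsto_one_div_add_atTop_nhds_zero_nat

lemma mol_tendsto_ae {g : E → ℝ} (hg : LocallyIntegrable g μ) :
    ∀ᵐ z ∂μ, Tendsto (fun m => mol μ m g z) atTop (𝓝 (g z)) :=
  ContDiffBump.ae_convolution_tendsto_right_of_locallyIntegrable (K := 2) tendsto_bump_rOut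
    (Eventually.of_forall fun m => by simp only [bump]; field_simp; norm_num) hg

lemma integrable_bump : Integrable ((bump E m).normed μ) μ :=
  (bump E m).integrable_normed

lemma integrable_mol {g : E → ℝ} (hg : Integrable g μ) : Integrable (mol μ m g) μ :=
  (integrable_bump μ m).integrable_convolution _ hg

lemma integral_mol {g : E → ℝ} (hg : Integrable g μ) : ∫ z, mol μ m g z ∂μ = ∫ z, g z ∂μ := by
  unfold mol
  rw [integral_convolution _ (integrable_bump μ m) hg, (bump E m).integral_normed]
  simp

lemma bump_bounded : ∃ C, ∀ y, ‖(bump E m).normed μ y‖ ≤ C := by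
  obtain ⟨C, hC⟩ := (bump E m).hasCompactSupport_normed.exists_bound_of_continuous
    ((bump E m).continuous_normed (μ := μ))
  exact ⟨C, hC⟩

lemma integrable_mol_integrand {g : E → ℝ} (hg : LocallyIntegrable g μ) (z : E) :
    Integrable (fun y => (bump E m).normed μ (z - y) * g y) μ := by
  have h1 : HasCompactSupport fun y => (bump E m).normed μ (z - y) :=
    (bump E m).hasCompactSupport_normed.comp_homeomorph (Homeomorph.subLeft z)
  have h2 : Continuous fun y => (bump E m).normed μ (z - y) :=
    (bump E m).continuous_normed.comp (by fun_prop)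
  exact hg.integrable_smul_left_of_hasCompactSupport h2 h1

lemma integral_bump_sub (z : E) : ∫ y, (bump E m).normed μ (z - y) ∂μ = 1 := by
  rw [integral_sub_left_eq_self (fun y => (bump E m).normed μ y) μ z, (bump E m).integral_normed]

lemma integrable_bump_sub (z : E) : Integrable (fun y => (bump E m).normed μ (z - y)) μ := by
  simpa using integrable_mol_integrand μ m (g := fun _ => (1 : ℝ)) (locallyIntegrable_const 1) z

lemma mol_mono {f g : E → ℝ} (hf : LocallyIntegrable f μ) (hg : LocallyIntegrable g μ)
    (hfg : ∀ᵐ y ∂μ, f y ≤ g y) (z : E) : mol μ m f z ≤ mol μ m g z := by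
  rw [mol_eq, mol_eq]
  refine integral_mono_ae (integrable_mol_integrand μ m hf z) (integrable_mol_integrand μ m hg z) ?_
  filter_upwards [hfg] with y hy
  exact mul_le_mul_of_nonneg_left hy ((bump E m).nonneg_normed _)

lemma mol_nonneg {g : E → ℝ} (hg : ∀ᵐ y ∂μ, 0 ≤ g y) (z : E) : 0 ≤ mol μ m g z := by
  rw [mol_eq]
  refine integral_nonneg_of_ae ?_
  filter_upwards [hg] with y hy
  exact mul_nonneg ((bump E m).nonneg_normed _) hy

lemma abs_mol_le {g : E → ℝ} (z : E) : |mol μ m g z| ≤ mol μ m (fun y => |g y|) z := by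
  rw [mol_eq, mol_eq]
  refine (abs_integral_le_integral_abs).trans (le_of_eq ?_)
  refine integral_congr_ae (ae_of_all _ fun y => ?_)
  simp only [abs_mul, abs_of_nonneg ((bump E m).nonneg_normed _)]

omit [NormedSpace ℝ E] [BorelSpace E] [FiniteDimensional ℝ E] [μ.IsAddHaarMeasure] in
lemma locallyIntegrable_abs {g : E → ℝ} (hg : LocallyIntegrable g μ) :
    LocallyIntegrable (fun y => |g y|) μ := fun x =>
  let ⟨s, hs, hi⟩ := hg x
  ⟨s, hs, hi.norm⟩

/-- Integrate the two-point bound against the kernel in `y` and in `y'` separately; each kernel has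
mass one, so the right-hand side becomes `mol g + mol g`. This controls a product of two
mollifications by one mollification without requiring dual Lebesgue spaces for the factors. -/
lemma mol_mul_le {B w g : E → ℝ} (hB : LocallyIntegrable B μ) (hw : LocallyIntegrable w μ)
    (hg : LocallyIntegrable g μ) (h : ∀ᵐ y ∂μ, ∀ᵐ y' ∂μ, |B y| * |w y'| ≤ g y + g y') (z : E) :
    |mol μ m B z| * |mol μ m w z| ≤ 2 * mol μ m g z := by
  have hρ : ∀ y, 0 ≤ (bump E m).normed μ (z - y) := fun y => (bump E m).nonneg_normed _
  have h1 : ∀ᵐ y ∂μ, |B y| * mol μ m (fun y => |w y|) z ≤ g y + mol μ m g z := by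
    filter_upwards [h] with y hy
    rw [mol_eq, ← integral_const_mul]
    have e : g y + mol μ m g z = ∫ y', (bump E m).normed μ (z - y') * (g y + g y') ∂μ := by
      simp only [mul_add]
      rw [integral_add ((integrable_bump_sub μ m z).mul_const _)
        (integrable_mol_integrand μ m hg z), integral_mul_const, integral_bump_sub, one_mul, mol_eq]
    rw [e]
    refine integral_mono_ae ((integrable_mol_integrand μ m (g := fun y => |w y|) (locallyIntegrable_abs μ hw) z).const_mul
      _) ?_ ?_
    · exact integrable_mol_integrand μ m (g := fun y' => g y + g y')
        ((locallyIntegrable_const _).add hg) z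
    · filter_upwards [hy] with y' hy'
      have := mul_le_mul_of_nonneg_left hy' (hρ y')
      linarith
  have h2 : mol μ m (fun y => |B y|) z * mol μ m (fun y => |w y|) z ≤ 2 * mol μ m g z := by
    have h3 : mol μ m (fun y => |B y|) z * mol μ m (fun y => |w y|) z =
        mol μ m (fun y => |B y| * mol μ m (fun y => |w y|) z) z := by
      rw [mol_eq μ m (fun y => |B y|), mol_eq μ m (fun y => |B y| * _), ← integral_mul_const]
      simp only [mul_assoc]
    have h4 : mol μ m (fun y => g y + mol μ m g z) z = 2 * mol μ m g z := by
      rw [mol_eq]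
      simp only [mul_add]
      rw [integral_add (integrable_mol_integrand μ m hg z)
        ((integrable_bump_sub μ m z).mul_const _), integral_mul_const, integral_bump_sub, ← mol_eq]
      ring
    rw [h3, ← h4]
    exact mol_mono μ m (g := fun y => g y + mol μ m g z) (by
      have := (locallyIntegrable_abs μ hB).smul (mol μ m (fun y => |w y|) z)
      convert! this using 1
      funext y
      simp [mul_comm])
      (hg.add (locallyIntegrable_const _)) h1 z
  refine le_trans ?_ h2
  exact mul_le_mul (abs_mol_le μ m z) (abs_mol_le μ m z) (abs_nonneg _)
    (mol_nonneg μ m (ae_of_all _ fun y => abs_nonneg _) z)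

lemma mol_sq_le {w : E → ℝ} (hw : LocallyIntegrable w μ)
    (hw2 : LocallyIntegrable (fun y => w y ^ 2) μ) (z : E) :
    mol μ m w z ^ 2 ≤ 2 * mol μ m (fun y => w y ^ 2) z := by
  have := mol_mul_le μ m hw hw hw2 (ae_of_all _ fun y => ae_of_all _ fun y' => by
    nlinarith [sq_nonneg (|w y| - |w y'|), sq_abs (w y), sq_abs (w y'), sq_nonneg (w y),
      sq_nonneg (w y')]) z
  rwa [← pow_two, sq_abs] at this

/-- Scheffé's argument: mollification preserves the integral, so the `L¹` distance is twice the
integral of `(g - mol g)₊`, which is dominated by `g`. -/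
lemma mol_tendsto_L1 {g : E → ℝ} (hg : Integrable g μ) (hg0 : ∀ᵐ y ∂μ, 0 ≤ g y) :
    Tendsto (fun m => ∫ z, |mol μ m g z - g z| ∂μ) atTop (𝓝 0) := by
  have e : ∀ m, ∫ z, |mol μ m g z - g z| ∂μ = 2 * ∫ z, max (g z - mol μ m g z) 0 ∂μ := by
    intro m
    have hi : Integrable (fun z => g z - mol μ m g z) μ := hg.sub (integrable_mol μ m hg)
    have h0 : ∫ z, (g z - mol μ m g z) ∂μ = 0 := by
      rw [integral_sub hg (integrable_mol μ m hg), integral_mol μ m hg, sub_self]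
    have : ∀ z, |mol μ m g z - g z| = 2 * max (g z - mol μ m g z) 0 - (g z - mol μ m g z) := by
      intro z
      rcases le_total (g z) (mol μ m g z) with h | h
      · rw [abs_of_nonneg (by linarith), max_eq_right (by linarith)]; ring
      · rw [abs_of_nonpos (by linarith), max_eq_left (by linarith)]; ring
    simp_rw [this]
    have hs : Integrable (fun z => max (g z - mol μ m g z) 0) μ :=
      hi.sup (integrable_zero _ _ _)
    rw [integral_sub (hs.const_mul 2) hi, h0, sub_zero, integral_const_mul]
  simp_rw [e]
  have h1 : Tendsto (fun m => ∫ z, max (g z - mol μ m g z) 0 ∂μ) atTop (𝓝 (∫ z, (0 : ℝ) ∂μ)) := by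
    refine tendsto_integral_of_dominated_convergence g (fun m => ?_) hg (fun m => ?_) ?_
    · exact ((hg.sub (integrable_mol μ m hg)).sup (integrable_zero _ _ _)).aestronglyMeasurable
    · filter_upwards [hg0] with z hz
      have := mol_nonneg μ m hg0 z
      rw [Real.norm_eq_abs, abs_of_nonneg (le_max_right _ _)]
      exact max_le (by linarith) hz
    · filter_upwards [mol_tendsto_ae μ hg.locallyIntegrable] with z hz
      have := ((tendsto_const_nhds (x := g z)).sub hz).max (tendsto_const_nhds (x := (0 : ℝ)))
      simpa using this
  simpa using h1.const_mul 2

/-- The kernel of the mollification at `z` as a test function. -/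
def kernel (z y : E) : ℝ := (bump E m).normed μ (z - y)

lemma kernel_contDiff (z : E) {n : ℕ∞} : ContDiff ℝ n (kernel μ m z) :=
  (bump E m).contDiff_normed.comp (contDiff_const.sub contDiff_id)

lemma kernel_hasCompactSupport (z : E) : HasCompactSupport (kernel μ m z) :=
  (bump E m).hasCompactSupport_normed.comp_homeomorph (Homeomorph.subLeft z)

lemma kernel_tsupport (z : E) : tsupport (kernel μ m z) ⊆ Metric.closedBall z (1 / (m + 1)) := by
  refine closure_minimal (fun y hy => ?_) Metric.isClosed_closedBall
  have h1 : z - y ∈ Function.support ((bump E m).normed μ) := hy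
  rw [(bump E m).support_normed_eq, Metric.mem_ball, dist_zero_right] at h1
  rw [Metric.mem_closedBall, dist_eq_norm_sub']
  exact h1.le

lemma fderiv_kernel (z y v : E) :
    fderiv ℝ (kernel μ m z) y v = -fderiv ℝ ((bump E m).normed μ) (z - y) v := by
  have h1 : HasFDerivAt ((bump E m).normed μ) (fderiv ℝ ((bump E m).normed μ) (z - y)) (z - y) :=
    (((bump E m).contDiff_normed (μ := μ) (n := 1)).differentiable (by norm_num) _).hasFDerivAt
  have h2 : HasFDerivAt (fun y : E => z - y) (-ContinuousLinearMap.id ℝ E) y := by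
    simpa using (hasFDerivAt_id y).const_sub z
  have h3 := (h1.comp y h2).fderiv
  change fderiv ℝ (kernel μ m z) y = _ at h3
  rw [h3]; simp

lemma fderiv_mol {g : E → ℝ} (hg : LocallyIntegrable g μ) (z v : E) :
    fderiv ℝ (mol μ m g) z v = -∫ y, g y * fderiv ℝ (kernel μ m z) y v ∂μ := by
  have hcs := (bump E m).hasCompactSupport_normed (μ := μ)
  have hcd := (bump E m).contDiff_normed (μ := μ) (n := 1)
  have h1 := hcs.hasFDerivAt_convolution_left (ContinuousLinearMap.lsmul ℝ ℝ) hcd hg z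
  have h2 : fderiv ℝ (mol μ m g) z = _ := h1.fderiv
  rw [h2, convolution_eq_swap]
  have hint : Integrable (fun t => ((ContinuousLinearMap.precompL E
      (ContinuousLinearMap.lsmul ℝ ℝ)) (fderiv ℝ ((bump E m).normed μ) (z - t))) (g t)) μ := by
    have hc1 : HasCompactSupport (fderiv ℝ ((bump E m).normed μ)) := hcs.fderiv ℝ
    have hc2 : Continuous (fderiv ℝ ((bump E m).normed μ)) := hcd.continuous_fderiv (by norm_num)
    have h4 : Integrable (fun t => g t • fderiv ℝ ((bump E m).normed μ) (z - t)) μ :=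
      hg.integrable_smul_right_of_hasCompactSupport (hc2.comp (by fun_prop))
        (hc1.comp_homeomorph (Homeomorph.subLeft z))
    refine h4.congr (ae_of_all _ fun t => ?_)
    ext w
    simp [mul_comm]
  rw [ContinuousLinearMap.integral_apply hint, ← integral_neg]
  refine integral_congr_ae (ae_of_all _ fun y => ?_)
  simp only [fderiv_kernel, ContinuousLinearMap.precompL_apply, ContinuousLinearMap.lsmul_apply,
    smul_eq_mul]
  ring

lemma mol_eq_kernel (g : E → ℝ) (z : E) : mol μ m g z = ∫ y, g y * kernel μ m z y ∂μ := by
  rw [mol_eq]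
  exact integral_congr_ae (ae_of_all _ fun y => mul_comm _ _)

end Mollify

instance instIsAddHaarSpaceTime (n : ℕ) : (volume : Measure (ℝ × Space n)).IsAddHaarMeasure :=
  Measure.prod.instIsAddHaarMeasure volume volume

end PhiCaloric
end

noncomputable section

namespace PhiCaloric

open Filter Topology

/-! ### Testing a linear evolution equation with a truncation of the solution -/

section Testing

variable {ι J : Type*} [Fintype ι] [Fintype J]

/-- The squared length of a family. -/
def sumSq (w : ι → ℝ) : ℝ := ∑ b, w b ^ 2

/-- The integrand `B : ∇(w κ(|w|²) θ)`, where `p` stands for `∇w` and `θ'` for `∇θ`. -/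
def testIntegrand (κ : ℝ → ℝ) (w : ι → ℝ) (p B : ι → J → ℝ) (θ : ℝ) (θ' : J → ℝ) : ℝ :=
  ∑ a, ∑ j, B a j * ((p a j * κ (sumSq w) +
    w a * (deriv κ (sumSq w) * (2 * ∑ b, w b * p b j))) * θ + w a * κ (sumSq w) * θ' j)

lemma sumSq_nonneg (w : ι → ℝ) : 0 ≤ sumSq w := Finset.sum_nonneg fun _ _ => sq_nonneg _

lemma sq_le_sumSq (w : ι → ℝ) (a : ι) : w a ^ 2 ≤ sumSq w :=
  Finset.single_le_sum (f := fun b => w b ^ 2) (fun _ _ => sq_nonneg _) (Finset.mem_univ a)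

lemma abs_mul_le_sumSq (w : ι → ℝ) (a b : ι) : |w a * w b| ≤ sumSq w := by
  have h1 := sq_le_sumSq w a
  have h2 := sq_le_sumSq w b
  rw [abs_mul]
  nlinarith [sq_nonneg (|w a| - |w b|), sq_abs (w a), sq_abs (w b)]

/-- The factors `w` coming from the chain rule appear only as `κ'(|w|²) w_a w_b`, which is bounded
by the assumption on `κ'`. What remains are products `B p` and `B w` with bounded coefficients. -/
lemma abs_testIntegrand_le {κ : ℝ → ℝ} {w : ι → ℝ} {p B : ι → J → ℝ} {θ : ℝ} {θ' : J → ℝ}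
    {C T X : ℝ} (hκ : ∀ y, 0 ≤ y → |κ y| ≤ 1) (hκ' : ∀ y, 0 ≤ y → |deriv κ y| * y ≤ C)
    (hp : ∀ a j b k, |B a j| * |p b k| ≤ X) (hw : ∀ a j b, |B a j| * |w b| ≤ X) (hX : 0 ≤ X)
    (hθ : |θ| ≤ T) (hθ' : ∀ j, |θ' j| ≤ T) :
    |testIntegrand κ w p B θ θ'| ≤
      Fintype.card ι * (Fintype.card J * ((1 + 2 * C * Fintype.card ι + 1) * T)) * X := by
  have hs := sumSq_nonneg w
  have hC : 0 ≤ C := by have := hκ' 0 le_rfl; simpa using this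
  have hT : 0 ≤ T := (abs_nonneg _).trans hθ
  have key : ∀ a j, |B a j * ((p a j * κ (sumSq w) +
      w a * (deriv κ (sumSq w) * (2 * ∑ b, w b * p b j))) * θ + w a * κ (sumSq w) * θ' j)| ≤
      (1 + 2 * C * Fintype.card ι + 1) * T * X := by
    intro a j
    have e : B a j * ((p a j * κ (sumSq w) +
        w a * (deriv κ (sumSq w) * (2 * ∑ b, w b * p b j))) * θ + w a * κ (sumSq w) * θ' j) =
        (B a j * p a j) * κ (sumSq w) * θ +
        2 * (∑ b, (w a * w b * deriv κ (sumSq w)) * (B a j * p b j)) * θ +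
        (B a j * w a) * κ (sumSq w) * θ' j := by
      simp only [Finset.mul_sum, Finset.sum_mul]
      have : ∀ b, w a * w b * deriv κ (sumSq w) * (B a j * p b j) =
        B a j * (w a * (deriv κ (sumSq w) * (w b * p b j))) := fun b => by ring
      simp only [this, mul_add, add_mul, Finset.mul_sum, Finset.sum_mul]
      congr 1
      · congr 1
        · ring
        · exact Finset.sum_congr rfl fun b _ => by ring
      · ring
    rw [e]
    have t1 : |(B a j * p a j) * κ (sumSq w) * θ| ≤ X * 1 * T := by
      rw [abs_mul, abs_mul, abs_mul]
      exact mul_le_mul (mul_le_mul (hp a j a j) (hκ _ hs) (abs_nonneg _) hX) hθ (abs_nonneg _)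
        (by positivity)
    have t3 : |(B a j * w a) * κ (sumSq w) * θ' j| ≤ X * 1 * T := by
      rw [abs_mul, abs_mul, abs_mul]
      exact mul_le_mul (mul_le_mul (hw a j a) (hκ _ hs) (abs_nonneg _) hX) (hθ' j) (abs_nonneg _)
        (by positivity)
    have t2' : |∑ b, (w a * w b * deriv κ (sumSq w)) * (B a j * p b j)| ≤
        Fintype.card ι * (C * X) := by
      refine (Finset.abs_sum_le_sum_abs _ _).trans ?_
      have : ∀ b ∈ Finset.univ, |(w a * w b * deriv κ (sumSq w)) * (B a j * p b j)| ≤ C * X := by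
        intro b _
        rw [abs_mul, abs_mul, abs_mul (B a j)]
        refine mul_le_mul ?_ (hp a j b j) (by positivity) hC
        calc |w a * w b| * |deriv κ (sumSq w)| ≤ sumSq w * |deriv κ (sumSq w)| := by
              gcongr
              exact abs_mul_le_sumSq w a b
          _ = |deriv κ (sumSq w)| * sumSq w := mul_comm _ _
          _ ≤ C := hκ' _ hs
      refine (Finset.sum_le_sum this).trans ?_
      simp
    have t2 : |2 * (∑ b, (w a * w b * deriv κ (sumSq w)) * (B a j * p b j)) * θ| ≤
        2 * (Fintype.card ι * (C * X)) * T := by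
      rw [abs_mul, abs_mul, abs_two]
      gcongr
    calc _ ≤ X * 1 * T + 2 * (Fintype.card ι * (C * X)) * T + X * 1 * T :=
          (abs_add_three _ _ _).trans (add_le_add (add_le_add t1 t2) t3)
      _ = _ := by ring
  unfold testIntegrand
  refine (Finset.abs_sum_le_sum_abs _ _).trans ?_
  refine (Finset.sum_le_sum fun a _ => (Finset.abs_sum_le_sum_abs _ _).trans
    (Finset.sum_le_sum fun j _ => key a j)).trans (le_of_eq ?_)
  simp; ring

variable {E : Type*} [NormedAddCommGroup E] [NormedSpace ℝ E] [MeasurableSpace E] [BorelSpace E]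
  [FiniteDimensional ℝ E] (μ : Measure E) [μ.IsAddHaarMeasure]

/-- The tested equation for smooth solutions. -/
lemma integral_testIntegrand_of_contDiff {w : ι → E → ℝ} {B : ι → J → E → ℝ} {v : J → E} {τ : E}
    {θ : E → ℝ} {κ K : ℝ → ℝ} (hw : ∀ a, ContDiff ℝ 1 (w a)) (hB : ∀ a j, ContDiff ℝ 1 (B a j))
    (hθ : ContDiff ℝ 1 θ) (hθc : HasCompactSupport θ) (hκ : ContDiff ℝ 1 κ)
    (hK : ∀ y, HasDerivAt K (κ y) y)
    (heq : ∀ z ∈ tsupport θ, ∀ a, fderiv ℝ (w a) z τ = ∑ j, fderiv ℝ (B a j) z (v j)) :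
    ∫ z, testIntegrand κ (fun a => w a z) (fun a j => fderiv ℝ (w a) z (v j))
      (fun a j => B a j z) (θ z) (fun j => fderiv ℝ θ z (v j)) ∂μ =
      1 / 2 * ∫ z, K (sumSq fun a => w a z) * fderiv ℝ θ z τ ∂μ := by
  set s : E → ℝ := fun z => sumSq fun a => w a z with hs
  have hsd : ContDiff ℝ 1 s := by
    simp only [hs, sumSq]
    exact ContDiff.sum fun a _ => (hw a).pow 2
  have hd1 : ∀ {f : E → ℝ}, ContDiff ℝ 1 f → ∀ z, DifferentiableAt ℝ f z := fun hf z =>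
    (hf.differentiable (by norm_num)) z
  have hsf : ∀ z u, fderiv ℝ s z u = 2 * ∑ b, w b z * fderiv ℝ (w b) z u := by
    intro z u
    have h1 : HasFDerivAt s (∑ b, (2 * w b z) • fderiv ℝ (w b) z) z := by
      have h2 : ∀ b ∈ Finset.univ, HasFDerivAt (fun z => w b z ^ 2)
          ((2 * w b z) • fderiv ℝ (w b) z) z := fun b _ => by
        simpa using ((hd1 (hw b) z).hasFDerivAt.pow 2)
      simpa only [hs, sumSq] using HasFDerivAt.fun_sum h2
    rw [h1.fderiv]
    simp [Finset.mul_sum, mul_assoc]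
  set ψ : ι → E → ℝ := fun a z => w a z * κ (s z) * θ z with hψ
  have hψd : ∀ a, ContDiff ℝ 1 (ψ a) := fun a => ((hw a).mul (hκ.comp hsd)).mul hθ
  have hψc : ∀ a, HasCompactSupport (ψ a) := fun a => hθc.mul_left
  have hψf : ∀ a z u, fderiv ℝ (ψ a) z u = (fderiv ℝ (w a) z u * κ (s z) +
      w a z * (deriv κ (s z) * (2 * ∑ b, w b z * fderiv ℝ (w b) z u))) * θ z +
      w a z * κ (s z) * fderiv ℝ θ z u := by
    intro a z u
    have h1 : HasFDerivAt (fun z => κ (s z)) (deriv κ (s z) • fderiv ℝ s z) z :=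
      ((hκ.differentiable (by norm_num)) (s z)).hasDerivAt.comp_hasFDerivAt z
        (hd1 hsd z).hasFDerivAt
    have h2 := ((hd1 (hw a) z).hasFDerivAt.mul h1).mul (hd1 hθ z).hasFDerivAt
    have h3 : fderiv ℝ (ψ a) z = _ := h2.fderiv
    rw [h3]
    simp only [_root_.add_apply, _root_.smul_apply, smul_eq_mul, hsf]
    simp only [Pi.mul_apply]
    ring
  have hcf : ∀ {f : E → ℝ}, ContDiff ℝ 1 f → ∀ u, Continuous fun z => fderiv ℝ f z u :=
    fun hf u => (hf.continuous_fderiv (by norm_num)).clm_apply continuous_const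
  have hcs : ∀ {f : E → ℝ}, HasCompactSupport f → ∀ u,
      HasCompactSupport fun z => fderiv ℝ f z u := fun hf u =>
    (hf.fderiv ℝ).comp_left (g := fun L : E →L[ℝ] ℝ => L u) (by simp)
  have hint : ∀ {f g : E → ℝ}, Continuous f → Continuous g → HasCompactSupport g →
      Integrable (fun z => f z * g z) μ := fun hf hg hc =>
    (hf.mul hg).integrable_of_hasCompactSupport hc.mul_left
  have hparts : ∀ {f g : E → ℝ}, ContDiff ℝ 1 f → ContDiff ℝ 1 g → HasCompactSupport g → ∀ u,
      ∫ z, f z * fderiv ℝ g z u ∂μ = -∫ z, fderiv ℝ f z u * g z ∂μ := fun hf hg hc u =>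
    integral_mul_fderiv_eq_neg_fderiv_mul_of_integrable
      (hint (hcf hf u) hg.continuous hc) (hint hf.continuous (hcf hg u) (hcs hc u))
      (hint hf.continuous hg.continuous hc) (fun z _ => hd1 hf z) (fun z _ => hd1 hg z)
  have hKs : ContDiff ℝ 1 (fun z => K (s z)) := by
    have : ContDiff ℝ 1 K := by
      rw [contDiff_one_iff_deriv]
      refine ⟨fun y => (hK y).differentiableAt, ?_⟩
      have e : deriv K = κ := funext fun y => (hK y).deriv
      rw [e]; exact hκ.continuous
    exact this.comp hsd
  have hKf : ∀ z u, fderiv ℝ (fun z => K (s z)) z u =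
      κ (s z) * (2 * ∑ b, w b z * fderiv ℝ (w b) z u) := by
    intro z u
    have h1 : HasFDerivAt (fun z => K (s z)) (κ (s z) • fderiv ℝ s z) z :=
      (hK (s z)).comp_hasFDerivAt z (hd1 hsd z).hasFDerivAt
    rw [h1.fderiv]
    simp [hsf]
  have e1 : ∀ z, testIntegrand κ (fun a => w a z) (fun a j => fderiv ℝ (w a) z (v j))
      (fun a j => B a j z) (θ z) (fun j => fderiv ℝ θ z (v j)) =
      ∑ a, ∑ j, B a j z * fderiv ℝ (ψ a) z (v j) := by
    intro z
    unfold testIntegrand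
    refine Finset.sum_congr rfl fun a _ => Finset.sum_congr rfl fun j _ => ?_
    rw [hψf]
  simp_rw [e1]
  have hi1 : ∀ a j, Integrable (fun z => B a j z * fderiv ℝ (ψ a) z (v j)) μ := fun a j =>
    hint (hB a j).continuous (hcf (hψd a) _) (hcs (hψc a) _)
  have hi2 : ∀ a j, Integrable (fun z => fderiv ℝ (B a j) z (v j) * ψ a z) μ := fun a j =>
    hint (hcf (hB a j) _) (hψd a).continuous (hψc a)
  rw [integral_finsetSum _ fun a _ => integrable_finsetSum _ fun j _ => hi1 a j]
  have e2 : ∀ a, ∫ z, ∑ j, B a j z * fderiv ℝ (ψ a) z (v j) ∂μ =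
      -∫ z, fderiv ℝ (w a) z τ * ψ a z ∂μ := by
    intro a
    rw [integral_finsetSum _ fun j _ => hi1 a j]
    simp_rw [fun j => hparts (hB a j) (hψd a) (hψc a) (v j)]
    rw [Finset.sum_neg_distrib, ← integral_finsetSum _ fun j _ => hi2 a j]
    congr 1
    refine integral_congr_ae (ae_of_all _ fun z => ?_)
    -- The equation is available only near the support of `θ`; elsewhere the test function `ψ a`
    -- vanishes.
    simp only [← Finset.sum_mul]
    by_cases hz : z ∈ tsupport θ
    · rw [heq z hz a]
    · have : ψ a z = 0 := by
        simp only [hψ, image_eq_zero_of_notMem_tsupport hz, mul_zero]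
      rw [this, mul_zero, mul_zero]
  simp_rw [e2]
  rw [Finset.sum_neg_distrib, ← integral_finsetSum _ fun a _ =>
    hint (hcf (hw a) τ) (hψd a).continuous (hψc a)]
  rw [hparts hKs hθ hθc τ]
  rw [mul_neg, ← integral_const_mul]
  congr 1
  refine integral_congr_ae (ae_of_all _ fun z => ?_)
  simp only [hKf, hψ]
  rw [Finset.mul_sum, Finset.mul_sum, Finset.sum_mul, Finset.mul_sum]
  exact Finset.sum_congr rfl fun a _ => by ring

end Testing

end PhiCaloric
end

/-! ### Weak solutions of the linear system: testing by mollification. -/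

noncomputable section

namespace PhiCaloric

open Filter Topology

section WeakTesting

variable {ι J : Type*} [Fintype ι] [Fintype J]
variable {E : Type*} [NormedAddCommGroup E] [NormedSpace ℝ E] [MeasurableSpace E] [BorelSpace E]
  [FiniteDimensional ℝ E] (μ : Measure E) [μ.IsAddHaarMeasure]

/-- `p` is the weak gradient of `w` in `O` in the directions `v`. -/
def WeakGrad (O : Set E) (v : E) (w p : E → ℝ) : Prop :=
  ∀ ζ : E → ℝ, ContDiff ℝ ∞ ζ → HasCompactSupport ζ → tsupport ζ ⊆ O →
    ∫ z, w z * fderiv ℝ ζ z v ∂μ = -∫ z, p z * ζ z ∂μ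

lemma eventually_kernel_subset {O : Set E} (hO : IsOpen O) {K : Set E} (hK : IsCompact K)
    (hKO : K ⊆ O) : ∀ᶠ m : ℕ in atTop, ∀ z ∈ K, tsupport (kernel μ m z) ⊆ O := by
  obtain ⟨δ, hδ, h1⟩ := hK.exists_cthickening_subset_open hO hKO
  have h2 : ∀ᶠ m : ℕ in atTop, (1 : ℝ) / (m + 1) < δ :=
    tendsto_one_div_add_atTop_nhds_zero_nat.eventually_lt_const hδ
  filter_upwards [h2] with m hm z hz
  refine (kernel_tsupport μ m z).trans (Subset.trans ?_ h1)
  exact (Metric.closedBall_subset_closedBall hm.le).trans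
    (Metric.closedBall_subset_cthickening hz δ)

variable {μ} in
-- The mollification kernel centred at `z` is itself an admissible test function as soon as its
-- support lies in `O`.
lemma WeakGrad.fderiv_mol {O : Set E} {v : E} {w p : E → ℝ} (h : WeakGrad μ O v w p)
    (hw : LocallyIntegrable w μ) {m : ℕ} {z : E} (hz : tsupport (kernel μ m z) ⊆ O) :
    fderiv ℝ (mol μ m w) z v = mol μ m p z := by
  rw [PhiCaloric.fderiv_mol μ m hw,
    h _ (kernel_contDiff μ m z) (kernel_hasCompactSupport μ m z) hz, neg_neg, mol_eq_kernel]

/-- A weak solution `w` of `∂_τ w = div B` with gradient `p` in `O`, together with a majorant `g`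
that makes the products of `B` with `p` and `w` and their mollifications integrable. -/
structure WeakSystem (O : Set E) (v : J → E) (τ : E) (w : ι → E → ℝ) (p B : ι → J → E → ℝ)
    (g : E → ℝ) : Prop where
  w_int : ∀ a, Integrable (w a) μ
  w_sq : ∀ a, Integrable (fun z => w a z ^ 2) μ
  p_int : ∀ a j, Integrable (p a j) μ
  B_int : ∀ a j, Integrable (B a j) μ
  g_int : Integrable g μ
  g_nonneg : ∀ z, 0 ≤ g z
  bound_p : ∀ a j b k, ∀ᵐ y ∂μ, ∀ᵐ y' ∂μ, |B a j y| * |p b k y'| ≤ g y + g y'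
  bound_w : ∀ a j b, ∀ᵐ y ∂μ, ∀ᵐ y' ∂μ, |B a j y| * |w b y'| ≤ g y + g y'
  grad : ∀ a j, WeakGrad μ O (v j) (w a) (p a j)
  evol : ∀ a, ∀ ζ : E → ℝ, ContDiff ℝ ∞ ζ → HasCompactSupport ζ → tsupport ζ ⊆ O →
    ∫ z, w a z * fderiv ℝ ζ z τ ∂μ = ∑ j, ∫ z, B a j z * fderiv ℝ ζ z (v j) ∂μ

lemma exists_bound_fderiv {θ : E → ℝ} (hθ : ContDiff ℝ 1 θ) (hc : HasCompactSupport θ) (u : E) :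
    ∃ T, ∀ z, |fderiv ℝ θ z u| ≤ T := by
  have h1 : Continuous fun z => fderiv ℝ θ z u :=
    (hθ.continuous_fderiv (by norm_num)).clm_apply continuous_const
  have h2 : HasCompactSupport fun z => fderiv ℝ θ z u :=
    (hc.fderiv ℝ).comp_left (g := fun L : E →L[ℝ] ℝ => L u) (by simp)
  exact h2.exists_bound_of_continuous h1

variable {μ}

lemma continuous_testIntegrand {κ : ℝ → ℝ} (hκ : ContDiff ℝ 1 κ) (θ : ℝ) (θ' : J → ℝ) :
    Continuous fun x : (ι → ℝ) × (ι → J → ℝ) × (ι → J → ℝ) =>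
      testIntegrand κ x.1 x.2.1 x.2.2 θ θ' := by
  have h1 := hκ.continuous
  have h2 := hκ.continuous_deriv (le_refl 1)
  unfold testIntegrand sumSq
  fun_prop

lemma tendsto_testIntegrand_pointwise {α : Type*} {l : Filter α} {κ : ℝ → ℝ}
    (hκ : ContDiff ℝ 1 κ) {θ : ℝ} {θ' : J → ℝ} {w : α → ι → ℝ} {p B : α → ι → J → ℝ}
    {w₀ : ι → ℝ} {p₀ B₀ : ι → J → ℝ} (hw : ∀ a, Tendsto (fun m => w m a) l (𝓝 (w₀ a)))
    (hp : ∀ a j, Tendsto (fun m => p m a j) l (𝓝 (p₀ a j)))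
    (hB : ∀ a j, Tendsto (fun m => B m a j) l (𝓝 (B₀ a j))) :
    Tendsto (fun m => testIntegrand κ (w m) (p m) (B m) θ θ') l
      (𝓝 (testIntegrand κ w₀ p₀ B₀ θ θ')) := by
  have h1 : Tendsto w l (𝓝 w₀) := tendsto_pi_nhds.2 hw
  have h2 : Tendsto p l (𝓝 p₀) := tendsto_pi_nhds.2 fun a => tendsto_pi_nhds.2 (hp a)
  have h3 : Tendsto B l (𝓝 B₀) := tendsto_pi_nhds.2 fun a => tendsto_pi_nhds.2 (hB a)
  have h4 := ((continuous_testIntegrand hκ θ θ').tendsto (w₀, p₀, B₀)).comp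
    (h1.prodMk_nhds (h2.prodMk_nhds h3))
  exact h4

lemma aestronglyMeasurable_testIntegrand {w : ι → E → ℝ} {p B : ι → J → E → ℝ} {κ : ℝ → ℝ}
    {θ : E → ℝ} {v : J → E} (hκ : ContDiff ℝ 1 κ) (hθ : ContDiff ℝ 1 θ)
    (hw : ∀ a, AEStronglyMeasurable (w a) μ) (hp : ∀ a j, AEStronglyMeasurable (p a j) μ)
    (hB : ∀ a j, AEStronglyMeasurable (B a j) μ) :
    AEStronglyMeasurable (fun z => testIntegrand κ (fun a => w a z) (fun a j => p a j z)
      (fun a j => B a j z) (θ z) (fun j => fderiv ℝ θ z (v j))) μ := by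
  have h1 := hκ.continuous
  have h2 := hκ.continuous_deriv (le_refl 1)
  have h3 : Continuous fun x : (ι → ℝ) × (ι → J → ℝ) × (ι → J → ℝ) × ℝ × (J → ℝ) =>
      testIntegrand κ x.1 x.2.1 x.2.2.1 x.2.2.2.1 x.2.2.2.2 := by
    unfold testIntegrand sumSq
    fun_prop
  refine h3.comp_aestronglyMeasurable (f := fun z => ((fun a => w a z), (fun a j => p a j z),
    (fun a j => B a j z), θ z, (fun j => fderiv ℝ θ z (v j)))) ?_
  have h4 : ∀ j, Continuous fun z => fderiv ℝ θ z (v j) := fun j =>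
    (hθ.continuous_fderiv (by norm_num)).clm_apply continuous_const
  refine AEStronglyMeasurable.prodMk ?_ (AEStronglyMeasurable.prodMk ?_
    (AEStronglyMeasurable.prodMk ?_ (AEStronglyMeasurable.prodMk ?_ ?_)))
  · exact (aemeasurable_pi_lambda _ fun a => (hw a).aemeasurable).aestronglyMeasurable
  · exact (aemeasurable_pi_lambda _ fun a => aemeasurable_pi_lambda _ fun j =>
      (hp a j).aemeasurable).aestronglyMeasurable
  · exact (aemeasurable_pi_lambda _ fun a => aemeasurable_pi_lambda _ fun j =>
      (hB a j).aemeasurable).aestronglyMeasurable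
  · exact hθ.continuous.aestronglyMeasurable
  · exact (continuous_pi h4).aestronglyMeasurable

lemma tendsto_L1_const_mul_mol {g : E → ℝ} (hg : Integrable g μ) (hg0 : ∀ z, 0 ≤ g z) (D : ℝ) :
    Tendsto (fun m => ∫ z, |D * mol μ m g z - D * g z| ∂μ) atTop (𝓝 0) := by
  have := (mol_tendsto_L1 μ hg (ae_of_all _ hg0)).const_mul |D|
  simpa only [← integral_const_mul, ← abs_mul, mul_sub, mul_zero] using this

section

variable {O : Set E} {v : J → E} {τ : E} {w : ι → E → ℝ} {p B : ι → J → E → ℝ} {g : E → ℝ}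
  {θ : E → ℝ} {κ K : ℝ → ℝ} {C : ℝ}

lemma aestronglyMeasurable_mol {f : E → ℝ} (hf : LocallyIntegrable f μ) (m : ℕ) :
    AEStronglyMeasurable (mol μ m f) μ :=
  (mol_contDiff μ m hf (n := 0)).continuous.aestronglyMeasurable

/-- Integrands of the mollified system are bounded by a constant times `mol g`, through `mol_mul_le`
and `abs_testIntegrand_le`, and `mol g` converges to `g` in `L¹`. Pointwise convergence holds at
Lebesgue points of the data. -/
lemma WeakSystem.tendsto_testIntegrand (h : WeakSystem μ O v τ w p B g)
    (hθ : ContDiff ℝ 1 θ) (hθc : HasCompactSupport θ) (hκ : ContDiff ℝ 1 κ)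
    (hκ1 : ∀ y, 0 ≤ y → |κ y| ≤ 1) (hκ' : ∀ y, 0 ≤ y → |deriv κ y| * y ≤ C) :
    Integrable (fun z => testIntegrand κ (fun a => w a z) (fun a j => p a j z)
      (fun a j => B a j z) (θ z) (fun j => fderiv ℝ θ z (v j))) μ ∧
    Tendsto (fun m => ∫ z, testIntegrand κ (fun a => mol μ m (w a) z)
      (fun a j => mol μ m (p a j) z) (fun a j => mol μ m (B a j) z) (θ z)
      (fun j => fderiv ℝ θ z (v j)) ∂μ) atTop
      (𝓝 (∫ z, testIntegrand κ (fun a => w a z) (fun a j => p a j z)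
      (fun a j => B a j z) (θ z) (fun j => fderiv ℝ θ z (v j)) ∂μ)) := by
  have hwl := fun a => (h.w_int a).locallyIntegrable
  have hpl := fun a j => (h.p_int a j).locallyIntegrable
  have hBl := fun a j => (h.B_int a j).locallyIntegrable
  have hgl := h.g_int.locallyIntegrable
  obtain ⟨T₁, hT₁⟩ := hθc.exists_bound_of_continuous hθ.continuous
  choose T₂ hT₂ using fun j => exists_bound_fderiv hθ hθc (v j)
  obtain ⟨T, hT1, hT2⟩ : ∃ T, T₁ ≤ T ∧ ∀ j, T₂ j ≤ T := by
    refine ⟨|T₁| + ∑ j, |T₂ j|, ?_, fun j => ?_⟩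
    · exact (le_abs_self _).trans
        (le_add_of_nonneg_right (Finset.sum_nonneg fun _ _ => abs_nonneg _))
    · exact (le_abs_self _).trans ((Finset.single_le_sum (f := fun j => |T₂ j|)
        (fun _ _ => abs_nonneg _) (Finset.mem_univ j)).trans
        (le_add_of_nonneg_left (abs_nonneg _)))
  have hTθ : ∀ z, |θ z| ≤ T := fun z => (hT₁ z).trans hT1
  have hTθ' : ∀ z j, |fderiv ℝ θ z (v j)| ≤ T := fun z j => (hT₂ j z).trans (hT2 j)
  obtain ⟨D, hD⟩ : ∃ D : ℝ,
      D = Fintype.card ι * (Fintype.card J * ((1 + 2 * C * Fintype.card ι + 1) * T)) * 2 := ⟨_, rfl⟩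
  refine tendsto_integral_of_tendsto_majorant (g := fun m z => D * mol μ m g z)
    (G := fun z => D * g z) ?_ ?_ ?_ ?_ ?_ ?_
  · exact fun m => aestronglyMeasurable_testIntegrand hκ hθ
      (fun a => aestronglyMeasurable_mol (hwl a) m)
      (fun a j => aestronglyMeasurable_mol (hpl a j) m)
      (fun a j => aestronglyMeasurable_mol (hBl a j) m)
  · exact fun m => (integrable_mol μ m h.g_int).const_mul D
  · exact h.g_int.const_mul D
  · exact tendsto_L1_const_mul_mol h.g_int h.g_nonneg D
  · intro m
    refine ae_of_all _ fun z => ?_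
    have := abs_testIntegrand_le (X := 2 * mol μ m g z) (w := fun a => mol μ m (w a) z)
      (p := fun a j => mol μ m (p a j) z) (B := fun a j => mol μ m (B a j) z) hκ1 hκ'
      (fun a j b k => mol_mul_le μ m (hBl a j) (hpl b k) hgl (h.bound_p a j b k) z)
      (fun a j b => mol_mul_le μ m (hBl a j) (hwl b) hgl (h.bound_w a j b) z)
      (mul_nonneg zero_le_two (mol_nonneg μ m (ae_of_all _ h.g_nonneg) z))
      (hTθ z) (hTθ' z)
    refine this.trans (le_of_eq ?_)
    rw [hD]; ring
  · filter_upwards [ae_all_iff.2 fun a => mol_tendsto_ae μ (hwl a),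
      ae_all_iff.2 fun a => ae_all_iff.2 fun j => mol_tendsto_ae μ (hpl a j),
      ae_all_iff.2 fun a => ae_all_iff.2 fun j => mol_tendsto_ae μ (hBl a j)] with z h1 h2 h3
    exact tendsto_testIntegrand_pointwise hκ h1 h2 h3

/-- Since `|K y| ≤ y`, it is enough to dominate `|mol w|²`, which `mol_sq_le` does by mollifications
of `w²`. -/
lemma WeakSystem.tendsto_integral_sumSq (h : WeakSystem μ O v τ w p B g)
    (hθ : ContDiff ℝ 1 θ) (hθc : HasCompactSupport θ) (hKc : Continuous K)
    (hK1 : ∀ y, 0 ≤ y → |K y| ≤ y) :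
    Tendsto (fun m => ∫ z, K (sumSq fun a => mol μ m (w a) z) * fderiv ℝ θ z τ ∂μ) atTop
      (𝓝 (∫ z, K (sumSq fun a => w a z) * fderiv ℝ θ z τ ∂μ)) := by
  have hwl := fun a => (h.w_int a).locallyIntegrable
  obtain ⟨T₃, hT₃⟩ := exists_bound_fderiv hθ hθc τ
  obtain ⟨g₂, hg₂⟩ : ∃ g₂ : E → ℝ, g₂ = fun z => sumSq fun a => w a z := ⟨_, rfl⟩
  have hg₂i : Integrable g₂ μ := by
    rw [hg₂]; exact integrable_finsetSum _ fun a _ => h.w_sq a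
  have hg₂0 : ∀ z, 0 ≤ g₂ z := fun z => by rw [hg₂]; exact sumSq_nonneg _
  have hθτ : Continuous fun z => fderiv ℝ θ z τ :=
    (hθ.continuous_fderiv (by norm_num)).clm_apply continuous_const
  refine (tendsto_integral_of_tendsto_majorant
    (g := fun m z => (Fintype.card ι * 2 * T₃) * mol μ m g₂ z)
    (G := fun z => (Fintype.card ι * 2 * T₃) * g₂ z) ?_ ?_ ?_ ?_ ?_ ?_).2
  · intro m
    refine Continuous.aestronglyMeasurable (Continuous.mul (hKc.comp ?_) hθτ)
    unfold sumSq
    exact continuous_finsetSum _ fun a _ =>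
      ((mol_contDiff μ m (hwl a) (n := 0)).continuous).pow 2
  · exact fun m => (integrable_mol μ m hg₂i).const_mul _
  · exact hg₂i.const_mul _
  · exact tendsto_L1_const_mul_mol hg₂i hg₂0 _
  · intro m
    refine ae_of_all _ fun z => ?_
    have hT₃0 : 0 ≤ T₃ := (abs_nonneg _).trans (hT₃ z)
    have h1 : sumSq (fun a => mol μ m (w a) z) ≤ Fintype.card ι * 2 * mol μ m g₂ z := by
      have h2 : ∀ a ∈ Finset.univ, mol μ m (w a) z ^ 2 ≤ 2 * mol μ m g₂ z := fun a _ => by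
        refine (mol_sq_le μ m (hwl a) (h.w_sq a).locallyIntegrable z).trans ?_
        refine mul_le_mul_of_nonneg_left ?_ zero_le_two
        refine mol_mono μ m (h.w_sq a).locallyIntegrable hg₂i.locallyIntegrable
          (ae_of_all _ fun y => ?_) z
        rw [hg₂]
        exact sq_le_sumSq (fun a => w a y) a
      refine (Finset.sum_le_sum h2).trans (le_of_eq ?_)
      rw [Finset.sum_const, Finset.card_univ, nsmul_eq_mul]; ring
    rw [abs_mul]
    refine (mul_le_mul (hK1 _ (sumSq_nonneg _)) (hT₃ z) (abs_nonneg _)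
      (sumSq_nonneg _)).trans ?_
    refine (mul_le_mul_of_nonneg_right h1 hT₃0).trans (le_of_eq (by ring))
  · filter_upwards [ae_all_iff.2 fun a => mol_tendsto_ae μ (hwl a)] with z h1
    refine Tendsto.mul ((hKc.tendsto _).comp ?_) tendsto_const_nhds
    exact tendsto_finsetSum _ fun a _ => (h1 a).pow 2

/-- The tested equation for weak solutions. -/
lemma WeakSystem.integral_testIntegrand (hO : IsOpen O) (h : WeakSystem μ O v τ w p B g)
    (hθ : ContDiff ℝ 1 θ) (hθc : HasCompactSupport θ)
    (hθO : tsupport θ ⊆ O) (hκ : ContDiff ℝ 1 κ) (hK : ∀ y, HasDerivAt K (κ y) y)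
    (hκ1 : ∀ y, 0 ≤ y → |κ y| ≤ 1) (hκ' : ∀ y, 0 ≤ y → |deriv κ y| * y ≤ C)
    (hK1 : ∀ y, 0 ≤ y → |K y| ≤ y) :
    ∫ z, testIntegrand κ (fun a => w a z) (fun a j => p a j z)
      (fun a j => B a j z) (θ z) (fun j => fderiv ℝ θ z (v j)) ∂μ =
      1 / 2 * ∫ z, K (sumSq fun a => w a z) * fderiv ℝ θ z τ ∂μ := by
  have hwl := fun a => (h.w_int a).locallyIntegrable
  have hBl := fun a j => (h.B_int a j).locallyIntegrable
  have hKc : Continuous K := (Differentiable.continuous (𝕜 := ℝ) fun y => (hK y).differentiableAt)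
  have lhs := (h.tendsto_testIntegrand hθ hθc hκ hκ1 hκ').2
  have rhs := h.tendsto_integral_sumSq hθ hθc hKc hK1
  refine tendsto_nhds_unique_of_eventuallyEq lhs (rhs.const_mul (1 / 2)) ?_
  filter_upwards [eventually_kernel_subset μ hO hθc hθO] with m hm
  rw [← integral_testIntegrand_of_contDiff μ (v := v) (fun a => mol_contDiff μ m (hwl a) (n := 1))
    (fun a j => mol_contDiff μ m (hBl a j) (n := 1)) hθ hθc hκ hK]
  · refine integral_congr_ae (ae_of_all _ fun z => ?_)
    by_cases hz : z ∈ tsupport θ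
    · simp only [(h.grad _ _).fderiv_mol (hwl _) (hm z hz)]
    · have h1 : θ z = 0 := image_eq_zero_of_notMem_tsupport hz
      have h2 : fderiv ℝ θ z = 0 :=
        image_eq_zero_of_notMem_tsupport fun h3 => hz (tsupport_fderiv_subset ℝ h3)
      simp [testIntegrand, h1, h2]
  · intro z hz a
    rw [fderiv_mol μ m (hwl a), h.evol a _ (kernel_contDiff μ m z) (kernel_hasCompactSupport μ m z)
      (hm z hz), ← Finset.sum_neg_distrib]
    exact Finset.sum_congr rfl fun j _ => (fderiv_mol μ m (hBl a j) z (v j)).symm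

end

/-- The chain rule for functions of the length of a weakly differentiable family. -/
lemma weakGrad_comp_sumSq {O : Set E} (hO : IsOpen O) {v : E} {w p : ι → E → ℝ}
    (hw : ∀ a, Integrable (w a) μ) (hp : ∀ a, Integrable (p a) μ)
    (hgrad : ∀ a, WeakGrad μ O v (w a) (p a)) {κ : ℝ → ℝ} {C C' : ℝ} (hκ : ContDiff ℝ 1 κ)
    (hκ1 : ∀ y, 0 ≤ y → |κ y| ≤ C') (hκ' : ∀ y, 0 ≤ y → |deriv κ y| * √y ≤ C) :
    WeakGrad μ O v (fun z => κ (sumSq fun a => w a z))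
      (fun z => deriv κ (sumSq fun a => w a z) * (2 * ∑ b, w b z * p b z)) := by
  intro ζ hζ hζc hζO
  have hwl := fun a => (hw a).locallyIntegrable
  have hpl := fun a => (hp a).locallyIntegrable
  have hζ1 : ContDiff ℝ 1 ζ := hζ.of_le (by exact_mod_cast le_top)
  have hcd := hκ.continuous_deriv (le_refl 1)
  obtain ⟨T₁, hT₁⟩ := hζc.exists_bound_of_continuous hζ.continuous
  have hζv : Continuous fun z => fderiv ℝ ζ z v :=
    (hζ1.continuous_fderiv (by norm_num)).clm_apply continuous_const
  have hζvc : HasCompactSupport fun z => fderiv ℝ ζ z v :=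
    (hζc.fderiv ℝ).comp_left (g := fun L : E →L[ℝ] ℝ => L v) (by simp)
  have hsm : ∀ m, ContDiff ℝ 1 fun z => sumSq fun a => mol μ m (w a) z := fun m => by
    unfold sumSq
    exact ContDiff.sum fun a _ => (mol_contDiff μ m (hwl a) (n := 1)).pow 2
  have lhs : Tendsto (fun m => ∫ z, κ (sumSq fun a => mol μ m (w a) z) * fderiv ℝ ζ z v ∂μ)
      atTop (𝓝 (∫ z, κ (sumSq fun a => w a z) * fderiv ℝ ζ z v ∂μ)) := by
    refine tendsto_integral_of_dominated_convergence (fun z => C' * |fderiv ℝ ζ z v|) (fun m => ?_)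
      ((hζv.integrable_of_hasCompactSupport hζvc).abs.const_mul _) (fun m => ?_) ?_
    · exact ((hκ.continuous.comp (hsm m).continuous).mul hζv).aestronglyMeasurable
    · refine ae_of_all _ fun z => ?_
      rw [norm_mul]
      exact mul_le_mul_of_nonneg_right (hκ1 _ (sumSq_nonneg _)) (abs_nonneg _)
    · filter_upwards [ae_all_iff.2 fun a => mol_tendsto_ae μ (hwl a)] with z h1
      refine Tendsto.mul ((hκ.continuous.tendsto _).comp ?_) tendsto_const_nhds
      exact tendsto_finsetSum _ fun a _ => (h1 a).pow 2
  set g : E → ℝ := fun z => ∑ b, |p b z| with hg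
  have hgi : Integrable g μ := integrable_finsetSum _ fun a _ => (hp a).abs
  have hg0 : ∀ z, 0 ≤ g z := fun z => Finset.sum_nonneg fun _ _ => abs_nonneg _
  set D : ℝ := 2 * (Fintype.card ι * C) * T₁
  have rhs := tendsto_integral_of_tendsto_majorant (μ := μ)
    (f := fun m z => deriv κ (sumSq fun a => mol μ m (w a) z) *
      (2 * ∑ b, mol μ m (w b) z * mol μ m (p b) z) * ζ z)
    (F := fun z => deriv κ (sumSq fun a => w a z) * (2 * ∑ b, w b z * p b z) * ζ z)
    (g := fun m z => D * mol μ m g z) (G := fun z => D * g z)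
    (fun m => by
      refine Continuous.aestronglyMeasurable (Continuous.mul (Continuous.mul
        (hcd.comp (hsm m).continuous) (continuous_const.mul ?_)) hζ.continuous)
      exact continuous_finsetSum _ fun a _ => ((mol_contDiff μ m (hwl a) (n := 0)).continuous).mul
        ((mol_contDiff μ m (hpl a) (n := 0)).continuous))
    (fun m => (integrable_mol μ m hgi).const_mul D) (hgi.const_mul D)
    (tendsto_L1_const_mul_mol hgi hg0 D)
    -- The factor `w` is bounded against `κ'` because `|κ'(y)| √y ≤ C`; hence a mollification of `∑
    -- |p b|` is a majorant, and `w p` need not be known to be integrable.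
    (fun m => ae_of_all _ fun z => by
      set W : ι → ℝ := fun a => mol μ m (w a) z
      have hs := sumSq_nonneg W
      have hT0 : 0 ≤ T₁ := (norm_nonneg _).trans (hT₁ z)
      have h1 : ∀ b, |mol μ m (p b) z| ≤ mol μ m g z := fun b =>
        (abs_mol_le μ m z).trans (mol_mono μ m (locallyIntegrable_abs μ (hpl b))
          hgi.locallyIntegrable (ae_of_all _ fun y => Finset.single_le_sum
            (f := fun b => |p b y|) (fun _ _ => abs_nonneg _) (Finset.mem_univ b)) z)
      have hgm := mol_nonneg μ m (ae_of_all _ hg0) z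
      have h2 : ∀ b ∈ Finset.univ, |deriv κ (sumSq W) * (W b * mol μ m (p b) z)| ≤
          C * mol μ m g z := by
        intro b _
        rw [abs_mul, abs_mul, ← mul_assoc]
        refine mul_le_mul ?_ (h1 b) (abs_nonneg _) ?_
        · refine le_trans ?_ (hκ' _ hs)
          refine mul_le_mul_of_nonneg_left ?_ (abs_nonneg _)
          exact Real.abs_le_sqrt (sq_le_sumSq W b)
        · exact (by positivity : (0 : ℝ) ≤ _).trans (hκ' _ hs)
      have e : deriv κ (sumSq W) * (2 * ∑ b, W b * mol μ m (p b) z) * ζ z =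
          2 * (∑ b, deriv κ (sumSq W) * (W b * mol μ m (p b) z)) * ζ z := by
        rw [← Finset.mul_sum]; ring
      rw [e, abs_mul, abs_mul, abs_two]
      have h3 := (Finset.abs_sum_le_sum_abs _ _).trans (Finset.sum_le_sum h2)
      rw [Finset.sum_const, Finset.card_univ, nsmul_eq_mul] at h3
      calc _ ≤ 2 * (Fintype.card ι * (C * mol μ m g z)) * T₁ := by
            refine mul_le_mul (mul_le_mul_of_nonneg_left h3 zero_le_two) (hT₁ z) (abs_nonneg _) ?_
            exact mul_nonneg zero_le_two ((abs_nonneg _).trans h3)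
        _ = _ := by simp only [D]; ring)
    (by
      filter_upwards [ae_all_iff.2 fun a => mol_tendsto_ae μ (hwl a),
        ae_all_iff.2 fun a => mol_tendsto_ae μ (hpl a)] with z h1 h2
      refine Tendsto.mul (Tendsto.mul ((hcd.tendsto _).comp ?_) (Tendsto.const_mul 2 ?_))
        tendsto_const_nhds
      · exact tendsto_finsetSum _ fun a _ => (h1 a).pow 2
      · exact tendsto_finsetSum _ fun a _ => (h1 a).mul (h2 a))
  refine tendsto_nhds_unique_of_eventuallyEq lhs rhs.2.neg ?_
  filter_upwards [eventually_kernel_subset μ hO hζc hζO] with m hm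
  have hd : ContDiff ℝ 1 fun z => κ (sumSq fun a => mol μ m (w a) z) := hκ.comp (hsm m)
  have hcf : Continuous fun z => fderiv ℝ (fun z => κ (sumSq fun a => mol μ m (w a) z)) z v :=
    (hd.continuous_fderiv (by norm_num)).clm_apply continuous_const
  rw [integral_mul_fderiv_eq_neg_fderiv_mul_of_integrable]
  · congr 1
    refine integral_congr_ae (ae_of_all _ fun z => ?_)
    by_cases hz : z ∈ tsupport ζ
    · have h1 : HasFDerivAt (fun z => sumSq fun a => mol μ m (w a) z)
          (∑ b, (2 * mol μ m (w b) z) • fderiv ℝ (mol μ m (w b)) z) z := by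
        unfold sumSq
        refine HasFDerivAt.fun_sum fun b _ => ?_
        have := ((((mol_contDiff μ m (hwl b) (n := 1)).differentiable (by norm_num)) z).hasFDerivAt.pow 2)
        simpa using this
      have h2 : HasFDerivAt (fun z => κ (sumSq fun a => mol μ m (w a) z)) _ z :=
        ((hκ.differentiable (by norm_num)) _).hasDerivAt.comp_hasFDerivAt z h1
      simp only
      rw [h2.fderiv]
      simp only [_root_.smul_apply, _root_.sum_apply, smul_eq_mul,
        (hgrad _).fderiv_mol (hwl _) (hm z hz), Finset.mul_sum, mul_assoc]
    · simp [image_eq_zero_of_notMem_tsupport hz]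
  · exact (hcf.mul hζ.continuous).integrable_of_hasCompactSupport hζc.mul_left
  · exact (hd.continuous.mul hζv).integrable_of_hasCompactSupport hζvc.mul_left
  · exact (hd.continuous.mul hζ.continuous).integrable_of_hasCompactSupport hζc.mul_left
  · exact fun z _ => (hd.differentiable (by norm_num)) z
  · exact fun z _ => (hζ1.differentiable (by norm_num)) z

end WeakTesting

end PhiCaloric
end

noncomputable section

namespace PhiCaloric

open Filter Topology

section Segments

variable {E : Type*} [NormedAddCommGroup E] [NormedSpace ℝ E] [MeasurableSpace E] [BorelSpace E]
  [FiniteDimensional ℝ E] {μ : Measure E} [μ.IsAddHaarMeasure]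

/-! ### Averages over segments -/

/-- The average of `f` over the segment from `z` to `z + h • e`. -/
def segAvg (h : ℝ) (e : E) (f : E → ℝ) (z : E) : ℝ := h⁻¹ * ∫ s in Ioc 0 h, f (z + s • e)

lemma integrable_translate {F : Type*} [NormedAddCommGroup F] {f : E → F} (hf : Integrable f μ)
    (y : E) : Integrable (fun z => f (z + y)) μ := hf.comp_add_right y

lemma integrable_segment {f : E → ℝ} (hfm : Measurable f) (hf : Integrable f μ) (h : ℝ) (e : E) :
    Integrable (fun x : E × ℝ => f (x.1 + x.2 • e)) (μ.prod (volume.restrict (Ioc 0 h))) := by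
  have hm : Measurable fun x : E × ℝ => f (x.1 + x.2 • e) := hfm.comp (by fun_prop)
  rw [integrable_prod_iff' hm.aestronglyMeasurable]
  refine ⟨ae_of_all _ fun s => by simpa using integrable_translate hf (s • e), ?_⟩
  have : ∀ s : ℝ, ∫ z, ‖f (z + s • e)‖ ∂μ = ∫ z, ‖f z‖ ∂μ := fun s =>
    integral_add_right_eq_self (fun z => ‖f z‖) (s • e)
  simp only [this]
  exact integrable_const _

lemma ae_integrableOn_segment {f : E → ℝ} (hfm : Measurable f) (hf : Integrable f μ) (h : ℝ)
    (e : E) : ∀ᵐ z ∂μ, IntegrableOn (fun s : ℝ => f (z + s • e)) (Ioc 0 h) :=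
  (integrable_segment hfm hf h e).prod_right_ae

lemma integrable_segAvg {f : E → ℝ} (hfm : Measurable f) (hf : Integrable f μ) (h : ℝ) (e : E) :
    Integrable (segAvg h e f) μ :=
  (integrable_segment hfm hf h e).integral_prod_left.const_mul _

lemma integral_segment {f : E → ℝ} (hfm : Measurable f) (hf : Integrable f μ) {h : ℝ}
    (hh : 0 ≤ h) (e : E) : ∫ z, (∫ s in Ioc 0 h, f (z + s • e)) ∂μ = h * ∫ z, f z ∂μ := by
  rw [integral_integral_swap (integrable_segment hfm hf h e)]
  have : ∀ s : ℝ, ∫ z, f (z + s • e) ∂μ = ∫ z, f z ∂μ := fun s =>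
    integral_add_right_eq_self f (s • e)
  simp [this, hh]

lemma integral_segAvg {f : E → ℝ} (hfm : Measurable f) (hf : Integrable f μ) {h : ℝ} (hh : 0 < h)
    (e : E) : ∫ z, segAvg h e f z ∂μ = ∫ z, f z ∂μ := by
  unfold segAvg
  rw [integral_const_mul, integral_segment hfm hf hh.le, inv_mul_cancel_left₀ hh.ne']

lemma sq_integral_le {g : ℝ → ℝ} {h : ℝ} (hh : 0 < h) (hg : IntegrableOn g (Ioc 0 h))
    (hg2 : IntegrableOn (fun s => g s ^ 2) (Ioc 0 h)) :
    (h⁻¹ * ∫ s in Ioc 0 h, g s) ^ 2 ≤ h⁻¹ * ∫ s in Ioc 0 h, g s ^ 2 := by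
  set c := h⁻¹ * ∫ s in Ioc 0 h, g s with hc
  have h1 : 0 ≤ ∫ s in Ioc 0 h, (g s - c) ^ 2 := integral_nonneg fun s => sq_nonneg _
  have h2 : ∫ s in Ioc 0 h, (g s - c) ^ 2 =
      (∫ s in Ioc 0 h, g s ^ 2) - 2 * c * (∫ s in Ioc 0 h, g s) + h * c ^ 2 := by
    have e : ∀ s, (g s - c) ^ 2 = g s ^ 2 - 2 * c * g s + c ^ 2 := fun s => by ring
    have hl : Integrable (fun s => 2 * c * g s) (volume.restrict (Ioc 0 h)) := hg.const_mul _
    have hs : Integrable (fun s => g s ^ 2 - 2 * c * g s) (volume.restrict (Ioc 0 h)) :=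
      hg2.sub hl
    simp_rw [e]
    rw [integral_add hs (integrable_const _), integral_sub hg2 hl, integral_const_mul]
    simp [hh.le]
  have h3 : ∫ s in Ioc 0 h, g s = h * c := by rw [hc]; field_simp
  rw [h2, h3] at h1
  rw [inv_mul_eq_div, le_div_iff₀ hh]
  nlinarith

/-! ### Mollification in `L¹` and difference quotients of weakly differentiable functions -/

lemma mol_tendsto_L1' {g : E → ℝ} (hg : Integrable g μ) :
    Tendsto (fun m => ∫ z, |mol μ m g z - g z| ∂μ) atTop (𝓝 0) := by
  have h1 := tendsto_integral_of_tendsto_majorant (μ := μ)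
    (f := fun m z => |mol μ m g z - g z|) (F := fun _ => 0)
    (g := fun m z => mol μ m (fun y => |g y|) z + |g z|) (G := fun z => |g z| + |g z|)
    (fun m => ((integrable_mol μ m hg).sub hg).abs.aestronglyMeasurable)
    (fun m => (integrable_mol μ m hg.abs).add hg.abs) (hg.abs.add hg.abs)
    (by simpa using mol_tendsto_L1 μ hg.abs (ae_of_all _ fun y => abs_nonneg _))
    (fun m => ae_of_all _ fun z => by
      rw [abs_abs]
      exact (abs_sub _ _).trans (add_le_add (abs_mol_le μ m z) le_rfl))
    (by
      filter_upwards [mol_tendsto_ae μ hg.locallyIntegrable] with z hz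
      have := (hz.sub_const (g z)).abs
      simpa using this)
  simpa using h1.2

lemma exists_subseq_tendsto_of_tendsto_L1 {α : Type*} [MeasurableSpace α] {ν : Measure α}
    {f : ℕ → α → ℝ} {F : α → ℝ} (hf : ∀ m, Integrable (f m) ν) (hF : Integrable F ν)
    (h : Tendsto (fun m => ∫ z, |f m z - F z| ∂ν) atTop (𝓝 0)) :
    ∃ ns : ℕ → ℕ, StrictMono ns ∧ ∀ᵐ z ∂ν, Tendsto (fun m => f (ns m) z) atTop (𝓝 (F z)) := by
  have h1 : Tendsto (fun m => eLpNorm (f m - F) 1 ν) atTop (𝓝 0) := by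
    have : (fun m => eLpNorm (f m - F) 1 ν) =
        fun m => ENNReal.ofReal (∫ z, |f m z - F z| ∂ν) := by
      funext m
      rw [eLpNorm_one_eq_lintegral_enorm,
        ofReal_integral_eq_lintegral_ofReal (f := fun z => |f m z - F z|) ((hf m).sub hF).norm
          (ae_of_all _ fun z => abs_nonneg _)]
      refine lintegral_congr fun z => ?_
      rw [← ofReal_norm]; rfl
    rw [this, ← ENNReal.ofReal_zero]
    exact ENNReal.tendsto_ofReal h
  exact (tendstoInMeasure_of_tendsto_eLpNorm one_ne_zero
    (fun m => (hf m).aestronglyMeasurable) hF.aestronglyMeasurable h1).exists_seq_tendsto_ae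

lemma ae_translate {p : E → Prop} (hp : ∀ᵐ z ∂μ, p z) (y : E) : ∀ᵐ z ∂μ, p (z + y) :=
  (measurePreserving_add_right μ y).quasiMeasurePreserving.ae hp

/-- A weakly differentiable function is absolutely continuous along almost every segment. -/
lemma WeakGrad.sub_eq_integral {O : Set E} (hO : IsOpen O) {e : E} {f Z : E → ℝ}
    (hf : Integrable f μ) (hZm : Measurable Z) (hZ : Integrable Z μ) (hw : WeakGrad μ O e f Z)
    {h : ℝ} (hh : 0 < h) : ∀ᵐ z ∂μ, (∀ s ∈ Icc 0 h, z + s • e ∈ O) →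
      f (z + h • e) - f z = ∫ s in Ioc 0 h, Z (z + s • e) := by
  have hsm : ∀ m, Measurable (mol μ m Z) := fun m =>
    (mol_contDiff μ m hZ.locallyIntegrable (n := 0)).continuous.measurable
  have hi : ∀ m, Integrable (fun z => ∫ s in Ioc 0 h, mol μ m Z (z + s • e)) μ := fun m =>
    (integrable_segment (hsm m) (integrable_mol μ m hZ) h e).integral_prod_left
  have hi0 : Integrable (fun z => ∫ s in Ioc 0 h, Z (z + s • e)) μ :=
    (integrable_segment hZm hZ h e).integral_prod_left
  have hL1 : Tendsto (fun m => ∫ z, |(∫ s in Ioc 0 h, mol μ m Z (z + s • e)) -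
      ∫ s in Ioc 0 h, Z (z + s • e)| ∂μ) atTop (𝓝 0) := by
    have h1 := (mol_tendsto_L1' hZ).const_mul h
    rw [mul_zero] at h1
    refine squeeze_zero (fun m => integral_nonneg fun z => abs_nonneg _) (fun m => ?_) h1
    have hd : Measurable fun z => |mol μ m Z z - Z z| := ((hsm m).sub hZm).abs
    have hdi : Integrable (fun z => |mol μ m Z z - Z z|) μ := ((integrable_mol μ m hZ).sub hZ).abs
    rw [← integral_segment hd hdi hh.le e]
    refine integral_mono_ae ((hi m).sub hi0).abs
      (integrable_segment hd hdi h e).integral_prod_left ?_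
    filter_upwards [ae_integrableOn_segment (hsm m) (integrable_mol μ m hZ) h e,
      ae_integrableOn_segment hZm hZ h e] with z h2 h3
    rw [← integral_sub h2 h3]
    exact abs_integral_le_integral_abs
  -- Fubini's theorem turns `L¹` convergence of the mollified derivative into `L¹` convergence of
  -- its segment integrals, hence into convergence on almost every segment along a subsequence. For
  -- the mollified functions the identity is the fundamental theorem of calculus.
  obtain ⟨ns, hns, h2⟩ := exists_subseq_tendsto_of_tendsto_L1 hi hi0 hL1
  have h3 := mol_tendsto_ae μ hf.locallyIntegrable
  filter_upwards [h2, h3, ae_translate h3 (h • e)] with z hz1 hz2 hz3 hseg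
  have hlim := (hz3.sub hz2).comp hns.tendsto_atTop
  refine tendsto_nhds_unique_of_eventuallyEq hlim hz1 ?_
  have hcomp : IsCompact ((fun s : ℝ => z + s • e) '' Icc 0 h) :=
    isCompact_Icc.image (by fun_prop)
  have hsub : (fun s : ℝ => z + s • e) '' Icc 0 h ⊆ O := by
    rintro _ ⟨s, hs, rfl⟩; exact hseg s hs
  have hev := (eventually_kernel_subset μ hO hcomp hsub)
  filter_upwards [hns.tendsto_atTop.eventually hev] with m hm
  have hd := mol_contDiff μ (ns m) hf.locallyIntegrable (n := 1)
  have hFTC := intervalIntegral.integral_eq_sub_of_hasDerivAt (a := 0) (b := h)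
    (f := fun s : ℝ => mol μ (ns m) f (z + s • e))
    (f' := fun s => mol μ (ns m) Z (z + s • e)) (fun s hs => by
      rw [uIcc_of_le hh.le] at hs
      have h4 : HasDerivAt (fun s : ℝ => z + s • e) e s := by
        simpa using ((hasDerivAt_id s).smul_const e).const_add z
      have h5 := ((hd.differentiable (by norm_num)) (z + s • e)).hasFDerivAt.comp_hasDerivAt s h4
      rw [hw.fderiv_mol hf.locallyIntegrable (hm _ ⟨s, hs, rfl⟩)] at h5
      exact h5) (by
      refine Continuous.intervalIntegrable ?_ _ _
      exact (mol_contDiff μ (ns m) hZ.locallyIntegrable (n := 0)).continuous.comp (by fun_prop))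
  rw [intervalIntegral.integral_of_le hh.le] at hFTC
  simp only [Function.comp_apply]
  rw [hFTC]
  simp

/-! ### Continuity of translations in `L²` -/

lemma integral_norm_sq_eq {α F : Type*} [MeasurableSpace α] {ν : Measure α} [NormedAddCommGroup F]
    {f : α → F} (hf : MemLp f 2 ν) : ∫ z, ‖f z‖ ^ 2 ∂ν = (eLpNorm f 2 ν).toReal ^ 2 := by
  have h1 := hf.eLpNorm_eq_integral_rpow_norm two_ne_zero ENNReal.ofNat_ne_top
  have h0 : 0 ≤ ∫ z, ‖f z‖ ^ (2 : ℝ) ∂ν := integral_nonneg fun z => by positivity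
  rw [h1, ENNReal.toReal_ofReal (by positivity)]
  simp only [ENNReal.toReal_ofNat]
  rw [← Real.rpow_natCast, ← Real.rpow_mul h0]
  norm_num

lemma tendsto_translate_L2 {F : Type*} [NormedAddCommGroup F] {f : E → F} (hf : MemLp f 2 μ)
    (e : E) : Tendsto (fun s : ℝ => ∫ z, ‖f (z + s • e) - f z‖ ^ 2 ∂μ) (𝓝 0) (𝓝 0) := by
  have hmp : ∀ s : ℝ, MeasurePreserving (fun z : E => z + s • e) μ μ := fun s =>
    measurePreserving_add_right μ (s • e)
  have hc : ∀ s : ℝ, MemLp (fun z => f (z + s • e)) 2 μ := fun s =>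
    hf.comp_measurePreserving (hmp s)
  have hg : Tendsto (fun s : ℝ => (⟨fun z : E => z + s • e, by fun_prop⟩ : C(E, E))) (𝓝 0)
      (𝓝 ⟨fun z : E => z + (0 : ℝ) • e, by fun_prop⟩) := by
    have : Continuous fun s : ℝ => (⟨fun z : E => z + s • e, by fun_prop⟩ : C(E, E)) := by
      refine ContinuousMap.continuous_of_continuous_uncurry _ ?_
      change Continuous fun x : ℝ × E => x.2 + x.1 • e
      fun_prop
    exact this.tendsto 0
  have h1 := Filter.Tendsto.compMeasurePreservingLp (μ := μ) (ν := μ)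
    (tendsto_const_nhds (x := hf.toLp f) (f := 𝓝 (0 : ℝ))) hg hmp (hmp 0)
    ENNReal.ofNat_ne_top
  have h2 := (tendsto_iff_norm_sub_tendsto_zero.1 h1).pow 2
  rw [zero_pow two_ne_zero] at h2
  refine h2.congr fun s => ?_
  have h3 : ∀ s : ℝ, Lp.compMeasurePreserving (fun z : E => z + s • e) (hmp s) (hf.toLp f) =
      (hc s).toLp _ := fun s => Lp.toLp_compMeasurePreserving hf (hmp s)
  have h4 := h3 s
  have h5 := h3 0
  change ‖Lp.compMeasurePreserving (fun z : E => z + s • e) (hmp s) (hf.toLp f) -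
    Lp.compMeasurePreserving (fun z : E => z + (0 : ℝ) • e) (hmp 0) (hf.toLp f)‖ ^ 2 = _
  rw [h4, h5, ← MemLp.toLp_sub, Lp.norm_toLp, ← integral_norm_sq_eq ((hc s).sub (hc 0))]
  simp

/-- Strong convergence of difference quotients. -/
lemma tendsto_diffQuot_L2 {K : Set E} {e : E} {f Z : E → ℝ} {h₀ : ℝ} (hh₀ : 0 < h₀)
    (hK : MeasurableSet K)
    (hZm : Measurable Z) (hZ : Integrable Z μ) (hZ2 : MemLp Z 2 μ)
    (hfZ : ∀ h, 0 < h → h < h₀ → ∀ᵐ z ∂μ, z ∈ K →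
      f (z + h • e) - f z = ∫ s in Ioc 0 h, Z (z + s • e)) :
    Tendsto (fun h : ℝ => ∫ z in K, ((f (z + h • e) - f z) / h - Z z) ^ 2 ∂μ) (𝓝[>] 0) (𝓝 0) := by
  have htr := tendsto_translate_L2 hZ2 e
  rw [Metric.tendsto_nhds_nhds] at htr
  rw [Metric.tendsto_nhdsWithin_nhds]
  intro ε hε
  obtain ⟨δ, hδ, h1⟩ := htr (ε / 2) (half_pos hε)
  refine ⟨min δ h₀, lt_min hδ hh₀, fun {h} hh hd => ?_⟩
  have hh' : 0 < h := hh
  rw [Real.dist_eq, sub_zero, abs_of_pos hh'] at hd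
  have hhδ : h < δ := hd.trans_le (min_le_left _ _)
  have hhh₀ : h < h₀ := hd.trans_le (min_le_right _ _)
  have hsqi : Integrable (fun z => Z z ^ 2) μ := by simpa using hZ2.integrable_sq
  have hprod : Integrable (fun x : E × ℝ => (Z (x.1 + x.2 • e) - Z x.1) ^ 2)
      (μ.prod (volume.restrict (Ioc 0 h))) := by
    have i1 := integrable_segment (f := fun z => Z z ^ 2) (hZm.pow_const 2) hsqi h e
    have i2 : Integrable (fun x : E × ℝ => Z x.1 ^ 2) (μ.prod (volume.restrict (Ioc 0 h))) :=
      hsqi.comp_fst _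
    refine ((i1.add i2).const_mul 2).mono' ?_ (ae_of_all _ fun x => ?_)
    · exact Measurable.aestronglyMeasurable (by fun_prop)
    · rw [Real.norm_eq_abs, abs_of_nonneg (sq_nonneg _)]
      simp only [Pi.add_apply]
      nlinarith [sq_nonneg (Z (x.1 + x.2 • e) + Z x.1)]
  -- The difference quotient is the average of `Z` over the segment, so its distance to `Z z` is
  -- estimated by Jensen's inequality; after Fubini's theorem only continuity of translations in
  -- `L²` is left.
  have hpt : ∀ᵐ z ∂μ, z ∈ K → ((f (z + h • e) - f z) / h - Z z) ^ 2 ≤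
      h⁻¹ * ∫ s in Ioc 0 h, (Z (z + s • e) - Z z) ^ 2 := by
    filter_upwards [hfZ h hh' hhh₀, ae_integrableOn_segment hZm hZ h e, hprod.prod_right_ae]
      with z h2 h3 h4 hz
    have e1 : (f (z + h • e) - f z) / h - Z z = h⁻¹ * ∫ s in Ioc 0 h, (Z (z + s • e) - Z z) := by
      rw [integral_sub h3 (integrable_const _), h2 hz]
      simp [hh'.le]
      field_simp
    rw [e1]
    exact sq_integral_le hh' (h3.sub (integrable_const _)) h4
  have hbd : ∫ z in K, ((f (z + h • e) - f z) / h - Z z) ^ 2 ∂μ ≤ ε / 2 := by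
    calc _ ≤ ∫ z in K, h⁻¹ * (∫ s in Ioc 0 h, (Z (z + s • e) - Z z) ^ 2) ∂μ := by
          refine integral_mono_of_nonneg (ae_of_all _ fun z => sq_nonneg _)
            (hprod.integral_prod_left.const_mul _).integrableOn ?_
          filter_upwards [ae_restrict_of_ae hpt, ae_restrict_mem hK] with z hz1 hz2
          exact hz1 hz2
      _ ≤ ∫ z, h⁻¹ * (∫ s in Ioc 0 h, (Z (z + s • e) - Z z) ^ 2) ∂μ :=
          setIntegral_le_integral (hprod.integral_prod_left.const_mul _)
            (ae_of_all _ fun z => mul_nonneg (by positivity) (integral_nonneg fun s => sq_nonneg _))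
      _ = h⁻¹ * ∫ s in Ioc 0 h, (∫ z, (Z (z + s • e) - Z z) ^ 2 ∂μ) := by
          rw [integral_const_mul, integral_integral_swap hprod]
      _ ≤ h⁻¹ * ∫ s in Ioc 0 h, ε / 2 := by
          refine mul_le_mul_of_nonneg_left ?_ (by positivity)
          refine setIntegral_mono_on hprod.integral_prod_right (integrable_const _)
            measurableSet_Ioc fun s hs => ?_
          have h5 := h1 (x := s) (by
            rw [Real.dist_eq, sub_zero, abs_of_pos hs.1]; exact hs.2.trans_lt hhδ)
          rw [Real.dist_eq, sub_zero] at h5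
          simpa using ((le_abs_self _).trans h5.le)
      _ = ε / 2 := by simp [hh'.le]; field_simp
  rw [Real.dist_eq, sub_zero, abs_of_nonneg (integral_nonneg fun z => sq_nonneg _)]
  linarith

end Segments

end PhiCaloric
end

/-! ### Difference quotients, weak compactness and cut-off functions. -/

noncomputable section

namespace PhiCaloric

open Filter Topology

section DiffQuot

variable {E : Type*} [NormedAddCommGroup E] [NormedSpace ℝ E] [MeasurableSpace E] [BorelSpace E]
  [FiniteDimensional ℝ E] {μ : Measure E} [μ.IsAddHaarMeasure]

/-- The difference quotient of `f` in direction `e`. -/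
def dq {F : Type*} [AddCommGroup F] [Module ℝ F] (h : ℝ) (e : E) (f : E → F) (z : E) : F :=
  h⁻¹ • (f (z + h • e) - f z)

lemma memLp_dq {F : Type*} [NormedAddCommGroup F] [NormedSpace ℝ F] {p : ℝ≥0∞} {f : E → F}
    (hf : MemLp f p μ) (h : ℝ) (e : E) : MemLp (dq h e f) p μ :=
  MemLp.const_smul ((hf.comp_measurePreserving (measurePreserving_add_right μ (h • e))).sub hf) _

lemma integrable_dq {F : Type*} [NormedAddCommGroup F] [NormedSpace ℝ F] {f : E → F}
    (hf : Integrable f μ) (h : ℝ) (e : E) : Integrable (dq h e f) μ :=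
  Integrable.smul _ ((integrable_translate hf _).sub hf)

/-- Discrete integration by parts. -/
lemma integral_dq_mul {f ζ : E → ℝ} (hf : Integrable f μ) (hζ : Continuous ζ)
    (hζc : HasCompactSupport ζ) (h : ℝ) (e : E) :
    ∫ z, dq h e f z * ζ z ∂μ = ∫ z, f z * (h⁻¹ * (ζ (z - h • e) - ζ z)) ∂μ := by
  obtain ⟨T, hT⟩ := hζc.exists_bound_of_continuous hζ
  have i1 : Integrable (fun z => f z * ζ z) μ :=
    hf.mul_bdd hζ.aestronglyMeasurable (ae_of_all _ hT)
  have i2 : Integrable (fun z => f z * ζ (z - h • e)) μ :=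
    hf.mul_bdd (c := T) (hζ.comp (by fun_prop)).aestronglyMeasurable
      (ae_of_all _ fun z => hT _)
  have i3 : Integrable (fun z => f (z + h • e) * ζ z) μ := by
    simpa using integrable_translate i2 (h • e)
  have e1 : ∫ z, f (z + h • e) * ζ z ∂μ = ∫ z, f z * ζ (z - h • e) ∂μ := by
    rw [← integral_add_right_eq_self (fun z => f z * ζ (z - h • e)) (h • e)]
    simp
  have e2 : ∀ z, dq h e f z * ζ z = h⁻¹ * (f (z + h • e) * ζ z - f z * ζ z) := fun z => by
    simp only [dq, smul_eq_mul]; ring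
  have e3 : ∀ z, f z * (h⁻¹ * (ζ (z - h • e) - ζ z)) =
      h⁻¹ * (f z * ζ (z - h • e) - f z * ζ z) := fun z => by ring
  simp_rw [e2, e3]
  rw [integral_const_mul, integral_const_mul, integral_sub i3 i1, integral_sub i2 i1, e1]

lemma norm_diffQuot_le_of_fderiv {ζ : E → ℝ} (hζ : ContDiff ℝ 1 ζ) {T : ℝ} {e : E}
    (hT : ∀ z, |fderiv ℝ ζ z e| ≤ T) (h : ℝ) (z : E) : |h⁻¹ * (ζ (z - h • e) - ζ z)| ≤ T := by
  have h0 : 0 ≤ T := (abs_nonneg _).trans (hT 0)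
  have hd : ∀ s : ℝ, HasDerivAt (fun s : ℝ => ζ (z - s • e)) (-fderiv ℝ ζ (z - s • e) e) s := by
    intro s
    have h4 : HasDerivAt (fun s : ℝ => z - s • e) (-e) s := by
      simpa using ((hasDerivAt_id s).smul_const e).const_sub z
    have := ((hζ.differentiable (by norm_num)) (z - s • e)).hasFDerivAt.comp_hasDerivAt s h4
    rw [map_neg] at this
    exact this
  have h1 := Convex.norm_image_sub_le_of_norm_hasDerivWithin_le (C := T) (s := univ)
    (fun s _ => (hd s).hasDerivWithinAt) (fun s _ => by simpa using hT _) convex_univ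
    (mem_univ 0) (mem_univ h)
  simp only [zero_smul, sub_zero, Real.norm_eq_abs] at h1
  rcases eq_or_ne h 0 with rfl | hh
  · simpa using h0
  rw [abs_mul, abs_inv, inv_mul_le_iff₀ (abs_pos.2 hh)]
  linarith

lemma tendsto_integral_dq_mul {f ζ : E → ℝ} (hf : Integrable f μ) (hζ1 : ContDiff ℝ 1 ζ)
    (hζc : HasCompactSupport ζ) (e : E) :
    Tendsto (fun h : ℝ => ∫ z, dq h e f z * ζ z ∂μ) (𝓝[>] 0)
      (𝓝 (-∫ z, f z * fderiv ℝ ζ z e ∂μ)) := by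
  obtain ⟨T, hT⟩ := exists_bound_fderiv hζ1 hζc e
  simp_rw [integral_dq_mul hf hζ1.continuous hζc]
  rw [← integral_neg]
  refine tendsto_integral_filter_of_dominated_convergence (fun z => |f z| * T) ?_ ?_
    (hf.abs.mul_const T) ?_
  · refine Eventually.of_forall fun h => hf.aestronglyMeasurable.mul ?_
    exact Continuous.aestronglyMeasurable (by have := hζ1.continuous; fun_prop)
  · refine Eventually.of_forall fun h => ae_of_all _ fun z => ?_
    rw [Real.norm_eq_abs, abs_mul]
    exact mul_le_mul_of_nonneg_left (norm_diffQuot_le_of_fderiv hζ1 hT h z) (abs_nonneg _)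
  · refine ae_of_all _ fun z => ?_
    have h4 : HasDerivAt (fun s : ℝ => z - s • e) (-e) 0 := by
      simpa using ((hasDerivAt_id (0 : ℝ)).smul_const e).const_sub z
    have h5 : HasDerivAt (fun s : ℝ => ζ (z - s • e)) (-fderiv ℝ ζ z e) 0 := by
      have h6 : HasFDerivAt ζ (fderiv ℝ ζ z) (z - (0 : ℝ) • e) := by
        simpa using ((hζ1.differentiable (by norm_num)) z).hasFDerivAt
      have h7 := h6.comp_hasDerivAt (0 : ℝ) h4
      rw [map_neg] at h7
      exact h7
    have h7 := h5.tendsto_slope_zero_right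
    have h8 := h7.const_mul (f z)
    simpa using h8

/-- A function with bounded difference quotients in `L²(O)` is weakly differentiable in `O`. -/
lemma exists_weakGrad_of_dq_le {O : Set E} (hO : IsOpen O) {e : E} {f : E → ℝ}
    (hf1 : Integrable f μ) (hf : MemLp f 2 μ) {C h₀ : ℝ} (hh₀ : 0 < h₀)
    (hb : ∀ h, 0 < h → h < h₀ → ∫ z in O, dq h e f z ^ 2 ∂μ ≤ C) :
    ∃ Z : E → ℝ, Measurable Z ∧ MemLp Z 2 μ ∧ (∀ z ∉ O, Z z = 0) ∧ WeakGrad μ O e f Z := by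
  have hg : ∀ h, MemLp (O.indicator (dq h e f)) 2 μ := fun h =>
    (memLp_dq hf h e).indicator hO.measurableSet
  let T : ℝ → WeakDual ℝ (Lp ℝ 2 μ) := fun h =>
    StrongDual.toWeakDual (InnerProductSpace.toDual ℝ _ ((hg h).toLp _))
  -- Along an ultrafilter finer than `𝓝[>] 0`, compactness of balls in the weak dual
  -- (Banach-Alaoglu) gives a limit directly, with no choice of a subsequence. The Riesz isomorphism
  -- identifies it with a function of `L²`.
  let U : Ultrafilter ℝ := Ultrafilter.of (𝓝[>] (0 : ℝ))
  have hU : (U : Filter ℝ) ≤ 𝓝[>] 0 := Ultrafilter.of_le _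
  have hmem : ∀ᶠ h in (U : Filter ℝ), T h ∈
      (WeakDual.toStrongDual ⁻¹' Metric.closedBall (0 : StrongDual ℝ (Lp ℝ 2 μ)) √C :
        Set (WeakDual ℝ (Lp ℝ 2 μ))) := by
    filter_upwards [hU (Ioo_mem_nhdsGT hh₀)] with h hh
    have h1 : ‖(hg h).toLp _‖ ^ 2 ≤ C := by
      rw [Lp.norm_toLp, ← integral_norm_sq_eq (hg h)]
      refine le_trans (le_of_eq ?_) (hb h hh.1 hh.2)
      rw [← integral_indicator hO.measurableSet]
      refine integral_congr_ae (ae_of_all _ fun z => ?_)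
      by_cases hz : z ∈ O <;> simp [hz]
    simp only [mem_preimage, T]
    rw [mem_closedBall_zero_iff]
    refine Real.le_sqrt_of_sq_le ?_
    change ‖InnerProductSpace.toDual ℝ (Lp ℝ 2 μ) ((hg h).toLp _)‖ ^ 2 ≤ C
    rwa [LinearIsometryEquiv.norm_map]
  obtain ⟨x, -, hx⟩ := (WeakDual.isCompact_closedBall
    (0 : StrongDual ℝ (Lp ℝ 2 μ)) √C).ultrafilter_le_nhds (U.map T) (by
      rw [le_principal_iff]; exact hmem)
  have hx' : Tendsto T U (𝓝 x) := hx
  let Z₀ : Lp ℝ 2 μ := (InnerProductSpace.toDual ℝ _).symm (WeakDual.toStrongDual x)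
  have hZ₀ : MemLp (Z₀ : E → ℝ) 2 μ := Lp.memLp Z₀
  let Z₁ := hZ₀.aestronglyMeasurable.mk Z₀
  have hZ₁ : Z₀ =ᵐ[μ] Z₁ := hZ₀.aestronglyMeasurable.ae_eq_mk
  refine ⟨O.indicator Z₁, hZ₀.aestronglyMeasurable.stronglyMeasurable_mk.measurable.indicator
    hO.measurableSet, ((memLp_congr_ae hZ₁).1 hZ₀).indicator hO.measurableSet,
    fun z hz => by simp [hz], fun ζ hζ hζc hζO => ?_⟩
  have hζL : MemLp ζ 2 μ := hζ.continuous.memLp_of_hasCompactSupport hζc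
  have hzero : ∀ z, z ∉ O → ζ z = 0 := fun z hz =>
    image_eq_zero_of_notMem_tsupport fun h => hz (hζO h)
  have l1 : Tendsto (fun h => T h (hζL.toLp ζ)) U (𝓝 (x (hζL.toLp ζ))) :=
    ((WeakDual.eval_continuous (hζL.toLp ζ)).tendsto x).comp hx'
  have l2 : ∀ h, T h (hζL.toLp ζ) = ∫ z, dq h e f z * ζ z ∂μ := by
    intro h
    change InnerProductSpace.toDual ℝ (Lp ℝ 2 μ) ((hg h).toLp _) (hζL.toLp ζ) = _
    rw [InnerProductSpace.toDual_apply_apply, L2.inner_def]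
    refine integral_congr_ae ?_
    filter_upwards [(hg h).coeFn_toLp, hζL.coeFn_toLp] with z h1 h2
    rw [h1, h2]
    by_cases hz : z ∈ O
    · simp [hz, mul_comm]
    · simp [hz, hzero z hz]
  have l3 : x (hζL.toLp ζ) = ∫ z, O.indicator Z₁ z * ζ z ∂μ := by
    have : WeakDual.toStrongDual x = InnerProductSpace.toDual ℝ (Lp ℝ 2 μ) Z₀ := by simp [Z₀]
    change WeakDual.toStrongDual x (hζL.toLp ζ) = _
    rw [this, InnerProductSpace.toDual_apply_apply, L2.inner_def]
    refine integral_congr_ae ?_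
    filter_upwards [hZ₁, hζL.coeFn_toLp] with z h1 h2
    rw [h1, h2]
    by_cases hz : z ∈ O
    · simp [hz, mul_comm]
    · simp [hz, hzero z hz]
  have l4 := (tendsto_integral_dq_mul hf1 (hζ.of_le (by exact_mod_cast le_top)) hζc e).mono_left hU
  simp_rw [l2] at l1
  have := tendsto_nhds_unique l1 l4
  rw [l3] at this
  linarith

lemma WeakGrad.neg_dir {O : Set E} {e : E} {f Z : E → ℝ} (h : WeakGrad μ O e f Z) :
    WeakGrad μ O (-e) f (fun z => -Z z) := by
  intro ζ hζ hζc hζO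
  have := h ζ hζ hζc hζO
  simp only [map_neg, mul_neg, neg_mul, integral_neg, this]

lemma WeakGrad.congr_on {O : Set E} {e : E} {f f' Z Z' : E → ℝ} (h : WeakGrad μ O e f Z)
    (hf : ∀ᵐ z ∂μ, z ∈ O → f' z = f z) (hZ : ∀ᵐ z ∂μ, z ∈ O → Z' z = Z z) :
    WeakGrad μ O e f' Z' := by
  intro ζ hζ hζc hζO
  have hz1 : ∀ z, z ∉ O → ζ z = 0 := fun z hz =>
    image_eq_zero_of_notMem_tsupport fun h => hz (hζO h)
  have hz2 : ∀ z, z ∉ O → fderiv ℝ ζ z = 0 := fun z hz =>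
    image_eq_zero_of_notMem_tsupport fun h => hz (hζO (tsupport_fderiv_subset ℝ h))
  have h1 := h ζ hζ hζc hζO
  have e1 : ∫ z, f' z * fderiv ℝ ζ z e ∂μ = ∫ z, f z * fderiv ℝ ζ z e ∂μ := by
    refine integral_congr_ae ?_
    filter_upwards [hf] with z hz
    by_cases h : z ∈ O
    · rw [hz h]
    · simp [hz2 z h]
  have e2 : ∫ z, Z' z * ζ z ∂μ = ∫ z, Z z * ζ z ∂μ := by
    refine integral_congr_ae ?_
    filter_upwards [hZ] with z hz
    by_cases h : z ∈ O
    · rw [hz h]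
    · simp [hz1 z h]
  rw [e1, e2, h1]

lemma integral_dq_mul_eq_sub {f ζ : E → ℝ} (hf : Integrable f μ) (hζ : Continuous ζ)
    (hζc : HasCompactSupport ζ) (h : ℝ) (e : E) :
    ∫ z, dq h e f z * ζ z ∂μ =
      h⁻¹ * (∫ z, f z * ζ (z - h • e) ∂μ - ∫ z, f z * ζ z ∂μ) := by
  obtain ⟨T, hT⟩ := hζc.exists_bound_of_continuous hζ
  have i1 : Integrable (fun z => f z * ζ z) μ :=
    hf.mul_bdd hζ.aestronglyMeasurable (ae_of_all _ hT)
  have i2 : Integrable (fun z => f z * ζ (z - h • e)) μ :=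
    hf.mul_bdd (c := T) (hζ.comp (by fun_prop)).aestronglyMeasurable
      (ae_of_all _ fun z => hT _)
  rw [integral_dq_mul hf hζ hζc, ← integral_sub i2 i1, ← integral_const_mul]
  exact integral_congr_ae (ae_of_all _ fun z => by ring)

lemma fderiv_translate (ζ : E → ℝ) (y z v : E) :
    fderiv ℝ (fun x => ζ (x - y)) z v = fderiv ℝ ζ (z - y) v := by
  rw [fderiv_comp_sub]

lemma integral_dq_mul_fderiv {f ζ : E → ℝ} (hf : Integrable f μ) (hζ : ContDiff ℝ ∞ ζ)
    (hζc : HasCompactSupport ζ) (h : ℝ) (e v : E) :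
    ∫ z, dq h e f z * fderiv ℝ ζ z v ∂μ =
      h⁻¹ * (∫ z, f z * fderiv ℝ (fun x => ζ (x - h • e)) z v ∂μ -
        ∫ z, f z * fderiv ℝ ζ z v ∂μ) := by
  have h1 : Continuous fun z => fderiv ℝ ζ z v :=
    (hζ.continuous_fderiv (by simp)).clm_apply continuous_const
  have h2 : HasCompactSupport fun z => fderiv ℝ ζ z v :=
    (hζc.fderiv ℝ).comp_left (g := fun L : E →L[ℝ] ℝ => L v) (by simp)
  simp_rw [integral_dq_mul_eq_sub hf h1 h2, fderiv_translate]

lemma translate_test {O O' : Set E} {y : E} (hseg : ∀ z ∈ O', z + y ∈ O)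
    {ζ : E → ℝ} (hζ : ContDiff ℝ ∞ ζ) (hζc : HasCompactSupport ζ) (hζO : tsupport ζ ⊆ O') :
    ContDiff ℝ ∞ (fun z => ζ (z - y)) ∧ HasCompactSupport (fun z => ζ (z - y)) ∧
    tsupport (fun z => ζ (z - y)) ⊆ O := by
  have hs : (fun z => ζ (z - y)) = ζ ∘ (Homeomorph.subRight y) := rfl
  refine ⟨hζ.comp (by fun_prop), ?_, ?_⟩
  · rw [hs]; exact hζc.comp_homeomorph _
  · rw [hs, tsupport_comp_eq_preimage]
    intro z hz
    have := hseg _ (hζO hz)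
    simpa using this

lemma WeakGrad.dq {O O' : Set E} {v e : E} {f Z : E → ℝ} (hw : WeakGrad μ O v f Z)
    (hf : Integrable f μ) (hZ : Integrable Z μ) {h : ℝ} (hO' : O' ⊆ O)
    (hseg : ∀ z ∈ O', z + h • e ∈ O) : WeakGrad μ O' v (dq h e f) (dq h e Z) := by
  intro ζ hζ hζc hζO
  obtain ⟨h1, h2, h3⟩ := translate_test hseg hζ hζc hζO
  rw [integral_dq_mul_fderiv hf hζ hζc, integral_dq_mul_eq_sub hZ hζ.continuous hζc,
    hw _ h1 h2 h3, hw _ hζ hζc (hζO.trans hO')]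
  ring

/-- Smooth cut-off functions. -/
lemma exists_cutoff {K O : Set E} (hK : IsCompact K) (hO : IsOpen O) (hKO : K ⊆ O) :
    ∃ θ : E → ℝ, ContDiff ℝ ∞ θ ∧ HasCompactSupport θ ∧ tsupport θ ⊆ O ∧ (∀ z ∈ K, θ z = 1) ∧
      ∀ z, 0 ≤ θ z ∧ θ z ≤ 1 := by
  obtain ⟨K', hK', h1, h2⟩ := exists_compact_between hK hO hKO
  obtain ⟨f, hf1, hf0, hf⟩ := exists_contMDiffMap_one_nhds_of_subset_interior (n := (⊤ : ℕ∞))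
    (modelWithCornersSelf ℝ E) hK.isClosed h1
  have hs : tsupport f ⊆ K' := by
    refine closure_minimal (fun z hz => ?_) hK'.isClosed
    by_contra h
    exact hz (hf0 z h)
  exact ⟨f, f.contMDiff.contDiff, hK'.of_isClosed_subset (isClosed_tsupport _) hs, hs.trans h2,
    fun z hz => hf1.self_of_nhdsSet z hz, hf⟩

end DiffQuot

end PhiCaloric
end

/-! ### Localized solutions and the linear system for their difference quotients. -/

noncomputable section

namespace PhiCaloric

open Filter Topology

/-- The spatial unit vectors in space-time. -/
def ex {n : ℕ} (k : Fin n) : ℝ × Space n := (0, EuclideanSpace.single k 1)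

/-- The time unit vector in space-time. -/
def et {n : ℕ} : ℝ × Space n := (1, 0)

/-- The energy density `φ'(|P|) |P|`. -/
def en {N n : ℕ} (φ : ℝ → ℝ) (P : Mat N n) : ℝ := d φ ‖P‖ * ‖P‖

/-- A globally integrable pair `(u, P)` that solves the system in the open set `O`. -/
structure Solution {N n : ℕ} (φ : ℝ → ℝ) (O : Set (ℝ × Space n)) (u : ℝ × Space n → Space N)
    (P : ℝ × Space n → Mat N n) : Prop where
  P_meas : Measurable P
  u_int : ∀ i, Integrable (fun z => u z i)
  u_sq : ∀ i, MemLp (fun z => u z i) 2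
  P_int : Integrable P
  P_sq : MemLp P 2
  A_int : Integrable (fun z => A φ (P z))
  energy : Integrable (fun z => en φ (P z))
  grad : ∀ i j, WeakGrad volume O (ex j) (fun z => u z i) (fun z => P z (i, j))
  evol : ∀ i, ∀ ζ : ℝ × Space n → ℝ, ContDiff ℝ ∞ ζ → HasCompactSupport ζ → tsupport ζ ⊆ O →
    ∫ z, u z i * fderiv ℝ ζ z et = ∑ j, ∫ z, A φ (P z) (i, j) * fderiv ℝ ζ z (ex j)

/-- All spatial segments of length `h` that start in `O'` lie in `O`. -/
def SegSubset {n : ℕ} (h : ℝ) (O' O : Set (ℝ × Space n)) : Prop :=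
  ∀ z ∈ O', ∀ k : Fin n, ∀ s ∈ Icc 0 h, z + s • ex k ∈ O

section Components

variable {α ι : Type*} [MeasurableSpace α] {ν : Measure α} [Fintype ι]

lemma integrable_coord {f : α → EuclideanSpace ℝ ι} (hf : Integrable f ν) (i : ι) :
    Integrable (fun z => f z i) ν := (EuclideanSpace.proj (𝕜 := ℝ) i).integrable_comp hf

lemma memLp_coord {p : ℝ≥0∞} {f : α → EuclideanSpace ℝ ι} (hf : MemLp f p ν) (i : ι) :
    MemLp (fun z => f z i) p ν :=
  (EuclideanSpace.proj (𝕜 := ℝ) i).comp_memLp' hf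

lemma abs_coord_le (P : EuclideanSpace ℝ ι) (i : ι) : |P i| ≤ ‖P‖ := PiLp.norm_apply_le P i

end Components

namespace Solution

variable {N n : ℕ} {φ : ℝ → ℝ} {c₀ c₁ : ℝ} {O O' : Set (ℝ × Space n)} {u : ℝ × Space n → Space N}
  {P : ℝ × Space n → Mat N n}

/-- The family `D_h^k u_i`, restricted to `O'`. -/
def W (u : ℝ × Space n → Space N) (O' : Set (ℝ × Space n)) (h : ℝ) (a : Fin N × Fin n)
    (z : ℝ × Space n) : ℝ := O'.indicator (dq h (ex a.2) fun z => u z a.1) z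

/-- The majorant of the products of difference quotients. -/
def maj (φ : ℝ → ℝ) (P : ℝ × Space n → Mat N n) (h : ℝ) (z : ℝ × Space n) : ℝ :=
  2 * (h⁻¹ ^ 2 + h⁻¹) * ∑ k : Fin n, (en φ (P z) + en φ (P (z + h • ex k)) +
    segAvg h (ex k) (fun z => en φ (P z)) z)

lemma measurable_en (hφ : IsOrlicz φ c₀ c₁) : Measurable fun Q : Mat N n => en φ Q :=
  (hφ.continuous_d_norm.mul continuous_norm).measurable

lemma en_nonneg (hφ : IsOrlicz φ c₀ c₁) (Q : Mat N n) : 0 ≤ en φ Q :=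
  hφ.d_mul_self_nonneg (norm_nonneg _)

lemma segAvg_nonneg {E : Type*} [NormedAddCommGroup E] [NormedSpace ℝ E] {h : ℝ} (hh : 0 < h)
    (e : E) {f : E → ℝ} (hf : ∀ z, 0 ≤ f z) (z : E) : 0 ≤ segAvg h e f z :=
  mul_nonneg (by positivity) (integral_nonneg fun s => hf _)

variable (hφ : IsOrlicz φ c₀ c₁) (hc₀ : 0 < c₀) (hs : Solution φ O u P)

include hs in
-- Absolute continuity along segments. There is no energy bound on `u` itself, so `D_h u` is always
-- estimated through the gradient; this needs the whole segment in `O` and is the reason why `W` is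
-- cut off outside `O'`.
lemma ae_abs_dq_le (hO : IsOpen O) {h : ℝ} (hh : 0 < h) (hseg : SegSubset h O' O)
    (a : Fin N × Fin n) : ∀ᵐ z, z ∈ O' →
      |dq h (ex a.2) (fun z => u z a.1) z| ≤ segAvg h (ex a.2) (fun z => ‖P z‖) z := by
  have hm : Measurable fun z => P z a :=
    (EuclideanSpace.proj (𝕜 := ℝ) a).continuous.measurable.comp hs.P_meas
  have hi := integrable_coord hs.P_int a
  filter_upwards [(hs.grad a.1 a.2).sub_eq_integral hO (hs.u_int a.1) hm hi hh,
    ae_integrableOn_segment hm hi h (ex a.2),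
    ae_integrableOn_segment hs.P_meas.norm hs.P_int.norm h (ex a.2)] with z hz h1 h2 hzO
  rw [dq, hz (hseg z hzO a.2), segAvg, smul_eq_mul, abs_mul, abs_of_pos (inv_pos.2 hh)]
  refine mul_le_mul_of_nonneg_left (abs_integral_le_integral_abs.trans ?_) (by positivity)
  exact integral_mono h1.abs h2 fun s => abs_coord_le _ _

include hφ hs in
lemma integrable_maj (h : ℝ) : Integrable (maj φ P h) := by
  refine Integrable.const_mul (integrable_finsetSum _ fun k _ => ?_) _
  exact (hs.energy.add (integrable_translate hs.energy _)).add
    (integrable_segAvg ((measurable_en hφ).comp hs.P_meas) hs.energy h (ex k))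

include hφ in
lemma maj_term_nonneg {h : ℝ} (hh : 0 < h) (z : ℝ × Space n) (k : Fin n) :
    0 ≤ en φ (P z) + en φ (P (z + h • ex k)) + segAvg h (ex k) (fun z => en φ (P z)) z :=
  add_nonneg (add_nonneg (en_nonneg hφ _) (en_nonneg hφ _))
    (segAvg_nonneg hh _ (fun _ => en_nonneg hφ _) z)

include hφ in
lemma le_maj {h : ℝ} (hh : 0 < h) (z : ℝ × Space n) (k : Fin n) :
    2 * (h⁻¹ ^ 2 + h⁻¹) * (en φ (P z) + en φ (P (z + h • ex k)) +
      segAvg h (ex k) (fun z => en φ (P z)) z) ≤ maj φ P h z := by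
  refine mul_le_mul_of_nonneg_left ?_ (by positivity)
  exact Finset.single_le_sum (f := fun k => en φ (P z) + en φ (P (z + h • ex k)) +
    segAvg h (ex k) (fun z => en φ (P z)) z) (fun k _ => maj_term_nonneg hφ hh z k)
    (Finset.mem_univ k)

lemma abs_dq_coord_le {h : ℝ} (hh : 0 < h) (e : ℝ × Space n) (f : ℝ × Space n → Mat N n)
    (a : Fin N × Fin n) (z : ℝ × Space n) :
    |dq h e (fun y => f y a) z| ≤ h⁻¹ * (‖f (z + h • e)‖ + ‖f z‖) := by
  rw [dq, smul_eq_mul, abs_mul, abs_of_pos (inv_pos.2 hh)]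
  refine mul_le_mul_of_nonneg_left ?_ (by positivity)
  exact (abs_sub _ _).trans (add_le_add (abs_coord_le _ _) (abs_coord_le _ _))

include hφ hc₀ hs in
/-- The difference quotients of a solution solve a linear system. -/
lemma weakSystem (hO : IsOpen O) (hO' : IsOpen O') {h : ℝ} (hh : 0 < h)
    (hseg : SegSubset h O' O) (hsub : O' ⊆ O) :
    WeakSystem volume O' ex et (W u O' h)
      (fun a j => dq h (ex a.2) fun z => P z (a.1, j))
      (fun a j => dq h (ex a.2) fun z => A φ (P z) (a.1, j)) (maj φ P h) := by
  have hpg := hφ.powerGrowth_d hc₀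
  have hend : ∀ z ∈ O', ∀ k : Fin n, z + h • ex k ∈ O := fun z hz k =>
    hseg z hz k h ⟨hh.le, le_rfl⟩
  have hcong : ∀ a : Fin N × Fin n, ∀ z ∈ O', W u O' h a z = dq h (ex a.2) (fun z => u z a.1) z :=
    fun a z hz => by simp [W, hz]
  have hA : ∀ Q : Mat N n, ‖A φ Q‖ = d φ ‖Q‖ := fun Q => by
    rw [A_eq_radial, hpg.norm_radial]
  have hAm : ∀ (a : Fin N × Fin n) (j : Fin n) (y : ℝ × Space n),
      |dq h (ex a.2) (fun z => A φ (P z) (a.1, j)) y| ≤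
        h⁻¹ * (d φ ‖P (y + h • ex a.2)‖ + d φ ‖P y‖) := fun a j y => by
    have := abs_dq_coord_le hh (ex a.2) (fun z => A φ (P z)) (a.1, j) y
    simpa only [hA] using this
  have hh1 : (0 : ℝ) < h⁻¹ := by positivity
  have hdn : ∀ Q : Mat N n, 0 ≤ d φ ‖Q‖ := fun Q => hφ.d_nonneg (norm_nonneg _)
  refine ⟨fun a => ?_, fun a => ?_, fun a j => integrable_dq (integrable_coord hs.P_int _) _ _,
    fun a j => integrable_dq (integrable_coord hs.A_int _) _ _, integrable_maj hφ hs h,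
    fun z => ?_, fun a j b k => ?_, fun a j b => ?_, fun a j => ?_, fun a ζ hζ hζc hζO => ?_⟩
  · exact (integrable_dq (hs.u_int a.1) _ _).indicator hO'.measurableSet
  · exact ((memLp_dq (hs.u_sq a.1) h (ex a.2)).indicator hO'.measurableSet).integrable_sq
  · exact mul_nonneg (by positivity) (Finset.sum_nonneg fun k _ => maj_term_nonneg hφ hh z k)
  -- Each factor is bounded by two values of `P`, one at its own point and one at the translated
  -- point. Young's inequality for the four pairs separates `y` from `y'`, as the two-point form of
  -- the majorant requires.
  · refine ae_of_all _ fun y => ae_of_all _ fun y' => ?_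
    have h1 := hAm a j y
    have h2 := abs_dq_coord_le hh (ex b.2) P (b.1, k) y'
    have h3 := le_maj hφ (P := P) hh y a.2
    have h4 := le_maj hφ (P := P) hh y' b.2
    have s1 := segAvg_nonneg hh (ex a.2) (fun z => en_nonneg hφ (P z)) y
    have s2 := segAvg_nonneg hh (ex b.2) (fun z => en_nonneg hφ (P z)) y'
    have y1 := hpg.young (norm_nonneg (P (y + h • ex a.2))) (norm_nonneg (P (y' + h • ex b.2)))
    have y2 := hpg.young (norm_nonneg (P (y + h • ex a.2))) (norm_nonneg (P y'))
    have y3 := hpg.young (norm_nonneg (P y)) (norm_nonneg (P (y' + h • ex b.2)))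
    have y4 := hpg.young (norm_nonneg (P y)) (norm_nonneg (P y'))
    have e1 := en_nonneg hφ (P y)
    have e2 := en_nonneg hφ (P y')
    have e3 := en_nonneg hφ (P (y + h • ex a.2))
    have e4 := en_nonneg hφ (P (y' + h • ex b.2))
    have h5 := mul_le_mul h1 h2 (abs_nonneg _)
      (mul_nonneg hh1.le (add_nonneg (hdn _) (hdn _)))
    refine h5.trans ?_
    simp only [en] at *
    have h6 : h⁻¹ * (d φ ‖P (y + h • ex a.2)‖ + d φ ‖P y‖) *
        (h⁻¹ * (‖P (y' + h • ex b.2)‖ + ‖P y'‖)) ≤ h⁻¹ ^ 2 *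
        (2 * (d φ ‖P y‖ * ‖P y‖ + d φ ‖P (y + h • ex a.2)‖ * ‖P (y + h • ex a.2)‖) +
        2 * (d φ ‖P y'‖ * ‖P y'‖ + d φ ‖P (y' + h • ex b.2)‖ * ‖P (y' + h • ex b.2)‖)) := by
      rw [show ∀ x y : ℝ, h⁻¹ * x * (h⁻¹ * y) = h⁻¹ ^ 2 * (x * y) from fun x y => by ring]
      refine mul_le_mul_of_nonneg_left ?_ (by positivity)
      nlinarith
    refine h6.trans ((?_ : _ ≤ _).trans (add_le_add h3 h4))
    have p1 : 0 ≤ h⁻¹ ^ 2 := by positivity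
    nlinarith [mul_nonneg hh1.le e1, mul_nonneg hh1.le e2, mul_nonneg hh1.le e3,
      mul_nonneg hh1.le e4, mul_nonneg hh1.le s1, mul_nonneg hh1.le s2, mul_nonneg p1 s1,
      mul_nonneg p1 s2]
  -- Here the second factor is an average of `|P|` over a segment; Young's inequality is applied
  -- inside the average, which is why `maj` contains averages of the energy.
  · refine ae_of_all _ fun y => ?_
    filter_upwards [ae_abs_dq_le hs hO hh hseg b,
      ae_integrableOn_segment hs.P_meas.norm hs.P_int.norm h (ex b.2),
      ae_integrableOn_segment ((measurable_en hφ).comp hs.P_meas) hs.energy h (ex b.2)]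
      with y' hy' i1 i2
    have h1 := hAm a j y
    have h2 : |W u O' h b y'| ≤ segAvg h (ex b.2) (fun z => ‖P z‖) y' := by
      by_cases hz : y' ∈ O'
      · rw [hcong b y' hz]; exact hy' hz
      · simpa [W, hz] using segAvg_nonneg hh _ (fun z => norm_nonneg (P z)) y'
    have h3 := le_maj hφ (P := P) hh y a.2
    have h4 := le_maj hφ (P := P) hh y' b.2
    have s1 := segAvg_nonneg hh (ex a.2) (fun z => en_nonneg hφ (P z)) y
    have s2 := segAvg_nonneg hh (ex b.2) (fun z => en_nonneg hφ (P z)) y'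
    have key : ∀ Q : Mat N n, d φ ‖Q‖ * segAvg h (ex b.2) (fun z => ‖P z‖) y' ≤
        en φ Q + segAvg h (ex b.2) (fun z => en φ (P z)) y' := by
      intro Q
      have e : en φ Q = h⁻¹ * ∫ s in Ioc 0 h, en φ Q := by
        simp [hh.le]; field_simp
      have i3 : Integrable (fun s : ℝ => en φ (P (y' + s • ex b.2)))
        (volume.restrict (Ioc 0 h)) := i2
      rw [e]
      simp only [segAvg]
      rw [mul_left_comm, ← integral_const_mul, ← mul_add, ← integral_add (integrable_const _) i3]
      refine mul_le_mul_of_nonneg_left ?_ hh1.le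
      refine integral_mono (i1.const_mul _) ((integrable_const _).add i3) fun s => ?_
      exact hpg.young (norm_nonneg _) (norm_nonneg _)
    have k1 := key (P y)
    have k2 := key (P (y + h • ex a.2))
    have h5 := mul_le_mul h1 h2 (abs_nonneg _)
      (mul_nonneg hh1.le (add_nonneg (hdn _) (hdn _)))
    refine h5.trans (le_trans ?_ (add_le_add h3 h4))
    have e1 := en_nonneg hφ (P y)
    have e2 := en_nonneg hφ (P y')
    have e3 := en_nonneg hφ (P (y + h • ex a.2))
    have e4 := en_nonneg hφ (P (y' + h • ex b.2))
    have p1 : 0 ≤ h⁻¹ ^ 2 := by positivity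
    have h6 := mul_le_mul_of_nonneg_left (add_le_add k1 k2) hh1.le
    nlinarith [mul_nonneg hh1.le e1, mul_nonneg hh1.le e2, mul_nonneg hh1.le e3,
      mul_nonneg hh1.le e4, mul_nonneg hh1.le s1, mul_nonneg hh1.le s2, mul_nonneg p1 s1,
      mul_nonneg p1 s2, mul_nonneg p1 e1, mul_nonneg p1 e2, mul_nonneg p1 e3, mul_nonneg p1 e4]
  · refine ((hs.grad a.1 j).dq (hs.u_int a.1) (integrable_coord hs.P_int _) hsub
      (fun z hz => hend z hz a.2)).congr_on (ae_of_all _ (hcong a)) (ae_of_all _ fun z _ => rfl)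
  · obtain ⟨t1, t2, t3⟩ := translate_test (fun z hz => hend z hz a.2) hζ hζc hζO
    have e1 : ∫ z, W u O' h a z * fderiv ℝ ζ z et =
        ∫ z, dq h (ex a.2) (fun z => u z a.1) z * fderiv ℝ ζ z et := by
      refine integral_congr_ae (ae_of_all _ fun z => ?_)
      by_cases hz : z ∈ O'
      · simp only [hcong a z hz]
      · have : fderiv ℝ ζ z = 0 :=
          image_eq_zero_of_notMem_tsupport fun h => hz (hζO (tsupport_fderiv_subset ℝ h))
        simp [this]
    rw [e1, integral_dq_mul_fderiv (hs.u_int a.1) hζ hζc, hs.evol a.1 _ t1 t2 t3,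
      hs.evol a.1 ζ hζ hζc (hζO.trans hsub), ← Finset.sum_sub_distrib, Finset.mul_sum]
    refine Finset.sum_congr rfl fun j _ => ?_
    rw [integral_dq_mul_fderiv (integrable_coord hs.A_int _) hζ hζc]

end Solution

end PhiCaloric
end

/-! ### Oscillation along segments and the Caccioppoli inequality for difference quotients. -/

noncomputable section

namespace PhiCaloric

open Filter Topology

section Oscillation

variable {E : Type*} [NormedAddCommGroup E] [NormedSpace ℝ E] [MeasurableSpace E] [BorelSpace E]
  [FiniteDimensional ℝ E] {μ : Measure E} [μ.IsAddHaarMeasure]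
  {F : Type*} [NormedAddCommGroup F] [MeasurableSpace F] [BorelSpace F]
  [SecondCountableTopology F]

/-- The mean quadratic oscillation of `f` along the segment from `z` to `z + h • e`. -/
def osc (h : ℝ) (e : E) (f : E → F) (z : E) : ℝ := h⁻¹ * ∫ s in Ioc 0 h, ‖f (z + s • e) - f z‖ ^ 2

lemma osc_nonneg {h : ℝ} (hh : 0 ≤ h) (e : E) (f : E → F) (z : E) : 0 ≤ osc h e f z :=
  mul_nonneg (inv_nonneg.2 hh) (integral_nonneg fun _ => sq_nonneg _)

lemma norm_sub_sq_le (x y : F) : ‖x - y‖ ^ 2 ≤ 2 * (‖x‖ ^ 2 + ‖y‖ ^ 2) := by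
  nlinarith [norm_sub_le x y, norm_nonneg (x - y), sq_nonneg (‖x‖ - ‖y‖)]

lemma integrable_norm_sq {f : E → F} (hf : MemLp f 2 μ) : Integrable (fun z => ‖f z‖ ^ 2) μ :=
  hf.integrable_norm_pow two_ne_zero

lemma integrable_segment_sub_sq {f : E → F} (hfm : Measurable f) (hf : MemLp f 2 μ) (h : ℝ)
    (e : E) : Integrable (fun x : E × ℝ => ‖f (x.1 + x.2 • e) - f x.1‖ ^ 2)
      (μ.prod (volume.restrict (Ioc 0 h))) := by
  have i1 := integrable_segment (f := fun z => ‖f z‖ ^ 2) (hfm.norm.pow_const 2)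
    (integrable_norm_sq hf) h e
  have i2 : Integrable (fun x : E × ℝ => ‖f x.1‖ ^ 2) (μ.prod (volume.restrict (Ioc 0 h))) :=
    (integrable_norm_sq hf).comp_fst _
  refine ((i1.add i2).const_mul 2).mono' ?_ (ae_of_all _ fun x => ?_)
  · have h1 : Measurable fun x : E × ℝ => f (x.1 + x.2 • e) := hfm.comp (by fun_prop)
    exact ((h1.sub (hfm.comp measurable_fst)).norm.pow_const 2).aestronglyMeasurable
  · rw [Real.norm_eq_abs, abs_of_nonneg (sq_nonneg _)]
    exact norm_sub_sq_le _ _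

lemma ae_integrableOn_segment_sub_sq {f : E → F} (hfm : Measurable f) (hf : MemLp f 2 μ) (h : ℝ)
    (e : E) : ∀ᵐ z ∂μ, IntegrableOn (fun s : ℝ => ‖f (z + s • e) - f z‖ ^ 2) (Ioc 0 h) :=
  (integrable_segment_sub_sq hfm hf h e).prod_right_ae

lemma integrable_osc {f : E → F} (hfm : Measurable f) (hf : MemLp f 2 μ) (h : ℝ) (e : E) :
    Integrable (osc h e f) μ :=
  (integrable_segment_sub_sq hfm hf h e).integral_prod_left.const_mul _

lemma setIntegral_osc_le {f : E → F} (hfm : Measurable f) (hf : MemLp f 2 μ) {h : ℝ} (hh : 0 < h)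
    {e : E} {K : Set E} {M : ℝ}
    (hM : ∀ s, 0 < s → s ≤ h → ∫ z in K, ‖f (z + s • e) - f z‖ ^ 2 ∂μ ≤ M) :
    ∫ z in K, osc h e f z ∂μ ≤ M := by
  have hp := integrable_segment_sub_sq hfm hf h e
  have hK : Integrable (fun x : E × ℝ => ‖f (x.1 + x.2 • e) - f x.1‖ ^ 2)
      ((μ.restrict K).prod (volume.restrict (Ioc 0 h))) := by
    have : (μ.restrict K).prod (volume.restrict (Ioc 0 h)) ≤
        μ.prod (volume.restrict (Ioc 0 h)) := Measure.prod_mono Measure.restrict_le_self le_rfl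
    exact hp.mono_measure this
  unfold osc
  rw [integral_const_mul, integral_integral_swap hK, inv_mul_le_iff₀ hh]
  calc _ ≤ ∫ s in Ioc 0 h, M :=
        setIntegral_mono_on hK.integral_prod_right (integrable_const _)
          measurableSet_Ioc fun s hs => hM s hs.1 hs.2
    _ = h * M := by simp [hh.le]

end Oscillation

section Algebra

variable {φ : ℝ → ℝ} {c₀ c₁ : ℝ} (hφ : IsOrlicz φ c₀ c₁) (hc₀ : 0 < c₀)

include hφ hc₀ in
lemma IsOrlicz.d_add_mul_le {s t : ℝ} (hs : 0 ≤ s) (ht : 0 ≤ t) :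
    d φ (s + t) * (s + t) ≤ 2 * 2 ^ c₁ * (d φ s * s + d φ t * t) := by
  have hpg := hφ.powerGrowth_d hc₀
  have hc₁ : 0 ≤ c₁ := hc₀.le.trans hφ.c₀_le_c₁
  wlog h : t ≤ s generalizing s t
  · have := this ht hs (le_of_not_ge h)
    rwa [add_comm t s, add_comm (d φ t * t)] at this
  have h1 := hpg.doubling hc₁ hs (by linarith : s ≤ s + t) (by linarith)
  have h2 : d φ (s + t) * (s + t) ≤ (2 ^ c₁ * d φ s) * (2 * s) :=
    mul_le_mul h1 (by linarith) (by positivity)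
      (mul_nonneg (by positivity) (hφ.d_nonneg hs))
  have h3 := hφ.d_mul_self_nonneg ht
  have h4 : (0 : ℝ) ≤ 2 * 2 ^ c₁ := by positivity
  nlinarith [mul_nonneg h4 h3]

end Algebra

namespace Solution

variable {N n : ℕ} {φ : ℝ → ℝ} {c₀ c₁ : ℝ} {O O' : Set (ℝ × Space n)} {u : ℝ × Space n → Space N}
  {P : ℝ × Space n → Mat N n}

variable (hφ : IsOrlicz φ c₀ c₁) (hc₀ : 0 < c₀) (hs : Solution φ O u P)

include hφ hs in
lemma measurable_VP : Measurable fun z => V φ (P z) := hφ.measurable_V.comp hs.P_meas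

include hφ hc₀ hs in
lemma memLp_V : MemLp (fun z => V φ (P z)) 2 volume := by
  have hm := (measurable_VP hφ hs).aestronglyMeasurable (μ := volume)
  rw [← memLp_norm_iff hm, memLp_two_iff_integrable_sq hm.norm]
  exact hs.energy.congr (ae_of_all _ fun z => (hφ.norm_V_sq hc₀ _).symm)

include hφ hc₀ hs in
-- This product comes from the derivative of the cut-off function. `D_h u` is bounded by the average
-- of `|P|` over a segment, whose interior values need not be comparable with `P z`; their excess is
-- measured by the increments of `V` along the segment, whence the oscillation term.
lemma exists_abs_A_mul_abs_u_le (hO : IsOpen O) : ∃ C, 0 < C ∧ ∀ h, 0 < h →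
    SegSubset h O' O → ∀ᵐ z, z ∈ O' → ∀ (k : Fin n) (b : Fin N × Fin n),
      ‖dq h (ex k) (fun z => A φ (P z)) z‖ * |dq h (ex b.2) (fun z => u z b.1) z| ≤
        C * (coef φ (‖P z‖ + ‖P (z + h • ex k)‖) * ‖dq h (ex k) P z‖ *
          (‖P z‖ + ‖P (z + h • ex k)‖) + h⁻¹ * osc h (ex b.2) (fun z => V φ (P z)) z) := by
  obtain ⟨C₁, hC₁, h1⟩ := hφ.exists_norm_radial_sub_le (F := Mat N n) hc₀
  obtain ⟨C₂, hC₂, h2⟩ := hφ.exists_coef_mul_norm_mul_le (F := Mat N n) hc₀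
  refine ⟨C₁ * (2 + C₂), by positivity, fun h hh hseg => ?_⟩
  have hall := ae_all_iff.2 fun b => ae_abs_dq_le hs hO hh hseg b
  have hP := ae_all_iff.2 fun k : Fin n =>
    ae_integrableOn_segment hs.P_meas.norm hs.P_int.norm h (ex k)
  have hV := ae_all_iff.2 fun k : Fin n =>
    ae_integrableOn_segment_sub_sq (measurable_VP hφ hs) (memLp_V hφ hc₀ hs) h (ex k)
  filter_upwards [hall, hP, hV] with z hz hzP hzV hzO k b
  have hh1 : 0 < h⁻¹ := by positivity
  set Q := P (z + h • ex k)
  set m := ‖P z‖ + ‖Q‖ with hm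
  have hm0 : 0 ≤ m := by positivity
  have hcoef := hφ.coef_nonneg hm0
  have hA : ‖dq h (ex k) (fun z => A φ (P z)) z‖ ≤ h⁻¹ * (C₁ * (coef φ m * ‖Q - P z‖)) := by
    rw [dq, norm_smul, Real.norm_of_nonneg hh1.le]
    refine mul_le_mul_of_nonneg_left ?_ hh1.le
    have := h1 Q (P z)
    rwa [add_comm, ← hm] at this
  have hD : ‖dq h (ex k) P z‖ = h⁻¹ * ‖Q - P z‖ := by
    rw [dq, norm_smul, Real.norm_of_nonneg hh1.le]
  refine (mul_le_mul hA (hz b hzO) (abs_nonneg _) (by positivity)).trans ?_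
  have key : (coef φ m * ‖Q - P z‖) * segAvg h (ex b.2) (fun z => ‖P z‖) z ≤
      2 * (coef φ m * ‖Q - P z‖ * m) + C₂ * osc h (ex b.2) (fun z => V φ (P z)) z := by
    have e : 2 * (coef φ m * ‖Q - P z‖ * m) =
        h⁻¹ * ∫ s in Ioc 0 h, 2 * (coef φ m * ‖Q - P z‖ * m) := by
      simp [hh.le]; field_simp
    rw [e]
    unfold segAvg osc
    rw [mul_left_comm, mul_left_comm C₂, ← integral_const_mul (coef φ m * ‖Q - P z‖),
      ← integral_const_mul C₂, ← mul_add, ← integral_add (integrable_const _) ((hzV b.2).const_mul _)]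
    refine mul_le_mul_of_nonneg_left ?_ hh1.le
    refine integral_mono ((hzP b.2).const_mul _)
      ((integrable_const _).add ((hzV b.2).const_mul _)) fun s => ?_
    exact h2 (P z) Q (P (z + s • ex b.2))
  rw [hD]
  have ho := osc_nonneg hh.le (ex b.2) (fun z => V φ (P z)) z
  have hx : 0 ≤ coef φ m * ‖Q - P z‖ * m := by positivity
  calc h⁻¹ * (C₁ * (coef φ m * ‖Q - P z‖)) * segAvg h (ex b.2) (fun z => ‖P z‖) z
      = h⁻¹ * C₁ * ((coef φ m * ‖Q - P z‖) * segAvg h (ex b.2) (fun z => ‖P z‖) z) := by ring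
    _ ≤ h⁻¹ * C₁ * (2 * (coef φ m * ‖Q - P z‖ * m) +
          C₂ * osc h (ex b.2) (fun z => V φ (P z)) z) :=
        mul_le_mul_of_nonneg_left key (by positivity)
    _ ≤ h⁻¹ * C₁ * ((2 + C₂) * (coef φ m * ‖Q - P z‖ * m) +
          (2 + C₂) * osc h (ex b.2) (fun z => V φ (P z)) z) := by
        refine mul_le_mul_of_nonneg_left ?_ (by positivity)
        nlinarith
    _ = _ := by ring

include hs in
lemma ae_sumSq_le (hO : IsOpen O) {h : ℝ} (hh : 0 < h) (hseg : SegSubset h O' O) :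
    ∀ᵐ z, sumSq (fun a => W u O' h a z) ≤
      ∑ a : Fin N × Fin n, segAvg h (ex a.2) (fun z => ‖P z‖ ^ 2) z := by
  have hall := ae_all_iff.2 fun b => ae_abs_dq_le hs hO hh hseg b
  have hP := ae_all_iff.2 fun k : Fin n =>
    ae_integrableOn_segment hs.P_meas.norm hs.P_int.norm h (ex k)
  have hP2 := ae_all_iff.2 fun k : Fin n =>
    ae_integrableOn_segment (hs.P_meas.norm.pow_const 2) (integrable_norm_sq hs.P_sq) h (ex k)
  filter_upwards [hall, hP, hP2] with z hz h1 h2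
  refine Finset.sum_le_sum fun a _ => ?_
  by_cases hzO : z ∈ O'
  · simp only [W, hzO, indicator_of_mem]
    refine (sq_le_sq' ?_ (hz a hzO |> (le_abs_self _).trans)).trans (sq_integral_le hh (h1 a.2) (h2 a.2))
    exact (neg_le_neg (hz a hzO)).trans (neg_abs_le _)
  · simp only [W, hzO, not_false_eq_true, indicator_of_notMem]
    simpa using segAvg_nonneg hh (ex a.2) (fun z => sq_nonneg ‖P z‖) z

lemma sum_mul_eq_sum_inner (X Y : Fin n → Mat N n) :
    ∑ a : Fin N × Fin n, ∑ j, X a.2 (a.1, j) * Y a.2 (a.1, j) = ∑ k, inner ℝ (X k) (Y k) := by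
  simp only [PiLp.inner_apply, Fintype.sum_prod_type, RCLike.inner_apply, conj_trivial]
  rw [Finset.sum_comm]
  exact Finset.sum_congr rfl fun k _ => Finset.sum_congr rfl fun i _ =>
    Finset.sum_congr rfl fun j _ => mul_comm _ _

/-- The integrand for the untruncated test function, estimated from below. -/
lemma le_testIntegrand_one {w : Fin N × Fin n → ℝ} {X Y : Fin n → Mat N n} {θ T : ℝ}
    {θ' : Fin n → ℝ} {S : Fin n → ℝ} (hθ' : ∀ j, |θ' j| ≤ T)
    (hw : ∀ a, ‖Y a.2‖ * |w a| ≤ S a.2) :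
    θ * ∑ k, inner ℝ (X k) (Y k) - N * n * T * ∑ k, S k ≤
      testIntegrand (fun _ => 1) w (fun a j => X a.2 (a.1, j)) (fun a j => Y a.2 (a.1, j)) θ θ' := by
  have e : testIntegrand (fun _ => 1) w (fun a j => X a.2 (a.1, j))
      (fun a j => Y a.2 (a.1, j)) θ θ' = θ * ∑ k, inner ℝ (X k) (Y k) +
      ∑ a : Fin N × Fin n, ∑ j, Y a.2 (a.1, j) * w a * θ' j := by
    rw [← sum_mul_eq_sum_inner, Finset.mul_sum, ← Finset.sum_add_distrib]
    refine Finset.sum_congr rfl fun a _ => ?_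
    rw [Finset.mul_sum, ← Finset.sum_add_distrib]
    refine Finset.sum_congr rfl fun j _ => ?_
    simp only [deriv_const', zero_mul, mul_zero, mul_one, add_zero]
    ring
  have h1 : |∑ a : Fin N × Fin n, ∑ j, Y a.2 (a.1, j) * w a * θ' j| ≤ N * n * T * ∑ k, S k := by
    have h2 : ∀ (a : Fin N × Fin n) (j : Fin n), |Y a.2 (a.1, j) * w a * θ' j| ≤ T * S a.2 := by
      intro a j
      rw [abs_mul, abs_mul, mul_comm T]
      have h3 := mul_le_mul_of_nonneg_right (abs_coord_le (Y a.2) (a.1, j)) (abs_nonneg (w a))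
      have h4 := h3.trans (hw a)
      exact mul_le_mul h4 (hθ' j) (abs_nonneg _) ((by positivity : (0:ℝ) ≤ _).trans h4)
    calc _ ≤ ∑ a : Fin N × Fin n, ∑ j : Fin n, T * S a.2 :=
          (Finset.abs_sum_le_sum_abs _ _).trans (Finset.sum_le_sum fun a _ =>
            (Finset.abs_sum_le_sum_abs _ _).trans (Finset.sum_le_sum fun j _ => h2 a j))
      _ = _ := by
        simp only [Finset.sum_const, Finset.card_univ, Fintype.card_fin, nsmul_eq_mul,
          Fintype.sum_prod_type]
        rw [Finset.mul_sum, Finset.mul_sum]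
        exact Finset.sum_congr rfl fun k _ => by ring
  rw [e]
  linarith [neg_abs_le (∑ a : Fin N × Fin n, ∑ j, Y a.2 (a.1, j) * w a * θ' j)]

set_option maxHeartbeats 1000000 in
include hφ hc₀ hs in
/-- The Caccioppoli inequality for difference quotients. -/
lemma exists_caccioppoli (hO : IsOpen O) (hO' : IsOpen O') (hsub : O' ⊆ O)
    {θ₀ : ℝ × Space n → ℝ} (hθ : ContDiff ℝ ∞ θ₀) (hθc : HasCompactSupport θ₀)
    (hθO : tsupport θ₀ ⊆ O') (hθ1 : ∀ z, 0 ≤ θ₀ z ∧ θ₀ z ≤ 1) :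
    ∃ C, 0 < C ∧ ∀ h, 0 < h → SegSubset h O' O →
      ∫ z, θ₀ z ^ 2 * ∑ k, ‖dq h (ex k) (fun z => V φ (P z)) z‖ ^ 2 ≤
        C * (1 + ∑ k, h⁻¹ * ∫ z in O', osc h (ex k) (fun z => V φ (P z)) z) := by
  obtain ⟨C₁, hC₁, h1⟩ := exists_abs_A_mul_abs_u_le (O' := O') hφ hc₀ hs hO
  obtain ⟨C₂, hC₂, h2⟩ := hφ.exists_coef_mul_le_inner (F := Mat N n) hc₀
  obtain ⟨C₃, hC₃, h3⟩ := hφ.exists_norm_V_sub_sq_le (F := Mat N n) hc₀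
  have hθ₀1 : ContDiff ℝ 1 θ₀ := hθ.of_le (by exact_mod_cast le_top)
  have hθsq : ContDiff ℝ 1 (fun z => θ₀ z ^ 2) := hθ₀1.pow 2
  have hsqc : HasCompactSupport (fun z => θ₀ z ^ 2) :=
    hθc.comp_left (g := fun x : ℝ => x ^ 2) (by simp)
  have hsqO : tsupport (fun z => θ₀ z ^ 2) ⊆ O' := by
    refine (closure_mono fun z hz => ?_).trans hθO
    simp only [Function.mem_support] at hz ⊢
    exact fun h => hz (by simp [h])
  choose T hT using fun j : Fin n => exists_bound_fderiv hθ₀1 hθc (ex j)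
  obtain ⟨T', hT'⟩ := exists_bound_fderiv hθsq hsqc (et (n := n))
  have hT0 : ∀ j, 0 ≤ T j := fun j => (abs_nonneg _).trans (hT j 0)
  have hT'0 : 0 ≤ T' := (abs_nonneg _).trans (hT' 0)
  set T₁ := ∑ j, T j with hT₁
  have hTT : ∀ j z, |fderiv ℝ θ₀ z (ex j)| ≤ T₁ := fun j z =>
    (hT j z).trans (Finset.single_le_sum (fun j _ => hT0 j) (Finset.mem_univ j))
  have hT₁0 : 0 ≤ T₁ := Finset.sum_nonneg fun j _ => hT0 j
  have hder : ∀ j z, fderiv ℝ (fun z => θ₀ z ^ 2) z (ex j) = 2 * θ₀ z * fderiv ℝ θ₀ z (ex j) := by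
    intro j z
    have := (((hθ₀1.differentiable (by norm_num)) z).hasFDerivAt.pow 2).fderiv
    rw [this]
    simp
  -- `M` is the coefficient of the mixed term, the `2 T₁` stemming from `∂_j(θ₀²) = 2 θ₀ ∂_j θ₀`.
  -- `Dc` is the constant left in front of the energy once half of the coercive term has absorbed
  -- the mixed term.
  set M := N * n * 2 * T₁ * C₁ with hM
  have hM0 : 0 ≤ M := by positivity
  set Dc := C₂ / 2 * M ^ 2 * (2 * 2 ^ c₁) with hDc
  have hDc0 : 0 ≤ Dc := by positivity
  set I₁ := ∫ z, en φ (P z)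
  have hI₁ : 0 ≤ I₁ := integral_nonneg fun z => en_nonneg hφ _
  set I₂ := ∫ z, ‖P z‖ ^ 2
  have hI₂ : 0 ≤ I₂ := integral_nonneg fun z => sq_nonneg _
  refine ⟨2 * C₂ * C₃ * (T' * (N * n * I₂) + Dc * (2 * n * I₁) + M + 1), by positivity,
    fun h hh hseg => ?_⟩
  have hws := weakSystem hφ hc₀ hs hO hO' hh hseg hsub
  have hκ1 : ∀ y : ℝ, 0 ≤ y → |(fun _ : ℝ => (1 : ℝ)) y| ≤ 1 := fun y _ => by simp
  have hκ2 : ∀ y : ℝ, 0 ≤ y → |deriv (fun _ : ℝ => (1 : ℝ)) y| * y ≤ 0 := fun y _ => by simp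
  have hint := (hws.tendsto_testIntegrand hθsq hsqc contDiff_const hκ1 hκ2).1
  -- No truncation: `κ = 1` and `K = id`, so the test function is `D_h u θ₀²`.
  have hid := hws.integral_testIntegrand hO' hθsq hsqc hsqO (K := id) contDiff_const
    (fun y => hasDerivAt_id y) hκ1 hκ2 (fun y hy => by simp [abs_of_nonneg hy])
  set TI := fun z => testIntegrand (fun _ => 1) (fun a => W u O' h a z)
    (fun a j => dq h (ex a.2) (fun z => P z (a.1, j)) z)
    (fun a j => dq h (ex a.2) (fun z => A φ (P z) (a.1, j)) z) (θ₀ z ^ 2)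
    (fun j => fderiv ℝ (fun z => θ₀ z ^ 2) z (ex j)) with hTI
  set VP := fun z => V φ (P z) with hVP
  set R := fun z => ∑ k, (Dc * (en φ (P z) + en φ (P (z + h • ex k))) +
    M * (h⁻¹ * O'.indicator (osc h (ex k) VP) z)) with hR
  have hh1 : 0 < h⁻¹ := by positivity
  have hosc : ∀ k, Integrable (O'.indicator (osc h (ex k) VP)) := fun k =>
    (integrable_osc (measurable_VP hφ hs) (memLp_V hφ hc₀ hs) h (ex k)).indicator hO'.measurableSet
  have hRint : Integrable R := integrable_finsetSum _ fun k _ =>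
    ((hs.energy.add (integrable_translate hs.energy _)).const_mul _).add
      (((hosc k).const_mul _).const_mul _)
  have hpt : ∀ᵐ z, (2 * C₂ * C₃)⁻¹ * (θ₀ z ^ 2 * ∑ k, ‖dq h (ex k) VP z‖ ^ 2) ≤ TI z + R z := by
    filter_upwards [h1 h hh hseg] with z hz
    have hR0 : ∀ k, 0 ≤ en φ (P z) + en φ (P (z + h • ex k)) := fun k =>
      add_nonneg (en_nonneg hφ _) (en_nonneg hφ _)
    have hosc0 : ∀ k, 0 ≤ osc h (ex k) VP z := fun k => osc_nonneg hh.le _ _ _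
    by_cases hzO : z ∈ O'
    swap
    · have hz0 : θ₀ z = 0 := image_eq_zero_of_notMem_tsupport fun h => hzO (hθO h)
      have : TI z = 0 := by
        simp only [hTI, testIntegrand, hder, hz0]
        simp
      rw [this, hz0]
      have : 0 ≤ R z := Finset.sum_nonneg fun k _ => add_nonneg (mul_nonneg hDc0 (hR0 k))
        (mul_nonneg hM0 (mul_nonneg hh1.le (indicator_nonneg (fun _ _ => osc_nonneg hh.le _ _ _) z)))
      simpa using this
    set X := fun k => dq h (ex k) P z
    set Y := fun k => dq h (ex k) (fun z => A φ (P z)) z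
    set m := fun k => ‖P z‖ + ‖P (z + h • ex k)‖
    have hm0 : ∀ k, 0 ≤ m k := fun k => by positivity
    have hcoef : ∀ k, 0 ≤ coef φ (m k) := fun k => hφ.coef_nonneg (hm0 k)
    have hlow := le_testIntegrand_one (w := fun a => W u O' h a z) (X := X) (Y := Y)
      (θ := θ₀ z ^ 2) (T := 2 * θ₀ z * T₁)
      (θ' := fun j => fderiv ℝ (fun z => θ₀ z ^ 2) z (ex j))
      (S := fun k => C₁ * (coef φ (m k) * ‖X k‖ * m k + h⁻¹ * osc h (ex k) VP z))
      (fun j => by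
        rw [hder, abs_mul, abs_of_nonneg (by linarith [(hθ1 z).1] : 0 ≤ 2 * θ₀ z)]
        exact mul_le_mul_of_nonneg_left (hTT j z) (by linarith [(hθ1 z).1]))
      (fun a => by
        have := hz hzO a.2 a
        simpa [W, hzO] using this)
    have hTIe : TI z = testIntegrand (fun _ => 1) (fun a => W u O' h a z)
      (fun a j => X a.2 (a.1, j)) (fun a j => Y a.2 (a.1, j)) (θ₀ z ^ 2)
      (fun j => fderiv ℝ (fun z => θ₀ z ^ 2) z (ex j)) := rfl
    rw [← hTIe] at hlow
    have hterm : ∀ k, (2 * C₂ * C₃)⁻¹ * (θ₀ z ^ 2 * ‖dq h (ex k) VP z‖ ^ 2) ≤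
        θ₀ z ^ 2 * inner ℝ (X k) (Y k) - N * n * (2 * θ₀ z * T₁) *
          (C₁ * (coef φ (m k) * ‖X k‖ * m k + h⁻¹ * osc h (ex k) VP z)) +
        (Dc * (en φ (P z) + en φ (P (z + h • ex k))) +
          M * (h⁻¹ * O'.indicator (osc h (ex k) VP) z)) := by
      intro k
      have a1 : coef φ (m k) * ‖X k‖ ^ 2 ≤ C₂ * inner ℝ (X k) (Y k) := by
        have := h2 (P (z + h • ex k)) (P z)
        rw [add_comm ‖P (z + h • ex k)‖] at this
        simp only [X, Y, dq, norm_smul, Real.norm_of_nonneg hh1.le, real_inner_smul_left,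
          real_inner_smul_right, A_eq_radial, mul_pow]
        rw [real_inner_comm]
        have h4 := mul_le_mul_of_nonneg_left this (sq_nonneg h⁻¹)
        simp only [m]
        nlinarith
      have a2 : ‖dq h (ex k) VP z‖ ^ 2 ≤ C₃ * (coef φ (m k) * ‖X k‖ ^ 2) := by
        have := h3 (P (z + h • ex k)) (P z)
        rw [add_comm ‖P (z + h • ex k)‖] at this
        simp only [X, dq, norm_smul, Real.norm_of_nonneg hh1.le, mul_pow, VP]
        have h4 := mul_le_mul_of_nonneg_left this (sq_nonneg h⁻¹)
        simp only [m]
        nlinarith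
      have a3 : coef φ (m k) * m k ^ 2 ≤ 2 * 2 ^ c₁ * (en φ (P z) + en φ (P (z + h • ex k))) := by
        have := hφ.d_add_mul_le hc₀ (norm_nonneg (P z)) (norm_nonneg (P (z + h • ex k)))
        rw [pow_two, ← mul_assoc, hφ.coef_mul]
        exact this
      rw [indicator_of_mem hzO]
      have hθz := hθ1 z
      set Ek := coef φ (m k) * ‖X k‖ ^ 2 with hEk
      have b1 : θ₀ z ^ 2 * (C₂⁻¹ * Ek) ≤ θ₀ z ^ 2 * inner ℝ (X k) (Y k) := by
        refine mul_le_mul_of_nonneg_left ?_ (sq_nonneg _)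
        rw [inv_mul_le_iff₀ hC₂]; exact a1
      have b2 : (2 * C₂ * C₃)⁻¹ * (θ₀ z ^ 2 * ‖dq h (ex k) VP z‖ ^ 2) ≤
          θ₀ z ^ 2 * ((2 * C₂)⁻¹ * Ek) := by
        rw [mul_inv, mul_assoc, mul_left_comm C₃⁻¹, ← mul_assoc, mul_comm _ (θ₀ z ^ 2), mul_assoc]
        refine mul_le_mul_of_nonneg_left (mul_le_mul_of_nonneg_left ?_ (by positivity))
          (sq_nonneg _)
        rw [inv_mul_le_iff₀ hC₃]; exact a2
      -- Young's inequality obtained by completing a square, with weights such that exactly half of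
      -- the coercive term `C₂⁻¹ Ek` is used. The square of the cut-off function provides the factor
      -- `θ₀²`.
      have b3 : M * θ₀ z * (coef φ (m k) * ‖X k‖ * m k) ≤ θ₀ z ^ 2 * ((2 * C₂)⁻¹ * Ek) +
          C₂ / 2 * M ^ 2 * (coef φ (m k) * m k ^ 2) := by
        have : 0 ≤ coef φ (m k) * ((2 * C₂)⁻¹ * (θ₀ z * ‖X k‖ - C₂ * M * m k) ^ 2) :=
          mul_nonneg (hcoef k) (by positivity)
        have e : coef φ (m k) * ((2 * C₂)⁻¹ * (θ₀ z * ‖X k‖ - C₂ * M * m k) ^ 2) =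
          θ₀ z ^ 2 * ((2 * C₂)⁻¹ * Ek) +
          C₂ / 2 * M ^ 2 * (coef φ (m k) * m k ^ 2) - M * θ₀ z * (coef φ (m k) * ‖X k‖ * m k) := by
          rw [hEk]; field_simp; ring
        linarith
      have b4 : C₂ / 2 * M ^ 2 * (coef φ (m k) * m k ^ 2) ≤
          Dc * (en φ (P z) + en φ (P (z + h • ex k))) := by
        rw [hDc, mul_assoc _ (2 * 2 ^ c₁)]
        exact mul_le_mul_of_nonneg_left a3 (by positivity)
      have b5 : M * θ₀ z * (h⁻¹ * osc h (ex k) VP z) ≤ M * (h⁻¹ * osc h (ex k) VP z) := by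
        refine mul_le_mul_of_nonneg_right ?_ (mul_nonneg hh1.le (hosc0 k))
        exact mul_le_of_le_one_right hM0 hθz.2
      have b6 : θ₀ z ^ 2 * (C₂⁻¹ * Ek) = 2 * (θ₀ z ^ 2 * ((2 * C₂)⁻¹ * Ek)) := by
        field_simp
      have b7 : N * n * (2 * θ₀ z * T₁) *
          (C₁ * (coef φ (m k) * ‖X k‖ * m k + h⁻¹ * osc h (ex k) VP z)) =
          M * θ₀ z * (coef φ (m k) * ‖X k‖ * m k) + M * θ₀ z * (h⁻¹ * osc h (ex k) VP z) := by
        rw [hM]; ring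
      rw [b7]
      linarith
    have hsum := Finset.sum_le_sum fun k (_ : k ∈ Finset.univ) => hterm k
    rw [Finset.sum_add_distrib, Finset.sum_sub_distrib, ← Finset.mul_sum, ← Finset.mul_sum,
      ← Finset.mul_sum, ← Finset.mul_sum] at hsum
    exact hsum.trans (add_le_add hlow le_rfl)
  have hV2 : Integrable (fun z => ∑ k, ‖dq h (ex k) VP z‖ ^ 2) :=
    integrable_finsetSum _ fun k _ => integrable_norm_sq (memLp_dq (memLp_V hφ hc₀ hs) h (ex k))
  have hLint : Integrable (fun z => θ₀ z ^ 2 * ∑ k, ‖dq h (ex k) VP z‖ ^ 2) := by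
    refine hV2.bdd_mul (c := 1) hθsq.continuous.aestronglyMeasurable (ae_of_all _ fun z => ?_)
    rw [Real.norm_of_nonneg (sq_nonneg _)]
    exact pow_le_one₀ (hθ1 z).1 (hθ1 z).2
  have hmain := integral_mono_ae (hLint.const_mul _) (hint.add hRint) hpt
  rw [integral_const_mul, integral_add' hint hRint, hid, inv_mul_le_iff₀ (by positivity)] at hmain
  refine hmain.trans ?_
  have hrhs : 1 / 2 * ∫ z, id (sumSq fun a => W u O' h a z) *
      fderiv ℝ (fun z => θ₀ z ^ 2) z et ≤ T' * (N * n * I₂) := by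
    have i1 : Integrable (fun z => ∑ a : Fin N × Fin n,
        segAvg h (ex a.2) (fun z => ‖P z‖ ^ 2) z) := integrable_finsetSum _ fun a _ =>
      integrable_segAvg (hs.P_meas.norm.pow_const 2) (integrable_norm_sq hs.P_sq) h (ex a.2)
    have hb : ∫ z, id (sumSq fun a => W u O' h a z) * fderiv ℝ (fun z => θ₀ z ^ 2) z et ≤
        ∫ z, T' * ∑ a : Fin N × Fin n, segAvg h (ex a.2) (fun z => ‖P z‖ ^ 2) z := by
      refine integral_mono_ae ?_ (i1.const_mul _) ?_
      · refine Integrable.mul_bdd (c := T') (integrable_finsetSum _ fun a _ => hws.w_sq a) ?_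
          (ae_of_all _ hT')
        exact ((hθsq.continuous_fderiv (by norm_num)).clm_apply
          continuous_const).aestronglyMeasurable
      · filter_upwards [ae_sumSq_le hs hO hh hseg] with z hz
        have h5 := sumSq_nonneg fun a => W u O' h a z
        rw [mul_comm]
        refine (mul_le_mul_of_nonneg_right ((le_abs_self _).trans (hT' z)) h5).trans ?_
        exact mul_le_mul_of_nonneg_left hz hT'0
    rw [integral_const_mul, integral_finsetSum _ fun a _ =>
      integrable_segAvg (hs.P_meas.norm.pow_const 2) (integrable_norm_sq hs.P_sq) h (ex a.2)] at hb
    simp_rw [integral_segAvg (hs.P_meas.norm.pow_const 2) (integrable_norm_sq hs.P_sq) hh] at hb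
    simp only [Finset.sum_const, Finset.card_univ, Fintype.card_prod, Fintype.card_fin,
      nsmul_eq_mul, Nat.cast_mul] at hb
    have : 0 ≤ T' * (N * n * I₂) := by positivity
    linarith
  have hRval : ∫ z, R z = Dc * (2 * n * I₁) +
      M * ∑ k, h⁻¹ * ∫ z in O', osc h (ex k) VP z := by
    have i3 : ∀ k, Integrable fun z => Dc * (en φ (P z) + en φ (P (z + h • ex k))) +
        M * (h⁻¹ * O'.indicator (osc h (ex k) VP) z) := fun k =>
      ((hs.energy.add (integrable_translate hs.energy _)).const_mul _).add
        (((hosc k).const_mul _).const_mul _)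
    simp only [hR]
    rw [integral_finsetSum _ fun k _ => i3 k]
    have : ∀ k, ∫ z, (Dc * (en φ (P z) + en φ (P (z + h • ex k))) +
        M * (h⁻¹ * O'.indicator (osc h (ex k) VP) z)) =
        Dc * (2 * I₁) + M * (h⁻¹ * ∫ z in O', osc h (ex k) VP z) := by
      intro k
      have i2 : Integrable fun z => en φ (P (z + h • ex k)) := integrable_translate hs.energy _
      have i4 : Integrable fun z => Dc * (en φ (P z) + en φ (P (z + h • ex k))) :=
        (hs.energy.add i2).const_mul _
      rw [integral_add i4 (((hosc k).const_mul _).const_mul _), integral_const_mul, integral_const_mul, integral_const_mul,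
        integral_add hs.energy i2, integral_indicator hO'.measurableSet,
        integral_add_right_eq_self (fun z => en φ (P z)) (h • ex k)]
      ring
    simp_rw [this]
    rw [Finset.sum_add_distrib, Finset.mul_sum, Finset.sum_const, Finset.card_univ,
      Fintype.card_fin, nsmul_eq_mul]
    ring
  rw [hRval]
  set S := ∑ k, h⁻¹ * ∫ z in O', osc h (ex k) VP z
  have hS : 0 ≤ S := Finset.sum_nonneg fun k _ =>
    mul_nonneg hh1.le (integral_nonneg fun z => osc_nonneg hh.le _ _ _)
  rw [mul_assoc (2 * C₂ * C₃)]
  refine mul_le_mul_of_nonneg_left ?_ (by positivity)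
  have p1 : 0 ≤ T' * (N * n * I₂) := by positivity
  have p2 : 0 ≤ Dc * (2 * n * I₁) := by positivity
  generalize T' * (N * n * I₂) = x₁ at *
  generalize Dc * (2 * n * I₁) = x₂ at *
  have p3 := mul_nonneg p1 hS
  have p4 := mul_nonneg p2 hS
  have e : (x₁ + x₂ + M + 1) * (1 + S) = x₁ + x₂ + M + 1 + x₁ * S + x₂ * S + M * S + S := by ring
  rw [e]
  linarith

end Solution

end PhiCaloric
end

/-! ### Bounds for the difference quotients of `V` in two passes. -/

noncomputable section

namespace PhiCaloric

open Filter Topology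

section Translations

variable {E : Type*} [NormedAddCommGroup E] [NormedSpace ℝ E] [MeasurableSpace E] [BorelSpace E]
  [FiniteDimensional ℝ E] {μ : Measure E} [μ.IsAddHaarMeasure]

lemma tendsto_translate_L1 {F : Type*} [NormedAddCommGroup F] {f : E → F} (hf : Integrable f μ)
    (e : E) : Tendsto (fun s : ℝ => ∫ z, ‖f (z + s • e) - f z‖ ∂μ) (𝓝 0) (𝓝 0) := by
  have hf1 : MemLp f 1 μ := memLp_one_iff_integrable.2 hf
  have hmp : ∀ s : ℝ, MeasurePreserving (fun z : E => z + s • e) μ μ := fun s =>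
    measurePreserving_add_right μ (s • e)
  have hc : ∀ s : ℝ, Integrable (fun z => f (z + s • e)) μ := fun s =>
    integrable_translate hf _
  have hg : Tendsto (fun s : ℝ => (⟨fun z : E => z + s • e, by fun_prop⟩ : C(E, E))) (𝓝 0)
      (𝓝 ⟨fun z : E => z + (0 : ℝ) • e, by fun_prop⟩) := by
    have : Continuous fun s : ℝ => (⟨fun z : E => z + s • e, by fun_prop⟩ : C(E, E)) := by
      refine ContinuousMap.continuous_of_continuous_uncurry _ ?_
      change Continuous fun x : ℝ × E => x.2 + x.1 • e
      fun_prop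
    exact this.tendsto 0
  have h1 := Filter.Tendsto.compMeasurePreservingLp (μ := μ) (ν := μ)
    (tendsto_const_nhds (x := hf1.toLp f) (f := 𝓝 (0 : ℝ))) hg hmp (hmp 0)
    ENNReal.one_ne_top
  have h2 := tendsto_iff_norm_sub_tendsto_zero.1 h1
  refine h2.congr fun s => ?_
  have h3 : ∀ s : ℝ, Lp.compMeasurePreserving (fun z : E => z + s • e) (hmp s) (hf1.toLp f) =
      (memLp_one_iff_integrable.2 (hc s)).toLp _ := fun s =>
    Lp.toLp_compMeasurePreserving hf1 (hmp s)
  have h4 := h3 s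
  have h5 := h3 0
  change ‖Lp.compMeasurePreserving (fun z : E => z + s • e) (hmp s) (hf1.toLp f) -
    Lp.compMeasurePreserving (fun z : E => z + (0 : ℝ) • e) (hmp 0) (hf1.toLp f)‖ = _
  rw [h4, h5, ← MemLp.toLp_sub, Lp.norm_toLp, eLpNorm_one_eq_lintegral_enorm,
    ← integral_norm_eq_lintegral_enorm ((hc s).sub (hc 0)).aestronglyMeasurable]
  simp

end Translations

lemma norm_ex {n : ℕ} (k : Fin n) : ‖(ex k : ℝ × Space n)‖ = 1 := by
  simp [ex, Prod.norm_def]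

lemma add_smul_ex_mem_thickening {n : ℕ} {K : Set (ℝ × Space n)} {r r' s : ℝ} (k : Fin n)
    (hs : r + |s| ≤ r') {z : ℝ × Space n} (hz : z ∈ Metric.thickening r K) :
    z + s • ex k ∈ Metric.thickening r' K := by
  rw [Metric.mem_thickening_iff] at hz ⊢
  obtain ⟨x, hx, hd⟩ := hz
  refine ⟨x, hx, ?_⟩
  have h1 : dist (z + s • ex k) z = |s| := by
    rw [dist_eq_norm, add_sub_cancel_left, norm_smul, norm_ex, mul_one, Real.norm_eq_abs]
  linarith [dist_triangle (z + s • ex k) z x]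

namespace Solution

variable {N n : ℕ} {φ : ℝ → ℝ} {c₀ c₁ : ℝ} {O O' : Set (ℝ × Space n)} {u : ℝ × Space n → Space N}
  {P : ℝ × Space n → Mat N n}

variable (hφ : IsOrlicz φ c₀ c₁) (hc₀ : 0 < c₀) (hs : Solution φ O u P)

include hφ hc₀ hs in
lemma exists_setIntegral_dq_V_le {K : Set (ℝ × Space n)} (hK : IsCompact K) (hO : IsOpen O)
    {r r' δ : ℝ} (hrr : r < r') (hr'0 : 0 < r') (hδ : Metric.thickening δ K ⊆ O)
    (hr' : r' < δ) :
    ∃ C, 0 < C ∧ ∀ h, 0 < h → h ≤ δ - r' →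
      ∫ z in Metric.thickening r K, ∑ k, ‖dq h (ex k) (fun z => V φ (P z)) z‖ ^ 2 ≤
        C * (1 + ∑ k, h⁻¹ * ∫ z in Metric.thickening r' K,
          osc h (ex k) (fun z => V φ (P z)) z) := by
  have hc : IsCompact (Metric.cthickening r K) := hK.cthickening
  have hsub : Metric.thickening r' K ⊆ O := (Metric.thickening_mono hr'.le K).trans hδ
  obtain ⟨θ, h1, h2, h3, h4, h5⟩ := exists_cutoff (E := ℝ × Space n) hc Metric.isOpen_thickening
    (Metric.cthickening_subset_thickening' hr'0 hrr K)
  obtain ⟨C, hC, hb⟩ := exists_caccioppoli hφ hc₀ hs hO (Metric.isOpen_thickening (δ := r')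
    (E := K)) hsub h1 h2 h3 h5
  refine ⟨C, hC, fun h hh hhd => ?_⟩
  have hseg : SegSubset h (Metric.thickening r' K) O := fun z hz k s hs' =>
    hδ (add_smul_ex_mem_thickening k (by rw [abs_of_nonneg hs'.1]; linarith [hs'.2]) hz)
  refine le_trans ?_ (hb h hh hseg)
  have hV2 : Integrable (fun z => ∑ k, ‖dq h (ex k) (fun z => V φ (P z)) z‖ ^ 2) :=
    integrable_finsetSum _ fun k _ => integrable_norm_sq (memLp_dq (memLp_V hφ hc₀ hs) h (ex k))
  rw [← integral_indicator Metric.isOpen_thickening.measurableSet]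
  refine integral_mono (hV2.indicator Metric.isOpen_thickening.measurableSet) ?_ fun z => ?_
  · refine hV2.bdd_mul (c := 1) (h1.continuous.pow 2).aestronglyMeasurable
      (ae_of_all _ fun z => ?_)
    rw [Real.norm_of_nonneg (sq_nonneg _)]
    exact pow_le_one₀ (h5 z).1 (h5 z).2
  · by_cases hz : z ∈ Metric.thickening r K
    · rw [indicator_of_mem hz, h4 z (Metric.thickening_subset_cthickening r K hz)]
      simp
    · rw [indicator_of_notMem hz]
      positivity

lemma norm_sub_sq_eq_dq {F : Type*} [NormedAddCommGroup F] [NormedSpace ℝ F]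
    {E : Type*} [NormedAddCommGroup E] [NormedSpace ℝ E] {s : ℝ} (hs : 0 < s) (e : E) (f : E → F) (z : E) :
    ‖f (z + s • e) - f z‖ ^ 2 = s ^ 2 * ‖dq s e f z‖ ^ 2 := by
  rw [dq, norm_smul, Real.norm_of_nonneg (by positivity)]
  field_simp

include hφ hc₀ hs in
/-- The difference quotients of `V(P)` are locally bounded in `L²`. -/
lemma exists_setIntegral_dq_V_le' {K : Set (ℝ × Space n)} (hK : IsCompact K) (hO : IsOpen O)
    {δ : ℝ} (hδ0 : 0 < δ) (hδ : Metric.thickening δ K ⊆ O) :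
    ∃ C, 0 < C ∧ ∀ h, 0 < h → h ≤ δ / 4 → ∀ k : Fin n,
      ∫ z in Metric.thickening (δ / 4) K, ‖dq h (ex k) (fun z => V φ (P z)) z‖ ^ 2 ≤ C := by
  set VP := fun z => V φ (P z) with hVP
  have hVm : Measurable VP := measurable_VP hφ hs
  have hV : MemLp VP 2 := memLp_V hφ hc₀ hs
  obtain ⟨C₁, hC₁, h1⟩ := exists_setIntegral_dq_V_le hφ hc₀ hs hK hO (r := δ / 2) (r' := 3 * δ / 4)
    (by linarith) (by linarith) hδ (by linarith)
  obtain ⟨C₂, hC₂, h2⟩ := exists_setIntegral_dq_V_le hφ hc₀ hs hK hO (r := δ / 4) (r' := δ / 2)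
    (by linarith) (by linarith) hδ (by linarith)
  set I := ∫ z, ‖VP z‖ ^ 2
  have hI : 0 ≤ I := integral_nonneg fun z => sq_nonneg _
  have hVi := integrable_norm_sq hV
  have hdqi : ∀ (h : ℝ) (k : Fin n), Integrable fun z => ‖dq h (ex k) VP z‖ ^ 2 := fun h k =>
    integrable_norm_sq (memLp_dq hV h (ex k))
  have htr : ∀ (s : ℝ) (k : Fin n), Integrable fun z => ‖VP (z + s • ex k)‖ ^ 2 := fun s k =>
    integrable_translate hVi _
  have hsubi : ∀ (s : ℝ) (k : Fin n), Integrable fun z => ‖VP (z + s • ex k) - VP z‖ ^ 2 :=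
    fun s k => integrable_norm_sq
      ((hV.comp_measurePreserving (measurePreserving_add_right volume (s • ex k))).sub hV)
  have e0 : ∀ (s : ℝ) (k : Fin n) (A : Set (ℝ × Space n)),
      ∫ z in A, ‖VP (z + s • ex k) - VP z‖ ^ 2 ≤ 4 * I := by
    intro s k A
    calc _ ≤ ∫ z, ‖VP (z + s • ex k) - VP z‖ ^ 2 :=
          setIntegral_le_integral (hsubi s k) (ae_of_all _ fun z => sq_nonneg _)
      _ ≤ ∫ z, 2 * (‖VP (z + s • ex k)‖ ^ 2 + ‖VP z‖ ^ 2) :=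
          integral_mono (hsubi s k) (((htr s k).add hVi).const_mul 2) fun z => norm_sub_sq_le _ _
      _ = 4 * I := by
          rw [integral_const_mul, integral_add (htr s k) hVi,
            integral_add_right_eq_self (fun z => ‖VP z‖ ^ 2) (s • ex k)]
          ring
  -- First pass. The oscillation is only bounded by the total energy, so the Caccioppoli inequality
  -- has right-hand side of order `1 + s⁻¹`; multiplied by `s²` this is of order `s`, that is, half
  -- a derivative of `V`.
  have e1 : ∀ s, 0 < s → s ≤ δ / 4 → ∀ k : Fin n,
      ∫ z in Metric.thickening (δ / 2) K, ‖VP (z + s • ex k) - VP z‖ ^ 2 ≤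
        C₁ * (δ / 4 + n * (4 * I)) * s := by
    intro s hs0 hsd k
    have h3 := h1 s hs0 (by linarith)
    have h4 : ∫ z in Metric.thickening (δ / 2) K, ‖dq s (ex k) VP z‖ ^ 2 ≤
        ∫ z in Metric.thickening (δ / 2) K, ∑ k, ‖dq s (ex k) VP z‖ ^ 2 :=
      integral_mono (hdqi s k).integrableOn
        (integrable_finsetSum _ fun k _ => hdqi s k).integrableOn fun z =>
          Finset.single_le_sum (f := fun k => ‖dq s (ex k) VP z‖ ^ 2)
            (fun k _ => sq_nonneg _) (Finset.mem_univ k)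
    have h5 : ∑ k : Fin n, s⁻¹ * ∫ z in Metric.thickening (3 * δ / 4) K, osc s (ex k) VP z ≤
        n * (s⁻¹ * (4 * I)) := by
      calc _ ≤ ∑ k : Fin n, s⁻¹ * (4 * I) := Finset.sum_le_sum fun k _ =>
            mul_le_mul_of_nonneg_left (setIntegral_osc_le hVm hV hs0 fun t _ _ => e0 t k _)
              (by positivity)
        _ = _ := by simp
    simp_rw [norm_sub_sq_eq_dq hs0]
    rw [integral_const_mul]
    calc _ ≤ s ^ 2 * (C₁ * (1 + n * (s⁻¹ * (4 * I)))) := by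
          refine mul_le_mul_of_nonneg_left (h4.trans (h3.trans ?_)) (sq_nonneg _)
          exact mul_le_mul_of_nonneg_left (by linarith) hC₁.le
      _ = C₁ * (s + n * (4 * I)) * s := by field_simp
      _ ≤ _ := by gcongr
  refine ⟨C₂ * (1 + n * (C₁ * (δ / 4 + n * (4 * I)))), by positivity, fun h hh hhd k => ?_⟩
  have h3 := h2 h hh (by linarith)
  have h4 : ∫ z in Metric.thickening (δ / 4) K, ‖dq h (ex k) VP z‖ ^ 2 ≤
      ∫ z in Metric.thickening (δ / 4) K, ∑ k, ‖dq h (ex k) VP z‖ ^ 2 :=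
    integral_mono (hdqi h k).integrableOn
      (integrable_finsetSum _ fun k _ => hdqi h k).integrableOn fun z =>
        Finset.single_le_sum (f := fun k => ‖dq h (ex k) VP z‖ ^ 2)
          (fun k _ => sq_nonneg _) (Finset.mem_univ k)
  -- Second pass, on a smaller set: by the first pass the oscillation is of order `h`, so the error
  -- term in the Caccioppoli inequality is bounded uniformly in `h`.
  have h5 : ∑ k : Fin n, h⁻¹ * ∫ z in Metric.thickening (δ / 2) K, osc h (ex k) VP z ≤
      n * (C₁ * (δ / 4 + n * (4 * I))) := by
    calc _ ≤ ∑ k : Fin n, h⁻¹ * (C₁ * (δ / 4 + n * (4 * I)) * h) := Finset.sum_le_sum fun k _ => by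
          refine mul_le_mul_of_nonneg_left (setIntegral_osc_le hVm hV hh fun t ht hth => ?_)
            (by positivity)
          exact (e1 t ht (hth.trans hhd) k).trans (mul_le_mul_of_nonneg_left hth (by positivity))
      _ = _ := by
          rw [Finset.sum_const, Finset.card_univ, Fintype.card_fin, nsmul_eq_mul]
          field_simp
  refine h4.trans (h3.trans ?_)
  exact mul_le_mul_of_nonneg_left (by linarith) hC₂.le

end Solution

end PhiCaloric
end

/-! ### Second order regularity and the choice of step sizes. -/

noncomputable section

namespace PhiCaloric

open Filter Topology

section Coordinates

variable {E : Type*} [NormedAddCommGroup E] [NormedSpace ℝ E] [MeasurableSpace E] [BorelSpace E]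
  [FiniteDimensional ℝ E] {μ : Measure E} [μ.IsAddHaarMeasure]

lemma tendsto_dq_L2 {K : Set E} {e : E} {f Z : E → ℝ} {h₀ : ℝ} (hh₀ : 0 < h₀)
    (hK : MeasurableSet K) (hZm : Measurable Z) (hZ : Integrable Z μ) (hZ2 : MemLp Z 2 μ)
    (hfZ : ∀ h, 0 < h → h < h₀ → ∀ᵐ z ∂μ, z ∈ K →
      f (z + h • e) - f z = ∫ s in Ioc 0 h, Z (z + s • e)) :
    Tendsto (fun h : ℝ => ∫ z in K, (dq h e f z - Z z) ^ 2 ∂μ) (𝓝[>] 0) (𝓝 0) := by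
  refine (tendsto_diffQuot_L2 hh₀ hK hZm hZ hZ2 hfZ).congr fun h => ?_
  simp only [dq, smul_eq_mul, div_eq_inv_mul]

lemma integrable_of_memLp_of_bounded {O : Set E} (hO : MeasurableSet O)
    (hb : Bornology.IsBounded O) {f : E → ℝ} (hf : MemLp f 2 μ) (h0 : ∀ z ∉ O, f z = 0) :
    Integrable f μ := by
  have : IsFiniteMeasure (μ.restrict O) := ⟨by
    rw [Measure.restrict_apply_univ]; exact hb.measure_lt_top⟩
  have h1 : IntegrableOn f O μ := (hf.restrict O).integrable one_le_two
  have h2 := h1.integrable_indicator hO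
  refine h2.congr (ae_of_all _ fun z => ?_)
  by_cases hz : z ∈ O <;> simp [hz, h0]

end Coordinates

/-- The second order regularity of a solution: difference quotients of `V(P)` converge to `Z`
in `O₂`, along a sequence of step sizes for which everything converges almost everywhere. -/
structure Regular {N n : ℕ} (φ : ℝ → ℝ) (O O₁ O₂ : Set (ℝ × Space n))
    (u : ℝ × Space n → Space N) (P : ℝ × Space n → Mat N n)
    (Z : Fin n → ℝ × Space n → Mat N n) (h : ℕ → ℝ) : Prop where
  isOpen₁ : IsOpen O₁
  isOpen₂ : IsOpen O₂
  sub₁ : O₁ ⊆ O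
  sub₂ : O₂ ⊆ O₁
  bdd : Bornology.IsBounded O₁
  h_pos : ∀ m, 0 < h m
  h_tendsto : Tendsto h atTop (𝓝 0)
  seg : ∀ m, SegSubset (h m) O₂ O
  reach : ∃ h₀ > 0, ∀ z ∈ O₂, ∀ (k : Fin n) (s : ℝ), |s| ≤ h₀ → z + s • ex k ∈ O₁
  bound : ∃ C h₀, 0 < h₀ ∧ ∀ s, 0 < s → s < h₀ → ∀ k : Fin n,
    ∫ z in O₁, ‖dq s (ex k) (fun z => V φ (P z)) z‖ ^ 2 ≤ C
  Z_meas : ∀ k, Measurable (Z k)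
  Z_sq : ∀ k, MemLp (Z k) 2
  V_L2 : ∀ k, Tendsto (fun m => ∫ z in O₂, ‖dq (h m) (ex k) (fun z => V φ (P z)) z - Z k z‖ ^ 2)
    atTop (𝓝 0)
  V_ae : ∀ k, ∀ᵐ z, z ∈ O₂ →
    Tendsto (fun m => dq (h m) (ex k) (fun z => V φ (P z)) z) atTop (𝓝 (Z k z))
  P_ae : ∀ k, ∀ᵐ z, z ∈ O₂ → Tendsto (fun m => P (z + h m • ex k)) atTop (𝓝 (P z))
  u_L2 : ∀ a : Fin N × Fin n, Tendsto (fun m => ∫ z in O₂,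
    (dq (h m) (ex a.2) (fun z => u z a.1) z - P z a) ^ 2) atTop (𝓝 0)
  u_ae : ∀ a : Fin N × Fin n, ∀ᵐ z, z ∈ O₂ →
    Tendsto (fun m => dq (h m) (ex a.2) (fun z => u z a.1) z) atTop (𝓝 (P z a))
  osc_tendsto : ∀ k, Tendsto (fun m => (h m)⁻¹ * ∫ z in O₂,
    osc (h m) (ex k) (fun z => V φ (P z)) z) atTop (𝓝 0)

namespace Solution

variable {N n : ℕ} {φ : ℝ → ℝ} {c₀ c₁ : ℝ} {O O' : Set (ℝ × Space n)} {u : ℝ × Space n → Space N}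
  {P : ℝ × Space n → Mat N n}

variable (hφ : IsOrlicz φ c₀ c₁) (hc₀ : 0 < c₀) (hs : Solution φ O u P)

include hφ hc₀ hs in
-- `|V|² = φ'(|P|)|P|` is at most `(|A(P)| + |P|)²`, and both summands are integrable.
lemma integrable_V : Integrable fun z => V φ (P z) := by
  refine (hs.A_int.norm.add hs.P_int.norm).mono' (measurable_VP hφ hs).aestronglyMeasurable
    (ae_of_all _ fun z => ?_)
  have h1 := hφ.norm_V_sq hc₀ (P z)
  have h2 : ‖A φ (P z)‖ = d φ ‖P z‖ := by
    rw [A_eq_radial, (hφ.powerGrowth_d hc₀).norm_radial]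
  have h3 := hφ.d_nonneg (norm_nonneg (P z))
  simp only [Pi.add_apply, h2]
  refine abs_le_of_sq_le_sq' ?_ (by positivity) |>.2
  rw [h1]
  nlinarith [norm_nonneg (P z), mul_nonneg h3 (norm_nonneg (P z)), sq_nonneg (d φ ‖P z‖),
    sq_nonneg ‖P z‖]

include hφ hc₀ hs in
-- Bounded difference quotients of `V` yield weak derivatives of its components in `O₁`; on the
-- smaller set `O₂`, from which short segments stay in `O₁`, the difference quotients then converge
-- strongly in `L²`. The same holds for those of `u`, whose weak gradient is given.
lemma exists_regular {K : Set (ℝ × Space n)} (hK : IsCompact K) (hO : IsOpen O) (hKO : K ⊆ O) :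
    ∃ O₁ O₂ Z h, K ⊆ O₂ ∧ Regular φ O O₁ O₂ u P Z h := by
  obtain ⟨δ, hδ, hδO⟩ := hK.exists_thickening_subset_open hO hKO
  set VP := fun z => V φ (P z) with hVP
  have hVm : Measurable VP := measurable_VP hφ hs
  have hV : MemLp VP 2 := memLp_V hφ hc₀ hs
  have hVi : Integrable VP := integrable_V hφ hc₀ hs
  obtain ⟨C, hC, hb⟩ := exists_setIntegral_dq_V_le' hφ hc₀ hs hK hO hδ hδO
  set O₁ := Metric.thickening (δ / 4) K with hO₁
  set O₂ := Metric.thickening (δ / 8) K with hO₂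
  have o1 : IsOpen O₁ := Metric.isOpen_thickening
  have o2 : IsOpen O₂ := Metric.isOpen_thickening
  have s1 : O₁ ⊆ O := (Metric.thickening_mono (by linarith) K).trans hδO
  have s2 : O₂ ⊆ O₁ := Metric.thickening_mono (by linarith) K
  have b1 : Bornology.IsBounded O₁ := hK.isBounded.thickening
  have hreach : ∀ z ∈ O₂, ∀ (k : Fin n) (s : ℝ), |s| ≤ δ / 8 → z + s • ex k ∈ O₁ :=
    fun z hz k s hs' => add_smul_ex_mem_thickening k (by linarith) hz
  have hdqi : ∀ (h : ℝ) (k : Fin n), Integrable fun z => ‖dq h (ex k) VP z‖ ^ 2 := fun h k =>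
    integrable_norm_sq (memLp_dq hV h (ex k))
  have hZ : ∀ (k : Fin n) (p : Fin N × Fin n), ∃ Z : ℝ × Space n → ℝ, Measurable Z ∧
      MemLp Z 2 volume ∧ (∀ z ∉ O₁, Z z = 0) ∧
      WeakGrad volume O₁ (ex k) (fun z => VP z p) Z := fun k p => by
    refine exists_weakGrad_of_dq_le o1 (integrable_coord hVi p) (memLp_coord hV p)
      (C := C) (h₀ := δ / 4) (by linarith) fun h hh hhd => ?_
    refine le_trans (setIntegral_mono ?_ (hdqi h k).integrableOn fun z => ?_) (hb h hh hhd.le k)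
    · exact (memLp_dq (memLp_coord hV p) h (ex k)).integrable_sq.integrableOn
    · have := abs_coord_le (dq h (ex k) VP z) p
      exact sq_le_sq' (abs_le.1 this).1 (abs_le.1 this).2
  choose Zf hZm hZ2 hZ0 hZw using hZ
  have hZi := fun k p => integrable_of_memLp_of_bounded o1.measurableSet b1 (hZ2 k p) (hZ0 k p)
  set Z : Fin n → ℝ × Space n → Mat N n := fun k z => WithLp.toLp 2 fun p => Zf k p z with hZdef
  have hZmeas : ∀ k, Measurable (Z k) := fun k =>
    (WithLp.measurable_toLp 2 _).comp (measurable_pi_lambda _ (hZm k))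
  have hnsq : ∀ Q : Mat N n, ‖Q‖ ^ 2 = ∑ p, Q p ^ 2 := fun Q => by
    rw [EuclideanSpace.real_norm_sq_eq]
  have hZsq : ∀ k, MemLp (Z k) 2 := fun k => by
    have hm := (hZmeas k).aestronglyMeasurable (μ := (volume : Measure (ℝ × Space n)))
    rw [← memLp_norm_iff hm, memLp_two_iff_integrable_sq hm.norm]
    simp_rw [hnsq]
    exact integrable_finsetSum _ fun p _ => (hZ2 k p).integrable_sq
  have hPm : ∀ a, Measurable fun z => P z a := fun a =>
    (EuclideanSpace.proj (𝕜 := ℝ) a).continuous.measurable.comp hs.P_meas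
  have cV : ∀ k p, Tendsto (fun h : ℝ => ∫ z in O₂, (dq h (ex k) (fun z => VP z p) z -
      Zf k p z) ^ 2) (𝓝[>] 0) (𝓝 0) := fun k p =>
    tendsto_dq_L2 (h₀ := δ / 8) (by linarith) o2.measurableSet (hZm k p) (hZi k p) (hZ2 k p)
      fun h hh hhd => by
        filter_upwards [(hZw k p).sub_eq_integral o1 (integrable_coord hVi p) (hZm k p) (hZi k p)
          hh] with z hz hzO
        exact hz fun s hs' => hreach z hzO k s (by rw [abs_of_nonneg hs'.1]; linarith [hs'.2])
  have cu : ∀ a : Fin N × Fin n, Tendsto (fun h : ℝ => ∫ z in O₂,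
      (dq h (ex a.2) (fun z => u z a.1) z - P z a) ^ 2) (𝓝[>] 0) (𝓝 0) := fun a =>
    tendsto_dq_L2 (h₀ := δ / 8) (by linarith) o2.measurableSet (hPm a)
      (integrable_coord hs.P_int a) (memLp_coord hs.P_sq a) fun h hh hhd => by
        filter_upwards [(hs.grad a.1 a.2).sub_eq_integral hO (hs.u_int a.1) (hPm a)
          (integrable_coord hs.P_int a) hh] with z hz hzO
        exact hz fun s hs' => s1 (hreach z hzO a.2 s (by
          rw [abs_of_nonneg hs'.1]; linarith [hs'.2]))
  have iV : ∀ (h : ℝ) (k : Fin n), Integrable fun z => ‖dq h (ex k) VP z - Z k z‖ ^ 2 :=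
    fun h k => integrable_norm_sq ((memLp_dq hV h (ex k)).sub (hZsq k))
  have iP : ∀ (h : ℝ) (k : Fin n), Integrable fun z => ‖P (z + h • ex k) - P z‖ ^ 2 :=
    fun h k => integrable_norm_sq
      ((hs.P_sq.comp_measurePreserving (measurePreserving_add_right volume (h • ex k))).sub
        hs.P_sq)
  have iu : ∀ (h : ℝ) (a : Fin N × Fin n), Integrable fun z =>
      (dq h (ex a.2) (fun z => u z a.1) z - P z a) ^ 2 := fun h a =>
    ((memLp_dq (hs.u_sq a.1) h (ex a.2)).sub (memLp_coord hs.P_sq a)).integrable_sq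
  have cV' : ∀ k, Tendsto (fun h : ℝ => ∫ z in O₂, ‖dq h (ex k) VP z - Z k z‖ ^ 2)
      (𝓝[>] 0) (𝓝 0) := fun k => by
    have := tendsto_finsetSum Finset.univ fun p _ => cV k p
    simp only [Finset.sum_const_zero] at this
    refine this.congr fun h => ?_
    rw [← integral_finsetSum]
    · simp_rw [hnsq]
      rfl
    · intro p _
      exact ((memLp_dq (memLp_coord hV p) h (ex k)).sub (hZ2 k p)).integrable_sq.integrableOn
  have cP : ∀ k : Fin n, Tendsto (fun h : ℝ => ∫ z in O₂, ‖P (z + h • ex k) - P z‖ ^ 2)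
      (𝓝[>] 0) (𝓝 0) := fun k => by
    refine squeeze_zero (fun h => integral_nonneg fun z => sq_nonneg _) (fun h => ?_)
      ((tendsto_translate_L2 hs.P_sq (ex k)).mono_left nhdsWithin_le_nhds)
    exact setIntegral_le_integral (iP h k) (ae_of_all _ fun z => sq_nonneg _)
  -- All squared errors are added up, so that one subsequence of step sizes gives almost everywhere
  -- convergence of all quantities at once.
  set err : ℝ → ℝ × Space n → ℝ := fun h z => ((∑ k, ‖dq h (ex k) VP z - Z k z‖ ^ 2) +
    ∑ k, ‖P (z + h • ex k) - P z‖ ^ 2) +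
    ∑ a : Fin N × Fin n, (dq h (ex a.2) (fun z => u z a.1) z - P z a) ^ 2 with herr
  have i1 : ∀ h, Integrable fun z => ∑ k, ‖dq h (ex k) VP z - Z k z‖ ^ 2 := fun h =>
    integrable_finsetSum _ fun k _ => iV h k
  have i2 : ∀ h, Integrable fun z => ∑ k, ‖P (z + h • ex k) - P z‖ ^ 2 := fun h =>
    integrable_finsetSum _ fun k _ => iP h k
  have i3 : ∀ h, Integrable fun z => ∑ a : Fin N × Fin n,
      (dq h (ex a.2) (fun z => u z a.1) z - P z a) ^ 2 := fun h =>
    integrable_finsetSum _ fun k _ => iu h k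
  have ierr : ∀ h, Integrable (err h) := fun h => ((i1 h).add (i2 h)).add (i3 h)
  have herr0 : ∀ h z, 0 ≤ err h z := fun h z => by positivity
  have cerr : Tendsto (fun h : ℝ => ∫ z in O₂, err h z) (𝓝[>] 0) (𝓝 0) := by
    have t1 := tendsto_finsetSum Finset.univ fun k _ => cV' k
    have t2 := tendsto_finsetSum Finset.univ fun k _ => cP k
    have t3 := tendsto_finsetSum Finset.univ fun a _ => cu a
    have t4 := (t1.add t2).add t3
    simp only [Finset.sum_const_zero, add_zero] at t4
    refine t4.congr fun h => ?_
    have j12 : Integrable (fun z => (∑ k, ‖dq h (ex k) VP z - Z k z‖ ^ 2) +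
      ∑ k, ‖P (z + h • ex k) - P z‖ ^ 2) := (i1 h).add (i2 h)
    simp only [herr]
    rw [integral_add j12.integrableOn (i3 h).integrableOn,
      integral_add (i1 h).integrableOn (i2 h).integrableOn,
      integral_finsetSum _ fun k _ => (iV h k).integrableOn,
      integral_finsetSum _ fun k _ => (iP h k).integrableOn,
      integral_finsetSum _ fun a _ => (iu h a).integrableOn]
  set h₀ : ℕ → ℝ := fun m => δ / 8 * (1 / ((m : ℝ) + 1)) with hh₀
  have h₀pos : ∀ m, 0 < h₀ m := fun m => by positivity
  have h₀le : ∀ m, h₀ m ≤ δ / 8 := fun m => by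
    refine mul_le_of_le_one_right (by linarith) ?_
    rw [div_le_one (by positivity)]
    have : (0 : ℝ) ≤ m := by positivity
    linarith
  have h₀t : Tendsto h₀ atTop (𝓝 0) := by
    simpa [hh₀] using tendsto_one_div_add_atTop_nhds_zero_nat.const_mul (δ / 8)
  have h₀t' : Tendsto h₀ atTop (𝓝[>] 0) :=
    tendsto_nhdsWithin_iff.2 ⟨h₀t, Eventually.of_forall h₀pos⟩
  obtain ⟨ns, hns, hae⟩ := exists_subseq_tendsto_of_tendsto_L1 (ν := volume.restrict O₂)
    (f := fun m => err (h₀ m)) (F := fun _ => 0) (fun m => (ierr _).integrableOn)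
    (integrable_zero _ _ _) (by
      refine (cerr.comp h₀t').congr fun m => integral_congr_ae (ae_of_all _ fun z => ?_)
      simp [abs_of_nonneg (herr0 _ _)])
  rw [ae_restrict_iff' o2.measurableSet] at hae
  have ht := h₀t'.comp hns.tendsto_atTop
  refine ⟨O₁, O₂, Z, h₀ ∘ ns, Metric.self_subset_thickening (by linarith) K, o1, o2, s1, s2, b1,
    fun m => h₀pos _, h₀t.comp hns.tendsto_atTop, fun m z hz k s hs' => ?_, ⟨δ / 8, by linarith,
    hreach⟩, ⟨C, δ / 4, by linarith, fun s hs0 hsd k => hb s hs0 hsd.le k⟩, hZmeas, hZsq,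
    fun k => (cV' k).comp ht, fun k => ?_, fun k => ?_, fun a => (cu a).comp ht, fun a => ?_,
    fun k => ?_⟩
  · refine s1 (hreach z hz k s ?_)
    rw [abs_of_nonneg hs'.1]
    exact hs'.2.trans (h₀le _)
  · filter_upwards [hae] with z hz hzO
    rw [tendsto_iff_norm_sub_tendsto_zero]
    have h1 : Tendsto (fun m => ‖dq ((h₀ ∘ ns) m) (ex k) VP z - Z k z‖ ^ 2) atTop (𝓝 0) := by
      refine squeeze_zero (fun m => sq_nonneg _) (fun m => ?_) (hz hzO)
      have := Finset.single_le_sum (f := fun k => ‖dq (h₀ (ns m)) (ex k) VP z - Z k z‖ ^ 2)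
        (fun k _ => sq_nonneg _) (Finset.mem_univ k)
      have p2 : 0 ≤ ∑ k, ‖P (z + h₀ (ns m) • ex k) - P z‖ ^ 2 := by positivity
      have p3 : 0 ≤ ∑ a : Fin N × Fin n,
        (dq (h₀ (ns m)) (ex a.2) (fun z => u z a.1) z - P z a) ^ 2 := by positivity
      simp only [herr, Function.comp_apply]
      linarith
    simpa [Real.sqrt_sq] using h1.sqrt
  · filter_upwards [hae] with z hz hzO
    rw [tendsto_iff_norm_sub_tendsto_zero]
    have h1 : Tendsto (fun m => ‖P (z + (h₀ ∘ ns) m • ex k) - P z‖ ^ 2) atTop (𝓝 0) := by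
      refine squeeze_zero (fun m => sq_nonneg _) (fun m => ?_) (hz hzO)
      have := Finset.single_le_sum (f := fun k => ‖P (z + h₀ (ns m) • ex k) - P z‖ ^ 2)
        (fun k _ => sq_nonneg _) (Finset.mem_univ k)
      have p2 : 0 ≤ ∑ k, ‖dq (h₀ (ns m)) (ex k) VP z - Z k z‖ ^ 2 := by positivity
      have p3 : 0 ≤ ∑ a : Fin N × Fin n,
        (dq (h₀ (ns m)) (ex a.2) (fun z => u z a.1) z - P z a) ^ 2 := by positivity
      simp only [herr, Function.comp_apply]
      linarith
    simpa [Real.sqrt_sq] using h1.sqrt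
  · filter_upwards [hae] with z hz hzO
    rw [tendsto_iff_norm_sub_tendsto_zero]
    have h1 : Tendsto (fun m => (dq ((h₀ ∘ ns) m) (ex a.2) (fun z => u z a.1) z - P z a) ^ 2)
        atTop (𝓝 0) := by
      refine squeeze_zero (fun m => sq_nonneg _) (fun m => ?_) (hz hzO)
      have := Finset.single_le_sum (f := fun a : Fin N × Fin n =>
        (dq (h₀ (ns m)) (ex a.2) (fun z => u z a.1) z - P z a) ^ 2)
        (fun k _ => sq_nonneg _) (Finset.mem_univ a)
      have p2 : 0 ≤ ∑ k, ‖dq (h₀ (ns m)) (ex k) VP z - Z k z‖ ^ 2 := by positivity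
      have p3 : 0 ≤ ∑ k, ‖P (z + h₀ (ns m) • ex k) - P z‖ ^ 2 := by positivity
      simp only [herr, Function.comp_apply]
      linarith
    simpa [Real.sqrt_sq_eq_abs] using h1.sqrt
  -- Boundedness of the difference quotients makes the oscillation of order `h²`; after division by
  -- `h` it is still of order `h`, so the error term of the Caccioppoli inequality disappears in the
  -- limit.
  · have t1 : Tendsto (fun m => C * h₀ (ns m)) atTop (𝓝 0) := by
      simpa using (h₀t.comp hns.tendsto_atTop).const_mul C
    refine squeeze_zero (fun m => mul_nonneg (inv_nonneg.2 (h₀pos _).le)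
      (integral_nonneg fun z => osc_nonneg (h₀pos _).le _ _ _)) (fun m => ?_) t1
    have hp : 0 < h₀ (ns m) := h₀pos _
    have h1 : ∫ z in O₂, osc (h₀ (ns m)) (ex k) VP z ≤ C * h₀ (ns m) ^ 2 := by
      refine setIntegral_osc_le hVm hV hp fun s hs0 hsh => ?_
      simp_rw [norm_sub_sq_eq_dq hs0]
      rw [integral_const_mul, mul_comm C]
      refine mul_le_mul (pow_le_pow_left₀ hs0.le hsh 2) ?_ (integral_nonneg fun z => sq_nonneg _)
        (sq_nonneg _)
      refine le_trans ?_ (hb s hs0 (hsh.trans ((h₀le _).trans (by linarith))) k)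
      exact setIntegral_mono_set (hdqi s k).integrableOn (ae_of_all _ fun z => sq_nonneg _)
        s2.eventuallyLE
    simp only [Function.comp_apply]
    rw [inv_mul_le_iff₀ hp]
    linarith

end Solution

end PhiCaloric
end

/-! ### Derivatives of radial maps and pointwise limits of difference quotients. -/

noncomputable section

namespace PhiCaloric

open Filter Topology

section Radial

variable {F : Type*} [NormedAddCommGroup F] [InnerProductSpace ℝ F]

/-- The differential of `radial τ` at `P ≠ 0`, where `t` is the derivative of `τ` at `|P|`. -/
def radialDeriv (τ : ℝ → ℝ) (t : ℝ) (P : F) : F →L[ℝ] F :=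
  (τ ‖P‖ / ‖P‖) • ContinuousLinearMap.id ℝ F +
    ((t - τ ‖P‖ / ‖P‖) / ‖P‖ ^ 2) • (innerSL ℝ P).smulRight P

lemma radialDeriv_apply (τ : ℝ → ℝ) (t : ℝ) (P X : F) : radialDeriv τ t P X =
    (τ ‖P‖ / ‖P‖) • X + ((t - τ ‖P‖ / ‖P‖) / ‖P‖ ^ 2 * inner ℝ P X) • P := by
  simp [radialDeriv, smul_smul]

lemma hasFDerivAt_norm {P : F} (hP : P ≠ 0) :
    HasFDerivAt (fun Q : F => ‖Q‖) (‖P‖⁻¹ • innerSL ℝ P) P := by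
  have h0 : ‖P‖ ≠ 0 := norm_ne_zero_iff.2 hP
  have h1 := (hasStrictFDerivAt_norm_sq P).hasFDerivAt.sqrt (pow_ne_zero 2 h0)
  have h2 : (fun Q : F => √(‖Q‖ ^ 2)) = fun Q => ‖Q‖ := by
    funext Q; exact Real.sqrt_sq (norm_nonneg Q)
  rw [h2, Real.sqrt_sq (norm_nonneg P)] at h1
  convert h1 using 1
  ext Y
  simp
  field_simp

lemma hasFDerivAt_radial {τ : ℝ → ℝ} {t : ℝ} {P : F} (hP : P ≠ 0) (hτ : HasDerivAt τ t ‖P‖) :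
    HasFDerivAt (radial τ) (radialDeriv τ t P) P := by
  have h0 : ‖P‖ ≠ 0 := norm_ne_zero_iff.2 hP
  have h1 := (hτ.div (hasDerivAt_id ‖P‖) h0).comp_hasFDerivAt P (hasFDerivAt_norm hP)
  have h2 := h1.smul (hasFDerivAt_id P)
  refine HasFDerivAt.congr_fderiv h2 ?_
  ext Y
  rw [radialDeriv_apply]
  simp [smul_smul]
  congr 1
  field_simp

variable {τ : ℝ → ℝ} {t l L : ℝ} {P : F}

/-- The derivative of a radial map acts as `t` in the direction of `P` and as `τ(|P|)/|P|` on its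
orthogonal complement. The assumptions say that the first eigenvalue lies between `l` and `L` times
the second; the lower bound `le_inner_radialDeriv` has the same reason. -/
lemma norm_radialDeriv_le (hP : P ≠ 0) (hl : 0 ≤ l) (hτ : 0 ≤ τ ‖P‖)
    (h1 : l * τ ‖P‖ ≤ t * ‖P‖) (h2 : t * ‖P‖ ≤ L * τ ‖P‖) (X : F) :
    ‖radialDeriv τ t P X‖ ≤ (2 + L) * (τ ‖P‖ / ‖P‖) * ‖X‖ := by
  have h0 : 0 < ‖P‖ := norm_pos_iff.2 hP
  rw [radialDeriv_apply]
  set b := τ ‖P‖ / ‖P‖ with hb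
  have hb0 : 0 ≤ b := div_nonneg hτ h0.le
  have hτb : τ ‖P‖ = b * ‖P‖ := by rw [hb]; field_simp
  have ht0 : 0 ≤ t := by
    have : 0 ≤ t * ‖P‖ := (mul_nonneg hl hτ).trans h1
    exact nonneg_of_mul_nonneg_left this h0
  have htL : t ≤ L * b := by
    rw [hτb, ← mul_assoc] at h2
    exact le_of_mul_le_mul_right h2 h0
  have e1 : |t - b| ≤ (1 + L) * b := by
    rw [abs_le]; constructor <;> nlinarith
  refine (norm_add_le _ _).trans ?_
  rw [norm_smul, norm_smul, Real.norm_of_nonneg hb0, Real.norm_eq_abs, abs_mul, abs_div,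
    abs_of_pos (pow_pos h0 2)]
  have e2 : |t - b| / ‖P‖ ^ 2 * |inner ℝ P X| * ‖P‖ ≤ |t - b| * ‖X‖ := by
    have := abs_real_inner_le_norm P X
    calc _ ≤ |t - b| / ‖P‖ ^ 2 * (‖P‖ * ‖X‖) * ‖P‖ := by gcongr
      _ = _ := by field_simp
  nlinarith [mul_le_mul_of_nonneg_right e1 (norm_nonneg X)]

lemma le_inner_radialDeriv (hP : P ≠ 0) (hτ : 0 ≤ τ ‖P‖)
    (h1 : l * τ ‖P‖ ≤ t * ‖P‖) (X : F) :
    min l 1 * (τ ‖P‖ / ‖P‖) * ‖X‖ ^ 2 ≤ inner ℝ X (radialDeriv τ t P X) := by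
  have h0 : 0 < ‖P‖ := norm_pos_iff.2 hP
  rw [radialDeriv_apply, inner_add_right, real_inner_smul_right, real_inner_smul_right,
    real_inner_self_eq_norm_sq, real_inner_comm P X]
  set b := τ ‖P‖ / ‖P‖ with hb
  have hb0 : 0 ≤ b := div_nonneg hτ h0.le
  have hτb : τ ‖P‖ = b * ‖P‖ := by rw [hb]; field_simp
  have htl : l * b ≤ t := by
    rw [hτb, ← mul_assoc] at h1
    exact le_of_mul_le_mul_right h1 h0
  have hi : (inner ℝ P X) ^ 2 ≤ ‖P‖ ^ 2 * ‖X‖ ^ 2 := by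
    have := abs_real_inner_le_norm P X
    rw [← sq_abs, ← mul_pow]
    exact pow_le_pow_left₀ (abs_nonneg _) this 2
  set i := inner ℝ P X ^ 2 / ‖P‖ ^ 2 with hidef
  have hi0 : 0 ≤ i := by positivity
  have hi1 : i ≤ ‖X‖ ^ 2 := by rw [hidef, div_le_iff₀ (by positivity)]; linarith
  have e : (t - b) / ‖P‖ ^ 2 * inner ℝ P X * inner ℝ P X = (t - b) * i := by
    rw [hidef]; field_simp
  rw [e]
  have hm1 : min l 1 * b ≤ l * b := mul_le_mul_of_nonneg_right (min_le_left _ _) hb0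
  have hm2 : min l 1 * b ≤ 1 * b := mul_le_mul_of_nonneg_right (min_le_right _ _) hb0
  nlinarith [mul_nonneg hi0 (by linarith : 0 ≤ t - min l 1 * b),
    mul_nonneg (by linarith : 0 ≤ ‖X‖ ^ 2 - i) (by linarith : 0 ≤ b - min l 1 * b)]

/-- Recovering difference quotients of the argument from those of the values. -/
lemma tendsto_diffQuot_of_leftInverse {f : F → F} {Lf M : F →L[ℝ] F} (hf : HasFDerivAt f Lf P)
    (hM : ∀ X, M (Lf X) = X) {s : ℕ → ℝ} {y : ℕ → F} {Z : F} (hy : Tendsto y atTop (𝓝 0))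
    (hZ : Tendsto (fun m => (s m)⁻¹ • (f (P + y m) - f P)) atTop (𝓝 Z)) :
    Tendsto (fun m => (s m)⁻¹ • y m) atTop (𝓝 (M Z)) := by
  have h1 : (fun x => f (P + x) - f P - Lf x) =o[𝓝 0] fun x => x :=
    hasFDerivAt_iff_isLittleO_nhds_zero.1 hf
  have h2 : (fun m => f (P + y m) - f P - Lf (y m)) =o[atTop] y := h1.comp_tendsto hy
  -- Applying the left inverse to the first order expansion shows that `y m` equals `M` of the
  -- increment up to a small multiple of `y m`, hence that `y m` is bounded by the increment. Only
  -- then is the remainder negligible after division by `s m`.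
  have h3 : (fun m => M (f (P + y m) - f P) - y m) =o[atTop] y := by
    have := (M.isBigO_comp (fun m => f (P + y m) - f P - Lf (y m)) atTop).trans_isLittleO h2
    simpa [map_sub, hM] using this
  have h4 : y =O[atTop] fun m => f (P + y m) - f P := by
    have h5 : y =O[atTop] fun m => M (f (P + y m) - f P) := by
      simpa using h3.right_isBigO_add
    exact h5.trans (M.isBigO_comp _ _)
  have h7 := h3.trans_isBigO h4
  have h8 : (fun m => (s m)⁻¹ • (M (f (P + y m) - f P) - y m)) =o[atTop]
      fun m => (s m)⁻¹ • (f (P + y m) - f P) :=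
    (Asymptotics.isBigO_refl (fun m => (s m)⁻¹) atTop).smul_isLittleO h7
  have h9 := (Asymptotics.isLittleO_one_iff ℝ).1 (h8.trans_isBigO (hZ.isBigO_one ℝ))
  have h10 := ((M.continuous.tendsto Z).comp hZ).sub h9
  rw [sub_zero] at h10
  refine h10.congr fun m => ?_
  simp [smul_sub]

end Radial

section Profiles

variable {φ : ℝ → ℝ} {c₀ c₁ : ℝ} (hφ : IsOrlicz φ c₀ c₁) (hc₀ : 0 < c₀)

include hφ in
lemma IsOrlicz.nu_pos {t : ℝ} (ht : 0 < t) : 0 < nu φ t :=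
  Real.sqrt_pos.2 (mul_pos (hφ.d_pos ht) ht)

include hφ in
lemma IsOrlicz.hasDerivAt_nu {t : ℝ} (ht : 0 < t) :
    HasDerivAt (nu φ) ((deriv (d φ) t * t + d φ t) / (2 * nu φ t)) t := by
  have h1 := ((hφ.hasDerivAt_d ht).mul (hasDerivAt_id t)).sqrt
    (mul_pos (hφ.d_pos ht) ht).ne'
  have h2 : nu φ = fun y => √(d φ y * y) := rfl
  rw [h2]
  simpa using! h1

include hφ in
lemma IsOrlicz.le_deriv_nu {t : ℝ} (ht : 0 < t) :
    (1 + c₀) / 2 * nu φ t ≤ (deriv (d φ) t * t + d φ t) / (2 * nu φ t) * t ∧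
    (deriv (d φ) t * t + d φ t) / (2 * nu φ t) * t ≤ (1 + c₁) / 2 * nu φ t := by
  have h0 := hφ.nu_pos ht
  have h1 := hφ.lower t ht
  have h2 := hφ.upper t ht
  have h3 := hφ.nu_sq ht.le
  have h4 := mul_le_mul_of_nonneg_right h1 ht.le
  have h5 := mul_le_mul_of_nonneg_right h2 ht.le
  rw [div_mul_eq_mul_div (deriv (d φ) t * t + d φ t)]
  constructor
  · rw [le_div_iff₀ (by positivity)]
    have e : (1 + c₀) / 2 * nu φ t * (2 * nu φ t) = (1 + c₀) * (d φ t * t) := by rw [← h3]; ring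
    rw [e]
    linarith
  · rw [div_le_iff₀ (by positivity)]
    have e : (1 + c₁) / 2 * nu φ t * (2 * nu φ t) = (1 + c₁) * (d φ t * t) := by rw [← h3]; ring
    rw [e]
    linarith

variable {F : Type*} [NormedAddCommGroup F] [InnerProductSpace ℝ F] [FiniteDimensional ℝ F]

include hφ hc₀ in
/-- Convergence of the difference quotients of `P` and `A(P)` where `P ≠ 0`, with the comparison
of their limits to that of `V(P)`. -/
lemma IsOrlicz.exists_tendsto_diffQuot {P : F} (hP : P ≠ 0) {s : ℕ → ℝ}
    {Q : ℕ → F} {Z : F} (hQ : Tendsto Q atTop (𝓝 P))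
    (hZ : Tendsto (fun m => (s m)⁻¹ • (V φ (Q m) - V φ P)) atTop (𝓝 Z)) :
    ∃ X : F, Tendsto (fun m => (s m)⁻¹ • (Q m - P)) atTop (𝓝 X) ∧
      Tendsto (fun m => (s m)⁻¹ • (radial (d φ) (Q m) - radial (d φ) P)) atTop
        (𝓝 (radialDeriv (d φ) (deriv (d φ) ‖P‖) P X)) ∧
      min c₀ 1 * ‖Z‖ ^ 2 ≤ (2 + (1 + c₁) / 2) ^ 2 *
        inner ℝ X (radialDeriv (d φ) (deriv (d φ) ‖P‖) P X) ∧
      ‖radialDeriv (d φ) (deriv (d φ) ‖P‖) P X‖ * ‖P‖ ≤ 2 * (2 + c₁) * (nu φ ‖P‖ * ‖Z‖) := by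
  have h0 : 0 < ‖P‖ := norm_pos_iff.2 hP
  have hν := hφ.nu_pos h0
  have hd := hφ.d_pos h0
  have hc₁ : 0 < c₁ := hc₀.trans_le hφ.c₀_le_c₁
  set t := (deriv (d φ) ‖P‖ * ‖P‖ + d φ ‖P‖) / (2 * nu φ ‖P‖) with ht
  obtain ⟨n1, n2⟩ := hφ.le_deriv_nu h0
  have hV : HasFDerivAt (V φ : F → F) (radialDeriv (nu φ) t P) P :=
    hasFDerivAt_radial hP (hφ.hasDerivAt_nu h0)
  have hA : HasFDerivAt (radial (d φ) : F → F) (radialDeriv (d φ) (deriv (d φ) ‖P‖) P) P :=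
    hasFDerivAt_radial hP (hφ.hasDerivAt_d h0)
  set k := nu φ ‖P‖ / ‖P‖ with hk
  have hk0 : 0 < k := div_pos hν h0
  have hk2 : k ^ 2 = d φ ‖P‖ / ‖P‖ := hφ.nu_div_sq h0.le
  -- The lower growth exponent `(1 + c₀)/2` of `ν` exceeds `1/2`, so the derivative of `V` at `P ≠
  -- 0` expands lengths at least by half of `ν(|P|)/|P|`. It is therefore injective, and limits of
  -- difference quotients of `V` determine those of `P`.
  have hVlow : ∀ X : F, k * ‖X‖ ≤ 2 * ‖radialDeriv (nu φ) t P X‖ := fun X => by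
    have h1 := le_inner_radialDeriv hP hν.le n1 X
    have h2 := real_inner_le_norm X (radialDeriv (nu φ) t P X)
    have h3 : (1 : ℝ) / 2 ≤ min ((1 + c₀) / 2) 1 := le_min (by linarith) (by norm_num)
    rcases (norm_nonneg X).eq_or_lt with h4 | h4
    · rw [← h4]; simp
    · have h5 : 1 / 2 * k * ‖X‖ ^ 2 ≤ ‖X‖ * ‖radialDeriv (nu φ) t P X‖ := by
        refine le_trans ?_ (h1.trans h2)
        gcongr
      nlinarith
  have hinj : LinearMap.ker (radialDeriv (nu φ) t P : F →ₗ[ℝ] F) = ⊥ := by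
    rw [LinearMap.ker_eq_bot']
    intro X hX
    have h1 := hVlow X
    rw [show radialDeriv (nu φ) t P X = 0 from hX, norm_zero, mul_zero] at h1
    exact norm_le_zero_iff.1 (nonpos_of_mul_nonpos_right h1 hk0)
  obtain ⟨M, hM⟩ := LinearMap.exists_leftInverse_of_injective _ hinj
  have hM' : ∀ X, M.toContinuousLinearMap (radialDeriv (nu φ) t P X) = X := fun X =>
    LinearMap.congr_fun hM X
  have hy : Tendsto (fun m => Q m - P) atTop (𝓝 0) := tendsto_sub_nhds_zero_iff.2 hQ
  set X := M.toContinuousLinearMap Z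
  have hX : Tendsto (fun m => (s m)⁻¹ • (Q m - P)) atTop (𝓝 X) :=
    tendsto_diffQuot_of_leftInverse hV hM' hy (by simpa using hZ)
  have hlim : ∀ {f : F → F} {Lf : F →L[ℝ] F}, HasFDerivAt f Lf P →
      Tendsto (fun m => (s m)⁻¹ • (f (Q m) - f P)) atTop (𝓝 (Lf X)) := fun {f Lf} hf => by
    have := (hasFDerivWithinAt_univ.2 hf).lim hy (Eventually.of_forall fun _ => mem_univ _) hX
    simpa using this
  have hZX : radialDeriv (nu φ) t P X = Z := tendsto_nhds_unique (hlim hV) hZ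
  refine ⟨X, hX, hlim hA, ?_, ?_⟩
  · have h1 := norm_radialDeriv_le hP (by positivity) hν.le n1 n2 X
    rw [hZX, ← hk] at h1
    have h2 := le_inner_radialDeriv hP hd.le (hφ.lower _ h0) X
    rw [← hk2] at h2
    have h3 : ‖Z‖ ^ 2 ≤ ((2 + (1 + c₁) / 2) * k * ‖X‖) ^ 2 :=
      pow_le_pow_left₀ (norm_nonneg _) h1 2
    have h4 : 0 ≤ min c₀ 1 := le_min hc₀.le zero_le_one
    calc _ ≤ min c₀ 1 * ((2 + (1 + c₁) / 2) * k * ‖X‖) ^ 2 := mul_le_mul_of_nonneg_left h3 h4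
      _ = (2 + (1 + c₁) / 2) ^ 2 * (min c₀ 1 * k ^ 2 * ‖X‖ ^ 2) := by ring
      _ ≤ _ := mul_le_mul_of_nonneg_left h2 (by positivity)
  · have h1 := norm_radialDeriv_le hP hc₀.le hd.le (hφ.lower _ h0) (hφ.upper _ h0) X
    rw [← hk2] at h1
    have h2 := hVlow X
    rw [hZX] at h2
    have h3 : nu φ ‖P‖ = k * ‖P‖ := by rw [hk]; field_simp
    rw [h3]
    calc _ ≤ (2 + c₁) * k ^ 2 * ‖X‖ * ‖P‖ := mul_le_mul_of_nonneg_right h1 h0.le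
      _ = (2 + c₁) * (k * ‖P‖) * (k * ‖X‖) := by ring
      _ ≤ (2 + c₁) * (k * ‖P‖) * (2 * ‖Z‖) := by gcongr
      _ = _ := by ring

end Profiles

/-! ### Sign of the term produced by the derivative of the truncation. -/

section Truncation

variable {N n : ℕ}

/-- `X k` stands for the `k`-th derivative of the gradient, and `hw`, `hw'` together express the
symmetry of second derivatives contracted with `P`. The sum then equals `b |w|² + β |P w|²`; for `β
< 0` use `|P w|² ≤ |P|² |w|²` and the eigenvalue `b + β|P|² ≥ 0`. -/
lemma truncation_term_nonneg {P : Mat N n} {X : Fin n → Mat N n} {b β : ℝ} (hb : 0 ≤ b)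
    (hβ : 0 ≤ b + β * ‖P‖ ^ 2) {w : Fin n → ℝ} (hw : ∀ j, inner ℝ P (X j) = w j)
    (hw' : ∀ j, ∑ a : Fin N × Fin n, P a * X a.2 (a.1, j) = w j) :
    0 ≤ ∑ a : Fin N × Fin n, ∑ j, (b • X a.2 + (β * inner ℝ P (X a.2)) • P) (a.1, j) *
      (P a * w j) := by
  have e1 : ∑ a : Fin N × Fin n, ∑ j, (b • X a.2 + (β * inner ℝ P (X a.2)) • P) (a.1, j) *
      (P a * w j) = b * (∑ j, w j ^ 2) + β * ∑ i, (∑ j, P (i, j) * w j) ^ 2 := by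
    have t1 : ∑ j, w j ^ 2 = ∑ a : Fin N × Fin n, ∑ j, X a.2 (a.1, j) * (P a * w j) := by
      rw [Finset.sum_comm]
      refine Finset.sum_congr rfl fun j _ => ?_
      rw [pow_two, ← hw' j, Finset.sum_mul, hw' j]
      exact Finset.sum_congr rfl fun a _ => by ring
    have t2 : ∑ i, (∑ j, P (i, j) * w j) ^ 2 =
        ∑ a : Fin N × Fin n, ∑ j, w a.2 * P (a.1, j) * (P a * w j) := by
      rw [Fintype.sum_prod_type]
      refine Finset.sum_congr rfl fun i _ => ?_
      rw [pow_two, Finset.sum_mul_sum]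
      exact Finset.sum_congr rfl fun k _ => Finset.sum_congr rfl fun j _ => by ring
    rw [t1, t2, Finset.mul_sum, Finset.mul_sum, ← Finset.sum_add_distrib]
    refine Finset.sum_congr rfl fun a _ => ?_
    rw [Finset.mul_sum, Finset.mul_sum, ← Finset.sum_add_distrib]
    refine Finset.sum_congr rfl fun j _ => ?_
    simp only [PiLp.add_apply, PiLp.smul_apply, smul_eq_mul, hw]
    ring
  rw [e1]
  have s0 : 0 ≤ ∑ j, w j ^ 2 := Finset.sum_nonneg fun _ _ => sq_nonneg _
  have s1 : 0 ≤ ∑ i, (∑ j, P (i, j) * w j) ^ 2 := Finset.sum_nonneg fun _ _ => sq_nonneg _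
  have s2 : ∑ i, (∑ j, P (i, j) * w j) ^ 2 ≤ ‖P‖ ^ 2 * ∑ j, w j ^ 2 := by
    rw [EuclideanSpace.real_norm_sq_eq, Fintype.sum_prod_type, Finset.sum_mul]
    exact Finset.sum_le_sum fun i _ => Finset.sum_mul_sq_le_sq_mul_sq _ _ _
  rcases le_total 0 β with h | h
  · positivity
  · nlinarith [mul_nonneg hβ s0, mul_le_mul_of_nonneg_left s2 (neg_nonneg.2 h)]

lemma norm_tensor_le (P : Mat N n) (k : Fin n) (θ' : Fin n → ℝ) :
    ‖(WithLp.toLp 2 fun p : Fin N × Fin n => P (p.1, k) * θ' p.2 : Mat N n)‖ ≤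
      ‖P‖ * ‖(WithLp.toLp 2 θ' : Space n)‖ := by
  refine abs_le_of_sq_le_sq' ?_ (by positivity) |>.2
  rw [mul_pow, EuclideanSpace.real_norm_sq_eq, EuclideanSpace.real_norm_sq_eq,
    EuclideanSpace.real_norm_sq_eq]
  simp only [Fintype.sum_prod_type, mul_pow]
  rw [← Finset.sum_mul_sum]
  refine mul_le_mul_of_nonneg_right ?_ (Finset.sum_nonneg fun _ _ => sq_nonneg _)
  refine Finset.sum_le_sum fun i _ => ?_
  exact Finset.single_le_sum (f := fun k => P (i, k) ^ 2) (fun _ _ => sq_nonneg _)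
    (Finset.mem_univ k)

/-- The limit integrand, estimated from below. -/
lemma le_testIntegrand_radialDeriv {P : Mat N n} {X : Fin n → Mat N n} {κ τ : ℝ → ℝ} {t θ : ℝ}
    {θ' : Fin n → ℝ} (hP : P ≠ 0) (hτ : 0 ≤ τ ‖P‖) (ht : 0 ≤ t) (hθ : 0 ≤ θ)
    (hκ : 0 ≤ κ (‖P‖ ^ 2)) (hκ' : 0 ≤ deriv κ (‖P‖ ^ 2))
    (hsym : ∀ j, deriv κ (‖P‖ ^ 2) * (2 * ∑ a : Fin N × Fin n, P a * X a.2 (a.1, j)) =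
      deriv κ (‖P‖ ^ 2) * (2 * inner ℝ P (X j))) :
    κ (‖P‖ ^ 2) * (θ * ∑ k, inner ℝ (X k) (radialDeriv τ t P (X k)) -
      (∑ k, ‖radialDeriv τ t P (X k)‖) * (‖P‖ * ‖(WithLp.toLp 2 θ' : Space n)‖)) ≤
    testIntegrand κ (fun a => P a) (fun a j => X a.2 (a.1, j))
      (fun a j => radialDeriv τ t P (X a.2) (a.1, j)) θ θ' := by
  have h0 : 0 < ‖P‖ := norm_pos_iff.2 hP
  set Y := fun k => radialDeriv τ t P (X k) with hY
  have hs : sumSq (fun a => P a) = ‖P‖ ^ 2 := by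
    rw [EuclideanSpace.real_norm_sq_eq]; rfl
  set s := ‖P‖ ^ 2 with hsdef
  set w : Fin n → ℝ := fun j => ∑ a : Fin N × Fin n, P a * X a.2 (a.1, j) with hw
  set Tn : Fin n → Mat N n := fun k => WithLp.toLp 2 fun p => P (p.1, k) * θ' p.2 with hTn
  have e : testIntegrand κ (fun a => P a) (fun a j => X a.2 (a.1, j))
      (fun a j => Y a.2 (a.1, j)) θ θ' =
      κ s * θ * (∑ a : Fin N × Fin n, ∑ j, X a.2 (a.1, j) * Y a.2 (a.1, j)) +
      2 * deriv κ s * θ * (∑ a : Fin N × Fin n, ∑ j, Y a.2 (a.1, j) * (P a * w j)) +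
      κ s * (∑ a : Fin N × Fin n, ∑ j, Tn a.2 (a.1, j) * Y a.2 (a.1, j)) := by
    simp only [testIntegrand, hs, Finset.mul_sum, ← Finset.sum_add_distrib]
    refine Finset.sum_congr rfl fun a _ => Finset.sum_congr rfl fun j _ => ?_
    simp only [hTn, hw, ← Finset.mul_sum]
    ring
  have hT2 : 0 ≤ 2 * deriv κ s * θ *
      (∑ a : Fin N × Fin n, ∑ j, Y a.2 (a.1, j) * (P a * w j)) := by
    -- Symmetry is assumed only after multiplication by `κ'`; where `κ'` vanishes the term vanishes
    -- as well, and elsewhere the factor can be cancelled.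
    rcases hκ'.eq_or_lt with h | h
    · rw [← h]; simp
    · refine mul_nonneg (by positivity) ?_
      simp only [hY, radialDeriv_apply]
      refine truncation_term_nonneg (div_nonneg hτ h0.le) ?_ (w := w) (fun j => ?_) fun j => rfl
      · have : τ ‖P‖ / ‖P‖ + (t - τ ‖P‖ / ‖P‖) / ‖P‖ ^ 2 * ‖P‖ ^ 2 = t := by field_simp; ring
        rwa [this]
      · have := hsym j
        have h2 := mul_left_cancel₀ h.ne' this
        linarith
  have hT3 : -((∑ k, ‖Y k‖) * (‖P‖ * ‖(WithLp.toLp 2 θ' : Space n)‖)) ≤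
      ∑ a : Fin N × Fin n, ∑ j, Tn a.2 (a.1, j) * Y a.2 (a.1, j) := by
    rw [Solution.sum_mul_eq_sum_inner Tn Y, Finset.sum_mul, ← Finset.sum_neg_distrib]
    refine Finset.sum_le_sum fun k _ => ?_
    have h1 := abs_real_inner_le_norm (Tn k) (Y k)
    have h2 := mul_le_mul_of_nonneg_right (norm_tensor_le P k θ') (norm_nonneg (Y k))
    have h3 := neg_abs_le (inner ℝ (Tn k) (Y k))
    linarith
  change _ ≤ testIntegrand κ (fun a => P a) (fun a j => X a.2 (a.1, j))
      (fun a j => Y a.2 (a.1, j)) θ θ'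
  rw [e, Solution.sum_mul_eq_sum_inner X Y]
  nlinarith [mul_le_mul_of_nonneg_left hT3 hκ]

end Truncation

end PhiCaloric
end

/-! ### Majorants that converge in `L¹` as the step size tends to zero. -/

noncomputable section

namespace PhiCaloric

open Filter Topology

/-- Convergence in `L¹` of a sequence of integrable functions. -/
structure TendstoL1 {α : Type*} [MeasurableSpace α] (ν : Measure α) (f : ℕ → α → ℝ) (F : α → ℝ) :
    Prop where
  int : ∀ m, Integrable (f m) ν
  int_lim : Integrable F ν
  tendsto : Tendsto (fun m => ∫ z, |f m z - F z| ∂ν) atTop (𝓝 0)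

namespace TendstoL1

variable {α : Type*} [MeasurableSpace α] {ν : Measure α} {f g : ℕ → α → ℝ} {F G : α → ℝ}

lemma add (hf : TendstoL1 ν f F) (hg : TendstoL1 ν g G) :
    TendstoL1 ν (fun m z => f m z + g m z) (fun z => F z + G z) where
  int m := (hf.int m).add (hg.int m)
  int_lim := hf.int_lim.add hg.int_lim
  tendsto := by
    have i1 : ∀ m, Integrable (fun z => |f m z - F z|) ν := fun m =>
      ((hf.int m).sub hf.int_lim).abs
    have i2 : ∀ m, Integrable (fun z => |g m z - G z|) ν := fun m =>
      ((hg.int m).sub hg.int_lim).abs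
    refine squeeze_zero (fun m => integral_nonneg fun z => abs_nonneg _) (fun m => ?_)
      (by simpa using hf.tendsto.add hg.tendsto)
    rw [← integral_add (i1 m) (i2 m)]
    refine integral_mono_of_nonneg (ae_of_all _ fun z => abs_nonneg _) ((i1 m).add (i2 m))
      (ae_of_all _ fun z => ?_)
    beta_reduce
    rw [add_sub_add_comm]
    exact abs_add_le _ _

lemma const (hF : Integrable F ν) : TendstoL1 ν (fun _ => F) F where
  int _ := hF
  int_lim := hF
  tendsto := by simp

lemma finsetSum {ι : Type*} {s : Finset ι} {f : ι → ℕ → α → ℝ} {F : ι → α → ℝ}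
    (h : ∀ i, TendstoL1 ν (f i) (F i)) :
    TendstoL1 ν (fun m z => ∑ i ∈ s, f i m z) (fun z => ∑ i ∈ s, F i z) := by
  classical
  induction s using Finset.induction_on with
  | empty =>
    simp only [Finset.sum_empty]
    exact TendstoL1.const (integrable_zero α ℝ ν)
  | insert a s ha ih => simpa only [Finset.sum_insert ha] using (h a).add ih

lemma const_mul (c : ℝ) (hf : TendstoL1 ν f F) :
    TendstoL1 ν (fun m z => c * f m z) (fun z => c * F z) where
  int m := (hf.int m).const_mul c
  int_lim := hf.int_lim.const_mul c
  tendsto := by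
    have := hf.tendsto.const_mul |c|
    simpa only [← integral_const_mul, ← abs_mul, mul_sub, mul_zero] using this

lemma of_norm {E : Type*} [NormedAddCommGroup E] {f : ℕ → α → E} {F : α → E}
    (hf : ∀ m, Integrable (f m) ν) (hF : Integrable F ν)
    (h : Tendsto (fun m => ∫ z, ‖f m z - F z‖ ∂ν) atTop (𝓝 0)) :
    TendstoL1 ν (fun m z => ‖f m z‖) (fun z => ‖F z‖) where
  int m := (hf m).norm
  int_lim := hF.norm
  tendsto := squeeze_zero (fun _ => integral_nonneg fun _ => abs_nonneg _) (fun m =>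
    integral_mono_of_nonneg (ae_of_all _ fun _ => abs_nonneg _) ((hf m).sub hF).norm
      (ae_of_all _ fun _ => abs_norm_sub_norm_le _ _)) h

/-- From `||f|² - |F|²| ≤ (1 + 1/t)|f - F|² + t|F|²`, with a weight `t` that tends to zero like the
`L²` distance. -/
lemma norm_sq {E : Type*} [NormedAddCommGroup E] {f : ℕ → α → E} {F : α → E}
    (hf : ∀ m, MemLp (f m) 2 ν) (hF : MemLp F 2 ν)
    (h : Tendsto (fun m => ∫ z, ‖f m z - F z‖ ^ 2 ∂ν) atTop (𝓝 0)) :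
    TendstoL1 ν (fun m z => ‖f m z‖ ^ 2) (fun z => ‖F z‖ ^ 2) where
  int m := (hf m).integrable_norm_pow two_ne_zero
  int_lim := hF.integrable_norm_pow two_ne_zero
  tendsto := by
    set Δ : ℕ → ℝ := fun m => ∫ z, ‖f m z - F z‖ ^ 2 ∂ν with hΔ
    have hΔ0 : ∀ m, 0 ≤ Δ m := fun m => integral_nonneg fun z => sq_nonneg _
    have iΔ : ∀ m, Integrable (fun z => ‖f m z - F z‖ ^ 2) ν := fun m =>
      ((hf m).sub hF).integrable_norm_pow two_ne_zero
    have iF : Integrable (fun z => ‖F z‖ ^ 2) ν := hF.integrable_norm_pow two_ne_zero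
    -- The summand `1/(m+1)` keeps the weight positive when `Δ m = 0`.
    set t : ℕ → ℝ := fun m => √(Δ m) + 1 / ((m : ℝ) + 1) with ht
    have ht0 : ∀ m, 0 < t m := fun m => by positivity
    have htt : Tendsto t atTop (𝓝 0) := by
      simpa [ht] using h.sqrt.add tendsto_one_div_add_atTop_nhds_zero_nat
    have hlim : Tendsto (fun m => Δ m + √(Δ m) + t m * ∫ z, ‖F z‖ ^ 2 ∂ν) atTop (𝓝 0) := by
      simpa using (h.add h.sqrt).add (htt.mul_const _)
    refine squeeze_zero (fun m => integral_nonneg fun z => abs_nonneg _) (fun m => ?_) hlim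
    have hpt : ∀ z, |‖f m z‖ ^ 2 - ‖F z‖ ^ 2| ≤
        (1 + (t m)⁻¹) * ‖f m z - F z‖ ^ 2 + t m * ‖F z‖ ^ 2 := by
      intro z
      have h1 := abs_norm_sub_norm_le (f m z) (F z)
      have h2 : ‖f m z‖ + ‖F z‖ ≤ ‖f m z - F z‖ + 2 * ‖F z‖ := by
        have := norm_le_norm_sub_add (f m z) (F z)
        linarith
      rw [sq_sub_sq, abs_mul, abs_of_nonneg (by positivity : 0 ≤ ‖f m z‖ + ‖F z‖)]
      set a := ‖f m z - F z‖
      set b := ‖F z‖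
      have h3 : (‖f m z‖ + b) * |‖f m z‖ - b| ≤ (a + 2 * b) * a := by gcongr
      have h4 : 0 ≤ (t m)⁻¹ * (a - t m * b) ^ 2 := mul_nonneg (inv_nonneg.2 (ht0 m).le) (sq_nonneg _)
      have h5 : (t m)⁻¹ * (a - t m * b) ^ 2 = (t m)⁻¹ * a ^ 2 - 2 * a * b + t m * b ^ 2 := by
        have := (ht0 m).ne'
        field_simp
        ring
      nlinarith
    have hI : Integrable (fun z => (1 + (t m)⁻¹) * ‖f m z - F z‖ ^ 2 + t m * ‖F z‖ ^ 2) ν :=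
      ((iΔ m).const_mul _).add (iF.const_mul _)
    refine (integral_mono_of_nonneg (ae_of_all _ fun z => abs_nonneg _) hI
      (ae_of_all _ hpt)).trans ?_
    rw [integral_add ((iΔ m).const_mul _) (iF.const_mul _), integral_const_mul,
      integral_const_mul]
    have h6 : (t m)⁻¹ * Δ m ≤ √(Δ m) := by
      rw [inv_mul_le_iff₀ (ht0 m)]
      have h7 := Real.mul_self_sqrt (hΔ0 m)
      have h8 : 0 ≤ 1 / ((m : ℝ) + 1) := by positivity
      nlinarith [Real.sqrt_nonneg (Δ m)]
    have h9 : (1 + (t m)⁻¹) * Δ m = Δ m + (t m)⁻¹ * Δ m := by ring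
    change (1 + (t m)⁻¹) * Δ m + _ ≤ _
    rw [h9]
    linarith

end TendstoL1

namespace Solution

variable {N n : ℕ} {φ : ℝ → ℝ} {c₀ c₁ : ℝ} {O O₁ O₂ : Set (ℝ × Space n)}
  {u : ℝ × Space n → Space N} {P : ℝ × Space n → Mat N n} {Z : Fin n → ℝ × Space n → Mat N n}
  {h : ℕ → ℝ}

/-- The majorant of all nonlinear expressions in the difference quotients. -/
def mjr (φ : ℝ → ℝ) (P : ℝ × Space n → Mat N n) (h : ℝ) (z : ℝ × Space n) : ℝ :=
  ∑ k : Fin n, (‖dq h (ex k) (fun z => V φ (P z)) z‖ ^ 2 + (en φ (P z) + en φ (P (z + h • ex k))) +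
    (‖P z‖ + ‖P (z + h • ex k)‖) + h⁻¹ * osc h (ex k) (fun z => V φ (P z)) z)

/-- The limit of the majorants. -/
def mjrLim (φ : ℝ → ℝ) (P : ℝ × Space n → Mat N n) (Z : Fin n → ℝ × Space n → Mat N n)
    (z : ℝ × Space n) : ℝ :=
  ∑ k : Fin n, (‖Z k z‖ ^ 2 + (en φ (P z) + en φ (P z)) + (‖P z‖ + ‖P z‖) + 0)

variable (hφ : IsOrlicz φ c₀ c₁) (hc₀ : 0 < c₀) (hs : Solution φ O u P)
  (hr : Regular φ O O₁ O₂ u P Z h)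

lemma tendstoL1_translate {f : ℝ × Space n → ℝ} (hf : Integrable f) (h0 : ∀ z, 0 ≤ f z)
    (ht : Tendsto h atTop (𝓝 0)) (A : Set (ℝ × Space n)) (e : ℝ × Space n) :
    TendstoL1 (volume.restrict A) (fun m z => f (z + h m • e)) f := by
  have := TendstoL1.of_norm (ν := volume.restrict A) (f := fun m z => f (z + h m • e)) (F := f)
    (fun m => (integrable_translate hf _).integrableOn) hf.integrableOn (by
      refine squeeze_zero (fun m => integral_nonneg fun z => norm_nonneg _) (fun m => ?_)
        ((tendsto_translate_L1 hf e).comp ht)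
      exact setIntegral_le_integral ((integrable_translate hf _).sub hf).norm
        (ae_of_all _ fun z => norm_nonneg _))
  simpa only [Real.norm_of_nonneg (h0 _)] using this

include hφ hc₀ hs hr in
-- The squares of the difference quotients of `V` converge in `L¹` by their strong `L²` convergence,
-- the translated terms by continuity of translations, and the oscillation term tends to `0` by the
-- regularity already obtained.
lemma tendstoL1_mjr : TendstoL1 (volume.restrict O₂) (fun m => mjr φ P (h m)) (mjrLim φ P Z) := by
  have hV := memLp_V hφ hc₀ hs
  refine TendstoL1.finsetSum fun k => ((TendstoL1.norm_sq
    (fun m => (memLp_dq hV (h m) (ex k)).restrict _) ((hr.Z_sq k).restrict _) (hr.V_L2 k)).add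
    ((TendstoL1.const hs.energy.integrableOn).add (tendstoL1_translate hs.energy
      (fun z => en_nonneg hφ _) hr.h_tendsto _ _))).add
    ((TendstoL1.const hs.P_int.norm.integrableOn).add (tendstoL1_translate hs.P_int.norm
      (fun z => norm_nonneg _) hr.h_tendsto _ _)) |>.add ?_
  have hi := integrable_osc (measurable_VP hφ hs) hV
  refine ⟨fun m => ((hi (h m) (ex k)).const_mul _).integrableOn, integrable_zero _ _ _, ?_⟩
  refine (hr.osc_tendsto k).congr fun m => ?_
  rw [← integral_const_mul]
  refine integral_congr_ae (ae_of_all _ fun z => ?_)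
  simp only [sub_zero]
  rw [abs_of_nonneg (mul_nonneg (inv_nonneg.2 (hr.h_pos m).le)
    (osc_nonneg (hr.h_pos m).le _ _ _))]

include hφ in
lemma mjr_term_nonneg {s : ℝ} (hs : 0 < s) (z : ℝ × Space n) (k : Fin n) :
    0 ≤ ‖dq s (ex k) (fun z => V φ (P z)) z‖ ^ 2 ∧ 0 ≤ en φ (P z) + en φ (P (z + s • ex k)) ∧
    0 ≤ ‖P z‖ + ‖P (z + s • ex k)‖ ∧ 0 ≤ s⁻¹ * osc s (ex k) (fun z => V φ (P z)) z :=
  ⟨sq_nonneg _, add_nonneg (en_nonneg hφ _) (en_nonneg hφ _), by positivity,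
    mul_nonneg (by positivity) (osc_nonneg hs.le _ _ _)⟩

include hφ in
lemma le_mjr {s : ℝ} (hs : 0 < s) (z : ℝ × Space n) (k : Fin n) :
    ‖dq s (ex k) (fun z => V φ (P z)) z‖ ^ 2 + (en φ (P z) + en φ (P (z + s • ex k))) +
      (‖P z‖ + ‖P (z + s • ex k)‖) + s⁻¹ * osc s (ex k) (fun z => V φ (P z)) z ≤ mjr φ P s z :=
  Finset.single_le_sum (f := fun k => ‖dq s (ex k) (fun z => V φ (P z)) z‖ ^ 2 +
    (en φ (P z) + en φ (P (z + s • ex k))) +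
    (‖P z‖ + ‖P (z + s • ex k)‖) + s⁻¹ * osc s (ex k) (fun z => V φ (P z)) z)
    (fun k _ => by
      obtain ⟨h1, h2, h3, h4⟩ := mjr_term_nonneg hφ (P := P) hs z k
      positivity) (Finset.mem_univ k)

include hφ in
lemma mjr_nonneg {s : ℝ} (hs : 0 < s) (z : ℝ × Space n) : 0 ≤ mjr φ P s z :=
  Finset.sum_nonneg fun k _ => by
    obtain ⟨h1, h2, h3, h4⟩ := mjr_term_nonneg hφ (P := P) hs z k
    positivity

lemma norm_dq {F : Type*} [NormedAddCommGroup F] [NormedSpace ℝ F] {s : ℝ} (hs : 0 < s)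
    (e : ℝ × Space n) (f : ℝ × Space n → F) (z : ℝ × Space n) :
    ‖dq s e f z‖ = s⁻¹ * ‖f (z + s • e) - f z‖ := by
  rw [dq, norm_smul, Real.norm_of_nonneg (by positivity)]

include hφ hc₀ in
-- The inequality for increments of `A` and `V` with a common base point, divided by the square of
-- the step. It dominates the coercive term and the term with `κ'`.
lemma exists_dq_A_mul_dq_P_le : ∃ C, 0 < C ∧ ∀ s, 0 < s → ∀ (z : ℝ × Space n) (k l : Fin n),
    ‖dq s (ex k) (fun z => A φ (P z)) z‖ * ‖dq s (ex l) P z‖ ≤ C * mjr φ P s z := by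
  obtain ⟨C, hC, h1⟩ := hφ.exists_norm_A_mul_norm_le (F := Mat N n) hc₀
  refine ⟨C * 2, by positivity, fun s hs z k l => ?_⟩
  have h2 := h1 (P z) (P (z + s • ex k)) (P (z + s • ex l))
  have h3 := le_mjr hφ (P := P) hs z k
  have h4 := le_mjr hφ (P := P) hs z l
  obtain ⟨a1, a2, a3, a4⟩ := mjr_term_nonneg hφ (P := P) hs z k
  obtain ⟨b1, b2, b3, b4⟩ := mjr_term_nonneg hφ (P := P) hs z l
  have h5 := mul_le_mul_of_nonneg_left h2 (sq_nonneg s⁻¹)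
  have h6 : ‖dq s (ex k) (fun z => A φ (P z)) z‖ * ‖dq s (ex l) P z‖ ≤
      C * (‖dq s (ex k) (fun z => V φ (P z)) z‖ ^ 2 +
        ‖dq s (ex l) (fun z => V φ (P z)) z‖ ^ 2) := by
    simp only [norm_dq hs, A_eq_radial]
    refine le_trans (le_of_eq ?_) (h5.trans (le_of_eq ?_)) <;> ring
  refine h6.trans ?_
  rw [mul_assoc]
  exact mul_le_mul_of_nonneg_left (by linarith) hC.le

include hφ hc₀ hs hr in
-- In the earlier bound, split `coef(t) |D_h P| t`, where `t = |P(z)| + |P(z + h e_k)|`, into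
-- `coef(t) |D_h P|²`, comparable with `|D_h V|²`, and `coef(t) t²`, bounded by the energies at the
-- two end points.
lemma exists_dq_A_mul_dq_u_le (hO : IsOpen O) : ∃ C, 0 < C ∧ ∀ m, ∀ᵐ z, z ∈ O₂ →
    ∀ (k : Fin n) (b : Fin N × Fin n),
    ‖dq (h m) (ex k) (fun z => A φ (P z)) z‖ * |dq (h m) (ex b.2) (fun z => u z b.1) z| ≤
      C * mjr φ P (h m) z := by
  obtain ⟨C₁, hC₁, h1⟩ := exists_abs_A_mul_abs_u_le (O' := O₂) hφ hc₀ hs hO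
  obtain ⟨C₂, hC₂, h2⟩ := hφ.exists_coef_mul_le_norm_V (F := Mat N n) hc₀
  refine ⟨C₁ * (C₂ + 2 * 2 ^ c₁ + 1), by positivity, fun m => ?_⟩
  have hp := hr.h_pos m
  filter_upwards [h1 (h m) hp (hr.seg m)] with z hz hzO k b
  refine (hz hzO k b).trans ?_
  rw [mul_assoc C₁]
  refine mul_le_mul_of_nonneg_left ?_ hC₁.le
  set s := h m
  set t := ‖P z‖ + ‖P (z + s • ex k)‖ with ht
  have h3 := le_mjr hφ (P := P) hp z k
  have h4 := le_mjr hφ (P := P) hp z b.2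
  obtain ⟨a1, a2, a3, a4⟩ := mjr_term_nonneg hφ (P := P) hp z k
  obtain ⟨b1, b2, b3, b4⟩ := mjr_term_nonneg hφ (P := P) hp z b.2
  have hcoef := hφ.coef_nonneg (by positivity : 0 ≤ t)
  have e1 : coef φ t * ‖dq s (ex k) P z‖ ^ 2 ≤
      C₂ * ‖dq s (ex k) (fun z => V φ (P z)) z‖ ^ 2 := by
    have := mul_le_mul_of_nonneg_left (h2 (P (z + s • ex k)) (P z)) (sq_nonneg s⁻¹)
    rw [add_comm ‖P (z + s • ex k)‖] at this
    simp only [norm_dq hp]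
    refine le_trans (le_of_eq ?_) (this.trans (le_of_eq ?_)) <;> ring
  have e2 : coef φ t * t ^ 2 ≤ 2 * 2 ^ c₁ * (en φ (P z) + en φ (P (z + s • ex k))) := by
    have := hφ.d_add_mul_le hc₀ (norm_nonneg (P z)) (norm_nonneg (P (z + s • ex k)))
    rw [pow_two, ← mul_assoc, hφ.coef_mul]
    exact this
  have e3 : coef φ t * ‖dq s (ex k) P z‖ * t ≤
      coef φ t * ‖dq s (ex k) P z‖ ^ 2 + coef φ t * t ^ 2 := by
    nlinarith [mul_nonneg hcoef (sq_nonneg (‖dq s (ex k) P z‖ - t)),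
      mul_nonneg hcoef (sq_nonneg ‖dq s (ex k) P z‖), mul_nonneg hcoef (sq_nonneg t)]
  have hM := mjr_nonneg hφ (P := P) hp z
  have e4 := mul_le_mul_of_nonneg_left
    (by linarith : ‖dq s (ex k) (fun z => V φ (P z)) z‖ ^ 2 ≤ mjr φ P s z) hC₂.le
  have e5 := mul_le_mul_of_nonneg_left
    (by linarith : en φ (P z) + en φ (P (z + s • ex k)) ≤ mjr φ P s z)
    (by positivity : (0 : ℝ) ≤ 2 * 2 ^ c₁)
  nlinarith

include hφ hc₀ in
lemma exists_dq_P_le {γ : ℝ} (hγ : 0 < γ) : ∃ C, 0 < C ∧ ∀ s, 0 < s →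
    ∀ (z : ℝ × Space n) (k : Fin n), γ ≤ ‖P z‖ + ‖P (z + s • ex k)‖ →
      ‖dq s (ex k) P z‖ ≤ C * mjr φ P s z := by
  obtain ⟨C, hC, h1⟩ := hφ.exists_norm_sub_div_le (F := Mat N n) hc₀ hγ
  refine ⟨1 + C, by positivity, fun s hs z k hγz => ?_⟩
  have h2 := h1 (P z) (P (z + s • ex k)) hγz s hs
  have h3 := le_mjr hφ (P := P) hs z k
  obtain ⟨a1, a2, a3, a4⟩ := mjr_term_nonneg hφ (P := P) hs z k
  have hM := mjr_nonneg hφ (P := P) hs z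
  rw [div_eq_inv_mul, div_eq_inv_mul, ← norm_dq hs, ← norm_dq hs (f := fun z => V φ (P z))] at h2
  have e4 := mul_le_mul_of_nonneg_left
    (by linarith : ‖dq s (ex k) (fun z => V φ (P z)) z‖ ^ 2 ≤ mjr φ P s z) hC.le
  nlinarith

include hφ hc₀ hs hr in
-- On the set where the truncation of `|D_h u|²` is active, `D_h P` must be dominated even if `P` is
-- small at both ends of the segment. In that case `D_h u`, an average of values of `P`, is large,
-- so `V(P)` oscillates along some segment by a fixed amount; then `h⁻¹ osc` is of order at least
-- `h⁻¹`, which exceeds a multiple of `|D_h P|`.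
lemma exists_dq_P_le_of_lt_sumSq (hO : IsOpen O) {γ : ℝ} (hγ : 0 < γ) : ∃ C, 0 < C ∧ ∀ m, ∀ᵐ z,
    z ∈ O₂ → γ ^ 2 < sumSq (fun a => W u O₂ (h m) a z) → ∀ k : Fin n,
      ‖dq (h m) (ex k) P z‖ ≤ C * mjr φ P (h m) z := by
  -- Small enough that `∑ |D_h u|² > γ²` forces one of the `N n` entries to exceed `γ₁`; the `+ 1`
  -- avoids division by zero.
  set γ₁ := γ / (N * n + 1) with hγ₁
  have hγ₁0 : 0 < γ₁ := by positivity
  obtain ⟨C₁, hC₁, h1⟩ := exists_dq_P_le (P := P) hφ hc₀ (by positivity : 0 < γ₁ / 4)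
  obtain ⟨C₂, hC₂, h2⟩ := hφ.exists_norm_le_of_small (F := Mat N n) hc₀
    (by positivity : 0 < γ₁ / 4)
  refine ⟨C₁ + C₂, by positivity, fun m => ?_⟩
  have hall := ae_all_iff.2 fun b => ae_abs_dq_le hs hO (hr.h_pos m) (hr.seg m) b
  have hP := ae_all_iff.2 fun k : Fin n =>
    ae_integrableOn_segment hs.P_meas.norm hs.P_int.norm (h m) (ex k)
  have hV := ae_all_iff.2 fun k : Fin n =>
    ae_integrableOn_segment_sub_sq (measurable_VP hφ hs) (memLp_V hφ hc₀ hs) (h m) (ex k)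
  filter_upwards [hall, hP, hV] with z hz hzP hzV hzO hlt k
  have hp := hr.h_pos m
  set s := h m
  have hM := mjr_nonneg hφ (P := P) hp z
  have hs1 : 0 < s⁻¹ := inv_pos.2 hp
  rcases le_or_gt (γ₁ / 4) (‖P z‖ + ‖P (z + s • ex k)‖) with hc | hc
  · refine (h1 s hp z k hc).trans (mul_le_mul_of_nonneg_right (by linarith) hM)
  obtain ⟨b, hb⟩ : ∃ b : Fin N × Fin n, γ₁ < |dq s (ex b.2) (fun z => u z b.1) z| := by
    by_contra! hcon
    have : sumSq (fun a => W u O₂ s a z) ≤ ∑ a : Fin N × Fin n, γ₁ ^ 2 := by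
      refine Finset.sum_le_sum fun a _ => ?_
      simp only [W, indicator_of_mem hzO]
      exact sq_le_sq' (abs_le.1 (hcon a)).1 (abs_le.1 (hcon a)).2
    simp only [Finset.sum_const, Finset.card_univ, Fintype.card_prod, Fintype.card_fin,
      nsmul_eq_mul, Nat.cast_mul] at this
    have h5 : (N * n : ℝ) * γ₁ ^ 2 ≤ γ ^ 2 := by
      have hx : (0 : ℝ) ≤ N * n := by positivity
      have hγe : γ = γ₁ * (N * n + 1) := by rw [hγ₁]; field_simp
      rw [hγe, mul_pow]
      nlinarith [sq_nonneg γ₁, mul_nonneg hx (sq_nonneg γ₁)]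
    linarith
  have hPz : ‖P z‖ ≤ γ₁ / 4 := by linarith [norm_nonneg (P (z + s • ex k))]
  have h6 : segAvg s (ex b.2) (fun z => ‖P z‖) z ≤ 2 * (γ₁ / 4) +
      C₂ * osc s (ex b.2) (fun z => V φ (P z)) z := by
    have e : 2 * (γ₁ / 4) = s⁻¹ * ∫ t in Ioc 0 s, 2 * (γ₁ / 4) := by
      simp [hp.le]; field_simp
    rw [e]
    unfold segAvg osc
    rw [mul_left_comm C₂, ← integral_const_mul C₂, ← mul_add,
      ← integral_add (integrable_const _) ((hzV b.2).const_mul _)]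
    refine mul_le_mul_of_nonneg_left ?_ hs1.le
    refine integral_mono (hzP b.2)
      ((integrable_const _).add ((hzV b.2).const_mul _)) fun t => ?_
    exact h2 (P z) (P (z + t • ex b.2)) hPz
  have h7 : γ₁ / 2 ≤ C₂ * osc s (ex b.2) (fun z => V φ (P z)) z := by
    linarith [hz b hzO]
  have h8 : ‖dq s (ex k) P z‖ ≤ s⁻¹ * (γ₁ / 4) := by
    rw [norm_dq hp]
    refine mul_le_mul_of_nonneg_left ?_ hs1.le
    refine (norm_sub_le _ _).trans ?_
    linarith
  have h3 := le_mjr hφ (P := P) hp z b.2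
  obtain ⟨a1, a2, a3, a4⟩ := mjr_term_nonneg hφ (P := P) hp z b.2
  calc ‖dq s (ex k) P z‖ ≤ s⁻¹ * (C₂ * osc s (ex b.2) (fun z => V φ (P z)) z) :=
        h8.trans (mul_le_mul_of_nonneg_left (by linarith) hs1.le)
    _ = C₂ * (s⁻¹ * osc s (ex b.2) (fun z => V φ (P z)) z) := by ring
    _ ≤ C₂ * mjr φ P s z := mul_le_mul_of_nonneg_left (by linarith) hC₂.le
    _ ≤ _ := mul_le_mul_of_nonneg_right (by linarith) hM

end Solution

end PhiCaloric
end

/-! ### Truncations and the symmetry of the limits of second difference quotients. -/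

noncomputable section

namespace PhiCaloric

open Filter Topology

/-- Truncations `κ(|w|²)` that vanish for `|w| ≤ γ`, with primitive `K`. -/
structure Truncation (γ C : ℝ) (κ K : ℝ → ℝ) : Prop where
  pos : 0 < γ
  contDiff : ContDiff ℝ 1 κ
  nonneg : ∀ y, 0 ≤ κ y
  le_one : ∀ y, κ y ≤ 1
  zero : ∀ y, y ≤ γ ^ 2 → κ y = 0
  deriv_nonneg : ∀ y, 0 ≤ deriv κ y
  deriv_mul_le : ∀ y, 0 ≤ y → deriv κ y * (1 + y) ≤ C
  hasDerivAt : ∀ y, HasDerivAt K (κ y) y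
  abs_le : ∀ y, 0 ≤ y → |K y| ≤ y

namespace Truncation

variable {γ C : ℝ} {κ K : ℝ → ℝ} (h : Truncation γ C κ K)

include h

lemma deriv_zero {y : ℝ} (hy : y ≤ γ ^ 2) : deriv κ y = 0 :=
  IsLocalMin.deriv_eq_zero (Eventually.of_forall fun x => by rw [h.zero y hy]; exact h.nonneg x)

lemma abs_le_one (y : ℝ) : |κ y| ≤ 1 := by rw [abs_of_nonneg (h.nonneg y)]; exact h.le_one y

lemma abs_deriv_mul_le {y : ℝ} (hy : 0 ≤ y) : |deriv κ y| * y ≤ C := by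
  have := h.deriv_mul_le y hy
  have h2 := h.deriv_nonneg y
  rw [abs_of_nonneg h2]
  nlinarith

lemma abs_deriv_mul_sqrt_le {y : ℝ} (hy : 0 ≤ y) : |deriv κ y| * √y ≤ C := by
  have h1 := h.deriv_mul_le y hy
  have h2 := h.deriv_nonneg y
  have h3 : √y ≤ 1 + y := by nlinarith [Real.sq_sqrt hy, sq_nonneg (√y - 1)]
  rw [abs_of_nonneg h2]
  exact (mul_le_mul_of_nonneg_left h3 h2).trans h1

lemma const_nonneg : 0 ≤ C := by
  have := h.deriv_mul_le 0 le_rfl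
  have h2 := h.deriv_nonneg 0
  nlinarith

lemma le_div {y : ℝ} (hy : 0 ≤ y) : κ y ≤ (γ ^ 2)⁻¹ * y := by
  have h0 : 0 < γ ^ 2 := pow_pos h.pos 2
  rcases le_total y (γ ^ 2) with h1 | h1
  · rw [h.zero y h1]; positivity
  · refine (h.le_one y).trans ?_
    rw [inv_mul_eq_div, le_div_iff₀ h0]
    linarith

lemma abs_sub_le {a b : ℝ} (ha : 0 ≤ a) (hb : 0 ≤ b) :
    |κ (b ^ 2) - κ (a ^ 2)| ≤ 2 * C * |b - a| := by
  have hd : ∀ t ∈ Ici (0 : ℝ), HasDerivWithinAt (fun t => κ (t ^ 2)) (deriv κ (t ^ 2) * (2 * t))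
      (Ici 0) t := fun t _ => by
    have h1 := (h.contDiff.differentiable (by norm_num) (t ^ 2)).hasDerivAt
    have h2 : HasDerivAt (fun t : ℝ => t ^ 2) (2 * t) t := by simpa using hasDerivAt_pow 2 t
    exact (HasDerivAt.comp (h₂ := κ) (h := fun t : ℝ => t ^ 2) t h1 h2).hasDerivWithinAt
  refine Convex.norm_image_sub_le_of_norm_hasDerivWithin_le hd (fun t ht => ?_) (convex_Ici 0) ha hb
  have h1 := h.abs_deriv_mul_sqrt_le (sq_nonneg t)
  rw [Real.sqrt_sq ht] at h1
  rw [Real.norm_eq_abs, abs_mul, abs_of_nonneg (by have : (0:ℝ) ≤ t := ht; positivity : 0 ≤ 2 * t)]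
  linarith

end Truncation

section Uniqueness

variable {E : Type*} [NormedAddCommGroup E] [NormedSpace ℝ E] [MeasurableSpace E] [BorelSpace E]
  [FiniteDimensional ℝ E] {μ : Measure E} [μ.IsAddHaarMeasure]

lemma integral_mul_eq_setIntegral {O : Set E} {f ζ : E → ℝ} (h0 : ∀ z, z ∉ O → ζ z = 0) :
    ∫ z, f z * ζ z ∂μ = ∫ z in O, f z * ζ z ∂μ :=
  (setIntegral_eq_integral_of_forall_compl_eq_zero fun z hz => by simp [h0 z hz]).symm

lemma WeakGrad.unique {O : Set E} (hO : IsOpen O) {e : E} {f Z Z' : E → ℝ}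
    (h : WeakGrad μ O e f Z) (h' : WeakGrad μ O e f Z') (hZ : IntegrableOn Z O μ)
    (hZ' : IntegrableOn Z' O μ) : ∀ᵐ z ∂μ, z ∈ O → Z z = Z' z := by
  have := hO.ae_eq_zero_of_integral_contDiff_smul_eq_zero (f := fun z => Z z - Z' z) (μ := μ)
    (hZ.sub hZ').locallyIntegrableOn fun ζ hζ hζc hζO => ?_
  · filter_upwards [this] with z hz hzO
    exact sub_eq_zero.1 (hz hzO)
  · have h0 : ∀ z, z ∉ O → ζ z = 0 := fun z hz =>
      image_eq_zero_of_notMem_tsupport fun h => hz (hζO h)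
    obtain ⟨T, hT⟩ := hζc.exists_bound_of_continuous hζ.continuous
    have i : ∀ {Y : E → ℝ}, IntegrableOn Y O μ → IntegrableOn (fun z => Y z * ζ z) O μ :=
      fun hY => hY.mul_bdd hζ.continuous.aestronglyMeasurable (ae_of_all _ hT)
    have h1 := h ζ hζ hζc hζO
    rw [h' ζ hζ hζc hζO, neg_inj, integral_mul_eq_setIntegral (f := Z') h0,
      integral_mul_eq_setIntegral (f := Z) h0] at h1
    simp only [smul_eq_mul, mul_comm (ζ _)]
    rw [integral_mul_eq_setIntegral h0]
    simp only [sub_mul]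
    rw [integral_sub (i hZ) (i hZ'), h1, sub_self]

end Uniqueness

namespace Solution

variable {N n : ℕ} {φ : ℝ → ℝ} {c₀ c₁ : ℝ} {O O₁ O₂ : Set (ℝ × Space n)}
  {u : ℝ × Space n → Space N} {P : ℝ × Space n → Mat N n} {Z : Fin n → ℝ × Space n → Mat N n}
  {h : ℕ → ℝ}

variable (hφ : IsOrlicz φ c₀ c₁) (hc₀ : 0 < c₀) (hs : Solution φ O u P)
  (hr : Regular φ O O₁ O₂ u P Z h)

/-- `X` consists of the limits of the difference quotients of `P` on `{P ≠ 0}`. -/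
def IsLimit (φ : ℝ → ℝ) (c₀ c₁ : ℝ) (P : ℝ × Space n → Mat N n)
    (Z : Fin n → ℝ × Space n → Mat N n) (h : ℕ → ℝ) (z : ℝ × Space n) (X : Fin n → Mat N n) :
    Prop :=
  ∀ k, Tendsto (fun m => dq (h m) (ex k) P z) atTop (𝓝 (X k)) ∧
    Tendsto (fun m => dq (h m) (ex k) (fun z => A φ (P z)) z) atTop
      (𝓝 (radialDeriv (d φ) (deriv (d φ) ‖P z‖) (P z) (X k))) ∧
    min c₀ 1 * ‖Z k z‖ ^ 2 ≤ (2 + (1 + c₁) / 2) ^ 2 *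
      inner ℝ (X k) (radialDeriv (d φ) (deriv (d φ) ‖P z‖) (P z) (X k)) ∧
    ‖radialDeriv (d φ) (deriv (d φ) ‖P z‖) (P z) (X k)‖ * ‖P z‖ ≤
      2 * (2 + c₁) * (nu φ ‖P z‖ * ‖Z k z‖)

include hφ hc₀ hr in
lemma exists_isLimit : ∃ X : ℝ × Space n → Fin n → Mat N n, ∀ᵐ z, z ∈ O₂ → P z ≠ 0 →
    IsLimit φ c₀ c₁ P Z h z (X z) := by
  classical
  have key : ∀ᵐ z, z ∈ O₂ → P z ≠ 0 → ∃ X, IsLimit φ c₀ c₁ P Z h z X := by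
    filter_upwards [ae_all_iff.2 hr.V_ae, ae_all_iff.2 hr.P_ae] with z hV hP hz hP0
    choose X hX using fun k => hφ.exists_tendsto_diffQuot hc₀ hP0 (hP k hz) (hV k hz)
    exact ⟨X, hX⟩
  refine ⟨fun z => if hz : ∃ X, IsLimit φ c₀ c₁ P Z h z X then hz.choose else 0, ?_⟩
  filter_upwards [key] with z hz h1 h2
  have h3 := hz h1 h2
  rw [dif_pos h3]
  exact h3.choose_spec

lemma sumSq_eq_norm_sq (Q : Mat N n) : sumSq (fun a => Q a) = ‖Q‖ ^ 2 := by
  rw [EuclideanSpace.real_norm_sq_eq]; rfl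

include hr in
lemma ae_tendsto_W : ∀ᵐ z, z ∈ O₂ → (∀ a, Tendsto (fun m => W u O₂ (h m) a z) atTop (𝓝 (P z a))) ∧
    Tendsto (fun m => sumSq fun a => W u O₂ (h m) a z) atTop (𝓝 (‖P z‖ ^ 2)) := by
  filter_upwards [ae_all_iff.2 hr.u_ae] with z hz hzO
  have h1 : ∀ a, Tendsto (fun m => W u O₂ (h m) a z) atTop (𝓝 (P z a)) := fun a => by
    simpa [W, hzO] using hz a hzO
  refine ⟨h1, ?_⟩
  rw [← sumSq_eq_norm_sq]
  exact tendsto_finsetSum _ fun a _ => (h1 a).pow 2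

variable {γ C : ℝ} {κ K : ℝ → ℝ} (ht : Truncation γ C κ K) {X : ℝ × Space n → Fin n → Mat N n}
  (hX : ∀ᵐ z, z ∈ O₂ → P z ≠ 0 → IsLimit φ c₀ c₁ P Z h z (X z))

lemma abs_sum_mul_le {ι : Type*} [Fintype ι] (w p : ι → ℝ) {M : ℝ}
    (hp : ∀ b, |p b| ≤ M) : |∑ b, w b * p b| ≤ Fintype.card ι * (√(sumSq w) * M) := by
  refine (Finset.abs_sum_le_sum_abs _ _).trans ?_
  rw [← nsmul_eq_mul, ← Finset.card_univ]
  refine Finset.sum_le_card_nsmul _ _ _ fun b _ => ?_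
  rw [abs_mul]
  refine mul_le_mul (Real.abs_le_sqrt (sq_le_sumSq w b)) (hp b) (abs_nonneg _) (Real.sqrt_nonneg _)

include hφ hc₀ hs hr ht hX in
-- For fixed `h` the chain rule holds for `κ(|D_h u|²)`, whose gradient involves the `j`-th columns
-- of the difference quotients of `P` in all directions `k`, that is `∂_j D_h^k u`. The limit `h →
-- 0` gives a formula for the weak derivative with the roles of `j` and `k` exchanged compared with
-- direct differentiation of `|P|²`.
lemma weakGrad_comp_norm_sq_left (hO : IsOpen O) (j : Fin n) :
    IntegrableOn (fun z => deriv κ (‖P z‖ ^ 2) *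
      (2 * ∑ a : Fin N × Fin n, P z a * X z a.2 (a.1, j))) O₂ ∧
    WeakGrad volume O₂ (ex j) (fun z => κ (‖P z‖ ^ 2)) fun z => deriv κ (‖P z‖ ^ 2) *
      (2 * ∑ a : Fin N × Fin n, P z a * X z a.2 (a.1, j)) := by
  have hsub := hr.sub₂.trans hr.sub₁
  have hws := fun m => weakSystem hφ hc₀ hs hO hr.isOpen₂ (hr.h_pos m) (hr.seg m) hsub
  set S : ℕ → ℝ × Space n → ℝ := fun m z => sumSq fun a => W u O₂ (h m) a z with hS
  set p : ℕ → Fin N × Fin n → ℝ × Space n → ℝ :=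
    fun m a => dq (h m) (ex a.2) fun z => P z (a.1, j) with hp
  have hwg := fun m => weakGrad_comp_sumSq hr.isOpen₂ (fun a => (hws m).w_int a)
    (fun a => (hws m).p_int a j) (fun a => (hws m).grad a j) ht.contDiff
    (fun y _ => ht.abs_le_one y) (fun y hy => ht.abs_deriv_mul_sqrt_le hy)
  obtain ⟨C₁, hC₁, hb⟩ := exists_dq_P_le_of_lt_sumSq hφ hc₀ hs hr hO ht.pos
  have hcd := ht.contDiff.continuous_deriv (le_refl 1)
  have hC := ht.const_nonneg
  have hSm : ∀ m, AEStronglyMeasurable (S m) volume := fun m =>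
    (integrable_finsetSum _ fun a _ => (hws m).w_sq a).aestronglyMeasurable
  set D : ℝ := 2 * (Fintype.card (Fin N × Fin n) * (C * C₁)) with hD
  have hlim : ∀ᵐ z ∂volume.restrict O₂, Tendsto (fun m => deriv κ (S m z) *
      (2 * ∑ b, W u O₂ (h m) b z * p m b z)) atTop (𝓝 (deriv κ (‖P z‖ ^ 2) *
      (2 * ∑ a : Fin N × Fin n, P z a * X z a.2 (a.1, j)))) := by
    rw [ae_restrict_iff' hr.isOpen₂.measurableSet]
    filter_upwards [hX, ae_tendsto_W hr] with z hz1 hz2 hzO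
    obtain ⟨hw, hw2⟩ := hz2 hzO
    -- Nothing is known about difference quotients of `P` where `P = 0`, but there the truncation is
    -- eventually inactive.
    by_cases hP : P z = 0
    · have h1 : ∀ᶠ m in atTop, S m z < γ ^ 2 :=
        hw2.eventually_lt_const (by rw [hP]; simpa using pow_pos ht.pos 2)
      have h2 : deriv κ (‖P z‖ ^ 2) = 0 := ht.deriv_zero (by rw [hP]; simpa using sq_nonneg γ)
      rw [h2, zero_mul]
      refine tendsto_const_nhds.congr' ?_
      filter_upwards [h1] with m hm
      rw [ht.deriv_zero hm.le, zero_mul]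
    · have h1 := hz1 hzO hP
      refine ((hcd.tendsto _).comp hw2).mul (Tendsto.const_mul _ (tendsto_finsetSum _ fun a _ =>
        (hw a).mul ?_))
      exact ((EuclideanSpace.proj (𝕜 := ℝ) (a.1, j)).continuous.tendsto _).comp (h1 a.2).1
  have hbd : ∀ m, ∀ᵐ z ∂volume.restrict O₂, |deriv κ (S m z) *
      (2 * ∑ b, W u O₂ (h m) b z * p m b z)| ≤ D * mjr φ P (h m) z := fun m => by
    rw [ae_restrict_iff' hr.isOpen₂.measurableSet]
    filter_upwards [hb m] with z hz hzO
    have hM := mjr_nonneg hφ (P := P) (hr.h_pos m) z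
    rcases le_or_gt (S m z) (γ ^ 2) with h1 | h1
    · rw [ht.deriv_zero h1, zero_mul, abs_zero]
      positivity
    · have h2 := abs_sum_mul_le (fun b => W u O₂ (h m) b z) (fun b => p m b z)
        (M := C₁ * mjr φ P (h m) z) fun b => by
          refine le_trans ?_ (hz hzO h1 b.2)
          exact abs_coord_le (dq (h m) (ex b.2) P z) (b.1, j)
      have h3 := ht.abs_deriv_mul_sqrt_le (sumSq_nonneg fun a => W u O₂ (h m) a z)
      rw [abs_mul, abs_mul, abs_two]
      calc _ ≤ |deriv κ (S m z)| * (2 * (Fintype.card (Fin N × Fin n) *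
            (√(S m z) * (C₁ * mjr φ P (h m) z)))) := by gcongr
        _ = |deriv κ (S m z)| * √(S m z) * (2 * (Fintype.card (Fin N × Fin n) *
            (C₁ * mjr φ P (h m) z))) := by ring
        _ ≤ C * (2 * (Fintype.card (Fin N × Fin n) * (C₁ * mjr φ P (h m) z))) := by gcongr
        _ = _ := by rw [hD]; ring
  have hmeas : ∀ m, AEStronglyMeasurable (fun z => deriv κ (S m z) *
      (2 * ∑ b, W u O₂ (h m) b z * p m b z)) volume := fun m => by
    refine (hcd.comp_aestronglyMeasurable (hSm m)).mul (AEStronglyMeasurable.const_mul ?_ _)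
    exact Finset.aestronglyMeasurable_fun_sum _ fun b _ =>
      ((hws m).w_int b).aestronglyMeasurable.mul ((hws m).p_int b j).aestronglyMeasurable
  have hmj := tendstoL1_mjr hφ hc₀ hs hr
  refine ⟨?_, fun ζ hζ hζc hζO => ?_⟩
  · exact (tendsto_integral_of_tendsto_majorant (fun m => (hmeas m).restrict)
      (hmj.const_mul D).int (hmj.const_mul D).int_lim (hmj.const_mul D).tendsto hbd hlim).1
  have h0 : ∀ z, z ∉ O₂ → ζ z = 0 := fun z hz =>
    image_eq_zero_of_notMem_tsupport fun h => hz (hζO h)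
  have h0' : ∀ z, z ∉ O₂ → fderiv ℝ ζ z (ex j) = 0 := fun z hz => by
    rw [image_eq_zero_of_notMem_tsupport fun h => hz (hζO (tsupport_fderiv_subset ℝ h))]
    rfl
  have hζv : Continuous fun z => fderiv ℝ ζ z (ex j) :=
    (hζ.continuous_fderiv (by simp)).clm_apply continuous_const
  have hζvc : HasCompactSupport fun z => fderiv ℝ ζ z (ex j) :=
    (hζc.fderiv ℝ).comp_left (g := fun L : ℝ × Space n →L[ℝ] ℝ => L (ex j)) (by simp)
  obtain ⟨T, hT⟩ := hζc.exists_bound_of_continuous hζ.continuous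
  have hT0 : 0 ≤ T := (norm_nonneg _).trans (hT 0)
  have t1 := (tendsto_integral_of_tendsto_majorant (μ := volume.restrict O₂)
      (f := fun m z => deriv κ (S m z) * (2 * ∑ b, W u O₂ (h m) b z * p m b z) * ζ z)
      (g := fun m z => T * D * mjr φ P (h m) z)
      (fun m => ((hmeas m).mul hζ.continuous.aestronglyMeasurable).restrict)
      (hmj.const_mul (T * D)).int (hmj.const_mul (T * D)).int_lim (hmj.const_mul (T * D)).tendsto
      (fun m => by
        filter_upwards [hbd m] with z hz
        rw [abs_mul, mul_comm, mul_assoc T]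
        exact mul_le_mul (hT z) hz (abs_nonneg _) hT0)
      (by
        filter_upwards [hlim] with z hz
        exact hz.mul_const (ζ z))).2
  have t2 : Tendsto (fun m => ∫ z in O₂, κ (S m z) * fderiv ℝ ζ z (ex j)) atTop
      (𝓝 (∫ z in O₂, κ (‖P z‖ ^ 2) * fderiv ℝ ζ z (ex j))) := by
    refine tendsto_integral_of_dominated_convergence (fun z => |fderiv ℝ ζ z (ex j)|) (fun m => ?_)
      (hζv.integrable_of_hasCompactSupport hζvc).abs.integrableOn (fun m => ?_) ?_
    · exact ((ht.contDiff.continuous.comp_aestronglyMeasurable (hSm m)).mul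
        hζv.aestronglyMeasurable).restrict
    · refine ae_of_all _ fun z => ?_
      rw [norm_mul]
      exact mul_le_of_le_one_left (abs_nonneg _) (ht.abs_le_one _)
    · rw [ae_restrict_iff' hr.isOpen₂.measurableSet]
      filter_upwards [ae_tendsto_W hr] with z hz hzO
      exact ((ht.contDiff.continuous.tendsto _).comp (hz hzO).2).mul_const _
  rw [integral_mul_eq_setIntegral h0', integral_mul_eq_setIntegral h0]
  refine tendsto_nhds_unique t2 (t1.neg.congr fun m => ?_)
  rw [← integral_mul_eq_setIntegral h0', ← integral_mul_eq_setIntegral h0]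
  exact (hwg m ζ hζ hζc hζO).symm

include hφ hc₀ hs hr ht hX in
-- The same weak derivative, computed as the limit of difference quotients of `κ(|P|²)` in the
-- direction `j`. They vanish if both end values are below `γ`, and otherwise they are controlled by
-- `exists_dq_P_le`.
lemma weakGrad_comp_norm_sq_right (j : Fin n) :
    IntegrableOn (fun z => deriv κ (‖P z‖ ^ 2) * (2 * inner ℝ (P z) (X z j))) O₂ ∧
    WeakGrad volume O₂ (ex j) (fun z => κ (‖P z‖ ^ 2))
      fun z => deriv κ (‖P z‖ ^ 2) * (2 * inner ℝ (P z) (X z j)) := by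
  set f : ℝ × Space n → ℝ := fun z => κ (‖P z‖ ^ 2) with hf
  have hfm : Measurable f := ht.contDiff.continuous.measurable.comp (hs.P_meas.norm.pow_const 2)
  have hfi : Integrable f := by
    refine ((integrable_norm_sq hs.P_sq).const_mul (γ ^ 2)⁻¹).mono' hfm.aestronglyMeasurable
      (ae_of_all _ fun z => ?_)
    rw [Real.norm_of_nonneg (ht.nonneg _)]
    exact ht.le_div (sq_nonneg _)
  obtain ⟨C₁, hC₁, hb⟩ := exists_dq_P_le (P := P) hφ hc₀ ht.pos
  have hC := ht.const_nonneg
  have hbd : ∀ m z, |dq (h m) (ex j) f z| ≤ 2 * C * C₁ * mjr φ P (h m) z := fun m z => by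
    have hp := hr.h_pos m
    have hM := mjr_nonneg hφ (P := P) hp z
    rcases lt_or_ge (‖P z‖ + ‖P (z + h m • ex j)‖) γ with h1 | h1
    · have e1 : f z = 0 := ht.zero _ (pow_le_pow_left₀ (norm_nonneg _)
        (by linarith [norm_nonneg (P (z + h m • ex j))]) 2)
      have e2 : f (z + h m • ex j) = 0 := ht.zero _ (pow_le_pow_left₀ (norm_nonneg _)
        (by linarith [norm_nonneg (P z)]) 2)
      rw [dq, e1, e2, sub_zero, smul_zero, abs_zero]
      positivity
    · have h2 := hb (h m) hp z j h1
      have h3 := ht.abs_sub_le (norm_nonneg (P z)) (norm_nonneg (P (z + h m • ex j)))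
      have h4 := abs_norm_sub_norm_le (P (z + h m • ex j)) (P z)
      have e := norm_dq hp (ex j) f z
      rw [Real.norm_eq_abs] at e
      rw [e]
      calc _ ≤ (h m)⁻¹ * (2 * C * ‖P (z + h m • ex j) - P z‖) := by
            refine mul_le_mul_of_nonneg_left (h3.trans ?_) (inv_nonneg.2 hp.le)
            gcongr
        _ = 2 * C * ‖dq (h m) (ex j) P z‖ := by rw [norm_dq hp]; ring
        _ ≤ _ := by rw [mul_assoc _ C₁]; gcongr
  have hlim : ∀ᵐ z ∂volume.restrict O₂, Tendsto (fun m => dq (h m) (ex j) f z) atTop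
      (𝓝 (deriv κ (‖P z‖ ^ 2) * (2 * inner ℝ (P z) (X z j)))) := by
    rw [ae_restrict_iff' hr.isOpen₂.measurableSet]
    filter_upwards [hX, hr.P_ae j] with z hz1 hz2 hzO
    have hP2 := hz2 hzO
    by_cases hP : P z = 0
    · have h1 : ∀ᶠ m in atTop, ‖P (z + h m • ex j)‖ < γ :=
        hP2.norm.eventually_lt_const (by rw [hP]; simpa using ht.pos)
      have h2 : deriv κ (‖P z‖ ^ 2) = 0 := ht.deriv_zero (by rw [hP]; simpa using sq_nonneg γ)
      have h3 : f z = 0 := ht.zero _ (by rw [hP]; simpa using sq_nonneg γ)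
      rw [h2, zero_mul]
      refine tendsto_const_nhds.congr' ?_
      filter_upwards [h1] with m hm
      have : f (z + h m • ex j) = 0 := ht.zero _ (pow_le_pow_left₀ (norm_nonneg _) hm.le 2)
      rw [dq, h3, this, sub_zero, smul_zero]
    · have h1 := (hz1 hzO hP j).1
      have h2 : HasFDerivAt (fun Q : Mat N n => κ (‖Q‖ ^ 2))
          (deriv κ (‖P z‖ ^ 2) • (2 • innerSL ℝ (P z))) (P z) :=
        ((ht.contDiff.differentiable (by norm_num) _).hasDerivAt).comp_hasFDerivAt (P z)
          (hasStrictFDerivAt_norm_sq (P z)).hasFDerivAt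
      have hy : Tendsto (fun m => P (z + h m • ex j) - P z) atTop (𝓝 0) :=
        tendsto_sub_nhds_zero_iff.2 hP2
      have := (hasFDerivWithinAt_univ.2 h2).lim hy (Eventually.of_forall fun _ => mem_univ _) h1
      simpa [dq, f] using this
  have hmeas : ∀ m, AEStronglyMeasurable (dq (h m) (ex j) f) volume := fun m =>
    (integrable_dq hfi _ _).aestronglyMeasurable
  have hmj := (tendstoL1_mjr hφ hc₀ hs hr)
  refine ⟨(tendsto_integral_of_tendsto_majorant (fun m => (hmeas m).restrict)
      (hmj.const_mul (2 * C * C₁)).int (hmj.const_mul _).int_lim (hmj.const_mul _).tendsto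
      (fun m => ae_of_all _ (hbd m)) hlim).1, fun ζ hζ hζc hζO => ?_⟩
  have h0 : ∀ z, z ∉ O₂ → ζ z = 0 := fun z hz =>
    image_eq_zero_of_notMem_tsupport fun h => hz (hζO h)
  obtain ⟨T, hT⟩ := hζc.exists_bound_of_continuous hζ.continuous
  have hT0 : 0 ≤ T := (norm_nonneg _).trans (hT 0)
  have t1 := (tendsto_integral_of_tendsto_majorant (μ := volume.restrict O₂)
      (f := fun m z => dq (h m) (ex j) f z * ζ z)
      (g := fun m z => T * (2 * C * C₁) * mjr φ P (h m) z)
      (fun m => ((hmeas m).mul hζ.continuous.aestronglyMeasurable).restrict)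
      (hmj.const_mul _).int (hmj.const_mul _).int_lim (hmj.const_mul _).tendsto
      (fun m => by
        refine ae_of_all _ fun z => ?_
        rw [abs_mul, mul_comm, mul_assoc T]
        exact mul_le_mul (hT z) (hbd m z) (abs_nonneg _) hT0)
      (by
        filter_upwards [hlim] with z hz
        exact hz.mul_const (ζ z))).2
  have t2 := (tendsto_integral_dq_mul hfi (hζ.of_le (by exact_mod_cast le_top)) hζc (ex j)).comp
    (tendsto_nhdsWithin_iff.2 ⟨hr.h_tendsto, Eventually.of_forall hr.h_pos⟩)
  have t3 := tendsto_nhds_unique (t1.congr fun m =>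
    (integral_mul_eq_setIntegral h0).symm) t2
  rw [← integral_mul_eq_setIntegral h0] at t3
  rw [t3, neg_neg]

include hφ hc₀ hs hr ht hX in
-- Uniqueness of the weak derivative of `κ(|P|²)`. The contracted and truncated symmetry is weaker
-- than symmetry of second derivatives, but it is exactly what the sign of the `κ'` term requires.
lemma ae_symm (hO : IsOpen O) : ∀ᵐ z, z ∈ O₂ → ∀ j,
    deriv κ (‖P z‖ ^ 2) * (2 * ∑ a : Fin N × Fin n, P z a * X z a.2 (a.1, j)) =
      deriv κ (‖P z‖ ^ 2) * (2 * inner ℝ (P z) (X z j)) := by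
  have := ae_all_iff.2 fun j => by
    obtain ⟨i1, w1⟩ := weakGrad_comp_norm_sq_left hφ hc₀ hs hr ht hX hO j
    obtain ⟨i2, w2⟩ := weakGrad_comp_norm_sq_right hφ hc₀ hs hr ht hX j
    exact w1.unique hr.isOpen₂ w2 i1 i2
  filter_upwards [this] with z hz hzO j
  exact hz j hzO

end Solution

end PhiCaloric
end

/-! ### The tested equation in the limit and the truncated energy inequality. -/

noncomputable section

namespace PhiCaloric

open Filter Topology

lemma testIntegrand_eq_zero {ι J : Type*} [Fintype ι] [Fintype J] {κ : ℝ → ℝ} {w : ι → ℝ}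
    {p B : ι → J → ℝ} {θ : ℝ} {θ' : J → ℝ} (h1 : κ (sumSq w) = 0) (h2 : deriv κ (sumSq w) = 0) :
    testIntegrand κ w p B θ θ' = 0 := by
  simp [testIntegrand, h1, h2]

namespace Solution

variable {N n : ℕ} {φ : ℝ → ℝ} {c₀ c₁ : ℝ} {O O₁ O₂ : Set (ℝ × Space n)}
  {u : ℝ × Space n → Space N} {P : ℝ × Space n → Mat N n} {Z : Fin n → ℝ × Space n → Mat N n}
  {h : ℕ → ℝ}

variable (hφ : IsOrlicz φ c₀ c₁) (hc₀ : 0 < c₀) (hs : Solution φ O u P)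
  (hr : Regular φ O O₁ O₂ u P Z h)

variable {γ C : ℝ} {κ K : ℝ → ℝ} (ht : Truncation γ C κ K) {X : ℝ × Space n → Fin n → Mat N n}
  (hX : ∀ᵐ z, z ∈ O₂ → P z ≠ 0 → IsLimit φ c₀ c₁ P Z h z (X z))
  {θ : ℝ × Space n → ℝ} (hθ : ContDiff ℝ 1 θ) (hθc : HasCompactSupport θ) (hθO : tsupport θ ⊆ O₂)

/-- The limit of the tested equations for the difference quotients. -/
def limitIntegrand (φ κ : ℝ → ℝ) (P : ℝ × Space n → Mat N n) (X : ℝ × Space n → Fin n → Mat N n)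
    (θ : ℝ × Space n → ℝ) (z : ℝ × Space n) : ℝ :=
  testIntegrand κ (fun a => P z a) (fun a j => X z a.2 (a.1, j))
    (fun a j => radialDeriv (d φ) (deriv (d φ) ‖P z‖) (P z) (X z a.2) (a.1, j)) (θ z)
    (fun j => fderiv ℝ θ z (ex j))

include hφ hc₀ hs hr in
-- Strong `L²` convergence of `D_h u` to `P` makes `|D_h u|²` an `L¹`-convergent majorant of
-- `|K(|D_h u|²)|`.
lemma tendsto_integral_comp_sumSq (hO : IsOpen O) (hK : Continuous K)
    (hK1 : ∀ y, 0 ≤ y → |K y| ≤ y) {f : ℝ × Space n → ℝ} (hf : Continuous f)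
    (hfc : HasCompactSupport f) :
    Tendsto (fun m => ∫ z in O₂, K (sumSq fun a => W u O₂ (h m) a z) * f z) atTop
      (𝓝 (∫ z in O₂, K (‖P z‖ ^ 2) * f z)) := by
  obtain ⟨T, hT⟩ := hfc.exists_bound_of_continuous hf
  have hws := fun m => weakSystem hφ hc₀ hs hO hr.isOpen₂ (hr.h_pos m) (hr.seg m)
    (hr.sub₂.trans hr.sub₁)
  have hmaj : TendstoL1 (volume.restrict O₂) (fun m z => sumSq fun a => W u O₂ (h m) a z)
      (fun z => sumSq fun a => P z a) := by
    refine TendstoL1.finsetSum fun a => ?_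
    have h1 := TendstoL1.norm_sq (ν := volume.restrict O₂) (F := fun z => P z a)
      (f := fun m => dq (h m) (ex a.2) fun z => u z a.1)
      (fun m => (memLp_dq (hs.u_sq a.1) (h m) (ex a.2)).restrict _)
      ((memLp_coord hs.P_sq a).restrict _) (by simpa using hr.u_L2 a)
    simp only [Real.norm_eq_abs, sq_abs] at h1
    have e : ∀ m, (fun z => W u O₂ (h m) a z ^ 2) =ᵐ[volume.restrict O₂]
        fun z => dq (h m) (ex a.2) (fun z => u z a.1) z ^ 2 := fun m => by
      filter_upwards [ae_restrict_mem hr.isOpen₂.measurableSet] with z hz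
      simp [W, hz]
    refine ⟨fun m => (h1.int m).congr (e m).symm, h1.int_lim, h1.tendsto.congr fun m => ?_⟩
    refine integral_congr_ae ?_
    filter_upwards [e m] with z hz
    rw [hz]
  refine (tendsto_integral_of_tendsto_majorant (fun m => ?_) (hmaj.const_mul T).int
    (hmaj.const_mul T).int_lim (hmaj.const_mul T).tendsto (fun m => ae_of_all _ fun z => ?_) ?_).2
  · exact ((hK.comp_aestronglyMeasurable (integrable_finsetSum _ fun a _ =>
      (hws m).w_sq a).aestronglyMeasurable).mul hf.aestronglyMeasurable).restrict
  · rw [abs_mul, mul_comm]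
    exact mul_le_mul (hT z) (hK1 _ (sumSq_nonneg _)) (abs_nonneg _)
      ((norm_nonneg _).trans (hT z))
  · rw [ae_restrict_iff' hr.isOpen₂.measurableSet]
    filter_upwards [ae_tendsto_W hr] with z hz hzO
    exact ((hK.tendsto _).comp (hz hzO).2).mul_const _

include hφ hc₀ hs hr ht hX hθ hθc hθO in
-- Dominated convergence with the `L¹`-convergent majorant `mjr` in the tested equations for `D_h
-- u`. Where `P = 0` the integrands vanish for small steps; elsewhere the difference quotients of
-- `P` and `A(P)` converge.
lemma integral_limitIntegrand (hO : IsOpen O) :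
    IntegrableOn (limitIntegrand φ κ P X θ) O₂ ∧
    ∫ z in O₂, limitIntegrand φ κ P X θ z =
      1 / 2 * ∫ z in O₂, K (‖P z‖ ^ 2) * fderiv ℝ θ z et := by
  have hws := fun m => weakSystem hφ hc₀ hs hO hr.isOpen₂ (hr.h_pos m) (hr.seg m)
    (hr.sub₂.trans hr.sub₁)
  have hid := fun m => (hws m).integral_testIntegrand hr.isOpen₂ hθ hθc hθO ht.contDiff
    ht.hasDerivAt (fun y _ => ht.abs_le_one y) (fun y hy => ht.abs_deriv_mul_le hy) ht.abs_le
  have hint := fun m => ((hws m).tendsto_testIntegrand hθ hθc ht.contDiff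
    (fun y _ => ht.abs_le_one y) (fun y hy => ht.abs_deriv_mul_le hy)).1
  set TI : ℕ → ℝ × Space n → ℝ := fun m z => testIntegrand κ (fun a => W u O₂ (h m) a z)
    (fun a j => dq (h m) (ex a.2) (fun z => P z (a.1, j)) z)
    (fun a j => dq (h m) (ex a.2) (fun z => A φ (P z) (a.1, j)) z) (θ z)
    (fun j => fderiv ℝ θ z (ex j)) with hTI
  obtain ⟨T₁, hT₁⟩ := hθc.exists_bound_of_continuous hθ.continuous
  choose T₂ hT₂ using fun j : Fin n => exists_bound_fderiv hθ hθc (ex j)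
  obtain ⟨T, hT1, hT2⟩ : ∃ T, T₁ ≤ T ∧ ∀ j, T₂ j ≤ T := by
    refine ⟨T₁ + ∑ j, |T₂ j|, le_add_of_nonneg_right (Finset.sum_nonneg fun _ _ => abs_nonneg _),
      fun j => ?_⟩
    have h1 := Finset.single_le_sum (f := fun j => |T₂ j|) (fun _ _ => abs_nonneg _)
      (Finset.mem_univ j)
    have h2 := (norm_nonneg _).trans (hT₁ 0)
    linarith [le_abs_self (T₂ j)]
  obtain ⟨C₁, hC₁, hb1⟩ := exists_dq_A_mul_dq_P_le (P := P) hφ hc₀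
  obtain ⟨C₂, hC₂, hb2⟩ := exists_dq_A_mul_dq_u_le hφ hc₀ hs hr hO
  set D := Fintype.card (Fin N × Fin n) * (Fintype.card (Fin n) *
    ((1 + 2 * C * Fintype.card (Fin N × Fin n) + 1) * T)) * (C₁ + C₂) with hD
  have hbd : ∀ m, ∀ᵐ z ∂volume.restrict O₂, |TI m z| ≤ D * mjr φ P (h m) z := fun m => by
    rw [ae_restrict_iff' hr.isOpen₂.measurableSet]
    filter_upwards [hb2 m] with z hz hzO
    have hM := mjr_nonneg hφ (P := P) (hr.h_pos m) z
    have h1 : ∀ (a : Fin N × Fin n) (j : Fin n),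
        |dq (h m) (ex a.2) (fun z => A φ (P z) (a.1, j)) z| ≤
        ‖dq (h m) (ex a.2) (fun z => A φ (P z)) z‖ := fun a j =>
      abs_coord_le (dq (h m) (ex a.2) (fun z => A φ (P z)) z) (a.1, j)
    have h2 : ∀ (a : Fin N × Fin n) (j : Fin n),
        |dq (h m) (ex a.2) (fun z => P z (a.1, j)) z| ≤ ‖dq (h m) (ex a.2) P z‖ := fun a j =>
      abs_coord_le (dq (h m) (ex a.2) P z) (a.1, j)
    rw [hD, mul_assoc]
    refine abs_testIntegrand_le (C := C) (X := (C₁ + C₂) * mjr φ P (h m) z)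
      (fun y _ => ht.abs_le_one y) (fun y hy => ht.abs_deriv_mul_le hy)
      (fun a j b k => ?_) (fun a j b => ?_) (by positivity) ((hT₁ z).trans hT1)
      fun j => (hT₂ j z).trans (hT2 j)
    · refine (mul_le_mul (h1 a j) (h2 b k) (abs_nonneg _) (norm_nonneg _)).trans
        ((hb1 (h m) (hr.h_pos m) z a.2 b.2).trans ?_)
      exact mul_le_mul_of_nonneg_right (by linarith) hM
    · simp only [W, indicator_of_mem hzO]
      refine (mul_le_mul_of_nonneg_right (h1 a j) (abs_nonneg _)).trans ((hz hzO a.2 b).trans ?_)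
      exact mul_le_mul_of_nonneg_right (by linarith) hM
  have hlim : ∀ᵐ z ∂volume.restrict O₂, Tendsto (fun m => TI m z) atTop
      (𝓝 (limitIntegrand φ κ P X θ z)) := by
    rw [ae_restrict_iff' hr.isOpen₂.measurableSet]
    filter_upwards [hX, ae_tendsto_W hr] with z hz1 hz2 hzO
    obtain ⟨hw, hw2⟩ := hz2 hzO
    by_cases hP : P z = 0
    · have h0 : sumSq (fun a => P z a) ≤ γ ^ 2 := by
        rw [sumSq_eq_norm_sq, hP]; simpa using sq_nonneg γ
      have h1 : ∀ᶠ m in atTop, sumSq (fun a => W u O₂ (h m) a z) < γ ^ 2 :=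
        hw2.eventually_lt_const (by rw [hP]; simpa using pow_pos ht.pos 2)
      rw [limitIntegrand, testIntegrand_eq_zero (ht.zero _ h0) (ht.deriv_zero h0)]
      refine tendsto_const_nhds.congr' ?_
      filter_upwards [h1] with m hm
      exact (testIntegrand_eq_zero (ht.zero _ hm.le) (ht.deriv_zero hm.le)).symm
    · have h1 := hz1 hzO hP
      refine tendsto_testIntegrand_pointwise ht.contDiff hw (fun a j => ?_) fun a j => ?_
      · exact ((EuclideanSpace.proj (𝕜 := ℝ) (a.1, j)).continuous.tendsto _).comp (h1 a.2).1
      · exact ((EuclideanSpace.proj (𝕜 := ℝ) (a.1, j)).continuous.tendsto _).comp (h1 a.2).2.1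
  have hmj := (tendstoL1_mjr hφ hc₀ hs hr).const_mul D
  obtain ⟨r1, r2⟩ := tendsto_integral_of_tendsto_majorant (fun m => (hint m).aestronglyMeasurable.restrict)
    hmj.int hmj.int_lim hmj.tendsto hbd hlim
  refine ⟨r1, tendsto_nhds_unique r2 ?_⟩
  have hKc : Continuous K :=
    (Differentiable.continuous (𝕜 := ℝ) fun y => (ht.hasDerivAt y).differentiableAt)
  have hθt : Continuous fun z => fderiv ℝ θ z et :=
    (hθ.continuous_fderiv (by norm_num)).clm_apply continuous_const
  have hθtc : HasCompactSupport fun z => fderiv ℝ θ z et :=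
    (hθc.fderiv ℝ).comp_left (g := fun L : ℝ × Space n →L[ℝ] ℝ => L et) (by simp)
  refine ((tendsto_integral_comp_sumSq hφ hc₀ hs hr hO hKc ht.abs_le hθt hθtc).const_mul
    (1 / 2)).congr fun m => ?_
  have h0 : ∀ z, z ∉ O₂ → fderiv ℝ θ z = 0 := fun z hz =>
    image_eq_zero_of_notMem_tsupport fun h => hz (hθO (tsupport_fderiv_subset ℝ h))
  have h0' : ∀ z, z ∉ O₂ → θ z = 0 := fun z hz =>
    image_eq_zero_of_notMem_tsupport fun h => hz (hθO h)
  rw [← integral_mul_eq_setIntegral (fun z hz => by rw [h0 z hz]; rfl)]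
  refine (hid m).symm.trans (setIntegral_eq_integral_of_forall_compl_eq_zero fun z hz => ?_).symm
  simp [testIntegrand, h0 z hz, h0' z hz]

/-- The ellipticity constant in the energy inequality. -/
def lowerConst (c₀ c₁ : ℝ) : ℝ := min c₀ 1 / (2 + (1 + c₁) / 2) ^ 2

lemma lowerConst_pos (hc₀ : 0 < c₀) (hc₁ : 0 < c₁) : 0 < lowerConst c₀ c₁ :=
  div_pos (lt_min hc₀ one_pos) (by positivity)

include hφ hc₀ hs in
lemma integrable_nu_mul {Y : ℝ × Space n → Mat N n} (hY : MemLp Y 2) :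
    Integrable fun z => nu φ ‖P z‖ * ‖Y z‖ := by
  have h1 := (memLp_V hφ hc₀ hs).norm
  have h2 : Integrable fun z => ‖V φ (P z)‖ * ‖Y z‖ := h1.integrable_mul hY.norm
  simpa only [hφ.V_norm hc₀] using h2

include hφ hc₀ hs hr ht hθ hθc hθO in
/-- The energy inequality for second derivatives, localized by `κ` and `θ`. -/
theorem energy_inequality (hO : IsOpen O) (hθ0 : ∀ z, 0 ≤ θ z) :
    IntegrableOn (fun z => lowerConst c₀ c₁ * (θ z * ∑ k, ‖Z k z‖ ^ 2) -
      2 * (2 + c₁) * ((nu φ ‖P z‖ * ∑ k, ‖Z k z‖) *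
        ‖(WithLp.toLp 2 fun j => fderiv ℝ θ z (ex j) : Space n)‖)) O₂ ∧
    ∫ z in O₂, κ (‖P z‖ ^ 2) * (lowerConst c₀ c₁ * (θ z * ∑ k, ‖Z k z‖ ^ 2) -
      2 * (2 + c₁) * ((nu φ ‖P z‖ * ∑ k, ‖Z k z‖) *
        ‖(WithLp.toLp 2 fun j => fderiv ℝ θ z (ex j) : Space n)‖)) ≤
      1 / 2 * ∫ z in O₂, K (‖P z‖ ^ 2) * fderiv ℝ θ z et := by
  obtain ⟨X, hX⟩ := exists_isLimit hφ hc₀ hr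
  obtain ⟨i1, e1⟩ := integral_limitIntegrand hφ hc₀ hs hr ht hX hθ hθc hθO hO
  have hc₁ : 0 < c₁ := hc₀.trans_le hφ.c₀_le_c₁
  set g : ℝ × Space n → Space n := fun z => WithLp.toLp 2 fun j => fderiv ℝ θ z (ex j) with hg
  have hgc : Continuous g := by
    refine (PiLp.continuous_toLp 2 _).comp (continuous_pi fun j => ?_)
    exact (hθ.continuous_fderiv (by norm_num)).clm_apply continuous_const
  have hgs : HasCompactSupport g :=
    (hθc.fderiv ℝ).comp_left (g := fun L : ℝ × Space n →L[ℝ] ℝ =>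
      (WithLp.toLp 2 fun j => L (ex j) : Space n)) (by ext; simp)
  obtain ⟨T₁, hT₁⟩ := hθc.exists_bound_of_continuous hθ.continuous
  obtain ⟨T₂, hT₂⟩ := hgs.exists_bound_of_continuous hgc
  have hκm : AEStronglyMeasurable (fun z => κ (‖P z‖ ^ 2)) (volume.restrict O₂) :=
    (ht.contDiff.continuous.measurable.comp (hs.P_meas.norm.pow_const 2)).aestronglyMeasurable
  have i2 : IntegrableOn (fun z => lowerConst c₀ c₁ * (θ z * ∑ k, ‖Z k z‖ ^ 2) -
      2 * (2 + c₁) * ((nu φ ‖P z‖ * ∑ k, ‖Z k z‖) * ‖g z‖)) O₂ := by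
    refine Integrable.sub (Integrable.const_mul ?_ _) (Integrable.const_mul ?_ _)
    · exact Integrable.bdd_mul (integrable_finsetSum _ fun k _ =>
        (integrable_norm_sq (hr.Z_sq k)).integrableOn) hθ.continuous.aestronglyMeasurable
        (ae_of_all _ hT₁)
    · refine Integrable.mul_bdd (c := T₂) ?_ hgc.norm.aestronglyMeasurable
        (ae_of_all _ fun z => by simpa using hT₂ z)
      simp only [Finset.mul_sum]
      exact integrable_finsetSum _ fun k _ =>
        (integrable_nu_mul hφ hc₀ hs (hr.Z_sq k)).integrableOn
  refine ⟨i2, (integral_mono_ae (Integrable.bdd_mul (c := 1) i2 hκm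
    (ae_of_all _ fun z => ht.abs_le_one _)) i1 ?_).trans e1.le⟩
  have hsy := ae_symm hφ hc₀ hs hr ht hX hO
  rw [EventuallyLE, ae_restrict_iff' hr.isOpen₂.measurableSet]
  filter_upwards [hX, hsy] with z hz1 hz2 hzO
  by_cases hP : P z = 0
  · have h0 : sumSq (fun a => P z a) ≤ γ ^ 2 := by
      rw [sumSq_eq_norm_sq, hP]; simpa using sq_nonneg γ
    rw [limitIntegrand, testIntegrand_eq_zero (ht.zero _ h0) (ht.deriv_zero h0),
      ht.zero _ (by rw [hP]; simpa using sq_nonneg γ), zero_mul]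
  have hX1 := hz1 hzO hP
  have h0 : 0 < ‖P z‖ := norm_pos_iff.2 hP
  have hd0 := hφ.d_pos h0
  have hder : 0 ≤ deriv (d φ) ‖P z‖ := by
    have := (mul_nonneg hc₀.le hd0.le).trans (hφ.lower _ h0)
    exact nonneg_of_mul_nonneg_left this h0
  refine le_trans ?_ (le_testIntegrand_radialDeriv (X := X z) (θ' := fun j => fderiv ℝ θ z (ex j))
    hP hd0.le hder (hθ0 z) (ht.nonneg _) (ht.deriv_nonneg _) (hz2 hzO))
  refine mul_le_mul_of_nonneg_left (sub_le_sub ?_ ?_) (ht.nonneg _)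
  · rw [mul_left_comm]
    refine mul_le_mul_of_nonneg_left ?_ (hθ0 z)
    rw [Finset.mul_sum]
    refine Finset.sum_le_sum fun k _ => ?_
    rw [lowerConst, div_mul_eq_mul_div, div_le_iff₀ (by positivity)]
    linarith [(hX1 k).2.2.1]
  · rw [← mul_assoc, ← mul_assoc]
    refine mul_le_mul_of_nonneg_right ?_ (norm_nonneg _)
    rw [Finset.mul_sum, Finset.mul_sum, Finset.sum_mul]
    exact Finset.sum_le_sum fun k _ => (hX1 k).2.2.2

end Solution

end PhiCaloric
end

/-! ### The weak gradient of `G(|P|)`. -/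

noncomputable section

namespace PhiCaloric

open Filter Topology

section Directional

variable {E : Type*} [NormedAddCommGroup E] [NormedSpace ℝ E] [MeasurableSpace E] [BorelSpace E]
  [FiniteDimensional ℝ E] {μ : Measure E} [μ.IsAddHaarMeasure] {O K : Set E} {e : E} {f Z : E → ℝ}
  {h₀ : ℝ}

lemma tendsto_dq_of_weakGrad (hw : WeakGrad μ O e f Z) (hO : IsOpen O) (hK : MeasurableSet K)
    (hf : Integrable f μ) (hZm : Measurable Z) (hZ : Integrable Z μ) (hZ2 : MemLp Z 2 μ)
    (hh₀ : 0 < h₀) (hseg : ∀ z ∈ K, ∀ s ∈ Icc 0 h₀, z + s • e ∈ O) :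
    Tendsto (fun h : ℝ => ∫ z in K, (dq h e f z - Z z) ^ 2 ∂μ) (𝓝[>] 0) (𝓝 0) :=
  tendsto_dq_L2 hh₀ hK hZm hZ hZ2 fun h hh hhd => by
    filter_upwards [hw.sub_eq_integral hO hf hZm hZ hh] with z hz hzO
    exact hz fun s hs' => hseg z hzO s ⟨hs'.1, hs'.2.trans hhd.le⟩

lemma exists_subseq_tendsto_dq (hf2 : MemLp f 2 μ) (hZ2 : MemLp Z 2 μ)
    (hlim : Tendsto (fun h : ℝ => ∫ z in K, (dq h e f z - Z z) ^ 2 ∂μ) (𝓝[>] 0) (𝓝 0))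
    {h : ℕ → ℝ} (hp : ∀ m, 0 < h m) (ht : Tendsto h atTop (𝓝 0)) (hK : MeasurableSet K) :
    ∃ ns : ℕ → ℕ, StrictMono ns ∧
      ∀ᵐ z ∂μ, z ∈ K → Tendsto (fun m => dq (h (ns m)) e f z) atTop (𝓝 (Z z)) := by
  have t := hlim.comp (tendsto_nhdsWithin_iff.2 ⟨ht, Eventually.of_forall hp⟩)
  obtain ⟨ns, hns, hae⟩ := exists_subseq_tendsto_of_tendsto_L1 (ν := μ.restrict K)
    (f := fun m z => (dq (h m) e f z - Z z) ^ 2) (F := fun _ => 0)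
    (fun m => ((memLp_dq hf2 _ e).sub hZ2).integrable_sq.integrableOn) (integrable_zero _ _ _) (by
      refine t.congr fun m => integral_congr_ae (ae_of_all _ fun z => ?_)
      simp)
  refine ⟨ns, hns, ?_⟩
  rw [ae_restrict_iff' hK] at hae
  filter_upwards [hae] with z hz hzK
  rw [tendsto_iff_norm_sub_tendsto_zero]
  simpa [Real.sqrt_sq_eq_abs] using (hz hzK).sqrt

/-- A set on which a weak derivative is the strong limit of difference quotients admits test
functions of class `C¹`. -/
lemma integral_mul_fderiv_eq_neg (hf : Integrable f μ) (hf2 : MemLp f 2 μ) (hZ2 : MemLp Z 2 μ)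
    (hlim : Tendsto (fun h : ℝ => ∫ z in K, (dq h e f z - Z z) ^ 2 ∂μ) (𝓝[>] 0) (𝓝 0))
    {ζ : E → ℝ} (hζ : ContDiff ℝ 1 ζ) (hζc : HasCompactSupport ζ) (hζK : tsupport ζ ⊆ K) :
    ∫ z, f z * fderiv ℝ ζ z e ∂μ = -∫ z, Z z * ζ z ∂μ := by
  have h1 := tendsto_integral_dq_mul hf hζ hζc e
  have h0 : ∀ z, z ∉ K → ζ z = 0 := fun z hz =>
    image_eq_zero_of_notMem_tsupport fun h => hz (hζK h)
  have hζ2 : MemLp ζ 2 μ := hζ.continuous.memLp_of_hasCompactSupport hζc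
  have h2 : Tendsto (fun h : ℝ => ∫ z, dq h e f z * ζ z ∂μ) (𝓝[>] 0) (𝓝 (∫ z, Z z * ζ z ∂μ)) := by
    rw [tendsto_iff_norm_sub_tendsto_zero]
    have h3 : Tendsto (fun h : ℝ => √(∫ z in K, (dq h e f z - Z z) ^ 2 ∂μ) *
        √(∫ z in K, ζ z ^ 2 ∂μ)) (𝓝[>] 0) (𝓝 0) := by
      simpa using hlim.sqrt.mul_const √(∫ z in K, ζ z ^ 2 ∂μ)
    refine squeeze_zero (fun _ => norm_nonneg _) (fun h => ?_) h3
    have hd : MemLp (fun z => dq h e f z - Z z) 2 μ := (memLp_dq hf2 h e).sub hZ2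
    have i1 : Integrable (fun z => dq h e f z * ζ z) μ := (memLp_dq hf2 h e).integrable_mul hζ2
    have i2 : Integrable (fun z => Z z * ζ z) μ := hZ2.integrable_mul hζ2
    rw [← integral_sub i1 i2]
    simp only [← sub_mul]
    rw [integral_mul_eq_setIntegral h0]
    refine (norm_integral_le_integral_norm _).trans ?_
    simp only [norm_mul]
    have := integral_mul_le_Lp_mul_Lq_of_nonneg (μ := μ.restrict K) Real.HolderConjugate.two_two
      (f := fun z => ‖dq h e f z - Z z‖) (g := fun z => ‖ζ z‖) (ae_of_all _ fun _ => norm_nonneg _)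
      (ae_of_all _ fun _ => norm_nonneg _) (by simpa using (hd.restrict K).norm)
      (by simpa using (hζ2.restrict K).norm)
    simpa [Real.sqrt_eq_rpow] using this
  have := tendsto_nhds_unique h2 h1
  rw [this, neg_neg]

end Directional

namespace Solution

variable {N n : ℕ} {φ : ℝ → ℝ} {c₀ c₁ : ℝ} {O O₁ O₂ : Set (ℝ × Space n)}
  {u : ℝ × Space n → Space N} {P : ℝ × Space n → Mat N n} {Z : Fin n → ℝ × Space n → Mat N n}
  {h : ℕ → ℝ}

variable (hφ : IsOrlicz φ c₀ c₁) (hc₀ : 0 < c₀) (hs : Solution φ O u P)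
  (hr : Regular φ O O₁ O₂ u P Z h)

lemma G_eq (γ t : ℝ) : G φ γ t = max (nu φ t - nu φ γ) 0 := rfl

include hφ hc₀ in
lemma abs_G_sub_le (γ : ℝ) (P Q : Mat N n) : |G φ γ ‖Q‖ - G φ γ ‖P‖| ≤ ‖V φ Q - V φ P‖ := by
  rw [G_eq, G_eq]
  refine (abs_max_sub_max_le_abs _ _ _).trans ?_
  rw [sub_sub_sub_cancel_right, ← hφ.V_norm hc₀, ← hφ.V_norm hc₀]
  exact abs_norm_sub_norm_le _ _

include hφ hc₀ in
lemma measurable_G (γ : ℝ) : Measurable fun Q : Mat N n => G φ γ ‖Q‖ := by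
  have h1 : Measurable fun Q : Mat N n => nu φ ‖Q‖ := by
    simp_rw [← hφ.V_norm hc₀ (F := Mat N n)]
    exact hφ.measurable_V.norm
  exact (h1.sub measurable_const).max measurable_const

include hφ hc₀ in
lemma G_nonneg_le (γ : ℝ) (Q : Mat N n) : 0 ≤ G φ γ ‖Q‖ ∧ G φ γ ‖Q‖ ≤ ‖V φ Q‖ := by
  rw [G_eq, ← hφ.V_norm hc₀]
  refine ⟨le_max_right _ _, max_le ?_ (norm_nonneg _)⟩
  have : 0 ≤ nu φ γ := Real.sqrt_nonneg _
  linarith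

include hφ hc₀ in
lemma G_eq_zero {γ : ℝ} {t : ℝ} (ht : 0 ≤ t) (h : t ≤ γ) : G φ γ t = 0 := by
  rw [G_eq]
  exact max_eq_right (sub_nonpos.2 ((hφ.powerGrowth_nu hc₀).mono ht h))

include hφ hc₀ hs hr in
/-- The weak gradient of `G(|P|)`, with its comparison to the derivatives of `V(P)`. -/
lemma exists_weakGrad_G (γ : ℝ) : ∃ Y : Fin n → ℝ × Space n → ℝ,
    ∀ j, Measurable (Y j) ∧ MemLp (Y j) 2 ∧
      (∀ ζ : ℝ × Space n → ℝ, ContDiff ℝ 1 ζ → HasCompactSupport ζ → tsupport ζ ⊆ O₂ →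
        ∫ z, G φ γ ‖P z‖ * fderiv ℝ ζ z (ex j) = -∫ z, Y j z * ζ z) ∧
      ∀ᵐ z, z ∈ O₂ → |Y j z| ≤ ‖Z j z‖ ∧ (‖P z‖ ≤ γ → Y j z = 0) := by
  set g : ℝ × Space n → ℝ := fun z => G φ γ ‖P z‖ with hg
  have hVi := integrable_V hφ hc₀ hs
  have hV2 := memLp_V hφ hc₀ hs
  have hgm : Measurable g := (measurable_G hφ hc₀ γ).comp hs.P_meas
  have hgV : ∀ z, ‖g z‖ ≤ ‖V φ (P z)‖ := fun z => by
    rw [Real.norm_of_nonneg (G_nonneg_le hφ hc₀ γ _).1]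
    exact (G_nonneg_le hφ hc₀ γ _).2
  have hgi : Integrable g := hVi.mono hgm.aestronglyMeasurable (ae_of_all _ hgV)
  have hg2 : MemLp g 2 := hV2.mono hgm.aestronglyMeasurable (ae_of_all _ hgV)
  have hdq : ∀ (s : ℝ) (e z : ℝ × Space n), |dq s e g z| ≤ ‖dq s e (fun z => V φ (P z)) z‖ :=
    fun s e z => by
      rw [dq, dq, smul_eq_mul, abs_mul, norm_smul, Real.norm_eq_abs]
      exact mul_le_mul_of_nonneg_left (abs_G_sub_le hφ hc₀ γ _ _) (abs_nonneg _)
  obtain ⟨C, s₀, hs₀, hb⟩ := hr.bound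
  have hY : ∀ j : Fin n, ∃ Y : ℝ × Space n → ℝ, Measurable Y ∧ MemLp Y 2 volume ∧
      (∀ z ∉ O₁, Y z = 0) ∧ WeakGrad volume O₁ (ex j) g Y := fun j => by
    refine exists_weakGrad_of_dq_le hr.isOpen₁ hgi hg2 hs₀ (C := C) fun s hs0 hs1 => ?_
    refine le_trans (setIntegral_mono (memLp_dq hg2 s (ex j)).integrable_sq.integrableOn
      (integrable_norm_sq (memLp_dq hV2 s (ex j))).integrableOn fun z => ?_) (hb s hs0 hs1 j)
    exact sq_le_sq' (abs_le.1 (hdq s (ex j) z)).1 (abs_le.1 (hdq s (ex j) z)).2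
  choose Y hYm hY2 hY0 hYw using hY
  obtain ⟨h₀, hh₀, hreach⟩ := hr.reach
  refine ⟨Y, fun j => ?_⟩
  have hYi := integrable_of_memLp_of_bounded hr.isOpen₁.measurableSet hr.bdd (hY2 j) (hY0 j)
  have l1 := tendsto_dq_of_weakGrad (hYw j) hr.isOpen₁ hr.isOpen₂.measurableSet hgi (hYm j) hYi (hY2 j) hh₀
    fun z hz s hs' => hreach z hz j s (by rw [abs_of_nonneg hs'.1]; exact hs'.2)
  -- Difference quotients in the opposite direction converge to `-Y`. Where `|P| ≤ γ` the function
  -- `G(|P|)` attains its minimum `0`, so quotients in both directions are nonnegative, and `Y = 0`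
  -- follows.
  have l2 := tendsto_dq_of_weakGrad (hYw j).neg_dir hr.isOpen₁ hr.isOpen₂.measurableSet hgi (hYm j).neg
    hYi.neg (hY2 j).neg hh₀ fun z hz s hs' => by
      have := hreach z hz j (-s) (by rw [abs_neg, abs_of_nonneg hs'.1]; exact hs'.2)
      simpa using this
  refine ⟨hYm j, hY2 j, fun ζ hζ hζc hζO => integral_mul_fderiv_eq_neg hgi hg2 (hY2 j) l1 hζ hζc hζO,
    ?_⟩
  obtain ⟨ns, hns, a1⟩ := exists_subseq_tendsto_dq hg2 (hY2 j) l1 hr.h_pos hr.h_tendsto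
    hr.isOpen₂.measurableSet
  obtain ⟨ns', hns', a2⟩ := exists_subseq_tendsto_dq hg2 (hY2 j).neg l2 hr.h_pos hr.h_tendsto
    hr.isOpen₂.measurableSet
  filter_upwards [a1, a2, hr.V_ae j] with z z1 z2 z3 hzO
  have hsign : ‖P z‖ ≤ γ → ∀ s : ℝ, 0 < s → ∀ e, 0 ≤ dq s e g z := fun hz s hs' e => by
    have e1 : g z = 0 := G_eq_zero hφ hc₀ (norm_nonneg _) hz
    rw [dq, e1, sub_zero, smul_eq_mul]
    exact mul_nonneg (by positivity) (G_nonneg_le hφ hc₀ γ _).1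
  refine ⟨?_, fun hz => le_antisymm ?_ ?_⟩
  · exact le_of_tendsto_of_tendsto' (z1 hzO).abs ((z3 hzO).comp hns.tendsto_atTop).norm
      fun m => hdq _ _ _
  · have := ge_of_tendsto' (z2 hzO) fun m => hsign hz _ (hr.h_pos _) _
    simpa using this
  · exact ge_of_tendsto' (z1 hzO) fun m => hsign hz _ (hr.h_pos _) _

end Solution

/-! ### The product rule with a factor of class `C¹`. -/

section Product

variable {n : ℕ} {U : Set (ℝ × Space n)} {g Y : ℝ × Space n → ℝ} {j : Fin n}

/-- The product rule for a weak partial derivative. -/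
lemma hasWeakPartial_mul (hU : IsOpen U) {ξ ξ' : ℝ × Space n → ℝ} (hξ : ContDiff ℝ 1 ξ)
    (hg : Integrable g) (hY : Integrable Y) (hξ' : ∀ z ∈ U, fderiv ℝ ξ z (ex j) = ξ' z)
    (h : ∀ ζ : ℝ × Space n → ℝ, ContDiff ℝ 1 ζ → HasCompactSupport ζ → tsupport ζ ⊆ U →
      ∫ z, g z * fderiv ℝ ζ z (ex j) = -∫ z, Y z * ζ z) :
    HasWeakPartial U j (fun z => g z * ξ z) (fun z => Y z * ξ z + g z * ξ' z) := by
  have hξv : Continuous fun z => fderiv ℝ ξ z (ex j) :=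
    (hξ.continuous_fderiv (by norm_num)).clm_apply continuous_const
  have l1 : ∀ {f ζ : ℝ × Space n → ℝ}, Integrable f → Continuous ζ →
      LocallyIntegrable fun z => f z * ζ z := fun hf hζ => by
    have := hf.locallyIntegrable.smul_continuous hζ
    simpa [mul_comm] using this
  have hcong : ∀ z ∈ U, Y z * ξ z + g z * fderiv ℝ ξ z (ex j) = Y z * ξ z + g z * ξ' z :=
    fun z hz => by rw [hξ' z hz]
  refine ⟨(l1 hg hξ.continuous).locallyIntegrableOn _, ?_, fun ζ hζ => ?_⟩
  · have h1 := ((l1 hY hξ.continuous).add (l1 hg hξv)).locallyIntegrableOn U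
    rw [locallyIntegrableOn_iff hU.isLocallyClosed] at h1 ⊢
    exact fun k hkU hk => (h1 k hkU hk).congr_fun (fun z hz => hcong z (hkU hz)) hk.measurableSet
  · obtain ⟨hs, hc, hsub⟩ := hζ
    have hs1 : ContDiff ℝ 1 ζ := hs.of_le (by exact_mod_cast le_top)
    have h0 : ∀ z, z ∉ U → ζ z = 0 := fun z hz =>
      image_eq_zero_of_notMem_tsupport fun h => hz (hsub h)
    have h0' : ∀ z, z ∉ U → fderiv ℝ ζ z (ex j) = 0 := fun z hz => by
      rw [image_eq_zero_of_notMem_tsupport fun h => hz (hsub (tsupport_fderiv_subset ℝ h))]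
      rfl
    have hζv : Continuous fun z => fderiv ℝ ζ z (ex j) :=
      (hs.continuous_fderiv (by simp)).clm_apply continuous_const
    have hζvc : HasCompactSupport fun z => fderiv ℝ ζ z (ex j) :=
      (hc.fderiv ℝ).comp_left (g := fun L : ℝ × Space n →L[ℝ] ℝ => L (ex j)) (by simp)
    have hi : ∀ {f ψ : ℝ × Space n → ℝ}, Integrable f → Continuous ψ → HasCompactSupport ψ →
        Integrable fun z => f z * ψ z := fun hf hψ hψc => by
      obtain ⟨T, hT⟩ := hψc.exists_bound_of_continuous hψ
      exact hf.mul_bdd hψ.aestronglyMeasurable (ae_of_all _ hT)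
    -- The product is only of class `C¹`, as `ξ` will be a power `η^(q/2)`; therefore the hypothesis
    -- on `g` admits test functions of class `C¹`.
    have key := h (fun z => ξ z * ζ z) (hξ.mul hs1) hc.mul_left
      ((tsupport_mul_subset_right).trans hsub)
    have e1 : ∀ z, g z * fderiv ℝ (fun z => ξ z * ζ z) z (ex j) =
        g z * (ξ z * fderiv ℝ ζ z (ex j)) + g z * (fderiv ℝ ξ z (ex j) * ζ z) := fun z => by
      rw [fderiv_fun_mul (hξ.differentiable (by norm_num) z) (hs1.differentiable (by norm_num) z)]
      simp only [FunLike.coe_add, Pi.add_apply, FunLike.coe_smul, Pi.smul_apply, smul_eq_mul]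
      ring
    have i1 : Integrable fun z => g z * (ξ z * fderiv ℝ ζ z (ex j)) := hi hg (hξ.continuous.mul hζv) hζvc.mul_left
    have i2 : Integrable fun z => g z * (fderiv ℝ ξ z (ex j) * ζ z) := hi hg (hξv.mul hs.continuous) hc.mul_left
    have i3 : Integrable fun z => Y z * (ξ z * ζ z) := hi hY (hξ.continuous.mul hs.continuous) hc.mul_left
    simp_rw [e1] at key
    rw [integral_add i1 i2] at key
    have e2 : ∫ z in U, g z * ξ z * spacePartial j ζ z =
        ∫ z, g z * (ξ z * fderiv ℝ ζ z (ex j)) := by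
      rw [← integral_mul_eq_setIntegral (ζ := spacePartial j ζ) (f := fun z => g z * ξ z) h0']
      exact integral_congr_ae (ae_of_all _ fun z => mul_assoc _ _ _)
    have e3 : ∫ z in U, (Y z * ξ z + g z * ξ' z) * ζ z =
        ∫ z, (Y z * (ξ z * ζ z) + g z * (fderiv ℝ ξ z (ex j) * ζ z)) := by
      rw [← integral_mul_eq_setIntegral h0]
      refine integral_congr_ae (ae_of_all _ fun z => ?_)
      by_cases hz : z ∈ U
      · simp only [hξ' z hz]
        ring
      · simp [h0 z hz]
    rw [e2, e3, integral_add i3 i2]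
    linarith

end Product

end PhiCaloric
end

/-! ### Approximation of the level set `{v > γ}` and cut-off functions in time. -/

noncomputable section

namespace PhiCaloric

open Filter Topology

section Trunc

/-- Smooth approximations of the characteristic function of `(γ², ∞)`. -/
def trunc (γ : ℝ) (m : ℕ) (y : ℝ) : ℝ := Real.smoothTransition ((m + 1) * (y - γ ^ 2))

/-- The primitive of `trunc`. -/
def truncPrim (γ : ℝ) (m : ℕ) (y : ℝ) : ℝ := ∫ s in (0 : ℝ)..y, trunc γ m s

variable {γ : ℝ} {m : ℕ}

lemma contDiff_trunc : ContDiff ℝ 1 (trunc γ m) := by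
  have h : ContDiff ℝ 1 fun y : ℝ => (m + 1 : ℝ) * (y - γ ^ 2) := by fun_prop
  exact (Real.smoothTransition.contDiff (n := 1)).comp h

lemma trunc_nonneg (y : ℝ) : 0 ≤ trunc γ m y := Real.smoothTransition.nonneg _

lemma trunc_le_one (y : ℝ) : trunc γ m y ≤ 1 := Real.smoothTransition.le_one _

lemma trunc_zero {y : ℝ} (hy : y ≤ γ ^ 2) : trunc γ m y = 0 :=
  Real.smoothTransition.zero_of_nonpos
    (mul_nonpos_of_nonneg_of_nonpos (by positivity) (sub_nonpos.2 hy))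

lemma trunc_one {y : ℝ} (hy : γ ^ 2 + 1 ≤ y) : trunc γ m y = 1 := by
  refine Real.smoothTransition.one_of_one_le ?_
  have h1 : (0 : ℝ) ≤ m := by positivity
  nlinarith

lemma tendsto_trunc (y : ℝ) :
    Tendsto (fun m => trunc γ m y) atTop (𝓝 ((Ioi (γ ^ 2)).indicator (fun _ => 1) y)) := by
  rcases le_or_gt y (γ ^ 2) with hy | hy
  · simp [trunc_zero hy, hy]
  · rw [indicator_of_mem (show y ∈ Ioi (γ ^ 2) from hy)]
    refine tendsto_const_nhds.congr' ?_
    have h0 : 0 < y - γ ^ 2 := sub_pos.2 hy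
    filter_upwards [eventually_ge_atTop ⌈(y - γ ^ 2)⁻¹⌉₊] with m hm
    refine (Real.smoothTransition.one_of_one_le ?_).symm
    have h1 : (y - γ ^ 2)⁻¹ ≤ m := (Nat.le_ceil _).trans (by exact_mod_cast hm)
    have h2 := mul_le_mul_of_nonneg_right h1 h0.le
    rw [inv_mul_cancel₀ h0.ne'] at h2
    nlinarith

lemma trunc_le_indicator (y : ℝ) : trunc γ m y ≤ (Ioi (γ ^ 2)).indicator (fun _ => 1) y := by
  rcases le_or_gt y (γ ^ 2) with hy | hy
  · simp [trunc_zero hy, hy]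
  · rw [indicator_of_mem (show y ∈ Ioi (γ ^ 2) from hy)]
    exact trunc_le_one y

lemma integral_indicator_Ioi {y : ℝ} (hy : 0 ≤ y) :
    ∫ s in (0 : ℝ)..y, (Ioi (γ ^ 2)).indicator (fun _ => (1 : ℝ)) s = max (y - γ ^ 2) 0 := by
  rw [intervalIntegral.integral_of_le hy, setIntegral_indicator measurableSet_Ioi, Ioc_inter_Ioi,
    max_eq_right (sq_nonneg γ)]
  simp

lemma intervalIntegrable_indicator (a b : ℝ) :
    IntervalIntegrable ((Ioi (γ ^ 2)).indicator fun _ => (1 : ℝ)) volume a b := by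
  have h : IntegrableOn (fun _ => (1 : ℝ)) (uIoc a b) :=
    intervalIntegrable_iff.1 (continuous_const.intervalIntegrable a b)
  rw [intervalIntegrable_iff]
  exact h.indicator measurableSet_Ioi

lemma truncPrim_nonneg {y : ℝ} (hy : 0 ≤ y) : 0 ≤ truncPrim γ m y :=
  intervalIntegral.integral_nonneg hy fun s _ => trunc_nonneg s

lemma truncPrim_le {y : ℝ} (hy : 0 ≤ y) : truncPrim γ m y ≤ max (y - γ ^ 2) 0 := by
  rw [← integral_indicator_Ioi hy]
  exact intervalIntegral.integral_mono_on hy (contDiff_trunc.continuous.intervalIntegrable _ _)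
    (intervalIntegrable_indicator _ _) fun s _ => trunc_le_indicator s

lemma tendsto_truncPrim {y : ℝ} (hy : 0 ≤ y) :
    Tendsto (fun m => truncPrim γ m y) atTop (𝓝 (max (y - γ ^ 2) 0)) := by
  rw [← integral_indicator_Ioi hy]
  refine intervalIntegral.tendsto_integral_filter_of_dominated_convergence (fun _ => 1)
    (Eventually.of_forall fun m => contDiff_trunc.continuous.aestronglyMeasurable)
    (Eventually.of_forall fun m => ae_of_all _ fun s _ => ?_) (by simp)
    (ae_of_all _ fun s _ => tendsto_trunc s)
  rw [Real.norm_of_nonneg (trunc_nonneg s)]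
  exact trunc_le_one s

lemma exists_truncation (hγ : 0 < γ) (m : ℕ) :
    ∃ C, Truncation γ C (trunc γ m) (truncPrim γ m) := by
  have hd : Continuous (deriv (trunc γ m)) := contDiff_trunc.continuous_deriv (le_refl 1)
  have hc : Continuous fun y => deriv (trunc γ m) y * (1 + y) := hd.mul (by fun_prop)
  obtain ⟨C, hC⟩ := (isCompact_Icc (a := (0 : ℝ)) (b := γ ^ 2 + 1)).exists_bound_of_continuousOn
    hc.continuousOn
  have hC0 : 0 ≤ C := (norm_nonneg _).trans (hC 0 ⟨le_rfl, by positivity⟩)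
  refine ⟨C, hγ, contDiff_trunc, trunc_nonneg, trunc_le_one, fun y => trunc_zero, fun y => ?_,
    fun y hy => ?_, fun y => ?_, fun y hy => ?_⟩
  · refine Monotone.deriv_nonneg fun a b hab => Real.smoothTransition.monotone ?_
    have h1 : (0 : ℝ) ≤ m := by positivity
    nlinarith
  · rcases le_or_gt y (γ ^ 2 + 1) with h1 | h1
    · exact (le_abs_self _).trans (hC y ⟨hy, h1⟩)
    · have : deriv (trunc γ m) y = 0 := by
        refine IsLocalMax.deriv_eq_zero (Eventually.of_forall fun x => ?_)
        rw [trunc_one h1.le]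
        exact trunc_le_one x
      rw [this, zero_mul]
      exact hC0
  · exact (contDiff_trunc.continuous.integral_hasStrictDerivAt 0 y).hasDerivAt
  · rw [abs_of_nonneg (truncPrim_nonneg hy)]
    refine (truncPrim_le hy).trans (max_le ?_ hy)
    linarith [sq_nonneg γ]

end Trunc

section TimeCutoff

/-- The time cut-off `t ↦ ∫ₜᵇ k`. -/
def timeCutoff (k : ℝ → ℝ) (b t : ℝ) : ℝ := ∫ s in t..b, k s

variable {k : ℝ → ℝ} {a b b' t : ℝ}

lemma hasDerivAt_timeCutoff (hk : Continuous k) (b t : ℝ) :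
    HasDerivAt (timeCutoff k b) (-k t) t := by
  have h1 := (hk.integral_hasStrictDerivAt b t).hasDerivAt.neg
  have h2 : timeCutoff k b = -fun t => ∫ s in b..t, k s := by
    funext t
    simp only [timeCutoff, Pi.neg_apply]
    exact intervalIntegral.integral_symm _ _
  rw [h2]
  exact h1

lemma contDiff_timeCutoff (hk : Continuous k) : ContDiff ℝ 1 (timeCutoff k b) := by
  rw [contDiff_one_iff_deriv]
  have h : deriv (timeCutoff k b) = fun t => -k t :=
    funext fun t => (hasDerivAt_timeCutoff hk b t).deriv
  exact ⟨fun t => (hasDerivAt_timeCutoff hk b t).differentiableAt, by rw [h]; exact hk.neg⟩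

variable (hk0 : ∀ s, 0 ≤ k s) (hs : ∀ s, s ∉ Icc a b' → k s = 0) (hb : b' ≤ b)

include hs hb in
lemma timeCutoff_zero (ht : b' < t) : timeCutoff k b t = 0 := by
  rcases le_total t b with h | h
  · rw [timeCutoff, intervalIntegral.integral_of_le h]
    refine setIntegral_eq_zero_of_forall_eq_zero fun s hs' => hs s fun h' => ?_
    exact absurd (ht.trans hs'.1) (not_lt.2 h'.2)
  · rw [timeCutoff, intervalIntegral.integral_of_ge h, neg_eq_zero]
    refine setIntegral_eq_zero_of_forall_eq_zero fun s hs' => hs s fun h' => ?_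
    exact absurd (hb.trans_lt hs'.1) (not_lt.2 h'.2)

include hk0 hs hb in
lemma timeCutoff_nonneg : 0 ≤ timeCutoff k b t := by
  rcases le_or_gt t b with h | h
  · exact intervalIntegral.integral_nonneg h fun s _ => hk0 s
  · rw [timeCutoff_zero hs hb (hb.trans_lt h)]

variable (hki : Integrable k) (h1 : ∫ s, k s = 1)

include hk0 hs hb hki h1 in
lemma timeCutoff_le_one : timeCutoff k b t ≤ 1 := by
  rcases le_or_gt t b with h | h
  · rw [timeCutoff, intervalIntegral.integral_of_le h, ← h1]
    exact setIntegral_le_integral hki (ae_of_all _ hk0)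
  · rw [timeCutoff_zero hs hb (hb.trans_lt h)]
    exact zero_le_one

include hs hb h1 in
lemma timeCutoff_one (ht : t < a) (hab : a ≤ b) : timeCutoff k b t = 1 := by
  rw [timeCutoff, intervalIntegral.integral_of_le (ht.le.trans hab), ← h1]
  refine setIntegral_eq_integral_of_forall_compl_eq_zero fun s hs' => hs s fun h' => hs' ?_
  exact ⟨ht.trans_le h'.1, h'.2.trans hb⟩

end TimeCutoff

end PhiCaloric
end

/-! ### The Caccioppoli inequality with a cut-off function in time. -/

noncomputable section

namespace PhiCaloric

open Filter Topology

section ParTest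

variable {n : ℕ} {t₀ α ρ q : ℝ} {x₀ : Space n} {η : ℝ × Space n → ℝ} {ψ ψ' : ℝ → ℝ} {b : ℝ}

lemma isOpen_cyl : IsOpen (cyl t₀ x₀ α ρ) := isOpen_Ioo.prod Metric.isOpen_ball

lemma isCompact_closure_cyl : IsCompact (closure (cyl t₀ x₀ α ρ)) := by
  rw [cyl, timeInt, closure_prod_eq]
  refine IsCompact.prod ?_ ?_
  · exact isCompact_Icc.of_isClosed_subset isClosed_closure
      (closure_minimal Ioo_subset_Icc_self isClosed_Icc)
  · exact (ProperSpace.isCompact_closedBall x₀ ρ).of_isClosed_subset isClosed_closure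
      Metric.closure_ball_subset_closedBall

/-- The test function `η^q ψ(t)`. -/
def parCutoff (η : ℝ × Space n → ℝ) (q : ℝ) (ψ : ℝ → ℝ) (z : ℝ × Space n) : ℝ := η z ^ q * ψ z.1

lemma hasFDerivAt_parCutoff (hη : ContDiff ℝ ∞ η) (hq : 1 ≤ q) (hψ : ∀ t, HasDerivAt ψ (ψ' t) t)
    (z v : ℝ × Space n) : fderiv ℝ (parCutoff η q ψ) z v =
      q * η z ^ (q - 1) * fderiv ℝ η z v * ψ z.1 + η z ^ q * (ψ' z.1 * v.1) := by
  have h1 : HasFDerivAt η (fderiv ℝ η z) z := (hη.differentiable (by simp) z).hasFDerivAt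
  have h2 := (Real.hasDerivAt_rpow_const (x := η z) (p := q) (Or.inr hq)).comp_hasFDerivAt z h1
  have h3 := (hψ z.1).comp_hasFDerivAt z (hasFDerivAt_fst (𝕜 := ℝ) (p := z))
  have h4 : HasFDerivAt (parCutoff η q ψ) _ z := h2.mul h3
  rw [h4.fderiv]
  simp
  ring

lemma contDiff_parCutoff (hη : ContDiff ℝ ∞ η) (hq : 1 ≤ q) (hψ : ContDiff ℝ 1 ψ) :
    ContDiff ℝ 1 (parCutoff η q ψ) := by
  have h1 : ContDiff ℝ (1 : ℕ) fun x : ℝ => x ^ q := Real.contDiff_rpow_const_of_le (by simpa)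
  exact (ContDiff.comp (by exact_mod_cast h1) (hη.of_le (by exact_mod_cast le_top))).mul
    (hψ.comp contDiff_fst)

/-- `η` need not vanish at the top `t₀` of the cylinder. The factor `ψ`, which vanishes after a time
`b < t₀`, makes the support compact in the open cylinder. -/
lemma IsParTest.exists_compact (hη : IsParTest t₀ x₀ α ρ η) (hq : q ≠ 0) (hb : b < t₀)
    (hψ : ∀ t, b < t → ψ t = 0) : ∃ F, IsCompact F ∧ F ⊆ cyl t₀ x₀ α ρ ∧
      ∀ z, z ∉ F → parCutoff η q ψ z = 0 := by
  obtain ⟨-, K, hK, hsub, h0⟩ := hη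
  refine ⟨K ∩ {z | z.1 ≤ b}, hK.inter_right (isClosed_le continuous_fst continuous_const),
    fun z hz => ⟨⟨(hsub hz.1).1.1, lt_of_le_of_lt hz.2 hb⟩, (hsub hz.1).2⟩, fun z hz => ?_⟩
  rcases le_or_gt z.1 b with h | h
  · have hzK : z ∉ K := fun hzK => hz ⟨hzK, h⟩
    rw [parCutoff, h0 z (h.trans hb.le) hzK, Real.zero_rpow hq, zero_mul]
  · rw [parCutoff, hψ _ h, mul_zero]

end ParTest

namespace Solution

variable {N n : ℕ} {φ : ℝ → ℝ} {c₀ c₁ : ℝ} {O O₁ O₂ : Set (ℝ × Space n)}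
  {u : ℝ × Space n → Space N} {P : ℝ × Space n → Mat N n} {Z : Fin n → ℝ × Space n → Mat N n}
  {h : ℕ → ℝ}

variable (hφ : IsOrlicz φ c₀ c₁) (hc₀ : 0 < c₀) (hs : Solution φ O u P)
  (hr : Regular φ O O₁ O₂ u P Z h)

include hφ hc₀ hs hr in
/-- The energy inequality on the level set `{|P| > γ}`. -/
lemma energy_inequality_level (hO : IsOpen O) {γ : ℝ} (hγ : 0 < γ) {θ : ℝ × Space n → ℝ}
    (hθ : ContDiff ℝ 1 θ) (hθc : HasCompactSupport θ) (hθO : tsupport θ ⊆ O₂)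
    (hθ0 : ∀ z, 0 ≤ θ z) :
    IntegrableOn (fun z => lowerConst c₀ c₁ * (θ z * ∑ k, ‖Z k z‖ ^ 2) -
      2 * (2 + c₁) * ((nu φ ‖P z‖ * ∑ k, ‖Z k z‖) *
        ‖(WithLp.toLp 2 fun j => fderiv ℝ θ z (ex j) : Space n)‖)) O₂ ∧
    ∫ z in O₂, {z | γ < ‖P z‖}.indicator (fun z => lowerConst c₀ c₁ * (θ z * ∑ k, ‖Z k z‖ ^ 2) -
      2 * (2 + c₁) * ((nu φ ‖P z‖ * ∑ k, ‖Z k z‖) *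
        ‖(WithLp.toLp 2 fun j => fderiv ℝ θ z (ex j) : Space n)‖)) z ≤
      1 / 2 * ∫ z in O₂, H γ ‖P z‖ * fderiv ℝ θ z et := by
  choose C hC using fun m => exists_truncation hγ m
  have key := fun m => energy_inequality hφ hc₀ hs hr (hC m) hθ hθc hθO hO hθ0
  set F : ℝ × Space n → ℝ := fun z => lowerConst c₀ c₁ * (θ z * ∑ k, ‖Z k z‖ ^ 2) -
      2 * (2 + c₁) * ((nu φ ‖P z‖ * ∑ k, ‖Z k z‖) *
        ‖(WithLp.toLp 2 fun j => fderiv ℝ θ z (ex j) : Space n)‖) with hF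
  have iF : IntegrableOn F O₂ := (key 0).1
  refine ⟨iF, ?_⟩
  have hvm : Measurable fun z => ‖P z‖ ^ 2 := hs.P_meas.norm.pow_const 2
  have t1 : Tendsto (fun m => ∫ z in O₂, trunc γ m (‖P z‖ ^ 2) * F z) atTop
      (𝓝 (∫ z in O₂, {z | γ < ‖P z‖}.indicator F z)) := by
    refine tendsto_integral_of_dominated_convergence (fun z => |F z|) (fun m => ?_) iF.abs
      (fun m => ae_of_all _ fun z => ?_) (ae_of_all _ fun z => ?_)
    · exact (contDiff_trunc.continuous.measurable.comp hvm).aestronglyMeasurable.mul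
        iF.aestronglyMeasurable
    · rw [norm_mul, Real.norm_of_nonneg (trunc_nonneg _)]
      exact mul_le_of_le_one_left (abs_nonneg _) (trunc_le_one _)
    · have h1 := (tendsto_trunc (γ := γ) (‖P z‖ ^ 2)).mul_const (F z)
      convert h1 using 2
      by_cases hz : γ < ‖P z‖
      · rw [indicator_of_mem (show z ∈ {z | γ < ‖P z‖} from hz), indicator_of_mem, one_mul]
        exact pow_lt_pow_left₀ hz hγ.le two_ne_zero
      · rw [indicator_of_notMem (show z ∉ {z | γ < ‖P z‖} from hz), indicator_of_notMem, zero_mul]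
        exact not_lt.2 (pow_le_pow_left₀ (norm_nonneg _) (not_lt.1 hz) 2)
  obtain ⟨T, hT⟩ := exists_bound_fderiv hθ hθc et
  have hθt : Continuous fun z => fderiv ℝ θ z et :=
    (hθ.continuous_fderiv (by norm_num)).clm_apply continuous_const
  have hKc : ∀ m, Continuous (truncPrim γ m) := fun m =>
    Differentiable.continuous (𝕜 := ℝ) fun y => ((hC m).hasDerivAt y).differentiableAt
  have t2 : Tendsto (fun m => ∫ z in O₂, truncPrim γ m (‖P z‖ ^ 2) * fderiv ℝ θ z et) atTop
      (𝓝 (∫ z in O₂, H γ ‖P z‖ * fderiv ℝ θ z et)) := by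
    refine tendsto_integral_of_dominated_convergence (fun z => ‖P z‖ ^ 2 * T) (fun m => ?_)
      ((integrable_norm_sq hs.P_sq).mul_const T).integrableOn
      (fun m => ae_of_all _ fun z => ?_) (ae_of_all _ fun z => ?_)
    · exact ((hKc m).measurable.comp hvm).aestronglyMeasurable.mul hθt.aestronglyMeasurable
    · rw [norm_mul, Real.norm_of_nonneg (truncPrim_nonneg (sq_nonneg _))]
      refine mul_le_mul ?_ (hT z) (abs_nonneg _) (sq_nonneg _)
      refine (truncPrim_le (sq_nonneg _)).trans (max_le ?_ (sq_nonneg _))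
      linarith [sq_nonneg γ]
    · exact (tendsto_truncPrim (sq_nonneg _)).mul_const _
  exact le_of_tendsto_of_tendsto' t1 (t2.const_mul (1 / 2)) fun m => (key m).2

lemma sum_norm_le {ι : Type*} [Fintype ι] {F : Type*} [NormedAddCommGroup F] (Z : ι → F) :
    (∑ k, ‖Z k‖) ^ 2 ≤ Fintype.card ι * ∑ k, ‖Z k‖ ^ 2 := by
  simpa using sq_sum_le_card_mul_sum_sq (s := Finset.univ) (f := fun k => ‖Z k‖)

/-- The absorption of the mixed term. -/
lemma absorb {c D q s S e B w ν x k : ℝ} (hc : 0 < c) (hk : 0 < k) (hs0 : 0 ≤ s) (hs1 : s ≤ 1)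
    (hq : 2 ≤ q) (hD : 0 ≤ D) (hx : 0 ≤ x) (hxS : x ≤ S) (hν : 0 ≤ ν) (hνe : ν ^ 2 = e)
    (hw : 0 ≤ w) (hwB : w ^ 2 ≤ k * B) :
    c / 2 * (s ^ q * B) - D ^ 2 * q ^ 2 * k / (2 * c) * (S ^ 2 * e) ≤
      c * (s ^ q * B) - D * ((ν * w) * (q * s ^ (q - 1) * x)) := by
  -- For `0 ≤ s ≤ 1` this needs `q - 1 ≥ q/2`, that is `q ≥ 2`. The square of `s^(q/2)` is the
  -- weight `s^q` of the good term, so the mixed term can be absorbed.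
  have h1 : s ^ (q - 1) ≤ s ^ (q / 2) :=
    Real.rpow_le_rpow_of_exponent_ge' hs0 hs1 (by linarith) (by linarith)
  have h2 : s ^ q = (s ^ (q / 2)) ^ 2 := by
    rw [← Real.rpow_natCast, ← Real.rpow_mul hs0]; norm_num
  have ha : 0 ≤ s ^ (q / 2) := Real.rpow_nonneg hs0 _
  rw [h2]
  set a := s ^ (q / 2)
  have h3 : D * ((ν * w) * (q * s ^ (q - 1) * x)) ≤ (a * w) * (D * q * S * ν) := by
    calc _ ≤ D * ((ν * w) * (q * a * S)) := by gcongr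
      _ = _ := by ring
  have h4 : (a * w) * (D * q * S * ν) ≤
      c / (2 * k) * (a * w) ^ 2 + k / (2 * c) * (D * q * S * ν) ^ 2 := by
    have h5 : 0 ≤ (2 * k * c)⁻¹ * (c * (a * w) - k * (D * q * S * ν)) ^ 2 := by positivity
    have h6 : (2 * k * c)⁻¹ * (c * (a * w) - k * (D * q * S * ν)) ^ 2 =
        c / (2 * k) * (a * w) ^ 2 + k / (2 * c) * (D * q * S * ν) ^ 2 -
        (a * w) * (D * q * S * ν) := by
      field_simp
      ring
    linarith
  have h7 : c / (2 * k) * (a * w) ^ 2 ≤ c / 2 * (a ^ 2 * B) := by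
    calc _ = c / (2 * k) * a ^ 2 * w ^ 2 := by ring
      _ ≤ c / (2 * k) * a ^ 2 * (k * B) := by gcongr
      _ = _ := by field_simp
  have h8 : k / (2 * c) * (D * q * S * ν) ^ 2 = D ^ 2 * q ^ 2 * k / (2 * c) * (S ^ 2 * e) := by
    rw [← hνe]; ring
  linarith

variable {t₀ α ρ q γ S a b : ℝ} {x₀ : Space n} {η : ℝ × Space n → ℝ} {k : ℝ → ℝ}

lemma H_nonneg (γ t : ℝ) : 0 ≤ H γ t := le_max_right _ _

lemma H_le_sq (γ t : ℝ) : H γ t ≤ t ^ 2 := max_le (by linarith [sq_nonneg γ]) (sq_nonneg _)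

include hs in
lemma integrable_H : Integrable fun z => H γ ‖P z‖ := by
  have hm : Measurable fun z => H γ ‖P z‖ :=
    ((hs.P_meas.norm.pow_const 2).sub measurable_const).max measurable_const
  refine (integrable_norm_sq hs.P_sq).mono' hm.aestronglyMeasurable (ae_of_all _ fun z => ?_)
  rw [Real.norm_of_nonneg (H_nonneg _ _)]
  exact H_le_sq _ _

lemma exists_abs_timeDeriv_le (hη : ContDiff ℝ ∞ η) :
    ∃ T, ∀ z ∈ cyl t₀ x₀ α ρ, |timeDeriv η z| ≤ T := by
  have h : Continuous fun z => timeDeriv η z :=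
    (hη.continuous_fderiv (by simp)).clm_apply continuous_const
  obtain ⟨T, hT⟩ := (isCompact_closure_cyl (t₀ := t₀) (x₀ := x₀) (α := α)
    (ρ := ρ)).exists_bound_of_continuousOn h.continuousOn
  exact ⟨T, fun z hz => hT z (subset_closure hz)⟩

lemma integrableOn_cyl_mul {f g : ℝ × Space n → ℝ} {T : ℝ} (hf : Integrable f) (hg : Continuous g)
    (hT : ∀ z ∈ cyl t₀ x₀ α ρ, |g z| ≤ T) : IntegrableOn (fun z => f z * g z) (cyl t₀ x₀ α ρ) :=
  Integrable.mul_bdd (c := T) hf.integrableOn hg.aestronglyMeasurable <|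
    (ae_restrict_iff' isOpen_cyl.measurableSet).2 (ae_of_all _ hT)

lemma rpow_mem {s p : ℝ} (h : 0 ≤ s ∧ s ≤ 1) (hp : 0 ≤ p) : |s ^ p| ≤ 1 := by
  rw [abs_of_nonneg (Real.rpow_nonneg h.1 _)]
  exact Real.rpow_le_one h.1 h.2 hp

/-- The right-hand side of the Caccioppoli inequality. -/
def cacRHS (φ : ℝ → ℝ) (γ q S : ℝ) (P : ℝ × Space n → Mat N n) (η : ℝ × Space n → ℝ)
    (Q : Set (ℝ × Space n)) : ℝ :=
  S ^ 2 * (∫ z in Q, {z | γ < ‖P z‖}.indicator (fun z => en φ (P z)) z) +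
    ∫ z in Q, H γ ‖P z‖ * (η z ^ (q - 1) * |timeDeriv η z|)

/-- The constant in the Caccioppoli inequality. -/
def cacConst (n : ℕ) (c₀ c₁ q : ℝ) : ℝ :=
  (2 * (2 + c₁)) ^ 2 * q ^ 2 * (n + 1) / (2 * lowerConst c₀ c₁) + q / 2

include hφ hc₀ hs hr in
-- The energy inequality on the level set with `θ = η^q ψ(t)`, `ψ(t) = ∫_t^{t₀} k`. Since `0 ≤ ψ ≤
-- 1` and `ψ' = -k`, the spatial terms are those of `η^q`, and the time derivative contributes a
-- `k`-average of the slices with the favourable sign. Both terms on the left are nonnegative, so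
-- each can be estimated separately with its own choice of `k`.
lemma caccioppoli_cutoff (hO : IsOpen O) (hγ : 0 < γ) (hq : 2 ≤ q)
    (hη : IsParTest t₀ x₀ α ρ η) (hη1 : ∀ z ∈ cyl t₀ x₀ α ρ, 0 ≤ η z ∧ η z ≤ 1)
    (hcyl : cyl t₀ x₀ α ρ ⊆ O₂) (hS : ∀ z ∈ cyl t₀ x₀ α ρ, ‖spaceGrad η z‖ ≤ S)
    (hk : Continuous k) (hk0 : ∀ s, 0 ≤ k s) (hki : Integrable k) (hk1 : ∫ s, k s = 1)
    (hks : ∀ s, s ∉ Icc a b → k s = 0) (hb : b < t₀) :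
    lowerConst c₀ c₁ / 2 * (∫ z in cyl t₀ x₀ α ρ, {z | γ < ‖P z‖}.indicator
        (fun z => ∑ k, ‖Z k z‖ ^ 2) z * (η z ^ q * timeCutoff k t₀ z.1)) +
      1 / 2 * ∫ z in cyl t₀ x₀ α ρ, H γ ‖P z‖ * (η z ^ q * k z.1) ≤
    cacConst n c₀ c₁ q * cacRHS φ γ q S P η (cyl t₀ x₀ α ρ) := by
  have hc₁ : 0 < c₁ := hc₀.trans_le hφ.c₀_le_c₁
  set c := lowerConst c₀ c₁ with hcdef
  have hc : 0 < c := lowerConst_pos hc₀ hc₁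
  set Q := cyl t₀ x₀ α ρ with hQ
  have hQm : MeasurableSet Q := isOpen_cyl.measurableSet
  set ψ := timeCutoff k t₀ with hψ
  have hψ0 : ∀ t, 0 ≤ ψ t := fun t => timeCutoff_nonneg hk0 hks hb.le
  have hψ1 : ∀ t, ψ t ≤ 1 := fun t => timeCutoff_le_one hk0 hks hb.le hki hk1
  have hψd := hasDerivAt_timeCutoff hk t₀
  have hψC : ContDiff ℝ 1 ψ := contDiff_timeCutoff hk
  set θ := parCutoff η q ψ with hθdef
  have hθ : ContDiff ℝ 1 θ := contDiff_parCutoff hη.1 (by linarith) hψC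
  obtain ⟨F, hF, hFQ, hF0⟩ := hη.exists_compact (q := q) (by linarith) hb
    fun t ht => timeCutoff_zero hks hb.le ht
  have hθs : tsupport θ ⊆ F := closure_minimal (fun z hz => by
    by_contra h
    exact hz (hF0 z h)) hF.isClosed
  have hθc : HasCompactSupport θ := HasCompactSupport.intro hF hF0
  have hθQ : ∀ z, z ∉ Q → θ z = 0 := fun z hz => hF0 z fun h => hz (hFQ h)
  have hθQ' : ∀ z, z ∉ Q → fderiv ℝ θ z = 0 := fun z hz =>
    image_eq_zero_of_notMem_tsupport fun h => hz (hFQ (hθs (tsupport_fderiv_subset ℝ h)))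
  have hθ0 : ∀ z, 0 ≤ θ z := fun z => by
    by_cases hz : z ∈ Q
    · exact mul_nonneg (Real.rpow_nonneg (hη1 z hz).1 _) (hψ0 _)
    · rw [hθQ z hz]
  have hfd := hasFDerivAt_parCutoff hη.1 (by linarith : 1 ≤ q) hψd
  obtain ⟨iF, key⟩ := energy_inequality_level hφ hc₀ hs hr hO hγ hθ hθc
    (hθs.trans (hFQ.trans hcyl)) hθ0
  set B : ℝ × Space n → ℝ := fun z => ∑ k, ‖Z k z‖ ^ 2 with hB
  have hBi : Integrable B := integrable_finsetSum _ fun k _ => integrable_norm_sq (hr.Z_sq k)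
  have hB0 : ∀ z, 0 ≤ B z := fun z => Finset.sum_nonneg fun _ _ => sq_nonneg _
  have hlm : MeasurableSet {z | γ < ‖P z‖} := measurableSet_lt measurable_const hs.P_meas.norm
  set D := 2 * (2 + c₁) with hD
  set M := D ^ 2 * q ^ 2 * (n + 1) / (2 * c) with hM
  have hηc := hη.1.continuous
  have hηt : Continuous fun z => timeDeriv η z :=
    (hη.1.continuous_fderiv (by simp)).clm_apply continuous_const
  have hrp : ∀ {p : ℝ}, 0 ≤ p → Continuous fun z => η z ^ p := fun hp =>
    hηc.rpow_const fun _ => Or.inr hp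
  obtain ⟨T, hT⟩ := exists_abs_timeDeriv_le (t₀ := t₀) (x₀ := x₀) (α := α) (ρ := ρ) hη.1
  obtain ⟨T', hT'⟩ := (HasCompactSupport.intro isCompact_Icc hks).exists_bound_of_continuous hk
  have hHi := integrable_H (γ := γ) hs
  have j1 : IntegrableOn (fun z => {z | γ < ‖P z‖}.indicator B z * (η z ^ q * ψ z.1)) Q := by
    refine integrableOn_cyl_mul (T := 1) (hBi.indicator hlm)
      ((hrp (by linarith)).mul (hψC.continuous.comp continuous_fst)) fun z hz => ?_
    rw [abs_mul, abs_of_nonneg (hψ0 _)]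
    exact mul_le_one₀ (rpow_mem (hη1 z hz) (by linarith)) (hψ0 _) (hψ1 _)
  have j2 : IntegrableOn (fun z => {z | γ < ‖P z‖}.indicator (fun z => en φ (P z)) z) Q :=
    (hs.energy.indicator hlm).integrableOn
  have j3 : IntegrableOn (fun z => H γ ‖P z‖ * (η z ^ (q - 1) * |timeDeriv η z|)) Q := by
    refine integrableOn_cyl_mul (T := T) hHi
      ((hrp (by linarith)).mul hηt.abs) fun z hz => ?_
    rw [abs_mul, abs_abs]
    calc _ ≤ 1 * T := mul_le_mul (rpow_mem (hη1 z hz) (by linarith)) (hT z hz) (abs_nonneg _)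
          zero_le_one
      _ = T := one_mul T
  have j4 : IntegrableOn (fun z => H γ ‖P z‖ * (η z ^ q * k z.1)) Q := by
    refine integrableOn_cyl_mul (T := T') hHi
      ((hrp (by linarith)).mul (hk.comp continuous_fst)) fun z hz => ?_
    rw [abs_mul]
    calc _ ≤ 1 * T' := mul_le_mul (rpow_mem (hη1 z hz) (by linarith)) (hT' _) (abs_nonneg _)
          zero_le_one
      _ = T' := one_mul T'
  have hgrad : ∀ z ∈ Q, ‖(WithLp.toLp 2 fun j => fderiv ℝ θ z (ex j) : Space n)‖ =
      q * η z ^ (q - 1) * ‖spaceGrad η z‖ * ψ z.1 := fun z hz => by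
    have e : (WithLp.toLp 2 fun j => fderiv ℝ θ z (ex j) : Space n) =
        (q * η z ^ (q - 1) * ψ z.1) • spaceGrad η z := by
      ext j
      change fderiv ℝ θ z (ex j) = q * η z ^ (q - 1) * ψ z.1 * fderiv ℝ η z (ex j)
      rw [hfd, show (ex j : ℝ × Space n).1 = 0 from rfl]
      ring
    rw [e, norm_smul, Real.norm_of_nonneg]
    · ring
    · exact mul_nonneg (mul_nonneg (by linarith) (Real.rpow_nonneg (hη1 z hz).1 _)) (hψ0 _)
  -- lower bound of the left-hand side
  have l1 : ∫ z in Q, (c / 2 * ({z | γ < ‖P z‖}.indicator B z * (η z ^ q * ψ z.1)) -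
      M * S ^ 2 * {z | γ < ‖P z‖}.indicator (fun z => en φ (P z)) z) ≤
      ∫ z in O₂, {z | γ < ‖P z‖}.indicator (fun z => c * (θ z * ∑ k, ‖Z k z‖ ^ 2) -
      D * ((nu φ ‖P z‖ * ∑ k, ‖Z k z‖) *
        ‖(WithLp.toLp 2 fun j => fderiv ℝ θ z (ex j) : Space n)‖)) z := by
    rw [setIntegral_eq_of_subset_of_forall_sdiff_eq_zero hr.isOpen₂.measurableSet hcyl]
    · refine setIntegral_mono_on ((j1.const_mul _).sub (j2.const_mul _))
        ((iF.indicator hlm).mono_set hcyl) hQm fun z hz => ?_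
      by_cases hzγ : γ < ‖P z‖
      · simp only [indicator_of_mem (show z ∈ {z | γ < ‖P z‖} from hzγ)]
        have h1 := sum_norm_le fun k => Z k z
        have h2 := absorb (c := c) (k := n + 1) (D := D) (q := q) (s := η z) (S := S)
          (e := en φ (P z)) (B := B z) (ν := nu φ ‖P z‖) hc (by positivity) (hη1 z hz).1 (hη1 z hz).2 hq
          (by positivity) (norm_nonneg (spaceGrad η z)) (hS z hz) (Real.sqrt_nonneg _)
          (hφ.nu_sq (norm_nonneg _)) (Finset.sum_nonneg fun k _ => norm_nonneg (Z k z))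
          (by
            refine h1.trans ?_
            rw [Fintype.card_fin]
            exact mul_le_mul_of_nonneg_right (by linarith) (hB0 z))
        have h3 := mul_le_mul_of_nonneg_left h2 (hψ0 z.1)
        have h4 : 0 ≤ M * S ^ 2 * en φ (P z) := mul_nonneg (by positivity) (en_nonneg hφ _)
        have h5 := mul_le_of_le_one_left h4 (hψ1 z.1)
        rw [← hM] at h3
        rw [hgrad z hz]
        change c / 2 * (B z * (η z ^ q * ψ z.1)) - M * S ^ 2 * en φ (P z) ≤
          c * (η z ^ q * ψ z.1 * B z) - D * ((nu φ ‖P z‖ * ∑ k, ‖Z k z‖) *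
            (q * η z ^ (q - 1) * ‖spaceGrad η z‖ * ψ z.1))
        linarith
      · simp only [indicator_of_notMem (show z ∉ {z | γ < ‖P z‖} from hzγ)]
        simp
    · intro z hz
      have h0 : (WithLp.toLp 2 fun j => fderiv ℝ θ z (ex j) : Space n) = 0 := by
        ext j
        simp [hθQ' z hz.2]
      refine indicator_apply_eq_zero.2 fun _ => ?_
      rw [h0, hθQ z hz.2]
      simp
  -- The derivative of `ψ` gives the summand `-H η^q k`, which is moved to the left-hand side; in
  -- the other summand `ψ ≤ 1` is dropped.
  have l2 : ∫ z in O₂, H γ ‖P z‖ * fderiv ℝ θ z et ≤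
      ∫ z in Q, (q * (H γ ‖P z‖ * (η z ^ (q - 1) * |timeDeriv η z|)) -
        H γ ‖P z‖ * (η z ^ q * k z.1)) := by
    rw [setIntegral_eq_of_subset_of_forall_sdiff_eq_zero hr.isOpen₂.measurableSet hcyl
      (fun z hz => by rw [hθQ' z hz.2]; simp)]
    obtain ⟨T₃, hT₃⟩ := exists_bound_fderiv hθ hθc et
    have hθt : Continuous fun z => fderiv ℝ θ z et :=
      (hθ.continuous_fderiv (by norm_num)).clm_apply continuous_const
    refine setIntegral_mono_on (integrableOn_cyl_mul hHi hθt fun z _ => hT₃ z)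
      ((j3.const_mul q).sub j4) hQm fun z hz => ?_
    have h1 : fderiv ℝ θ z et = q * η z ^ (q - 1) * timeDeriv η z * ψ z.1 - η z ^ q * k z.1 := by
      rw [hfd z et]
      simp only [timeDeriv, et]
      ring
    have h2 : q * η z ^ (q - 1) * timeDeriv η z * ψ z.1 ≤
        q * (η z ^ (q - 1) * |timeDeriv η z|) := by
      have h3 : timeDeriv η z * ψ z.1 ≤ |timeDeriv η z| := by
        have := mul_le_of_le_one_right (abs_nonneg (timeDeriv η z)) (hψ1 z.1)
        refine le_trans ?_ this
        exact mul_le_mul_of_nonneg_right (le_abs_self _) (hψ0 _)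
      have h4 : 0 ≤ q * η z ^ (q - 1) :=
        mul_nonneg (by linarith) (Real.rpow_nonneg (hη1 z hz).1 _)
      have := mul_le_mul_of_nonneg_left h3 h4
      linarith
    rw [h1]
    have := mul_le_mul_of_nonneg_left h2 (H_nonneg γ ‖P z‖)
    linarith
  rw [integral_sub (j1.const_mul _) (j2.const_mul _), integral_const_mul, integral_const_mul] at l1
  rw [integral_sub (j3.const_mul _) j4, integral_const_mul] at l2
  have hI2 : 0 ≤ ∫ z in Q, {z | γ < ‖P z‖}.indicator (fun z => en φ (P z)) z :=
    integral_nonneg fun z => indicator_nonneg (fun z _ => en_nonneg hφ _) z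
  have hI3 : 0 ≤ ∫ z in Q, H γ ‖P z‖ * (η z ^ (q - 1) * |timeDeriv η z|) :=
    setIntegral_nonneg hQm fun z hz => mul_nonneg (H_nonneg _ _)
      (mul_nonneg (Real.rpow_nonneg (hη1 z hz).1 _) (abs_nonneg _))
  have hM0 : 0 ≤ M := by positivity
  change c / 2 * (∫ z in Q, {z | γ < ‖P z‖}.indicator B z * (η z ^ q * ψ z.1)) + 1 / 2 * _ ≤
    (M + q / 2) * (S ^ 2 * _ + _)
  have e1 := mul_nonneg hM0 hI3
  have e2 := mul_nonneg (mul_nonneg (by linarith : 0 ≤ q / 2) (sq_nonneg S)) hI2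
  have e3 := l1.trans key
  linarith

end Solution

end PhiCaloric
end

/-! ### Estimates of the gradient and of the time slices. -/

noncomputable section

namespace PhiCaloric

open Filter Topology

namespace Solution

variable {N n : ℕ} {φ : ℝ → ℝ} {c₀ c₁ : ℝ} {O O₁ O₂ : Set (ℝ × Space n)}
  {u : ℝ × Space n → Space N} {P : ℝ × Space n → Mat N n} {Z : Fin n → ℝ × Space n → Mat N n}
  {h : ℕ → ℝ}

variable (hφ : IsOrlicz φ c₀ c₁) (hc₀ : 0 < c₀) (hs : Solution φ O u P)
  (hr : Regular φ O O₁ O₂ u P Z h)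

variable {t₀ α ρ q γ S : ℝ} {x₀ : Space n} {η : ℝ × Space n → ℝ}

lemma cacRHS_nonneg (hφ : IsOrlicz φ c₀ c₁) (hη1 : ∀ z ∈ cyl t₀ x₀ α ρ, 0 ≤ η z ∧ η z ≤ 1) :
    0 ≤ cacRHS φ γ q S P η (cyl t₀ x₀ α ρ) :=
  add_nonneg (mul_nonneg (sq_nonneg S) (integral_nonneg fun z =>
    indicator_nonneg (fun _ _ => en_nonneg hφ _) z)) <|
    setIntegral_nonneg isOpen_cyl.measurableSet fun z hz => mul_nonneg (H_nonneg _ _)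
      (mul_nonneg (Real.rpow_nonneg (hη1 z hz).1 _) (abs_nonneg _))

include hφ hc₀ hs hr in
/-- Both sides of the cut-off inequality with a mollifier in time centred at `s`. -/
lemma caccioppoli_kernel (hO : IsOpen O) (hγ : 0 < γ) (hq : 2 ≤ q)
    (hη : IsParTest t₀ x₀ α ρ η) (hη1 : ∀ z ∈ cyl t₀ x₀ α ρ, 0 ≤ η z ∧ η z ≤ 1)
    (hcyl : cyl t₀ x₀ α ρ ⊆ O₂) (hS : ∀ z ∈ cyl t₀ x₀ α ρ, ‖spaceGrad η z‖ ≤ S)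
    {m : ℕ} {s : ℝ} (hsm : s + 1 / (m + 1) < t₀) :
    lowerConst c₀ c₁ / 2 * (∫ z in cyl t₀ x₀ α ρ, {z | γ < ‖P z‖}.indicator
        (fun z => ∑ k, ‖Z k z‖ ^ 2) z * (η z ^ q * timeCutoff (kernel volume m s) t₀ z.1)) ≤
      cacConst n c₀ c₁ q * cacRHS φ γ q S P η (cyl t₀ x₀ α ρ) ∧
    1 / 2 * (∫ z in cyl t₀ x₀ α ρ, H γ ‖P z‖ * (η z ^ q * kernel volume m s z.1)) ≤
      cacConst n c₀ c₁ q * cacRHS φ γ q S P η (cyl t₀ x₀ α ρ) ∧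
    (∀ t, 0 ≤ timeCutoff (kernel volume m s) t₀ t ∧ timeCutoff (kernel volume m s) t₀ t ≤ 1) ∧
    ∀ t, t < s - 1 / (m + 1) → timeCutoff (kernel volume m s) t₀ t = 1 := by
  have hk : Continuous (kernel (volume : Measure ℝ) m s) := (kernel_contDiff volume m s (n := 0)).continuous
  have hk0 : ∀ t, 0 ≤ kernel (volume : Measure ℝ) m s t := fun t => (bump ℝ m).nonneg_normed _
  have hki : Integrable (kernel (volume : Measure ℝ) m s) := integrable_bump_sub volume m s
  have hk1 : ∫ t, kernel (volume : Measure ℝ) m s t = 1 := integral_bump_sub volume m s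
  have hks : ∀ t, t ∉ Icc (s - 1 / (m + 1)) (s + 1 / (m + 1)) →
      kernel (volume : Measure ℝ) m s t = 0 := fun t ht => by
    refine image_eq_zero_of_notMem_tsupport fun h => ht ?_
    have := kernel_tsupport volume m s h
    rwa [Real.closedBall_eq_Icc] at this
  have key := caccioppoli_cutoff hφ hc₀ hs hr hO hγ hq hη hη1 hcyl hS hk hk0 hki hk1 hks hsm
  have hψ0 : ∀ t, 0 ≤ timeCutoff (kernel volume m s) t₀ t := fun t =>
    timeCutoff_nonneg hk0 hks hsm.le
  have i1 : 0 ≤ ∫ z in cyl t₀ x₀ α ρ, {z | γ < ‖P z‖}.indicator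
        (fun z => ∑ k, ‖Z k z‖ ^ 2) z * (η z ^ q * timeCutoff (kernel volume m s) t₀ z.1) :=
    setIntegral_nonneg isOpen_cyl.measurableSet fun z hz => mul_nonneg
      (indicator_nonneg (fun z _ => Finset.sum_nonneg fun _ _ => sq_nonneg _) z)
      (mul_nonneg (Real.rpow_nonneg (hη1 z hz).1 _) (hψ0 _))
  have i2 : 0 ≤ ∫ z in cyl t₀ x₀ α ρ, H γ ‖P z‖ * (η z ^ q * kernel volume m s z.1) :=
    setIntegral_nonneg isOpen_cyl.measurableSet fun z hz => mul_nonneg (H_nonneg _ _)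
      (mul_nonneg (Real.rpow_nonneg (hη1 z hz).1 _) (hk0 _))
  have hc := lowerConst_pos hc₀ (hc₀.trans_le hφ.c₀_le_c₁)
  have hm : (0 : ℝ) < 1 / (m + 1) := by positivity
  refine ⟨?_, ?_, fun t => ⟨hψ0 t, timeCutoff_le_one hk0 hks hsm.le hki hk1⟩,
    fun t ht => timeCutoff_one hks hsm.le hk1 ht (by linarith)⟩
  · linarith
  · have := mul_nonneg (by linarith : 0 ≤ lowerConst c₀ c₁ / 2) i1
    linarith

include hφ hc₀ hs hr in
/-- The estimate of the second derivatives. -/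
lemma caccioppoli_gradient (hO : IsOpen O) (hγ : 0 < γ) (hq : 2 ≤ q)
    (hη : IsParTest t₀ x₀ α ρ η) (hη1 : ∀ z ∈ cyl t₀ x₀ α ρ, 0 ≤ η z ∧ η z ≤ 1)
    (hcyl : cyl t₀ x₀ α ρ ⊆ O₂) (hS : ∀ z ∈ cyl t₀ x₀ α ρ, ‖spaceGrad η z‖ ≤ S) :
    lowerConst c₀ c₁ / 2 * (∫ z in cyl t₀ x₀ α ρ, {z | γ < ‖P z‖}.indicator
        (fun z => ∑ k, ‖Z k z‖ ^ 2) z * η z ^ q) ≤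
      cacConst n c₀ c₁ q * cacRHS φ γ q S P η (cyl t₀ x₀ α ρ) := by
  -- The factor `2` keeps the support of the kernel, of radius `1/(m+1)`, below `t₀`, while the
  -- associated time cut-off tends to `1` at every time before `t₀`.
  set s : ℕ → ℝ := fun m => t₀ - 2 * (1 / ((m : ℝ) + 1)) with hsdef
  have hm : ∀ m : ℕ, (0 : ℝ) < 1 / (m + 1) := fun m => by positivity
  have key := fun m : ℕ => caccioppoli_kernel hφ hc₀ hs hr hO hγ hq hη hη1 hcyl hS (m := m)
    (s := s m) (by have := hm m; simp only [hsdef]; linarith)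
  have hBi : Integrable fun z => ∑ k, ‖Z k z‖ ^ 2 :=
    integrable_finsetSum _ fun k _ => integrable_norm_sq (hr.Z_sq k)
  have hlm : MeasurableSet {z | γ < ‖P z‖} := measurableSet_lt measurable_const hs.P_meas.norm
  have hηc : Continuous fun z => η z ^ q :=
    hη.1.continuous.rpow_const fun _ => Or.inr (by linarith)
  refine le_of_tendsto' (Tendsto.const_mul _ (tendsto_integral_of_dominated_convergence
    ({z | γ < ‖P z‖}.indicator fun z => ∑ k, ‖Z k z‖ ^ 2) (fun m => ?_)
    (hBi.indicator hlm).integrableOn (fun m => ?_) ?_)) fun m => (key m).1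
  · refine ((hBi.indicator hlm).aestronglyMeasurable.mul
      (hηc.aestronglyMeasurable.mul ?_)).restrict
    exact ((contDiff_timeCutoff (kernel_contDiff volume m (s m)
      (n := 0)).continuous).continuous.comp continuous_fst).aestronglyMeasurable
  · rw [ae_restrict_iff' isOpen_cyl.measurableSet]
    refine ae_of_all _ fun z hz => ?_
    have h0 : 0 ≤ {z | γ < ‖P z‖}.indicator (fun z => ∑ k, ‖Z k z‖ ^ 2) z :=
      indicator_nonneg (fun z _ => Finset.sum_nonneg fun _ _ => sq_nonneg _) z
    obtain ⟨h1, h2⟩ := (key m).2.2.1 z.1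
    rw [Real.norm_eq_abs, abs_mul, abs_of_nonneg h0, abs_mul, abs_of_nonneg h1]
    exact mul_le_of_le_one_right h0 (mul_le_one₀ (rpow_mem (hη1 z hz) (by linarith)) h1 h2)
  · rw [ae_restrict_iff' isOpen_cyl.measurableSet]
    refine ae_of_all _ fun z hz => Tendsto.const_mul _ ?_
    have hlt : ∀ᶠ m : ℕ in atTop, z.1 < s m - 1 / ((m : ℝ) + 1) := by
      have h1 : Tendsto (fun m : ℕ => s m - 1 / ((m : ℝ) + 1)) atTop (𝓝 t₀) := by
        have h2 := (tendsto_one_div_add_atTop_nhds_zero_nat (𝕜 := ℝ)).const_mul 2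
        have h3 := (h2.const_sub t₀).sub (tendsto_one_div_add_atTop_nhds_zero_nat (𝕜 := ℝ))
        simpa [hsdef] using h3
      exact h1.eventually_const_lt hz.1.2
    refine tendsto_const_nhds.congr' ?_
    filter_upwards [hlt] with m hm
    rw [(key m).2.2.2 _ hm, mul_one]

include hφ hc₀ hs hr in
/-- The estimate of the time slices. -/
lemma caccioppoli_slice (hO : IsOpen O) (hγ : 0 < γ) (hq : 2 ≤ q)
    (hη : IsParTest t₀ x₀ α ρ η) (hη1 : ∀ z ∈ cyl t₀ x₀ α ρ, 0 ≤ η z ∧ η z ≤ 1)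
    (hcyl : cyl t₀ x₀ α ρ ⊆ O₂) (hS : ∀ z ∈ cyl t₀ x₀ α ρ, ‖spaceGrad η z‖ ≤ S) :
    ∀ᵐ t, t ∈ timeInt t₀ α ρ →
      ∫⁻ x in Metric.ball x₀ ρ, ENNReal.ofReal (H γ ‖P (t, x)‖ * η (t, x) ^ q) ≤
      ENNReal.ofReal (2 * (cacConst n c₀ c₁ q * cacRHS φ γ q S P η (cyl t₀ x₀ α ρ))) := by
  set Q := cyl t₀ x₀ α ρ with hQ
  set M := cacConst n c₀ c₁ q * cacRHS φ γ q S P η Q with hM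
  have hηc : Continuous fun z => η z ^ q :=
    hη.1.continuous.rpow_const fun _ => Or.inr (by linarith)
  set F : ℝ × Space n → ℝ := Q.indicator fun z => H γ ‖P z‖ * η z ^ q with hF
  have hFi : Integrable F := by
    rw [hF, integrable_indicator_iff isOpen_cyl.measurableSet]
    exact integrableOn_cyl_mul (T := 1) (integrable_H hs) hηc fun z hz =>
      rpow_mem (hη1 z hz) (by linarith)
  have hFi' : Integrable F ((volume : Measure ℝ).prod volume) := hFi
  set f : ℝ → ℝ := fun t => ∫ x, F (t, x) with hf
  have hfi : Integrable f := hFi'.integral_prod_left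
  have hF0 : ∀ z, 0 ≤ F z := fun z => indicator_nonneg (fun z hz => mul_nonneg (H_nonneg _ _)
    (Real.rpow_nonneg (hη1 z hz).1 _)) z
  -- By Fubini's theorem the slice term of the cut-off inequality is the mollification in time of `t
  -- ↦ ∫ H η^q`. The bound is uniform in the scale and therefore passes to almost every time.
  have hmol : ∀ (m : ℕ) (s : ℝ), mol volume m f s =
      ∫ z in Q, H γ ‖P z‖ * (η z ^ q * kernel volume m s z.1) := fun m s => by
    have hk : Continuous (kernel (volume : Measure ℝ) m s) :=
      (kernel_contDiff volume m s (n := 0)).continuous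
    obtain ⟨C, hC⟩ := bump_bounded (E := ℝ) volume m
    have i1 : Integrable (fun z : ℝ × Space n => F z * kernel volume m s z.1)
        ((volume : Measure ℝ).prod volume) :=
      hFi'.mul_bdd (c := C) (hk.comp continuous_fst).aestronglyMeasurable
        (ae_of_all _ fun z => hC _)
    rw [mol_eq_kernel, ← integral_indicator isOpen_cyl.measurableSet]
    have e : ∀ z : ℝ × Space n, Q.indicator
        (fun z => H γ ‖P z‖ * (η z ^ q * kernel volume m s z.1)) z =
        F z * kernel volume m s z.1 := fun z => by
      by_cases hz : z ∈ Q
      · simp only [hF, indicator_of_mem hz]; ring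
      · simp [hF, hz]
    rw [integral_congr_ae (ae_of_all _ e), show (volume : Measure (ℝ × Space n)) = (volume : Measure ℝ).prod volume from rfl,
      integral_prod _ i1]
    exact integral_congr_ae (ae_of_all _ fun t => (integral_mul_const _ _).symm)
  filter_upwards [mol_tendsto_ae volume hfi.locallyIntegrable, hFi'.prod_right_ae] with t h1 h2 ht
  have h3 : f t ≤ 2 * M := by
    refine le_of_tendsto h1 ?_
    have h4 : ∀ᶠ m : ℕ in atTop, 1 / ((m : ℝ) + 1) < t₀ - t :=
      (tendsto_one_div_add_atTop_nhds_zero_nat (𝕜 := ℝ)).eventually_lt_const (sub_pos.2 ht.2)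
    filter_upwards [h4] with m hm
    have := (caccioppoli_kernel hφ hc₀ hs hr hO hγ hq hη hη1 hcyl hS (m := m) (s := t)
      (by linarith)).2.1
    rw [hmol]
    linarith
  calc ∫⁻ x in Metric.ball x₀ ρ, ENNReal.ofReal (H γ ‖P (t, x)‖ * η (t, x) ^ q)
      ≤ ∫⁻ x, ENNReal.ofReal (F (t, x)) := by
        rw [← lintegral_indicator Metric.isOpen_ball.measurableSet]
        refine lintegral_mono fun x => ?_
        by_cases hx : x ∈ Metric.ball x₀ ρ
        · have : (t, x) ∈ Q := ⟨ht, hx⟩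
          simp [hx, hF, this]
        · simp [hx]
    _ = ENNReal.ofReal (f t) :=
        (ofReal_integral_eq_lintegral_ofReal h2 (ae_of_all _ fun x => hF0 _)).symm
    _ ≤ _ := ENNReal.ofReal_le_ofReal h3

include hφ hc₀ in
lemma G_sq_le (z : ℝ × Space n) :
    G φ γ ‖P z‖ ^ 2 ≤ {z | γ < ‖P z‖}.indicator (fun z => en φ (P z)) z := by
  by_cases hz : γ < ‖P z‖
  · rw [indicator_of_mem (show z ∈ {z | γ < ‖P z‖} from hz)]
    obtain ⟨h1, h2⟩ := G_nonneg_le hφ hc₀ γ (P z)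
    refine (pow_le_pow_left₀ h1 h2 2).trans (hφ.norm_V_sq hc₀ _).le
  · rw [indicator_of_notMem (show z ∉ {z | γ < ‖P z‖} from hz),
      G_eq_zero hφ hc₀ (norm_nonneg _) (not_lt.1 hz)]
    simp

/-- The constant in the estimate of the gradient of `G η^{q/2}`. -/
def gradConst (n : ℕ) (c₀ c₁ q : ℝ) : ℝ :=
  4 / lowerConst c₀ c₁ * cacConst n c₀ c₁ q + q ^ 2 / 2

include hφ hc₀ hs hr in
-- The product rule gives `η^(q/2) ∇G + (q/2) G η^(q/2-1) ∇η`; since `q/2 ≥ 1`, the power is of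
-- class `C¹`. The first part is controlled by the estimate of the second derivatives because `|∂_j
-- G| ≤ |Z_j|` and `∂_j G = 0` off `{v > γ}`; the second part by `G² ≤ φ'(v)v` on `{v > γ}`.
lemma exists_hasWeakPartial (hO : IsOpen O) (hγ : 0 < γ) (hq : 2 ≤ q)
    (hη : IsParTest t₀ x₀ α ρ η) (hη1 : ∀ z ∈ cyl t₀ x₀ α ρ, 0 ≤ η z ∧ η z ≤ 1)
    (hcyl : cyl t₀ x₀ α ρ ⊆ O₂) (hS : ∀ z ∈ cyl t₀ x₀ α ρ, ‖spaceGrad η z‖ ≤ S) :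
    ∃ W : ℝ × Space n → Space n,
      (∀ j : Fin n, HasWeakPartial (cyl t₀ x₀ α ρ) j
        (fun z => G φ γ ‖P z‖ * η z ^ (q / 2)) (fun z => W z j)) ∧
      ∫⁻ z in cyl t₀ x₀ α ρ, ‖W z‖ₑ ^ 2 ≤
        ENNReal.ofReal (gradConst n c₀ c₁ q * cacRHS φ γ q S P η (cyl t₀ x₀ α ρ)) := by
  set Q := cyl t₀ x₀ α ρ with hQ
  have hQm : MeasurableSet Q := isOpen_cyl.measurableSet
  have hc := lowerConst_pos hc₀ (hc₀.trans_le hφ.c₀_le_c₁)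
  obtain ⟨Y, hY⟩ := exists_weakGrad_G hφ hc₀ hs hr γ
  set g : ℝ × Space n → ℝ := fun z => G φ γ ‖P z‖ with hg
  have hgm : Measurable g := (measurable_G hφ hc₀ γ).comp hs.P_meas
  have hgi : Integrable g := (integrable_V hφ hc₀ hs).mono hgm.aestronglyMeasurable
    (ae_of_all _ fun z => by
      rw [Real.norm_of_nonneg (G_nonneg_le hφ hc₀ γ _).1]
      exact (G_nonneg_le hφ hc₀ γ _).2)
  have hpow : ContDiff ℝ 1 fun z => η z ^ (q / 2) := by
    have h1 : ContDiff ℝ (1 : ℕ) fun x : ℝ => x ^ (q / 2) :=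
      Real.contDiff_rpow_const_of_le (by simp only [Nat.cast_one]; linarith)
    exact ContDiff.comp (by exact_mod_cast h1) (hη.1.of_le (by exact_mod_cast le_top))
  have hpd : ∀ z v, fderiv ℝ (fun z => η z ^ (q / 2)) z v =
      q / 2 * η z ^ (q / 2 - 1) * fderiv ℝ η z v := fun z v => by
    have h1 : HasFDerivAt η (fderiv ℝ η z) z := (hη.1.differentiable (by simp) z).hasFDerivAt
    have h2 := (Real.hasDerivAt_rpow_const (x := η z) (p := q / 2)
      (Or.inr (by linarith))).comp_hasFDerivAt z h1
    have h3 : HasFDerivAt (fun z => η z ^ (q / 2)) _ z := h2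
    rw [h3.fderiv]
    simp
  -- Cutting off outside the bounded set `O₂` makes the square integrable derivatives integrable;
  -- inside the cylinder nothing changes.
  set Y' : ℝ × Space n → Space n := fun z => WithLp.toLp 2 fun j => O₂.indicator (Y j) z with hY'
  have hYi : ∀ j, Integrable (O₂.indicator (Y j)) := fun j =>
    integrable_of_memLp_of_bounded hr.isOpen₂.measurableSet (hr.bdd.subset hr.sub₂)
      ((hY j).2.1.indicator hr.isOpen₂.measurableSet) fun z hz => by simp [hz]
  set W : ℝ × Space n → Space n := fun z => η z ^ (q / 2) • Y' z +
    (g z * (q / 2 * η z ^ (q / 2 - 1))) • spaceGrad η z with hW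
  refine ⟨W, fun j => ?_, ?_⟩
  · have h1 := hasWeakPartial_mul (isOpen_cyl (t₀ := t₀) (x₀ := x₀) (α := α) (ρ := ρ)) hpow hgi
      (hYi j) (fun z _ => hpd z (ex j)) fun ζ hζ hζc hζQ => by
        rw [(hY j).2.2.1 ζ hζ hζc (hζQ.trans hcyl)]
        congr 1
        refine integral_congr_ae (ae_of_all _ fun z => ?_)
        by_cases hz : z ∈ O₂
        · simp [hz]
        · have : ζ z = 0 := image_eq_zero_of_notMem_tsupport fun h => hz (hcyl (hζQ h))
          simp [this]
    have e : (fun z => W z j) = fun z => O₂.indicator (Y j) z * η z ^ (q / 2) +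
        g z * (q / 2 * η z ^ (q / 2 - 1) * fderiv ℝ η z (ex j)) := by
      funext z
      simp only [hW, hY', PiLp.add_apply, PiLp.smul_apply, smul_eq_mul]
      change η z ^ (q / 2) * O₂.indicator (Y j) z +
        g z * (q / 2 * η z ^ (q / 2 - 1)) * fderiv ℝ η z (ex j) = _
      ring
    rw [e]
    exact h1
  set B : ℝ × Space n → ℝ := fun z => ∑ k, ‖Z k z‖ ^ 2 with hB
  have hBi : Integrable B := integrable_finsetSum _ fun k _ => integrable_norm_sq (hr.Z_sq k)
  have hlm : MeasurableSet {z | γ < ‖P z‖} := measurableSet_lt measurable_const hs.P_meas.norm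
  have hηc : Continuous fun z => η z ^ q :=
    hη.1.continuous.rpow_const fun _ => Or.inr (by linarith)
  set R : ℝ × Space n → ℝ := fun z => 2 * ({z | γ < ‖P z‖}.indicator B z * η z ^ q) +
    q ^ 2 / 2 * S ^ 2 * {z | γ < ‖P z‖}.indicator (fun z => en φ (P z)) z with hR
  have j1 : IntegrableOn (fun z => {z | γ < ‖P z‖}.indicator B z * η z ^ q) Q :=
    integrableOn_cyl_mul (T := 1) (hBi.indicator hlm) hηc fun z hz =>
      rpow_mem (hη1 z hz) (by linarith)
  have j2 : IntegrableOn (fun z => {z | γ < ‖P z‖}.indicator (fun z => en φ (P z)) z) Q :=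
    (hs.energy.indicator hlm).integrableOn
  have hRi : IntegrableOn R Q := (j1.const_mul 2).add (j2.const_mul _)
  have hWR : ∀ᵐ z ∂volume.restrict Q, ‖W z‖ ^ 2 ≤ R z := by
    rw [ae_restrict_iff' hQm]
    filter_upwards [ae_all_iff.2 fun j => (hY j).2.2.2] with z hz hzQ
    obtain ⟨s0, s1⟩ := hη1 z hzQ
    have hY2 : ‖Y' z‖ ^ 2 ≤ {z | γ < ‖P z‖}.indicator B z := by
      rw [EuclideanSpace.real_norm_sq_eq]
      simp only [hY', indicator_of_mem (hcyl hzQ)]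
      by_cases hzγ : γ < ‖P z‖
      · rw [indicator_of_mem (show z ∈ {z | γ < ‖P z‖} from hzγ)]
        refine Finset.sum_le_sum fun j _ => ?_
        have := (hz j (hcyl hzQ)).1
        exact sq_le_sq' (abs_le.1 this).1 (abs_le.1 this).2
      · rw [indicator_of_notMem (show z ∉ {z | γ < ‖P z‖} from hzγ)]
        refine (Finset.sum_eq_zero fun j _ => ?_).le
        rw [(hz j (hcyl hzQ)).2 (not_lt.1 hzγ)]
        simp
    have hg2 := G_sq_le (P := P) hφ hc₀ (γ := γ) z
    have h1 : ‖W z‖ ≤ η z ^ (q / 2) * ‖Y' z‖ + g z * (q / 2) * S := by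
      refine (norm_add_le _ _).trans ?_
      rw [norm_smul, norm_smul, Real.norm_of_nonneg (Real.rpow_nonneg s0 _), Real.norm_eq_abs,
        abs_mul, abs_mul, abs_of_nonneg (G_nonneg_le hφ hc₀ γ (P z)).1,
        abs_of_nonneg (by linarith : 0 ≤ q / 2)]
      have h2 := rpow_mem (p := q / 2 - 1) ⟨s0, s1⟩ (by linarith)
      have h3 := hS z hzQ
      have h4 := (G_nonneg_le hφ hc₀ γ (P z)).1
      refine add_le_add le_rfl ?_
      calc G φ γ ‖P z‖ * (q / 2 * |η z ^ (q / 2 - 1)|) * ‖spaceGrad η z‖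
          ≤ G φ γ ‖P z‖ * (q / 2 * 1) * S := by gcongr
        _ = _ := by rw [mul_one]
    have h5 : (η z ^ (q / 2)) ^ 2 = η z ^ q := by
      rw [← Real.rpow_natCast, ← Real.rpow_mul s0]; norm_num
    have h6 : ‖W z‖ ^ 2 ≤ 2 * (η z ^ q * ‖Y' z‖ ^ 2) + q ^ 2 / 2 * S ^ 2 * g z ^ 2 := by
      refine (pow_le_pow_left₀ (norm_nonneg _) h1 2).trans ?_
      rw [← h5]
      nlinarith [sq_nonneg (η z ^ (q / 2) * ‖Y' z‖ - g z * (q / 2) * S)]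
    refine h6.trans (add_le_add ?_ (mul_le_mul_of_nonneg_left hg2 (by positivity)))
    rw [mul_comm (η z ^ q)]
    exact mul_le_mul_of_nonneg_left
      (mul_le_mul_of_nonneg_right hY2 (Real.rpow_nonneg s0 _)) zero_le_two
  have hR0 : 0 ≤ᵐ[volume.restrict Q] R := by
    filter_upwards [hWR] with z hz
    exact (sq_nonneg _).trans hz
  calc ∫⁻ z in Q, ‖W z‖ₑ ^ 2 ≤ ∫⁻ z in Q, ENNReal.ofReal (R z) := by
        refine lintegral_mono_ae ?_
        filter_upwards [hWR] with z hz
        rw [← ofReal_norm, ← ENNReal.ofReal_pow (norm_nonneg _)]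
        exact ENNReal.ofReal_le_ofReal hz
    _ = ENNReal.ofReal (∫ z in Q, R z) := (ofReal_integral_eq_lintegral_ofReal hRi hR0).symm
    _ ≤ _ := by
        refine ENNReal.ofReal_le_ofReal ?_
        have h1 := caccioppoli_gradient hφ hc₀ hs hr hO hγ hq hη hη1 hcyl hS
        have e1 : ∫ z in Q, R z = 2 * (∫ z in Q, {z | γ < ‖P z‖}.indicator B z * η z ^ q) +
            q ^ 2 / 2 * (S ^ 2 * ∫ z in Q, {z | γ < ‖P z‖}.indicator (fun z => en φ (P z)) z) := by
          rw [← mul_assoc, ← integral_const_mul, ← integral_const_mul]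
          exact integral_add (j1.const_mul 2) (j2.const_mul _)
        have h2 : S ^ 2 * ∫ z in Q, {z | γ < ‖P z‖}.indicator (fun z => en φ (P z)) z ≤
            cacRHS φ γ q S P η Q := by
          refine le_add_of_nonneg_right ?_
          exact setIntegral_nonneg hQm fun z hz => mul_nonneg (H_nonneg _ _)
            (mul_nonneg (Real.rpow_nonneg (hη1 z hz).1 _) (abs_nonneg _))
        have h3 := mul_le_mul_of_nonneg_left h1 (by positivity : 0 ≤ 4 / lowerConst c₀ c₁)
        have h4 : 4 / lowerConst c₀ c₁ * (lowerConst c₀ c₁ / 2 *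
            (∫ z in Q, {z | γ < ‖P z‖}.indicator B z * η z ^ q)) =
            2 * (∫ z in Q, {z | γ < ‖P z‖}.indicator B z * η z ^ q) := by
          field_simp
          ring
        have h5 := mul_le_mul_of_nonneg_left h2 (by positivity : 0 ≤ q ^ 2 / 2)
        rw [e1, gradConst]
        linarith

end Solution

end PhiCaloric
end

/-! ### Localization of a local weak solution. -/

noncomputable section

namespace PhiCaloric

open Filter Topology

section Localize

variable {N n : ℕ} {φ : ℝ → ℝ} {c₀ c₁ : ℝ} {J : Set ℝ} {Ω : Set (Space n)}
  {u : ℝ × Space n → Space N} {Du : ℝ × Space n → Mat N n}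

lemma setIntegral_mul_eq_integral_mul {U O : Set (ℝ × Space n)} (hOU : O ⊆ U)
    {f f' ζ : ℝ × Space n → ℝ} (hf : ∀ᵐ z, z ∈ O → f' z = f z) (h0 : ∀ z, z ∉ O → ζ z = 0) :
    ∫ z in U, f z * ζ z = ∫ z, f' z * ζ z := by
  rw [← integral_mul_eq_setIntegral fun z hz => h0 z fun h => hz (hOU h)]
  refine integral_congr_ae ?_
  filter_upwards [hf] with z hz
  by_cases h : z ∈ O
  · rw [hz h]
  · simp [h0 z h]

lemma memLp_two_of_bounded (hu : IsLocalWeakSolution φ J Ω u Du) {I : Set ℝ} {K : Set (Space n)}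
    (hI : IsCompact I) (hIJ : I ⊆ J) (hK : IsCompact K) (hKΩ : K ⊆ Ω) :
    MemLp u 2 (volume.restrict (I ×ˢ K)) := by
  have hm : AEStronglyMeasurable u (volume.restrict (I ×ˢ K)) :=
    hu.meas.mono_measure (Measure.restrict_mono (prod_mono hIJ hKΩ) le_rfl)
  obtain ⟨M, hM⟩ := hu.bounded I K hI hIJ hK hKΩ
  refine ⟨hm, ?_⟩
  rw [eLpNorm_lt_top_iff_lintegral_rpow_enorm_lt_top two_ne_zero ENNReal.ofNat_ne_top]
  simp only [ENNReal.toReal_ofNat, ENNReal.rpow_ofNat]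
  have e : (volume : Measure (ℝ × Space n)).restrict (I ×ˢ K) =
      (volume.restrict I).prod (volume.restrict K) := (Measure.prod_restrict I K).symm
  rw [e] at hm ⊢
  rw [lintegral_prod _ (hm.enorm.pow_const 2)]
  refine (lintegral_mono_ae hM).trans_lt ?_
  rw [lintegral_const, Measure.restrict_apply_univ]
  exact ENNReal.mul_lt_top ENNReal.coe_lt_top hI.measure_lt_top

lemma aestronglyMeasurable_of_coord {ι : Type*} [Fintype ι] {α : Type*} [MeasurableSpace α]
    {ν : Measure α} {f : α → EuclideanSpace ℝ ι}
    (h : ∀ i, AEStronglyMeasurable (fun z => f z i) ν) : AEStronglyMeasurable f ν := by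
  have h1 : AEMeasurable (fun z i => f z i) ν :=
    aemeasurable_pi_lambda _ fun i => (h i).aemeasurable
  exact ((WithLp.measurable_toLp 2 (ι → ℝ)).comp_aemeasurable h1).aestronglyMeasurable

/-- A local weak solution, cut off outside of a relatively compact product set. -/
lemma IsLocalWeakSolution.exists_solution (hφ : IsOrlicz φ c₀ c₁) (hc₀ : 0 < c₀)
    (hu : IsLocalWeakSolution φ J Ω u Du)
    (hDu : LocallyIntegrableOn (fun z => ‖Du z‖ ^ 2) (J ×ˢ Ω)) {I : Set ℝ} {K : Set (Space n)}
    (hI : IsCompact I) (hIJ : I ⊆ J) (hK : IsCompact K) (hKΩ : K ⊆ Ω) {O : Set (ℝ × Space n)}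
    (hO : IsOpen O) (hOK : O ⊆ I ×ˢ K) :
    ∃ u' P, Solution φ O u' P ∧ ∀ᵐ z, z ∈ O → P z = Du z := by
  have hOU : O ⊆ J ×ˢ Ω := hOK.trans (prod_mono hIJ hKΩ)
  have hOm := hO.measurableSet
  have hC : IsCompact (I ×ˢ K) := hI.prod hK
  have hb : Bornology.IsBounded O := hC.isBounded.subset hOK
  have hloc : ∀ {f : ℝ × Space n → ℝ}, LocallyIntegrableOn f (J ×ˢ Ω) → IntegrableOn f O :=
    fun hf => (hf.integrableOn_compact_subset (prod_mono hIJ hKΩ) hC).mono_set hOK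
  have hDm : AEStronglyMeasurable Du (volume.restrict O) :=
    aestronglyMeasurable_of_coord fun a => (hloc (hu.grad a.1 a.2).right).aestronglyMeasurable
  -- A measurable representative of the gradient, set to zero outside `O`, so that all integrability
  -- is global on space-time.
  set P : ℝ × Space n → Mat N n := O.indicator (hDm.mk Du) with hP
  have hPD : ∀ᵐ z, z ∈ O → P z = Du z := by
    have := hDm.ae_eq_mk
    rw [EventuallyEq, ae_restrict_iff' hOm] at this
    filter_upwards [this] with z hz hzO
    rw [hP, indicator_of_mem hzO, hz hzO]
  have hPD' : P =ᵐ[volume.restrict O] Du := by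
    rw [EventuallyEq, ae_restrict_iff' hOm]
    exact hPD
  have hP0 : ∀ z, z ∉ O → P z = 0 := fun z hz => by simp [hP, hz]
  have hPm : Measurable P := hDm.stronglyMeasurable_mk.measurable.indicator hOm
  have hfin : volume O < ⊤ := hb.measure_lt_top
  have hzero : ∀ {f : ℝ × Space n → ℝ}, (∀ z, z ∉ O → f z = 0) → IntegrableOn f O → Integrable f :=
    fun h0 hf => (integrableOn_iff_integrable_of_support_subset fun z hz => by
      by_contra h
      exact hz (h0 z h)).1 hf
  have hPsq : MemLp P 2 := by
    rw [memLp_two_iff_integrable_sq_norm hPm.aestronglyMeasurable]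
    refine hzero (fun z hz => by simp [hP0 z hz]) ((hloc hDu).congr ?_)
    filter_upwards [hPD'] with z hz
    rw [hz]
  have hPi : Integrable P := by
    rw [← integrable_norm_iff hPm.aestronglyMeasurable]
    exact integrable_of_memLp_of_bounded hOm hb hPsq.norm fun z hz => by simp [hP0 z hz]
  have hen : Integrable fun z => en φ (P z) := by
    have h1 : IntegrableOn (fun z => φ ‖P z‖) O := (hloc hu.energy).congr (by
      filter_upwards [hPD'] with z hz
      rw [hz])
    refine hzero (fun z hz => by simp [en, hP0 z hz]) ?_
    refine (h1.const_mul (2 ^ (c₁ + 1))).mono'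
      ((Solution.measurable_en hφ).comp hPm).aestronglyMeasurable (ae_of_all _ fun z => ?_)
    rw [Real.norm_of_nonneg (Solution.en_nonneg hφ _)]
    exact hφ.d_mul_le hc₀ (norm_nonneg _)
  have hpg := hφ.powerGrowth_d hc₀
  have hA : Integrable fun z => A φ (P z) := by
    have hAm : Measurable fun z => A φ (P z) := hφ.measurable_A.comp hPm
    rw [← integrable_norm_iff hAm.aestronglyMeasurable]
    refine hzero (fun z hz => by simp [A, hP0 z hz]) ?_
    -- On a set of finite measure, `φ'(|P|)` is integrable: it is at most `φ'(1)` if `|P| ≤ 1` and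
    -- at most `φ'(|P|)|P|` otherwise.
    have hcst : IntegrableOn (fun _ : ℝ × Space n => d φ 1) O := integrableOn_const hfin.ne
    refine (hcst.add hen.integrableOn).mono' hAm.norm.aestronglyMeasurable
      (ae_of_all _ fun z => ?_)
    rw [norm_norm, A_eq_radial, hpg.norm_radial, Pi.add_apply]
    have h1 := hφ.d_nonneg (norm_nonneg (P z))
    rcases le_total ‖P z‖ 1 with h | h
    · exact (hpg.mono (norm_nonneg _) h).trans
        (le_add_of_nonneg_right (Solution.en_nonneg hφ _))
    · refine (le_mul_of_one_le_right h1 h).trans (le_add_of_nonneg_left (hφ.d_nonneg zero_le_one))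
  set u' : ℝ × Space n → Space N := O.indicator u with hu'
  have hu2 : MemLp u' 2 := by
    rw [hu', memLp_indicator_iff_restrict hOm]
    exact (memLp_two_of_bounded hu hI hIJ hK hKΩ).mono_measure (Measure.restrict_mono hOK le_rfl)
  have huu : ∀ i, ∀ z, z ∈ O → u' z i = u z i := fun i z hz => by rw [hu', indicator_of_mem hz]
  have hTest : ∀ {ζ : ℝ × Space n → ℝ}, tsupport ζ ⊆ O → (∀ z, z ∉ O → ζ z = 0) ∧
      ∀ v z, z ∉ O → fderiv ℝ ζ z v = 0 := fun hζO =>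
    ⟨fun z hz => image_eq_zero_of_notMem_tsupport fun h => hz (hζO h), fun v z hz => by
      rw [image_eq_zero_of_notMem_tsupport fun h => hz (hζO (tsupport_fderiv_subset ℝ h))]
      rfl⟩
  refine ⟨u', P, ⟨hPm, fun i => integrable_of_memLp_of_bounded hOm hb (memLp_coord hu2 i)
    fun z hz => by simp [hu', hz], fun i => memLp_coord hu2 i, hPi, hPsq, hA, hen,
    fun i j ζ hζ hζc hζO => ?_, fun i ζ hζ hζc hζO => ?_⟩, hPD⟩
  · obtain ⟨h0, h0'⟩ := hTest hζO
    have key := (hu.grad i j).parts ζ ⟨hζ, hζc, hζO.trans hOU⟩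
    have e1 := setIntegral_mul_eq_integral_mul hOU (ae_of_all _ (huu i)) (h0' (ex j))
    have e2 := setIntegral_mul_eq_integral_mul (f := fun z => Du z (i, j))
      (f' := fun z => P z (i, j)) hOU
      (by filter_upwards [hPD] with z hz hzO using by rw [hz hzO]) h0
    rw [← e1, ← e2]
    exact key
  · obtain ⟨h0, h0'⟩ := hTest hζO
    -- Testing with `ζ e_i` extracts the `i`-th equation of the system.
    set ξ : ℝ × Space n → Space N := fun z => ζ z • EuclideanSpace.single i 1 with hξ
    have hξs : tsupport ξ ⊆ tsupport ζ := tsupport_smul_subset_left ζ _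
    have hξt : IsTest (J ×ˢ Ω) ξ := ⟨hζ.smul contDiff_const, hζc.smul_right,
      hξs.trans (hζO.trans hOU)⟩
    have hξd : ∀ z v, fderiv ℝ ξ z v = fderiv ℝ ζ z v • EuclideanSpace.single i 1 := fun z v => by
      have h1 : HasFDerivAt ζ (fderiv ℝ ζ z) z := (hζ.differentiable (by simp) z).hasFDerivAt
      rw [(h1.smul_const (EuclideanSpace.single i (1 : ℝ))).fderiv]
      simp
    have key := hu.weak ξ hξt
    have e1 : ∀ z, inner ℝ (A φ (Du z)) (spaceJac ξ z) =
        ∑ j, A φ (Du z) (i, j) * fderiv ℝ ζ z (ex j) := fun z => by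
      have h1 : ∀ p : Fin N × Fin n, spaceJac ξ z p =
          if p.1 = i then fderiv ℝ ζ z (ex p.2) else 0 := fun p => by
        change fderiv ℝ ξ z (ex p.2) p.1 = _
        rw [hξd]
        simp
      rw [PiLp.inner_apply, Fintype.sum_prod_type, Finset.sum_eq_single i]
      · refine Finset.sum_congr rfl fun j _ => ?_
        rw [h1, if_pos rfl]
        simp [mul_comm]
      · intro k _ hk
        refine Finset.sum_eq_zero fun j _ => ?_
        rw [h1, if_neg hk]
        simp
      · simp
    have e2 : ∀ z, inner ℝ (u z) (timeDeriv ξ z) = u z i * fderiv ℝ ζ z et := fun z => by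
      change inner ℝ (u z) (fderiv ℝ ξ z et) = _
      rw [hξd, real_inner_smul_right]
      simp [EuclideanSpace.inner_single_right, mul_comm]
    simp only [e1, e2] at key
    rw [setIntegral_mul_eq_integral_mul (f' := fun z => u' z i) hOU (ae_of_all _ (huu i))
      (h0' et)] at key
    rw [← key]
    have hint : ∀ j, Integrable fun z => A φ (P z) (i, j) * fderiv ℝ ζ z (ex j) := fun j => by
      obtain ⟨T, hT⟩ := exists_bound_fderiv (hζ.of_le (by exact_mod_cast le_top)) hζc (ex j)
      exact (integrable_coord hA (i, j)).mul_bdd (c := T)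
        ((hζ.continuous_fderiv (by simp)).clm_apply continuous_const).aestronglyMeasurable
        (ae_of_all _ hT)
    rw [← integral_finsetSum _ fun j _ => hint j,
      setIntegral_eq_integral_of_forall_compl_eq_zero (s := J ×ˢ Ω)
        fun z hz => Finset.sum_eq_zero fun j _ => by rw [h0' _ z fun h => hz (hOU h), mul_zero]]
    refine integral_congr_ae ?_
    filter_upwards [hPD] with z hz
    refine Finset.sum_congr rfl fun j _ => ?_
    by_cases hzO : z ∈ O
    · rw [hz hzO]
    · rw [h0' _ z hzO, mul_zero, mul_zero]

end Localize

end PhiCaloric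
end

/-! ### Averages over cylinders and assembly of the inequality. -/

noncomputable section

namespace PhiCaloric

open Filter Topology Solution

section Cylinders

variable {n : ℕ} {t₀ α R ρ : ℝ} {x₀ : Space n} {η : ℝ × Space n → ℝ}

lemma volume_cyl (r : ℝ) : volume (cyl t₀ x₀ α r) =
    ENNReal.ofReal (α * r ^ 2) * volume (Metric.ball x₀ r) := by
  rw [cyl, Measure.volume_eq_prod, Measure.prod_prod, timeInt, Real.volume_Ioo, sub_sub_cancel]

lemma volume_cyl_le (hα : 0 < α) (hR : 0 < R) (hρ : 0 < ρ) (hρR : ρ ≤ 2 * R) :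
    volume (cyl t₀ x₀ α ρ) ≤ 2 ^ (n + 2) * volume (cyl t₀ x₀ α R) := by
  have e : (2 : ℝ≥0∞) ^ (n + 2) = ENNReal.ofReal (2 ^ (n + 2)) := by
    rw [ENNReal.ofReal_pow (by norm_num), ENNReal.ofReal_ofNat]
  rw [volume_cyl, volume_cyl, Measure.addHaar_ball_of_pos volume x₀ hρ,
    Measure.addHaar_ball_of_pos volume x₀ hR,
    finrank_euclideanSpace_fin, ← mul_assoc, ← mul_assoc, ← mul_assoc, e,
    ← ENNReal.ofReal_mul (by positivity), ← ENNReal.ofReal_mul (by positivity),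
    ← ENNReal.ofReal_mul (by positivity)]
  refine mul_le_mul_left (ENNReal.ofReal_le_ofReal ?_) _
  calc α * ρ ^ 2 * ρ ^ n ≤ α * (2 * R) ^ 2 * (2 * R) ^ n := by gcongr
    _ = 2 ^ (n + 2) * (α * R ^ 2) * R ^ n := by rw [mul_pow, mul_pow]; ring

lemma ofReal_mul_inv_volume_ball (hα : 0 < α) (hR : 0 < R) :
    ENNReal.ofReal (1 / α) * (volume (Metric.ball x₀ R))⁻¹ =
      ENNReal.ofReal (R ^ 2) * (volume (cyl t₀ x₀ α R))⁻¹ := by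
  rw [volume_cyl, ENNReal.mul_inv (Or.inr measure_ball_lt_top.ne)
    (Or.inl ENNReal.ofReal_ne_top), ← ENNReal.ofReal_inv_of_pos (by positivity), ← mul_assoc,
    ← ENNReal.ofReal_mul (by positivity)]
  congr 2
  field_simp

lemma gradSup_cyl_lt_top (hη : ContDiff ℝ ∞ η) : gradSup (cyl t₀ x₀ α ρ) η < ⊤ := by
  have h : Continuous (spaceGrad η) := (PiLp.continuous_toLp 2 _).comp <| continuous_pi fun j =>
    (hη.continuous_fderiv (by simp)).clm_apply continuous_const
  obtain ⟨T, hT⟩ := (isCompact_closure_cyl (t₀ := t₀) (x₀ := x₀) (α := α)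
    (ρ := ρ)).exists_bound_of_continuousOn h.continuousOn
  refine (iSup₂_le fun z hz => ?_ : gradSup _ η ≤ ENNReal.ofReal T).trans_lt ENNReal.ofReal_lt_top
  rw [← ofReal_norm]
  exact ENNReal.ofReal_le_ofReal (hT z (subset_closure hz))

lemma norm_spaceGrad_le (hη : ContDiff ℝ ∞ η) {z : ℝ × Space n} (hz : z ∈ cyl t₀ x₀ α ρ) :
    ‖spaceGrad η z‖ ≤ (gradSup (cyl t₀ x₀ α ρ) η).toReal := by
  rw [← toReal_enorm]
  exact ENNReal.toReal_mono (gradSup_cyl_lt_top hη).ne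
    (le_iSup₂ (f := fun z _ => ‖spaceGrad η z‖ₑ) z hz)

end Cylinders

lemma HasWeakPartial.congr_left {n : ℕ} {U : Set (ℝ × Space n)} {j : Fin n}
    {f f' g : ℝ × Space n → ℝ} (h : HasWeakPartial U j f g)
    (hf : f =ᵐ[volume.restrict U] f') : HasWeakPartial U j f' g where
  left z hz := by
    obtain ⟨V, hV, hi⟩ := h.left z hz
    refine ⟨V ∩ U, inter_mem hV self_mem_nhdsWithin, (hi.mono_set inter_subset_left).congr ?_⟩
    exact ae_restrict_of_ae_restrict_of_subset inter_subset_right hf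
  right := h.right
  parts ζ hζ := by
    rw [← h.parts ζ hζ]
    refine integral_congr_ae ?_
    filter_upwards [hf] with z hz
    rw [hz]

lemma ofReal_setIntegral_le {α : Type*} [MeasurableSpace α] {ν : Measure α} {s : Set α}
    (hs : MeasurableSet s) {f : α → ℝ} (hf : ∀ z ∈ s, 0 ≤ f z) :
    ENNReal.ofReal (∫ z in s, f z ∂ν) ≤ ∫⁻ z in s, ENNReal.ofReal (f z) ∂ν := by
  refine (Real.ofReal_le_enorm _).trans ((enorm_integral_le_lintegral_enorm _).trans ?_)
  exact (setLIntegral_congr_fun hs fun z hz => Real.enorm_eq_ofReal (hf z hz)).le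

/-- Only `φ'(v)v ≤ 2^(c₁+1) φ(v)` is needed for the first term; the second term receives the same
factor, which is at least `1`. The supremum of `|∇η|` is finite since `η` is smooth on the compact
closure of the cylinder. -/
lemma ofReal_cacRHS_le {N n : ℕ} {φ : ℝ → ℝ} {c₀ c₁ : ℝ} (hφ : IsOrlicz φ c₀ c₁) (hc₀ : 0 < c₀)
    {P : ℝ × Space n → Mat N n} {t₀ α ρ q γ : ℝ} {x₀ : Space n} {η : ℝ × Space n → ℝ}
    (hη : ContDiff ℝ ∞ η) (hη1 : ∀ z ∈ cyl t₀ x₀ α ρ, 0 ≤ η z ∧ η z ≤ 1) :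
    ENNReal.ofReal (cacRHS φ γ q (gradSup (cyl t₀ x₀ α ρ) η).toReal P η (cyl t₀ x₀ α ρ)) ≤
      ENNReal.ofReal (2 ^ (c₁ + 1)) * ((∫⁻ z in cyl t₀ x₀ α ρ, {z | γ < ‖P z‖}.indicator
          (fun z => ENNReal.ofReal (φ ‖P z‖) * gradSup (cyl t₀ x₀ α ρ) η ^ 2) z) +
        ∫⁻ z in cyl t₀ x₀ α ρ, ENNReal.ofReal (H γ ‖P z‖ * η z ^ (q - 1) * |timeDeriv η z|)) := by
  have hc₁ : 0 < c₁ := hc₀.trans_le hφ.c₀_le_c₁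
  have hQm : MeasurableSet (cyl t₀ x₀ α ρ) := isOpen_cyl.measurableSet
  have h1 : (1 : ℝ) ≤ 2 ^ (c₁ + 1) := Real.one_le_rpow one_le_two (by linarith)
  have hS := (gradSup_cyl_lt_top (t₀ := t₀) (x₀ := x₀) (α := α) (ρ := ρ) hη).ne
  rw [cacRHS, mul_add]
  refine ENNReal.ofReal_add_le.trans (add_le_add ?_ ?_)
  · rw [ENNReal.ofReal_mul (sq_nonneg _), ENNReal.ofReal_pow ENNReal.toReal_nonneg,
      ENNReal.ofReal_toReal hS]
    refine (mul_le_mul_right (ofReal_setIntegral_le hQm fun z _ =>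
      indicator_nonneg (fun z _ => Solution.en_nonneg hφ _) z) _).trans ?_
    rw [← lintegral_const_mul' _ _ (ENNReal.pow_ne_top hS),
      ← lintegral_const_mul' _ _ ENNReal.ofReal_ne_top]
    refine lintegral_mono fun z => ?_
    by_cases hz : z ∈ {z | γ < ‖P z‖}
    · rw [indicator_of_mem hz, indicator_of_mem hz, mul_comm, ← mul_assoc,
        ← ENNReal.ofReal_mul (by positivity)]
      gcongr
      exact hφ.d_mul_le hc₀ (norm_nonneg _)
    · rw [indicator_of_notMem hz, indicator_of_notMem hz]
      simp
  · refine (ofReal_setIntegral_le hQm fun z hz => mul_nonneg (H_nonneg _ _)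
      (mul_nonneg (Real.rpow_nonneg (hη1 z hz).1 _) (abs_nonneg _))).trans ?_
    simp only [mul_assoc]
    exact le_mul_of_one_le_left' (by simpa using ENNReal.ofReal_le_ofReal h1)

/-- The assembly of the estimates of the time slices and of the gradient. -/
lemma essSup_add_laverage_le {n : ℕ} {t₀ α R ρ X M M' : ℝ} {x₀ : Space n}
    {f : ℝ × Space n → ℝ≥0∞} {W : ℝ × Space n → Space n} {E₁ E₂ : ℝ≥0∞} (hα : 0 < α) (hR : 0 < R)
    (hRρ : R ≤ ρ) (hρR : ρ ≤ 2 * R) (hM : 0 ≤ M) (hM' : 0 ≤ M') {D : ℝ}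
    (hX : ENNReal.ofReal X ≤ ENNReal.ofReal D * (E₁ + E₂)) (hX0 : 0 ≤ X)
    (hf : ∀ᵐ t, t ∈ timeInt t₀ α ρ → ∫⁻ x in Metric.ball x₀ ρ, f (t, x) ≤ ENNReal.ofReal (M * X))
    (hW : ∫⁻ z in cyl t₀ x₀ α ρ, ‖W z‖ₑ ^ 2 ≤ ENNReal.ofReal (M' * X)) :
    essSup (fun t => ENNReal.ofReal (1 / α) * ⨍⁻ x in Metric.ball x₀ R, f (t, x) ∂volume)
        (volume.restrict (timeInt t₀ α R)) +
      ENNReal.ofReal (R ^ 2) * (⨍⁻ z in cyl t₀ x₀ α R, ‖W z‖ₑ ^ 2 ∂volume) ≤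
    Real.toNNReal (2 ^ (n + 2) * (M + M') * D) *
      (ENNReal.ofReal (R ^ 2) * ((volume (cyl t₀ x₀ α ρ))⁻¹ * E₁) +
        ENNReal.ofReal (R ^ 2) * ((volume (cyl t₀ x₀ α ρ))⁻¹ * E₂)) := by
  have hρ : 0 < ρ := hR.trans_le hRρ
  have hαR : α * R ^ 2 ≤ α * ρ ^ 2 := by gcongr
  have hT : timeInt t₀ α R ⊆ timeInt t₀ α ρ := Ioo_subset_Ioo_left (by linarith)
  have hB := Metric.ball_subset_ball (x := x₀) hRρ
  have hQ : cyl t₀ x₀ α R ⊆ cyl t₀ x₀ α ρ := prod_mono hT hB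
  set k := ENNReal.ofReal (R ^ 2) * (volume (cyl t₀ x₀ α R))⁻¹ with hk
  have h1 : essSup (fun t => ENNReal.ofReal (1 / α) * ⨍⁻ x in Metric.ball x₀ R, f (t, x) ∂volume)
      (volume.restrict (timeInt t₀ α R)) ≤ k * ENNReal.ofReal (M * X) := by
    refine essSup_le_of_ae_le _ ?_
    filter_upwards [ae_restrict_of_ae hf, ae_restrict_mem measurableSet_Ioo] with t ht htR
    rw [setLAverage_eq, ENNReal.div_eq_inv_mul, ← mul_assoc,
      ofReal_mul_inv_volume_ball (t₀ := t₀) hα hR]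
    exact mul_le_mul_right ((lintegral_mono_set hB).trans (ht (hT htR))) _
  have h2 : ENNReal.ofReal (R ^ 2) * (⨍⁻ z in cyl t₀ x₀ α R, ‖W z‖ₑ ^ 2 ∂volume) ≤
      k * ENNReal.ofReal (M' * X) := by
    rw [setLAverage_eq, ENNReal.div_eq_inv_mul, ← mul_assoc]
    exact mul_le_mul_right ((lintegral_mono_set hQ).trans hW) _
  -- The estimates hold on the large cylinder, while the averages on the left are over the small
  -- one; as `ρ ≤ 2R`, the volumes differ at most by the factor `2^(n+2)`.
  have h3 : (volume (cyl t₀ x₀ α R))⁻¹ ≤ 2 ^ (n + 2) * (volume (cyl t₀ x₀ α ρ))⁻¹ := by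
    have h0 : (2 : ℝ≥0∞) ^ (n + 2) ≠ 0 := by simp
    have ht : (2 : ℝ≥0∞) ^ (n + 2) ≠ ⊤ := ENNReal.pow_ne_top (by simp)
    have := ENNReal.inv_le_inv.2 (volume_cyl_le (t₀ := t₀) (x₀ := x₀) hα hR hρ hρR)
    rw [ENNReal.mul_inv (Or.inl h0) (Or.inl ht)] at this
    calc _ = 2 ^ (n + 2) * ((2 ^ (n + 2))⁻¹ * (volume (cyl t₀ x₀ α R))⁻¹) := by
          rw [← mul_assoc, ENNReal.mul_inv_cancel h0 ht, one_mul]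
      _ ≤ _ := by gcongr
  calc _ ≤ k * ENNReal.ofReal (M * X) + k * ENNReal.ofReal (M' * X) := add_le_add h1 h2
    _ = ENNReal.ofReal (R ^ 2) * (volume (cyl t₀ x₀ α R))⁻¹ *
        (ENNReal.ofReal (M + M') * ENNReal.ofReal X) := by
      rw [← mul_add, ← ENNReal.ofReal_add (by positivity) (by positivity), ← add_mul,
        ENNReal.ofReal_mul (by positivity)]
    _ ≤ ENNReal.ofReal (R ^ 2) * (2 ^ (n + 2) * (volume (cyl t₀ x₀ α ρ))⁻¹) *
        (ENNReal.ofReal (M + M') * (ENNReal.ofReal D * (E₁ + E₂))) := by gcongr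
    _ = _ := by
      have e : ((Real.toNNReal (2 ^ (n + 2) * (M + M') * D) : ℝ≥0) : ℝ≥0∞) =
          2 ^ (n + 2) * ENNReal.ofReal (M + M') * ENNReal.ofReal D := by
        change ENNReal.ofReal _ = _
        rw [ENNReal.ofReal_mul (by positivity), ENNReal.ofReal_mul (by positivity),
          ENNReal.ofReal_pow (by norm_num), ENNReal.ofReal_ofNat]
      rw [e]
      ring

/-- The constant of the Caccioppoli inequality. -/
def mainConst (n : ℕ) (c₀ c₁ q : ℝ) : ℝ :=
  2 ^ (n + 2) * (2 * cacConst n c₀ c₁ q + gradConst n c₀ c₁ q) * 2 ^ (c₁ + 1)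

lemma exists_isCompact_neighbourhoods {n : ℕ} {J : Set ℝ} {Ω : Set (Space n)} (hJ : IsOpen J)
    (hΩ : IsOpen Ω) {t₀ α ρ : ℝ} {x₀ : Space n} (hα : 0 < α) (hρ : 0 < ρ)
    (h : closure (cyl t₀ x₀ α ρ) ⊆ J ×ˢ Ω) :
    ∃ (I : Set ℝ) (K : Set (Space n)), IsCompact I ∧ I ⊆ J ∧ IsCompact K ∧ K ⊆ Ω ∧
      closure (cyl t₀ x₀ α ρ) ⊆ interior I ×ˢ interior K := by
  have hα' : 0 < α * ρ ^ 2 := by positivity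
  have n1 : (closure (timeInt t₀ α ρ)).Nonempty :=
    (nonempty_Ioo.2 (by linarith : t₀ - α * ρ ^ 2 < t₀)).closure
  have n2 : (closure (Metric.ball x₀ ρ)).Nonempty := (Metric.nonempty_ball.2 hρ).closure
  rw [cyl, closure_prod_eq] at h ⊢
  have h' := h
  rw [prod_subset_prod_iff] at h'
  obtain ⟨a, b⟩ : closure (timeInt t₀ α ρ) ⊆ J ∧ closure (Metric.ball x₀ ρ) ⊆ Ω := by
    rcases h' with h' | h' | h'
    · exact h'
    · exact absurd h' n1.ne_empty
    · exact absurd h' n2.ne_empty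
  have c1 : IsCompact (closure (timeInt t₀ α ρ)) := isCompact_Icc.of_isClosed_subset
    isClosed_closure (closure_minimal Ioo_subset_Icc_self isClosed_Icc)
  have c2 : IsCompact (closure (Metric.ball x₀ ρ)) := (ProperSpace.isCompact_closedBall x₀ ρ
    ).of_isClosed_subset isClosed_closure Metric.closure_ball_subset_closedBall
  obtain ⟨I, hI, hI1, hI2⟩ := exists_compact_between c1 hJ a
  obtain ⟨K, hK, hK1, hK2⟩ := exists_compact_between c2 hΩ b
  exact ⟨I, K, hI, hI2, hK, hK2, prod_mono hI1 hK1⟩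

/-- The solution is cut off in a product neighbourhood of the closed cylinder, where the regularity
theory applies to the cut-off pair; its gradient agrees with `Du` almost everywhere on the cylinder,
and both sides of the inequality depend only on such values. -/
theorem IsLocalWeakSolution.caccioppoli {N n : ℕ} {φ : ℝ → ℝ} {c₀ c₁ : ℝ}
    (hφ : IsOrlicz φ c₀ c₁) (hc₀ : 0 < c₀) {J : Set ℝ} {Ω : Set (Space n)} (hJ : IsOpen J)
    (hΩ : IsOpen Ω) {u : ℝ × Space n → Space N} {Du : ℝ × Space n → Mat N n}
    (hu : IsLocalWeakSolution φ J Ω u Du)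
    (hDu : LocallyIntegrableOn (fun z => ‖Du z‖ ^ 2) (J ×ˢ Ω)) {q γ α R ρ t₀ : ℝ} {x₀ : Space n}
    (hq : 2 ≤ q) (hγ : 0 < γ) (hα : 0 < α) (hR : 0 < R) (hRρ : R ≤ ρ) (hρR : ρ ≤ 2 * R)
    (hcyl : closure (cyl t₀ x₀ α ρ) ⊆ J ×ˢ Ω) {η : ℝ × Space n → ℝ} (hη : IsParTest t₀ x₀ α ρ η)
    (hη1 : ∀ z ∈ cyl t₀ x₀ α ρ, 0 ≤ η z ∧ η z ≤ 1) :
    ∃ W : ℝ × Space n → Space n,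
      (∀ j : Fin n, HasWeakPartial (cyl t₀ x₀ α ρ) j
        (fun z => G φ γ ‖Du z‖ * η z ^ (q / 2)) (fun z => W z j)) ∧
      essSup (fun t => ENNReal.ofReal (1 / α) *
            ⨍⁻ x in Metric.ball x₀ R, ENNReal.ofReal (H γ ‖Du (t, x)‖ * η (t, x) ^ q) ∂volume)
          (volume.restrict (timeInt t₀ α R)) +
        ENNReal.ofReal (R ^ 2) * (⨍⁻ z in cyl t₀ x₀ α R, ‖W z‖ₑ ^ 2 ∂volume)
      ≤ Real.toNNReal (mainConst n c₀ c₁ q) * (ENNReal.ofReal (R ^ 2) *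
            (⨍⁻ z in cyl t₀ x₀ α ρ, {z | γ < ‖Du z‖}.indicator
              (fun z => ENNReal.ofReal (φ ‖Du z‖) *
                gradSup (cyl t₀ x₀ α ρ) η ^ 2) z ∂volume) +
          ENNReal.ofReal (R ^ 2) *
            (⨍⁻ z in cyl t₀ x₀ α ρ, ENNReal.ofReal
              (H γ ‖Du z‖ * η z ^ (q - 1) * |timeDeriv η z|) ∂volume)) := by
  obtain ⟨I, K, hI, hIJ, hK, hKΩ, hIK⟩ :=
    exists_isCompact_neighbourhoods hJ hΩ hα (hR.trans_le hRρ) hcyl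
  have hO : IsOpen (interior I ×ˢ interior K) := isOpen_interior.prod isOpen_interior
  obtain ⟨u', P, hs, hP⟩ := hu.exists_solution hφ hc₀ hDu hI hIJ hK hKΩ hO
    (prod_mono interior_subset interior_subset)
  obtain ⟨O₁, O₂, Z, h, hKO, hr⟩ :=
    Solution.exists_regular hφ hc₀ hs isCompact_closure_cyl hO hIK
  have hO₂ := subset_closure.trans hKO
  have hc₁ : 0 < c₁ := hc₀.trans_le hφ.c₀_le_c₁
  have hlow := lowerConst_pos hc₀ hc₁
  have hcac : 0 ≤ cacConst n c₀ c₁ q := by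
    have : 0 ≤ q := by linarith
    rw [cacConst]
    positivity
  have hgrad : 0 ≤ gradConst n c₀ c₁ q := by
    rw [gradConst]
    positivity
  set Q := cyl t₀ x₀ α ρ with hQ
  have hQO : Q ⊆ interior I ×ˢ interior K := subset_closure.trans hIK
  have hPQ : ∀ᵐ z, z ∈ Q → P z = Du z := by
    filter_upwards [hP] with z hz hzQ using hz (hQO hzQ)
  have hPQ' : ∀ᵐ z ∂volume.restrict Q, P z = Du z :=
    (ae_restrict_iff' isOpen_cyl.measurableSet).2 hPQ
  have hSle : ∀ z ∈ Q, ‖spaceGrad η z‖ ≤ (gradSup Q η).toReal := fun z => norm_spaceGrad_le hη.1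
  obtain ⟨W, hW, hWle⟩ :=
    Solution.exists_hasWeakPartial hφ hc₀ hs hr hO hγ hq hη hη1 hO₂ hSle
  refine ⟨W, fun j => (hW j).congr_left ?_, ?_⟩
  · filter_upwards [hPQ'] with z hz
    rw [hz]
  have hslice := Solution.caccioppoli_slice hφ hc₀ hs hr hO hγ hq hη hη1 hO₂ hSle
  have hf : ∀ᵐ t, t ∈ timeInt t₀ α ρ → ∫⁻ x in Metric.ball x₀ ρ,
      ENNReal.ofReal (H γ ‖Du (t, x)‖ * η (t, x) ^ q) ≤
      ENNReal.ofReal (2 * cacConst n c₀ c₁ q * cacRHS φ γ q (gradSup Q η).toReal P η Q) := by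
    filter_upwards [hslice, Measure.ae_ae_of_ae_prod hPQ] with t ht hxt htI
    rw [mul_assoc]
    refine (lintegral_congr_ae ?_).trans_le (ht htI)
    rw [EventuallyEq, ae_restrict_iff' Metric.isOpen_ball.measurableSet]
    filter_upwards [hxt] with x hx hxB
    rw [hx ⟨htI, hxB⟩]
  have hX := ofReal_cacRHS_le (q := q) (γ := γ) (P := P) hφ hc₀ hη.1 hη1
  have key := essSup_add_laverage_le (M := 2 * cacConst n c₀ c₁ q)
    (f := fun z => ENNReal.ofReal (H γ ‖Du z‖ * η z ^ q)) hα hR hRρ hρR (by positivity) hgrad hX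
    (Solution.cacRHS_nonneg hφ hη1) hf hWle
  refine key.trans (le_of_eq ?_)
  rw [setLAverage_eq, setLAverage_eq, ENNReal.div_eq_inv_mul, ENNReal.div_eq_inv_mul]
  congr 3
  · congr 1
    refine lintegral_congr_ae ?_
    filter_upwards [hPQ'] with z hz
    simp only [indicator, mem_ofPred_eq, hz, hQ]
  · congr 1
    refine lintegral_congr_ae ?_
    filter_upwards [hPQ'] with z hz
    rw [hz]

end PhiCaloric
end

/-! ### The theorem. -/

open PhiCaloric in
theorem corollary3p7 (n : ℕ) (c₀ c₁ : ℝ) (hc₀ : 0 < c₀) :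
    (∃ q K : ℝ, 1 < q ∧ 0 < K ∧
      ∀ φ : ℝ → ℝ, IsOrlicz φ c₀ c₁ → ExponentCondition φ q K) ∧
    ∀ q K : ℝ, 1 < q → 0 < K → ∃ c : ℝ≥0,
      ∀ φ : ℝ → ℝ, IsOrlicz φ c₀ c₁ → ExponentCondition φ q K →
      ∀ (N : ℕ) (J : Set ℝ) (Ω : Set (Space n)),
        IsOpen J → J.OrdConnected → IsOpen Ω →
      ∀ (u : ℝ × Space n → Space N) (Du : ℝ × Space n → Mat N n),
        IsLocalWeakSolution φ J Ω u Du →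
        LocallyIntegrableOn (fun z => ‖Du z‖ ^ 2) (J ×ˢ Ω) →
      ∀ (γ α R ρ t₀ : ℝ) (x₀ : Space n),
        0 < γ → 0 < α → 0 < R → R ≤ ρ → ρ ≤ 2 * R →
        closure (cyl t₀ x₀ α ρ) ⊆ J ×ˢ Ω →
      ∀ η : ℝ × Space n → ℝ, IsParTest t₀ x₀ α ρ η →
        (∀ z ∈ cyl t₀ x₀ α ρ, 0 ≤ η z ∧ η z ≤ 1) →
      ∃ W : ℝ × Space n → Space n,
        (∀ j : Fin n, HasWeakPartial (cyl t₀ x₀ α ρ) j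
          (fun z => G φ γ ‖Du z‖ * η z ^ (q / 2)) (fun z => W z j)) ∧
        essSup (fun t => ENNReal.ofReal (1 / α) *
              ⨍⁻ x in Metric.ball x₀ R, ENNReal.ofReal (H γ ‖Du (t, x)‖ * η (t, x) ^ q) ∂volume)
            (volume.restrict (timeInt t₀ α R)) +
          ENNReal.ofReal (R ^ 2) * (⨍⁻ z in cyl t₀ x₀ α R, ‖W z‖ₑ ^ 2 ∂volume)
        ≤ c * (ENNReal.ofReal (R ^ 2) *
              (⨍⁻ z in cyl t₀ x₀ α ρ, {z | γ < ‖Du z‖}.indicator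
                (fun z => ENNReal.ofReal (φ ‖Du z‖) *
                  gradSup (cyl t₀ x₀ α ρ) η ^ 2) z ∂volume) +
            ENNReal.ofReal (R ^ 2) *
              (⨍⁻ z in cyl t₀ x₀ α ρ, ENNReal.ofReal
                (H γ ‖Du z‖ * η z ^ (q - 1) * |timeDeriv η z|) ∂volume)) := by
  -- In part (i), `q - 1 = 1/min(c₀, 1)` and `K = 1`. In part (ii) the constant depends on `n, c₀,
  -- c₁, q` alone, since the exponent condition is used only to conclude `q ≥ 2`.
  refine ⟨⟨(1 + min c₀ 1) / min c₀ 1, 1, ?_, one_pos, fun φ hφ => hφ.exponentCondition hc₀⟩,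
    fun q K hq hK => ⟨Real.toNNReal (mainConst n c₀ c₁ q), ?_⟩⟩
  · have : 0 < min c₀ 1 := lt_min hc₀ one_pos
    rw [lt_div_iff₀ this]
    linarith
  · intro φ hφ hφq N J Ω hJ _ hΩ u Du hu hDu γ α R ρ t₀ x₀ hγ hα hR hRρ hρR hcyl η hη hη1
    exact hu.caccioppoli hφ hc₀ hJ hΩ hDu (hφ.two_le_of_exponentCondition hc₀ hq hK hφq) hγ hα hR
      hRρ hρR hcyl hη hη1
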